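/- Let $\Gamma\rightrightarrows M$ be a Lie groupoid (smooth, real, finite-dimensional manifolds; neither Hausdorffness nor second countability is needed), with source and target maps $s,t:\Gamma\to M$, and write $gh$ ("$g$ after $h$") for the composite of arrows with $s(g)=t(h)$. Let $\Gamma_p$ be the manifold of composable sequences of $p$ arrows and $\Gamma_\bullet$ the resulting simplicial manifold, with $\Gamma_0=M$. For $k\ge 0$ let $H^k(\Gamma_\bullet,S^1)$ be the cohomology of $\Gamma_\bullet$ with values in the sheaf $S^1$ of smooth $S^1$-valued functions (that is, $\mathrm{Ext}^k(\mathbb Z,S^1)$ in the category of abelian sheaves on $\Gamma_\bullet$), and $H^k(M,S^1)$ the sheaf cohomology of $M$. An $S^1$-central extension of $\Gamma\rightrightarrows M$ is a Lie groupoid $R\rightrightarrows M$ with a morphism of Lie groupoids $(\pi,\mathrm{id}):[R\rightrightarrows M]\to[\Gamma\rightrightarrows M]$ and an $S^1$-action on $R$ making $\pi:R\to\Gamma$ a smooth principal $S^1$-bundle, such that $(a\cdot x)(b\cdot y)=ab\cdot(xy)$ for all $a,b\in S^1$ and composable $x,y\in R$. An isomorphism of central extensions is an $S^1$-equivariant diffeomorphism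 over $\Gamma$ that is a groupoid morphism. The tensor product $R\otimes R'$ is the associated bundle $R\times_{S^1}R'$ over $\Gamma$ with the groupoid structure induced from $R$ and $R'$. For a morphism of Lie groupoids $\varphi:[\Gamma'\rightrightarrows M']\to[\Gamma\rightrightarrows M]$, the pullback $\varphi^*R$ is the central extension of $\Gamma'\rightrightarrows M'$ with an $S^1$-equivariant morphism of Lie groupoids to $R$ covering $\varphi$. Then the set $\mathrm{CE}(\Gamma\rightrightarrows M)$ of isomorphism classes of $S^1$-central extensions is an abelian group under $\otimes$, pullback along a morphism is a group homomorphism, and there is an exact sequence of abelian groups $$H^1(\Gamma_\bullet,S^1)\longrightarrow H^1(M,S^1)\overset{\delta}{\longrightarrow}\mathrm{CE}(\Gamma\rightrightarrows M)\overset{c}{\longrightarrow}H^2(\Gamma_\bullet,S^1)\longrightarrow H^2(M,S^1),$$ natural with respect to all morphisms of Lie groupoids (all four squares commute), in which: 1. the first and the last map are restriction along $M=\Gamma_0$; 2. $\delta$ sends the class of a principal $S^1$-bundle $L\to M$ to the class of the central extension whose fibre over $g\in\Gamma$ is $\mathrm{Iso}_{S^1}(L_{s(g)},L_{t(g)})$,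 i.e. the central extension $R$ that acts smoothly on $L$ by $S^1$-equivariant maps between the fibres with the central $S^1$ acting by scalars; 3. $c$ sends a central extension $R$ to the class of the $S^1$-gerbe on $\Gamma_\bullet$, trivialized over $M$, that it defines. Explicitly, $c([R])\in H^2(\Gamma_\bullet,S^1)=\mathrm{Ext}^2(\mathbb Z,S^1)$ is the Yoneda class of any exact sequence $0\to S^1\to E\to P\to\mathbb Z\to 0$ of abelian sheaves on $\Gamma_\bullet$ with a section $v$ of $P$ over $M=\Gamma_0$ lifting $1$ and an identification, equivariant and compatible with the simplicial operators, of the local sections of $R$ with the local lifts to $E$ of $t^*v-s^*v$, under which the multiplication of $R$ corresponds to the addition of $E$. -/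

import Mathlib

open CategoryTheory Abelian Opposite Limits TopologicalSpace
open scoped Manifold ContDiff

universe u

noncomputable section

/-! ### Smooth maps into finite powers of a manifold -/

section PiManifold

variable {EN HN : Type*} [NormedAddCommGroup EN] [NormedSpace ℝ EN] [TopologicalSpace HN]
  {I : ModelWithCorners ℝ EN HN} {N : Type*} [TopologicalSpace N] [ChartedSpace HN N]
  {E H : Type*} [NormedAddCommGroup E] [NormedSpace ℝ E] [TopologicalSpace H]
  {J : ModelWithCorners ℝ E H} {P : Type*} [TopologicalSpace P] [ChartedSpace H P]
  {ι : Type*} [Fintype ι]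

theorem contMDiffWithinAt_piManifold {f : N → ι → P} {s : Set N} {x : N}
    (h : ∀ i, ContMDiffWithinAt I J ∞ (fun y => f y i) s x) :
    ContMDiffWithinAt I (ModelWithCorners.pi fun _ : ι => J) ∞ f s x := by
  rw [contMDiffWithinAt_iff]
  refine ⟨continuousWithinAt_pi.2 fun i => (h i).continuousWithinAt, ?_⟩
  rw [contDiffWithinAt_pi]
  intro i
  exact (contMDiffWithinAt_iff.1 (h i)).2

theorem contMDiff_piManifold_apply (i : ι) :
    ContMDiff (ModelWithCorners.pi fun _ : ι => J) J ∞ (fun y : ι → P => y i) := by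
  intro x
  rw [ContMDiffAt, contMDiffWithinAt_iff]
  refine ⟨(continuous_apply i).continuousWithinAt, ?_⟩
  have h2 : ContDiffWithinAt ℝ ∞ (fun e : ι → E => e i)
      (Set.univ ∩ Set.range (ModelWithCorners.pi fun _ : ι => J))
      (extChartAt (ModelWithCorners.pi fun _ : ι => J) x x) :=
    (contDiff_apply ℝ E i).contDiffWithinAt
  simp only [Set.univ_inter, Set.preimage_univ] at h2 ⊢
  refine h2.congr_of_eventuallyEq_of_mem ?_ (Set.mem_range_self _)
  filter_upwards [extChartAt_target_mem_nhdsWithin (I := ModelWithCorners.pi fun _ : ι => J) x]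
    with e he
  have := (extChartAt (ModelWithCorners.pi fun _ : ι => J) x).right_inv he
  exact congrFun this i

end PiManifold

/-! ### Lie groupoids -/

/-- The structure of a Lie groupoid `Γ ⇉ M` on two given manifolds. An arrow `g` goes from `src g`
to `tgt g`, and `mul g h` is the composite "`g` after `h`", which is only meaningful when
`src g = tgt h`. The set of composable pairs is an embedded submanifold of `Γ × Γ` because `src` is
a submersion, and smoothness of the multiplication is smoothness on that subset. -/
structure LieGroupoidStr {EM HM EΓ HΓ : Type*} [NormedAddCommGroup EM] [NormedSpace ℝ EM]
    [TopologicalSpace HM] [NormedAddCommGroup EΓ] [NormedSpace ℝ EΓ] [TopologicalSpace HΓ]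
    (IM : ModelWithCorners ℝ EM HM) (IΓ : ModelWithCorners ℝ EΓ HΓ)
    (M Γ : Type*) [TopologicalSpace M] [ChartedSpace HM M]
    [TopologicalSpace Γ] [ChartedSpace HΓ Γ] where
  src : Γ → M
  tgt : Γ → M
  one : M → Γ
  inv : Γ → Γ
  mul : Γ → Γ → Γ
  src_one : ∀ x, src (one x) = x
  tgt_one : ∀ x, tgt (one x) = x
  src_inv : ∀ g, src (inv g) = tgt g
  tgt_inv : ∀ g, tgt (inv g) = src g
  src_mul : ∀ g h, src g = tgt h → src (mul g h) = src h
  tgt_mul : ∀ g h, src g = tgt h → tgt (mul g h) = tgt g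
  mul_assoc : ∀ g h k, src g = tgt h → src h = tgt k → mul (mul g h) k = mul g (mul h k)
  one_mul : ∀ g, mul (one (tgt g)) g = g
  mul_one : ∀ g, mul g (one (src g)) = g
  inv_mul : ∀ g, mul (inv g) g = one (src g)
  mul_inv : ∀ g, mul g (inv g) = one (tgt g)
  src_submersion : Manifold.IsSubmersion IΓ IM ∞ src
  tgt_submersion : Manifold.IsSubmersion IΓ IM ∞ tgt
  contMDiff_one : ContMDiff IM IΓ ∞ one
  contMDiff_inv : ContMDiff IΓ IΓ ∞ inv
  contMDiffOn_mul : ContMDiffOn (IΓ.prod IΓ) IΓ ∞ (fun p : Γ × Γ => mul p.1 p.2)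
    {p | src p.1 = tgt p.2}

/-- A (finite-dimensional, real, smooth) Lie groupoid `Γ ⇉ M`. -/
structure LieGroupoid where
  /-- dimension of the manifold of objects -/
  m : ℕ
  /-- dimension of the manifold of arrows -/
  n : ℕ
  M : Type u
  Γ : Type u
  [topM : TopologicalSpace M]
  [chartM : ChartedSpace (EuclideanSpace ℝ (Fin m)) M]
  [mfdM : IsManifold (𝓡 m) ∞ M]
  [topΓ : TopologicalSpace Γ]
  [chartΓ : ChartedSpace (EuclideanSpace ℝ (Fin n)) Γ]
  [mfdΓ : IsManifold (𝓡 n) ∞ Γ]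
  str : LieGroupoidStr (𝓡 m) (𝓡 n) M Γ

attribute [instance] LieGroupoid.topM LieGroupoid.chartM LieGroupoid.mfdM
  LieGroupoid.topΓ LieGroupoid.chartΓ LieGroupoid.mfdΓ

/-- A morphism of Lie groupoids. -/
structure LieGroupoid.Hom (G' G : LieGroupoid.{u}) where
  obj : G'.M → G.M
  arr : G'.Γ → G.Γ
  contMDiff_obj : ContMDiff (𝓡 G'.m) (𝓡 G.m) ∞ obj
  contMDiff_arr : ContMDiff (𝓡 G'.n) (𝓡 G.n) ∞ arr
  src_arr : ∀ g, G.str.src (arr g) = obj (G'.str.src g)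
  tgt_arr : ∀ g, G.str.tgt (arr g) = obj (G'.str.tgt g)
  arr_one : ∀ x, arr (G'.str.one x) = G.str.one (obj x)
  arr_mul : ∀ g h, G'.str.src g = G'.str.tgt h →
    arr (G'.str.mul g h) = G.str.mul (arr g) (arr h)

/-! ### Sheaf cohomology and its functoriality -/

section ExtMap

universe w w' v v' u₁ u₂

variable {A : Type u₁} [Category.{v} A] [Abelian A] [HasExt.{w} A]
  {B : Type u₂} [Category.{v'} B] [Abelian B] [HasExt.{w'} B]
  (T : A ⥤ B) [T.Additive] [PreservesFiniteLimits T] [PreservesFiniteColimits T]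

/-- The map on `Ext` groups given by an exact functor `T`, followed by composition with morphisms
`Z' ⟶ T Z` and `T F ⟶ F'`. -/
def extMap {Z F : A} {Z' F' : B} (ζ : Z' ⟶ T.obj Z) (α : T.obj F ⟶ F') (k : ℕ) :
    Ext Z F k →+ Ext Z' F' k :=
  ((Ext.mk₀ ζ).precomp F' (zero_add k)).comp
    (((Ext.mk₀ α).postcomp (T.obj Z) (add_zero k)).comp (T.mapExtAddHom Z F k))

end ExtMap

section Cohomology

variable {C D : Type u} [SmallCategory C] [SmallCategory D]
  (J : GrothendieckTopology C) (K : GrothendieckTopology D)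

/-- Sheaves of abelian groups on a small site. -/
abbrev AbSheaf := Sheaf J AddCommGrpCat.{u}

/-- The constant sheaf `ℤ`. -/
abbrev ZSheaf : AbSheaf J :=
  (constantSheaf J AddCommGrpCat.{u}).obj (AddCommGrpCat.of (ULift.{u} ℤ))

/-- The map from the constant presheaf `ℤ` to its sheafification. -/
def ZSheaf.unit :
    (Functor.const Cᵒᵖ).obj (AddCommGrpCat.of (ULift.{u} ℤ)) ⟶ (ZSheaf J).obj :=
  toSheafify J ((Functor.const Cᵒᵖ).obj (AddCommGrpCat.of (ULift.{u} ℤ)))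

/-- The section `1` of the constant sheaf `ℤ`. -/
def ZSheaf.one (X : C) : (ZSheaf J).obj.obj (op X) :=
  (ZSheaf.unit J).app (op X) (ULift.up 1)

/-- The morphism out of the constant sheaf induced by a morphism out of the constant presheaf. -/
def ZSheaf.lift (A : AbSheaf J)
    (s : (Functor.const Cᵒᵖ).obj (AddCommGrpCat.of (ULift.{u} ℤ)) ⟶ A.obj) : ZSheaf J ⟶ A :=
  ((sheafificationAdjunction J AddCommGrpCat.{u}).homEquiv _ _).symm s

variable (T : C ⥤ D) [T.IsContinuous J K]

/-- The functor `A ↦ A ∘ T` on sheaves. -/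
def precompSheaf : AbSheaf K ⥤ AbSheaf J := T.sheafPushforwardContinuous AddCommGrpCat.{u} J K

/-- The left adjoint ("inverse image") of `A ↦ A ∘ T`. -/
def inverseImage : AbSheaf J ⥤ AbSheaf K := T.sheafPullback AddCommGrpCat.{u} J K

def inverseImageAdj : inverseImage J K T ⊣ precompSheaf J K T :=
  T.sheafAdjunctionContinuous AddCommGrpCat.{u} J K

instance : (precompSheaf J K T).Additive where
  map_add := rfl

instance : PreservesFiniteLimits (precompSheaf J K T) :=
  have := (inverseImageAdj J K T).rightAdjoint_preservesLimits
  inferInstance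

instance [T.IsCocontinuous J K] : PreservesFiniteColimits (precompSheaf J K T) :=
  have : PreservesColimitsOfSize.{0, 0} (precompSheaf J K T) :=
    (T.sheafAdjunctionCocontinuous AddCommGrpCat.{u} J K).leftAdjoint_preservesColimits
  inferInstance

instance : (inverseImage J K T).Additive := (inverseImageAdj J K T).left_adjoint_additive

instance : PreservesFiniteColimits (inverseImage J K T) :=
  have : PreservesColimitsOfSize.{0, 0} (inverseImage J K T) :=
    (inverseImageAdj J K T).leftAdjoint_preservesColimits
  inferInstance

instance [RepresentablyFlat T] : PreservesFiniteLimits (inverseImage J K T) := by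
  have : PreservesFiniteLimits (T.op.lan : _ ⥤ Dᵒᵖ ⥤ AddCommGrpCat.{u}) := inferInstance
  exact Functor.sheafPullbackConstruction.preservesFiniteLimits T AddCommGrpCat.{u} J K

variable {J K}

/-- For a continuous and cocontinuous functor `T : C ⥤ D`, the map `H^k(D, B) → H^k(C, A)` induced
by the exact functor `B ↦ B ∘ T` and a morphism `B ∘ T ⟶ A`. -/
def cohomologyRestrict [T.IsCocontinuous J K] {A : AbSheaf J} {B : AbSheaf K}
    (α : (precompSheaf J K T).obj B ⟶ A) (k : ℕ) : Sheaf.H B k →+ Sheaf.H A k :=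
  extMap (precompSheaf J K T)
    (ZSheaf.lift J ((precompSheaf J K T).obj (ZSheaf K)) (Functor.whiskerLeft T.op (ZSheaf.unit K)))
    α k

/-- For `T : C ⥤ D` with a functor `S : D ⥤ C` and natural arrows `X ⟶ T (S X)`: the morphism
`N ⟶ W` of presheaves on `D`, for `N` constant, extending a morphism `N ⟶ W ∘ T` on `C`. -/
def constExtend {C D : Type u} [SmallCategory C] [SmallCategory D] (T : C ⥤ D) (S : D ⥤ C)
    (η : 𝟭 D ⟶ S ⋙ T) {N : AddCommGrpCat.{u}} {W : Dᵒᵖ ⥤ AddCommGrpCat.{u}}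
    (b : (Functor.const Cᵒᵖ).obj N ⟶ T.op ⋙ W) : (Functor.const Dᵒᵖ).obj N ⟶ W where
  app X := b.app (op (S.obj X.unop)) ≫ W.map (η.app X.unop).op
  naturality X Y f := by
    have h1 : b.app (op (S.obj Y.unop)) =
        b.app (op (S.obj X.unop)) ≫ W.map (T.map (S.map f.unop)).op :=
      (Category.id_comp _).symm.trans (b.naturality (S.map f.unop).op)
    have h3 : W.map (T.map (S.map f.unop)).op ≫ W.map (η.app Y.unop).op =
        W.map (η.app X.unop).op ≫ W.map f := by
      rw [← Functor.map_comp, ← Functor.map_comp]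
      congr 1
      exact congrArg Quiver.Hom.op (η.naturality f.unop).symm
    refine (Category.id_comp _).trans ?_
    rw [h1]
    refine (Category.assoc _ _ _).trans (Eq.trans ?_ (Category.assoc _ _ _).symm)
    exact congrArg _ h3

/-- The map of sheaves `ℤ_D ⟶ T⁻¹ ℤ_C` sending `1` to `1`. -/
def ZSheaf.toInverseImage (S : D ⥤ C) (η : 𝟭 D ⟶ S ⋙ T) :
    ZSheaf K ⟶ (inverseImage J K T).obj (ZSheaf J) :=
  ZSheaf.lift K _ (constExtend T S η (W := ((inverseImage J K T).obj (ZSheaf J)).obj)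
    (ZSheaf.unit J ≫ ((inverseImageAdj J K T).unit.app (ZSheaf J)).hom))

/-- For a flat continuous functor `T : C ⥤ D` with a functor `S : D ⥤ C` and natural arrows
`X ⟶ T (S X)`, the map
`H^k(C, A) → H^k(D, B)` induced by the inverse image functor and a morphism `A ⟶ B ∘ T`. -/
def cohomologyPullback [RepresentablyFlat T] (S : D ⥤ C) (η : 𝟭 D ⟶ S ⋙ T)
    {A : AbSheaf J} {B : AbSheaf K} (α : A ⟶ (precompSheaf J K T).obj B) (k : ℕ) :
    Sheaf.H A k →+ Sheaf.H B k :=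
  extMap (inverseImage J K T) (ZSheaf.toInverseImage T S η)
    (((inverseImageAdj J K T).homEquiv A B).symm α) k

end Cohomology

/-! ### The sheaf of smooth `S¹`-valued functions on a manifold -/

section CircleSheaf

variable {m : ℕ} (M : Type u) [TopologicalSpace M] [ChartedSpace (EuclideanSpace ℝ (Fin m)) M]

/-- The presheaf `U ↦ C^∞(U, S¹)` of abelian groups on a manifold. -/
def circlePresheaf : (Opens M)ᵒᵖ ⥤ AddCommGrpCat.{u} where
  obj U := AddCommGrpCat.of (Additive C^∞⟮𝓡 m, U.unop; 𝓡 1, Circle⟯)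
  map h := AddCommGrpCat.ofHom
    (ContMDiffMap.restrictMonoidHom (𝓡 m) (𝓡 1) Circle (leOfHom h.unop)).toAdditive
  map_id _ := rfl
  map_comp _ _ := rfl

theorem contMDiff_of_restrict {U : Opens M} (f : U → Circle)
    (h : ∀ x : U, ∃ (V : Opens M) (hV : V ≤ U), x.1 ∈ V ∧
      ContMDiff (𝓡 m) (𝓡 1) ∞ (fun y : V => f ⟨y.1, hV y.2⟩)) :
    ContMDiff (𝓡 m) (𝓡 1) ∞ f := by
  intro x
  obtain ⟨V, hV, hx, hs⟩ := h x
  let g : M → Circle := Function.extend (Subtype.val : U → M) f (fun _ => 1)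
  have hg : ∀ y : U, g y.1 = f y := fun y => Subtype.val_injective.extend_apply _ _ _
  have h1 : ContMDiffAt (𝓡 m) (𝓡 1) ∞ (fun y : V => g y.1) ⟨x.1, hx⟩ := by
    have : (fun y : V => g y.1) = fun y : V => f ⟨y.1, hV y.2⟩ :=
      funext fun y => hg ⟨y.1, hV y.2⟩
    rw [this]
    exact hs _
  have h2 : ContMDiffAt (𝓡 m) (𝓡 1) ∞ g x.1 :=
    (contMDiffAt_subtype_iff (U := V) (x := ⟨x.1, hx⟩)).1 h1
  have h3 : ContMDiffAt (𝓡 m) (𝓡 1) ∞ (fun y : U => g y.1) x :=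
    (contMDiffAt_subtype_iff (x := x)).2 h2
  have h4 : (fun y : U => g y.1) = f := funext hg
  rwa [h4] at h3

theorem circlePresheaf_isSheaf :
    Presheaf.IsSheaf (Opens.grothendieckTopology M) (circlePresheaf (m := m) M) := by
  rw [Presheaf.isSheaf_iff_isSheaf_forget _ _ (forget AddCommGrpCat), isSheaf_iff_isSheaf_of_type]
  intro U S hS fam hfam
  have key : ∀ {V W : Opens M} (i : V ⟶ U) (j : W ⟶ U) (hi : S i) (hj : S j) (x : M)
      (hV : x ∈ V) (hW : x ∈ W),
      (show C^∞⟮𝓡 m, V; 𝓡 1, Circle⟯ from fam i hi) ⟨x, hV⟩ =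
        (show C^∞⟮𝓡 m, W; 𝓡 1, Circle⟯ from fam j hj) ⟨x, hW⟩ := by
    intro V W i j hi hj x hV hW
    have := hfam (homOfLE inf_le_left : V ⊓ W ⟶ V) (homOfLE inf_le_right : V ⊓ W ⟶ W) hi hj rfl
    exact DFunLike.congr_fun (F := C^∞⟮𝓡 m, (V ⊓ W : Opens M); 𝓡 1, Circle⟯) this ⟨x, hV, hW⟩
  choose V i hi hx using hS
  let g : U → Circle := fun x =>
    (show C^∞⟮𝓡 m, V x.1 x.2; 𝓡 1, Circle⟯ from fam (i x.1 x.2) (hi x.1 x.2)) ⟨x.1, hx x.1 x.2⟩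
  have hg : ContMDiff (𝓡 m) (𝓡 1) ∞ g := by
    refine contMDiff_of_restrict M g fun x => ⟨V x.1 x.2, leOfHom (i x.1 x.2), hx x.1 x.2, ?_⟩
    have : (fun y : V x.1 x.2 => g ⟨y.1, leOfHom (i x.1 x.2) y.2⟩) =
        (show C^∞⟮𝓡 m, V x.1 x.2; 𝓡 1, Circle⟯ from fam (i x.1 x.2) (hi x.1 x.2)) :=
      funext fun y => key _ _ _ _ _ _ _
    rw [this]
    exact ContMDiffMap.contMDiff _
  refine ⟨(⟨g, hg⟩ : C^∞⟮𝓡 m, U; 𝓡 1, Circle⟯), ?_, ?_⟩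
  · intro W j hj
    refine ContMDiffMap.ext (f := (_ : C^∞⟮𝓡 m, W; 𝓡 1, Circle⟯)) fun y => ?_
    exact key _ _ _ _ _ _ _
  · intro t ht
    refine ContMDiffMap.ext (f := (t : C^∞⟮𝓡 m, U; 𝓡 1, Circle⟯)) fun y => ?_
    exact DFunLike.congr_fun (F := C^∞⟮𝓡 m, V y.1 y.2; 𝓡 1, Circle⟯)
      (ht (i y.1 y.2) (hi y.1 y.2)) ⟨y.1, hx y.1 y.2⟩

/-- The sheaf `S¹` on a manifold `M`: the sheaf of smooth `S¹`-valued functions. -/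
def circleSheaf : AbSheaf (Opens.grothendieckTopology M) :=
  ⟨circlePresheaf (m := m) M, circlePresheaf_isSheaf M⟩

end CircleSheaf

/-! ### The simplicial manifold of a Lie groupoid -/

namespace LieGroupoid

variable (G G' : LieGroupoid.{u})

/-- The pairs of vertices of the `p`-simplex. -/
abbrev Pairs (p : SimplexCategory) := Fin (p.len + 1) × Fin (p.len + 1)

/-- The manifold `Γ_p` of composable sequences of `p` arrows. A point is recorded by the `p + 1`
objects involved together with all the composites `x (i, j)`, an arrow from the `j`-th object to
the `i`-th one; it is determined by the `p` consecutive arrows `x (i, i + 1)`. -/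
@[ext]
structure Nerve (p : SimplexCategory) : Type u where
  arrow : Pairs p → G.Γ
  arrow_self : ∀ i, arrow (i, i) = G.str.one (G.str.src (arrow (i, i)))
  composable : ∀ i j k, G.str.src (arrow (i, j)) = G.str.tgt (arrow (j, k))
  mul_arrow : ∀ i j k, G.str.mul (arrow (i, j)) (arrow (j, k)) = arrow (i, k)

/-- `Γ_p` has the topology of a subspace of a finite power of `Γ`. -/
instance (p : SimplexCategory) : TopologicalSpace (G.Nerve p) :=
  TopologicalSpace.induced Nerve.arrow inferInstance

variable {G G'}

/-- The `i`-th object of a composable sequence. -/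
def Nerve.vertex {p : SimplexCategory} (x : G.Nerve p) (i : Fin (p.len + 1)) : G.M :=
  G.str.src (x.arrow (i, i))

/-- The simplicial structure; for a face map this leaves out one of the `p + 1` objects. -/
def Nerve.map {p q : SimplexCategory} (φ : q ⟶ p) (x : G.Nerve p) : G.Nerve q where
  arrow ij := x.arrow (φ.toOrderHom ij.1, φ.toOrderHom ij.2)
  arrow_self _ := x.arrow_self _
  composable _ _ _ := x.composable _ _ _
  mul_arrow _ _ _ := x.mul_arrow _ _ _

theorem Nerve.continuous_arrow {p : SimplexCategory} :
    Continuous (Nerve.arrow : G.Nerve p → Pairs p → G.Γ) :=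
  continuous_induced_dom

theorem Nerve.arrow_injective {p : SimplexCategory} :
    Function.Injective (Nerve.arrow : G.Nerve p → Pairs p → G.Γ) :=
  fun _ _ h => Nerve.ext h

theorem Nerve.continuous_map {p q : SimplexCategory} (φ : q ⟶ p) :
    Continuous (Nerve.map φ : G.Nerve p → G.Nerve q) :=
  continuous_induced_rng.2 (continuous_pi fun ij =>
    (continuous_apply (φ.toOrderHom ij.1, φ.toOrderHom ij.2)).comp Nerve.continuous_arrow)

/-- The map of simplicial manifolds induced by a morphism of Lie groupoids. -/
def Hom.nerveMap (φ : Hom G' G) {p : SimplexCategory} (x : G'.Nerve p) : G.Nerve p where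
  arrow ij := φ.arr (x.arrow ij)
  arrow_self i := by rw [φ.src_arr, ← φ.arr_one, ← x.arrow_self i]
  composable i j k := by rw [φ.src_arr, φ.tgt_arr, x.composable i j k]
  mul_arrow i j k := by rw [← φ.arr_mul _ _ (x.composable i j k), x.mul_arrow i j k]

theorem Hom.continuous_nerveMap (φ : Hom G' G) {p : SimplexCategory} :
    Continuous (φ.nerveMap (p := p)) :=
  continuous_induced_rng.2 (continuous_pi fun ij =>
    φ.contMDiff_arr.continuous.comp ((continuous_apply ij).comp Nerve.continuous_arrow))

theorem continuous_src (G : LieGroupoid.{u}) : Continuous G.str.src :=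
  G.str.src_submersion.contMDiff.continuous

theorem Nerve.continuous_vertex {p : SimplexCategory} (i : Fin (p.len + 1)) :
    Continuous (fun x : G.Nerve p => x.vertex i) :=
  G.continuous_src.comp ((continuous_apply (i, i)).comp Nerve.continuous_arrow)

/-- The sequence of `p` identity arrows at a point of `M`; for `p = 0` this is the identification
`M = Γ_0`. -/
def Nerve.const (p : SimplexCategory) (x : G.M) : G.Nerve p where
  arrow _ := G.str.one x
  arrow_self _ := by rw [G.str.src_one]
  composable _ _ _ := by rw [G.str.src_one, G.str.tgt_one]
  mul_arrow _ _ _ := by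
    have h := G.str.one_mul (G.str.one x)
    rwa [G.str.tgt_one] at h

theorem Nerve.vertex_const (p : SimplexCategory) (x : G.M) (i : Fin (p.len + 1)) :
    (Nerve.const p x).vertex i = x :=
  G.str.src_one x

theorem Nerve.continuous_const (p : SimplexCategory) :
    Continuous (Nerve.const p : G.M → G.Nerve p) :=
  continuous_induced_rng.2 (continuous_pi fun _ => G.str.contMDiff_one.continuous)

/-- The model of the finite power of `Γ` in which `Γ_p` is an embedded submanifold. -/
abbrev pairsModel (G : LieGroupoid.{u}) (p : SimplexCategory) :=
  ModelWithCorners.pi fun _ : Pairs p => 𝓡 G.n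

/-- Smoothness of a map on an open subset `U` of the submanifold `Γ_p` of the power of `Γ`:
smoothness on this subset of the ambient manifold. -/
def SmoothOnNerve {E H : Type*} [NormedAddCommGroup E] [NormedSpace ℝ E] [TopologicalSpace H]
    (J : ModelWithCorners ℝ E H) {N : Type*} [TopologicalSpace N] [ChartedSpace H N]
    {p : SimplexCategory} (U : Opens (G.Nerve p)) (f : U → N) : Prop :=
  ∃ g : (Pairs p → G.Γ) → N, (∀ x : U, g x.1.arrow = f x) ∧
    ContMDiffOn (G.pairsModel p) J ∞ g {y | ∃ x ∈ U, x.arrow = y}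

/-- An open subset of one of the manifolds `Γ_p`. These are the objects of the site of the
simplicial manifold `Γ_•`. -/
structure SimplicialOpen (G : LieGroupoid.{u}) : Type u where
  deg : SimplexCategory
  set : Opens (G.Nerve deg)

/-- A morphism `(Γ_p ⊇ U) ⟶ (Γ_q ⊇ V)` is a simplicial operator `Γ_p → Γ_q` that maps `U`
into `V`. -/
@[ext]
structure SimplicialOpen.Hom (U V : G.SimplicialOpen) : Type u where
  operator : V.deg ⟶ U.deg
  mem : ∀ x ∈ U.set, Nerve.map operator x ∈ V.set

instance : SmallCategory G.SimplicialOpen where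
  Hom := SimplicialOpen.Hom
  id U := ⟨𝟙 _, fun _ hx => hx⟩
  comp f g := ⟨g.operator ≫ f.operator, fun x hx => g.mem _ (f.mem x hx)⟩

/-- The map underlying a morphism. -/
def SimplicialOpen.Hom.toFun {U V : G.SimplicialOpen} (f : U ⟶ V) (x : U.set) : V.set :=
  ⟨Nerve.map f.operator x.1, f.mem x.1 x.2⟩

/-- The inclusion of a smaller open subset of the same `Γ_p`. -/
def SimplicialOpen.incl {p : SimplexCategory} {V U : Opens (G.Nerve p)} (h : V ≤ U) :
    (⟨p, V⟩ : G.SimplicialOpen) ⟶ ⟨p, U⟩ :=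
  ⟨𝟙 p, fun _ hx => h hx⟩

/-- Coverings are the open coverings in each degree. -/
def topology (G : LieGroupoid.{u}) : GrothendieckTopology G.SimplicialOpen where
  sieves U := {S | ∀ x ∈ U.set, ∃ (V : Opens (G.Nerve U.deg)) (h : V ≤ U.set), x ∈ V ∧
    S (SimplicialOpen.incl h)}
  top_mem' U x hx := ⟨U.set, le_rfl, hx, trivial⟩
  pullback_stable' U W S f hS x hx := by
    obtain ⟨V, hV, hxV, hS⟩ := hS _ (f.mem x hx)
    refine ⟨W.set ⊓ V.comap ⟨_, Nerve.continuous_map f.operator⟩, inf_le_left, ⟨hx, hxV⟩, ?_⟩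
    exact S.downward_closed hS (Z := ⟨W.deg, W.set ⊓ V.comap ⟨_, Nerve.continuous_map f.operator⟩⟩)
      ⟨f.operator, fun y hy => hy.2⟩
  transitive' U S hS R hR x hx := by
    obtain ⟨V, hV, hxV, hSV⟩ := hS x hx
    obtain ⟨W, hW, hxW, hRW⟩ := hR hSV x hxV
    exact ⟨W, hW.trans hV, hxW, hRW⟩

/-- The group `C^∞(U, S¹)` for an open subset `U` of `Γ_p`. -/
def circleSections (U : G.SimplicialOpen) : Subgroup (U.set → Circle) where
  carrier := {f | SmoothOnNerve (𝓡 1) U.set f}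
  one_mem' := ⟨fun _ => 1, fun _ => rfl, contMDiffOn_const⟩
  mul_mem' := by
    rintro f f' ⟨g, hg, h⟩ ⟨g', hg', h'⟩
    exact ⟨fun y => g y * g' y, fun x => congrArg₂ (· * ·) (hg x) (hg' x), h.mul h'⟩
  inv_mem' := by
    rintro f ⟨g, hg, h⟩
    exact ⟨fun y => (g y)⁻¹, fun x => congrArg (·⁻¹) (hg x), h.inv⟩

theorem contMDiff_reindex {p q : SimplexCategory} (σ : Pairs q → Pairs p) :
    ContMDiff (G.pairsModel p) (G.pairsModel q) ∞ (fun y : Pairs p → G.Γ => fun k => y (σ k)) :=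
  fun _ => contMDiffWithinAt_piManifold fun k => contMDiff_piManifold_apply (σ k) _

theorem SmoothOnNerve.comp_map {U V : G.SimplicialOpen} (h : U ⟶ V) {f : V.set → Circle}
    (hf : SmoothOnNerve (𝓡 1) V.set f) :
    SmoothOnNerve (𝓡 1) U.set (fun x => f (SimplicialOpen.Hom.toFun h x)) := by
  obtain ⟨g, hg, hs⟩ := hf
  refine ⟨fun y => g fun k => y (h.operator.toOrderHom k.1, h.operator.toOrderHom k.2),
    fun x => hg (SimplicialOpen.Hom.toFun h x), ?_⟩
  refine hs.comp (contMDiff_reindex (G := G)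
    (fun k : Pairs V.deg => (h.operator.toOrderHom k.1, h.operator.toOrderHom k.2))).contMDiffOn ?_
  rintro _ ⟨x, hx, rfl⟩
  exact ⟨_, h.mem x hx, rfl⟩

theorem SmoothOnNerve.of_local {p : SimplexCategory} (U : Opens (G.Nerve p)) (f : U → Circle)
    (h : ∀ x : U, ∃ (V : Opens (G.Nerve p)) (hV : V ≤ U), x.1 ∈ V ∧
      SmoothOnNerve (𝓡 1) V (fun y : V => f ⟨y.1, hV y.2⟩)) :
    SmoothOnNerve (𝓡 1) U f := by
  have hinj : Function.Injective (fun y : U => y.1.arrow) :=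
    Nerve.arrow_injective.comp Subtype.val_injective
  let g : (Pairs p → G.Γ) → Circle := Function.extend (fun y : U => y.1.arrow) f (fun _ => 1)
  have hg : ∀ y : U, g y.1.arrow = f y := fun y => hinj.extend_apply _ _ _
  refine ⟨g, hg, ?_⟩
  rintro _ ⟨x, hx, rfl⟩
  obtain ⟨V, hV, hxV, g', hg', hs⟩ := h ⟨x, hx⟩
  have h1 := hs x.arrow ⟨x, hxV, rfl⟩
  have h2 : ContMDiffWithinAt (G.pairsModel p) (𝓡 1) ∞ g {y | ∃ x ∈ V, x.arrow = y} x.arrow := by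
    refine h1.congr ?_ ?_
    · rintro _ ⟨y, hy, rfl⟩
      rw [hg ⟨y, hV hy⟩, hg' ⟨y, hy⟩]
    · rw [hg ⟨x, hx⟩, hg' ⟨x, hxV⟩]
  refine h2.mono_of_mem_nhdsWithin ?_
  obtain ⟨O, hO, hOV⟩ := isOpen_induced_iff.1 V.isOpen
  rw [mem_nhdsWithin]
  refine ⟨O, hO, ?_, ?_⟩
  · have : x ∈ (Nerve.arrow ⁻¹' O : Set (G.Nerve p)) := by rw [hOV]; exact hxV
    exact this
  · rintro _ ⟨hyO, y, hy, rfl⟩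
    have : y ∈ (V : Set (G.Nerve p)) := by rw [← hOV]; exact hyO
    exact ⟨y, this, rfl⟩

/-- The presheaf of smooth `S¹`-valued functions on the site of `Γ_•`. -/
def circlePresheaf (G : LieGroupoid.{u}) : G.SimplicialOpenᵒᵖ ⥤ AddCommGrpCat.{u} where
  obj U := AddCommGrpCat.of (Additive (circleSections U.unop))
  map h := AddCommGrpCat.ofHom (MonoidHom.toAdditive
    { toFun := fun f => ⟨fun x => f.1 (SimplicialOpen.Hom.toFun h.unop x), f.2.comp_map h.unop⟩
      map_one' := rfl
      map_mul' := fun _ _ => rfl })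
  map_id _ := rfl
  map_comp _ _ := rfl

theorem circlePresheaf_isSheaf : Presheaf.IsSheaf G.topology G.circlePresheaf := by
  rw [Presheaf.isSheaf_iff_isSheaf_forget _ _ (forget AddCommGrpCat), isSheaf_iff_isSheaf_of_type]
  intro U S hS fam hfam
  have key : ∀ {W : G.SimplicialOpen} (j : W ⟶ U) (hj : S j) (w : W.set) (V : Opens (G.Nerve U.deg))
      (hV : V ≤ U.set) (hSV : S (SimplicialOpen.incl hV)) (hw : Nerve.map j.operator w.1 ∈ V),
      (show circleSections W from fam j hj).1 w =
        (show circleSections ⟨U.deg, V⟩ from fam (SimplicialOpen.incl hV) hSV).1 ⟨_, hw⟩ := by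
    intro W j hj w V hV hSV hw
    let W' : G.SimplicialOpen := ⟨W.deg, W.set ⊓ V.comap ⟨_, Nerve.continuous_map j.operator⟩⟩
    let a : W' ⟶ W := SimplicialOpen.incl inf_le_left
    let b : W' ⟶ ⟨U.deg, V⟩ := ⟨j.operator, fun y hy => hy.2⟩
    have := hfam a b hj hSV rfl
    exact congrFun (congrArg Subtype.val (this : (_ : circleSections W') = _)) ⟨w.1, w.2, hw⟩
  choose V hV hx hSV using hS
  let g : U.set → Circle := fun x =>
    (show circleSections ⟨U.deg, _⟩ from fam (SimplicialOpen.incl (hV x.1 x.2)) (hSV x.1 x.2)).1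
      ⟨x.1, hx x.1 x.2⟩
  have hg : SmoothOnNerve (𝓡 1) U.set g := by
    refine SmoothOnNerve.of_local U.set g fun x => ⟨V x.1 x.2, hV x.1 x.2, hx x.1 x.2, ?_⟩
    have : (fun y : V x.1 x.2 => g ⟨y.1, hV x.1 x.2 y.2⟩) =
        (show circleSections ⟨U.deg, _⟩ from fam (SimplicialOpen.incl (hV x.1 x.2)) (hSV x.1 x.2)).1 :=
      funext fun y => (key (SimplicialOpen.incl (hV x.1 x.2)) (hSV x.1 x.2) y _ _ _ _).symm
    rw [this]
    exact Subtype.property _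
  refine ⟨(⟨g, hg⟩ : circleSections U), ?_, ?_⟩
  · intro W j hj
    refine Subtype.ext (a1 := (_ : circleSections W)) (funext fun y => ?_)
    exact (key j hj y _ _ _ _).symm
  · intro t ht
    refine Subtype.ext (a1 := (t : circleSections U)) (funext fun y => ?_)
    exact congrFun (congrArg Subtype.val
      (ht (SimplicialOpen.incl (hV y.1 y.2)) (hSV y.1 y.2) : (_ : circleSections ⟨U.deg, _⟩) = _))
      ⟨y.1, hx y.1 y.2⟩

/-- The sheaf `S¹` on `Γ_•`: the sheaf of smooth `S¹`-valued functions. -/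
def simplicialCircleSheaf (G : LieGroupoid.{u}) : AbSheaf G.topology :=
  ⟨G.circlePresheaf, circlePresheaf_isSheaf⟩


/-! ### The cohomology groups and the maps between them -/

/-- `H^k(Γ_•, S¹)`, the cohomology of the sheaf of smooth `S¹`-valued functions on `Γ_•`. A sheaf on
the site of `Γ_•` is a family of sheaves `F_p` on the manifolds `Γ_p` with compatible maps
`f⁻¹ F_q → F_p` for all simplicial operators `f : Γ_p → Γ_q`; an injective resolution of such a
sheaf consists of injective resolutions `F_p → I_p^•` with compatible maps `f⁻¹ I_q^• → I_p^•`, so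
the derived functors of global sections are the total cohomology of the double complex
`Γ(Γ_p, I_p^q)`. -/
abbrev simplicialH (G : LieGroupoid.{u}) (k : ℕ) : Type u :=
  Sheaf.H.{u} G.simplicialCircleSheaf k

/-- `H^k(M, S¹)`, the cohomology of the sheaf of smooth `S¹`-valued functions on `M`. -/
abbrev baseH (G : LieGroupoid.{u}) (k : ℕ) : Type u :=
  Sheaf.H.{u} (circleSheaf (m := G.m) G.M) k

/-- The embedding of the site of `M = Γ_0` into the site of `Γ_•`. -/
def baseInclusion (G : LieGroupoid.{u}) : Opens G.M ⥤ G.SimplicialOpen where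
  obj U := ⟨.mk 0, U.comap ⟨fun x : G.Nerve (.mk 0) => x.vertex 0, Nerve.continuous_vertex 0⟩⟩
  map {U V} h := ⟨𝟙 _, fun x hx => by
    change x.vertex 0 ∈ U at hx
    exact leOfHom h hx⟩
  map_id _ := rfl
  map_comp _ _ := rfl

theorem baseInclusion_compatiblePreserving :
    CompatiblePreserving.{u} G.topology G.baseInclusion where
  compatible := by
    intro ℱ Z T x hx Y₁ Y₂ X f₁ f₂ g₁ g₂ hg₁ hg₂ e
    have h0 : f₁.operator = f₂.operator := by
      have := congrArg SimplicialOpen.Hom.operator e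
      exact (Category.id_comp _).symm.trans (this.trans (Category.id_comp _))
    let k : X ⟶ G.baseInclusion.obj (Y₁ ⊓ Y₂) :=
      ⟨f₁.operator, fun y hy => ⟨f₁.mem y hy, by
        have := f₂.mem y hy
        rw [← h0] at this
        exact this⟩⟩
    have h := hx (homOfLE inf_le_left : Y₁ ⊓ Y₂ ⟶ Y₁) (homOfLE inf_le_right : Y₁ ⊓ Y₂ ⟶ Y₂)
      hg₁ hg₂ rfl
    have e₁ : f₁ = k ≫ G.baseInclusion.map (homOfLE inf_le_left : Y₁ ⊓ Y₂ ⟶ Y₁) :=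
      SimplicialOpen.Hom.ext (Category.id_comp _).symm
    have e₂ : f₂ = k ≫ G.baseInclusion.map (homOfLE inf_le_right : Y₁ ⊓ Y₂ ⟶ Y₂) :=
      SimplicialOpen.Hom.ext (h0.symm.trans (Category.id_comp _).symm)
    rw [e₁, e₂, op_comp, op_comp, Functor.map_comp, Functor.map_comp]
    exact congrArg (ℱ.obj.map k.op) h

theorem baseInclusion_coverPreserving :
    CoverPreserving (Opens.grothendieckTopology G.M) G.topology G.baseInclusion where
  cover_preserve := by
    intro U S hS x hx
    obtain ⟨V, i, hi, hxV⟩ := hS _ hx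
    exact ⟨(G.baseInclusion.obj V).set, fun _ hy => leOfHom i hy, hxV, V, i, 𝟙 _, hi,
      SimplicialOpen.Hom.ext (Category.id_comp _).symm⟩

instance : G.baseInclusion.IsContinuous (Opens.grothendieckTopology G.M) G.topology :=
  Functor.isContinuous_of_coverPreserving baseInclusion_compatiblePreserving
    baseInclusion_coverPreserving

instance : G.baseInclusion.IsCocontinuous (Opens.grothendieckTopology G.M) G.topology where
  cover_lift := by
    intro U S hS x hx
    obtain ⟨V, hV, hxV, hSV⟩ := hS (Nerve.const _ x) (by
      change (Nerve.const _ x).vertex 0 ∈ U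
      rwa [Nerve.vertex_const])
    refine ⟨U ⊓ V.comap ⟨_, Nerve.continuous_const _⟩, homOfLE inf_le_left, ?_, hx, hxV⟩
    refine S.downward_closed hSV
      (Z := G.baseInclusion.obj (U ⊓ V.comap ⟨_, Nerve.continuous_const _⟩))
      ⟨𝟙 _, fun y hy => ?_⟩
    have h1 : Nerve.const _ (y.vertex 0) = y := by
      refine Nerve.ext (funext fun ij => ?_)
      obtain ⟨i, j⟩ := ij
      have hi : i = 0 := Subsingleton.elim (α := Fin 1) _ _
      have hj : j = 0 := Subsingleton.elim (α := Fin 1) _ _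
      subst hi hj
      exact (y.arrow_self 0).symm
    have h2 : Nerve.const _ (y.vertex 0) ∈ V := hy.2
    exact h1 ▸ h2

/-- The sheaf `S¹` on `Γ_•` restricts to the sheaf `S¹` on `M = Γ_0`. -/
def restrictCircle (G : LieGroupoid.{u}) :
    (precompSheaf (Opens.grothendieckTopology G.M) G.topology G.baseInclusion).obj
      G.simplicialCircleSheaf ⟶ circleSheaf (m := G.m) G.M where
  hom :=
    { app := fun U => AddCommGrpCat.ofHom (MonoidHom.toAdditive
        { toFun := fun f => (⟨fun x => f.1 ⟨Nerve.const _ x.1, by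
              change (Nerve.const _ x.1).vertex 0 ∈ U.unop
              rw [Nerve.vertex_const]; exact x.2⟩, by
            obtain ⟨g, hg, hs⟩ := f.2
            have h1 : ContMDiff (𝓡 G.m) (G.pairsModel (.mk 0)) ∞
                (fun x : U.unop => (Nerve.const (.mk 0) x.1).arrow) := fun x =>
              contMDiffWithinAt_piManifold fun _ =>
                (G.str.contMDiff_one.comp contMDiff_subtype_val) x
            have h2 : ∀ x : U.unop, Nerve.const (.mk 0) x.1 ∈ (G.baseInclusion.obj U.unop).set := by
              intro x
              change (Nerve.const _ x.1).vertex 0 ∈ U.unop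
              rw [Nerve.vertex_const]; exact x.2
            have h3 := hs.comp_contMDiff h1 fun x => ⟨_, h2 x, rfl⟩
            have h4 : (fun x : U.unop => g (Nerve.const (.mk 0) x.1).arrow) = fun x : U.unop =>
                f.1 ⟨Nerve.const (.mk 0) x.1, h2 x⟩ := funext fun x => hg ⟨_, h2 x⟩
            exact h4 ▸ h3⟩ : C^∞⟮𝓡 G.m, U.unop; 𝓡 1, Circle⟯)
          map_one' := rfl
          map_mul' := fun _ _ => rfl })
      naturality := fun _ _ _ => rfl }

/-- The restriction `H^k(Γ_•, S¹) → H^k(M, S¹)`. -/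
def restriction (G : LieGroupoid.{u}) (k : ℕ) : G.simplicialH k →+ G.baseH k :=
  cohomologyRestrict G.baseInclusion G.restrictCircle k

/-- Pulling back open subsets along a morphism of Lie groupoids. -/
def Hom.preimage (φ : Hom G' G) : G.SimplicialOpen ⥤ G'.SimplicialOpen where
  obj U := ⟨U.deg, U.set.comap ⟨_, φ.continuous_nerveMap⟩⟩
  map h := ⟨h.operator, fun _ hx => h.mem _ hx⟩
  map_id _ := rfl
  map_comp _ _ := rfl

instance (φ : Hom G' G) : RepresentablyFlat φ.preimage where
  cofiltered X :=
    { cone_objs := by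
        intro V W
        let Z : G.SimplicialOpen := ⟨X.deg,
          V.right.set.comap ⟨_, Nerve.continuous_map V.hom.operator⟩ ⊓
          W.right.set.comap ⟨_, Nerve.continuous_map W.hom.operator⟩⟩
        let f : X ⟶ φ.preimage.obj Z := ⟨𝟙 _, fun x hx => ⟨V.hom.mem x hx, W.hom.mem x hx⟩⟩
        let a : Z ⟶ V.right := ⟨V.hom.operator, fun x hx => hx.1⟩
        let b : Z ⟶ W.right := ⟨W.hom.operator, fun x hx => hx.2⟩
        exact ⟨StructuredArrow.mk f, StructuredArrow.homMk a (SimplicialOpen.Hom.ext (Category.comp_id _)),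
          StructuredArrow.homMk b (SimplicialOpen.Hom.ext (Category.comp_id _)),
          trivial⟩
      cone_maps := by
        intro V W a b
        let Z : G.SimplicialOpen := ⟨X.deg,
          V.right.set.comap ⟨_, Nerve.continuous_map V.hom.operator⟩⟩
        let f : X ⟶ φ.preimage.obj Z := ⟨𝟙 _, fun x hx => V.hom.mem x hx⟩
        let c : Z ⟶ V.right := ⟨V.hom.operator, fun x hx => hx⟩
        refine ⟨StructuredArrow.mk f, StructuredArrow.homMk c (SimplicialOpen.Hom.ext (Category.comp_id _)), ?_⟩
        ext
        refine SimplicialOpen.Hom.ext ?_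
        have ha := congrArg SimplicialOpen.Hom.operator (StructuredArrow.w a)
        have hb := congrArg SimplicialOpen.Hom.operator (StructuredArrow.w b)
        exact ha.trans hb.symm
      nonempty := ⟨StructuredArrow.mk (Y := (⟨X.deg, ⊤⟩ : G.SimplicialOpen))
        (⟨𝟙 _, fun _ _ => Set.mem_univ _⟩ : X ⟶ φ.preimage.obj ⟨X.deg, ⊤⟩)⟩ }

instance (φ : Hom G' G) : φ.preimage.IsContinuous G.topology G'.topology :=
  Functor.isContinuous_of_coverPreserving (compatiblePreservingOfFlat _ _)
    { cover_preserve := by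
        intro U S hS x hx
        obtain ⟨V, hV, hxV, hSV⟩ := hS (φ.nerveMap x) hx
        exact ⟨V.comap ⟨_, φ.continuous_nerveMap⟩, fun _ hy => hV hy, hxV,
          ⟨U.deg, V⟩, SimplicialOpen.incl hV, 𝟙 _, hSV, rfl⟩ }

/-- Pullback of smooth `S¹`-valued functions along a morphism of Lie groupoids. -/
def Hom.pullbackCircle (φ : Hom G' G) : G.simplicialCircleSheaf ⟶
    (precompSheaf G.topology G'.topology φ.preimage).obj G'.simplicialCircleSheaf where
  hom :=
    { app := fun U => AddCommGrpCat.ofHom (MonoidHom.toAdditive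
        { toFun := fun f => (⟨fun x => f.1 ⟨φ.nerveMap x.1, x.2⟩, by
            obtain ⟨g, hg, hs⟩ := f.2
            refine ⟨fun y => g fun ij => φ.arr (y ij), fun x => hg ⟨φ.nerveMap x.1, x.2⟩, ?_⟩
            have h1 : ContMDiff (G'.pairsModel U.unop.deg) (G.pairsModel U.unop.deg) ∞
                (fun (y : Pairs U.unop.deg → G'.Γ) ij => φ.arr (y ij)) := fun y =>
              contMDiffWithinAt_piManifold fun ij =>
                (φ.contMDiff_arr.comp (contMDiff_piManifold_apply ij)) y
            refine hs.comp h1.contMDiffOn ?_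
            rintro _ ⟨x, hx, rfl⟩
            exact ⟨φ.nerveMap x, hx, rfl⟩⟩ : circleSections (φ.preimage.obj U.unop))
          map_one' := rfl
          map_mul' := fun _ _ => rfl })
      naturality := fun _ _ _ => rfl }

/-- Enlarging an open subset of `Γ_p` to all of `Γ_p`. -/
def SimplicialOpen.enlarge (G' G : LieGroupoid.{u}) : G'.SimplicialOpen ⥤ G.SimplicialOpen where
  obj U := ⟨U.deg, ⊤⟩
  map h := ⟨h.operator, fun _ _ => trivial⟩
  map_id _ := rfl
  map_comp _ _ := rfl

/-- The inclusion of an open subset into the preimage of all of `Γ_p`. -/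
def Hom.toEnlarge (φ : Hom G' G) :
    𝟭 G'.SimplicialOpen ⟶ SimplicialOpen.enlarge G' G ⋙ φ.preimage where
  app _ := ⟨𝟙 _, fun _ _ => trivial⟩
  naturality _ _ _ := rfl

/-- The pullback `φ^* : H^k(Γ_•, S¹) → H^k(Γ'_•, S¹)` along a morphism of Lie groupoids. -/
def Hom.pullbackH (φ : Hom G' G) (k : ℕ) : G.simplicialH k →+ G'.simplicialH k :=
  cohomologyPullback φ.preimage (SimplicialOpen.enlarge G' G) φ.toEnlarge φ.pullbackCircle k

/-- Pulling back open subsets of `M` along the map of objects. -/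
def Hom.basePreimage (φ : Hom G' G) : Opens G.M ⥤ Opens G'.M where
  obj U := U.comap ⟨φ.obj, φ.contMDiff_obj.continuous⟩
  map h := homOfLE fun _ hx => leOfHom h hx

instance (φ : Hom G' G) : RepresentablyFlat φ.basePreimage where
  cofiltered X :=
    { cone_objs := fun V W => ⟨StructuredArrow.mk (Y := V.right ⊓ W.right)
          (homOfLE fun _ hx => ⟨leOfHom V.hom hx, leOfHom W.hom hx⟩ :
            X ⟶ φ.basePreimage.obj (V.right ⊓ W.right)),
        StructuredArrow.homMk (homOfLE inf_le_left) rfl,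
        StructuredArrow.homMk (homOfLE inf_le_right) rfl, trivial⟩
      cone_maps := fun V W a b => ⟨V, 𝟙 _, by ext; exact Subsingleton.elim _ _⟩
      nonempty := ⟨StructuredArrow.mk (Y := (⊤ : Opens G.M))
        (homOfLE fun _ _ => Set.mem_univ _ : X ⟶ φ.basePreimage.obj ⊤)⟩ }

instance (φ : Hom G' G) : φ.basePreimage.IsContinuous (Opens.grothendieckTopology G.M)
    (Opens.grothendieckTopology G'.M) :=
  Functor.isContinuous_of_coverPreserving (compatiblePreservingOfFlat _ _)
    { cover_preserve := by
        intro U S hS x hx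
        obtain ⟨V, i, hi, hxV⟩ := hS (φ.obj x) hx
        exact ⟨φ.basePreimage.obj V, φ.basePreimage.map i, ⟨V, i, 𝟙 _, hi, rfl⟩, hxV⟩ }

/-- Pullback of smooth `S¹`-valued functions along the map of objects. -/
def Hom.basePullbackCircle (φ : Hom G' G) : circleSheaf (m := G.m) G.M ⟶
    (precompSheaf (Opens.grothendieckTopology G.M) (Opens.grothendieckTopology G'.M)
      φ.basePreimage).obj (circleSheaf (m := G'.m) G'.M) where
  hom :=
    { app := fun U => AddCommGrpCat.ofHom (MonoidHom.toAdditive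
        { toFun := fun f => (⟨fun x => (show C^∞⟮𝓡 G.m, U.unop; 𝓡 1, Circle⟯ from f)
              ⟨φ.obj x.1, x.2⟩, by
            refine (ContMDiffMap.contMDiff
              (show C^∞⟮𝓡 G.m, U.unop; 𝓡 1, Circle⟯ from f)).comp ?_
            rw [← ContMDiff.subtypeVal_comp_iff]
            exact φ.contMDiff_obj.comp contMDiff_subtype_val⟩ :
            C^∞⟮𝓡 G'.m, (φ.basePreimage.obj U.unop); 𝓡 1, Circle⟯)
          map_one' := rfl
          map_mul' := fun _ _ => rfl })
      naturality := fun _ _ _ => rfl }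

/-- The pullback `H^k(M, S¹) → H^k(M', S¹)` along the map of objects. -/
def Hom.basePullbackH (φ : Hom G' G) (k : ℕ) : G.baseH k →+ G'.baseH k :=
  cohomologyPullback φ.basePreimage ((Functor.const _).obj (⊤ : Opens G.M))
    { app := fun _ => homOfLE le_top, naturality := fun _ _ _ => rfl } φ.basePullbackCircle k

end LieGroupoid

/-! ### Principal `S¹`-bundles -/

/-- A smooth principal `S¹`-bundle over a manifold `B`. -/
structure CircleBundle {n : ℕ} (B : Type u) [TopologicalSpace B]
    [ChartedSpace (EuclideanSpace ℝ (Fin n)) B] where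
  total : Type u
  [top : TopologicalSpace total]
  [chart : ChartedSpace (ModelProd (EuclideanSpace ℝ (Fin n)) (EuclideanSpace ℝ (Fin 1))) total]
  [mfd : IsManifold ((𝓡 n).prod (𝓡 1)) ∞ total]
  [action : MulAction Circle total]
  proj : total → B
  contMDiff_proj : ContMDiff ((𝓡 n).prod (𝓡 1)) (𝓡 n) ∞ proj
  contMDiff_smul : ContMDiff ((𝓡 1).prod ((𝓡 n).prod (𝓡 1))) ((𝓡 n).prod (𝓡 1)) ∞
    (fun q : Circle × total => q.1 • q.2)
  proj_smul : ∀ (z : Circle) (r : total), proj (z • r) = proj r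
  /-- local triviality: around each point there is an equivariant diffeomorphism
  `π⁻¹(U) ≅ U × S¹` over `U` -/
  locally_trivial : ∀ b : B, ∃ (U : Opens B) (e : OpenPartialHomeomorph total (B × Circle)),
    b ∈ U ∧ e.source = proj ⁻¹' U ∧ e.target = (U : Set B) ×ˢ Set.univ ∧
    (∀ r ∈ e.source, (e r).1 = proj r) ∧
    (∀ (z : Circle), ∀ r ∈ e.source, (e (z • r)).2 = z * (e r).2) ∧
    ContMDiffOn ((𝓡 n).prod (𝓡 1)) ((𝓡 n).prod (𝓡 1)) ∞ e e.source ∧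
    ContMDiffOn ((𝓡 n).prod (𝓡 1)) ((𝓡 n).prod (𝓡 1)) ∞ e.symm e.target

attribute [instance] CircleBundle.top CircleBundle.chart CircleBundle.mfd CircleBundle.action

/-- A smooth section of an `S¹`-bundle over an open subset. -/
structure CircleBundle.Section {n : ℕ} {B : Type u} [TopologicalSpace B]
    [ChartedSpace (EuclideanSpace ℝ (Fin n)) B] (L : CircleBundle (n := n) B)
    (U : Opens B) where
  toFun : U → L.total
  contMDiff_toFun : ContMDiff (𝓡 n) ((𝓡 n).prod (𝓡 1)) ∞ toFun
  proj_toFun : ∀ x, L.proj (toFun x) = x.1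

/-- `L.HasClass a` says that `a ∈ H^1(M, S¹) = Ext^1(ℤ, S¹)` is the class of the `S¹`-bundle `L`:
`a` is the class of an extension `0 → S¹ → E → ℤ → 0` whose torsor of local lifts of `1 ∈ ℤ` is
identified (by the equivariant maps `ρ`) with the torsor of local sections of `L`. -/
def CircleBundle.HasClass {m : ℕ} {M : Type u} [TopologicalSpace M]
    [ChartedSpace (EuclideanSpace ℝ (Fin m)) M] (L : CircleBundle (n := m) M)
    (a : Sheaf.H.{u} (circleSheaf (m := m) M) 1) : Prop :=
  ∃ (E : AbSheaf (Opens.grothendieckTopology M)) (i : circleSheaf (m := m) M ⟶ E)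
    (q : E ⟶ ZSheaf (Opens.grothendieckTopology M)) (w : i ≫ q = 0)
    (h : (ShortComplex.mk i q w).ShortExact)
    (ρ : ∀ U : Opens M, L.Section U → E.obj.obj (op U)),
    (∀ (U V : Opens M) (j : V ⟶ U) (σ : L.Section U) (τ : L.Section V),
      (∀ x : V, τ.toFun x = σ.toFun ⟨x.1, leOfHom j x.2⟩) → ρ V τ = E.obj.map j.op (ρ U σ)) ∧
    (∀ (U : Opens M) (f : C^∞⟮𝓡 m, U; 𝓡 1, Circle⟯) (σ τ : L.Section U),
      (∀ x, τ.toFun x = f x • σ.toFun x) →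
        ρ U τ = i.hom.app (op U) (Additive.ofMul f : Additive C^∞⟮𝓡 m, U; 𝓡 1, Circle⟯) + ρ U σ) ∧
    (∀ (U : Opens M) (σ : L.Section U), q.hom.app (op U) (ρ U σ) = ZSheaf.one _ U) ∧
    a = h.extClass

/-! ### `S¹`-central extensions -/

/-- An `S¹`-central extension of a Lie groupoid `Γ ⇉ M`: a Lie groupoid `R ⇉ M` with a morphism
`(π, id)` to `Γ ⇉ M` and an `S¹`-action making `π : R → Γ` a principal `S¹`-bundle, such that
`(s • x)(t • y) = st • (x y)`. -/
structure CentralExtension (G : LieGroupoid.{u}) extends CircleBundle (n := G.n) G.Γ where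
  str : LieGroupoidStr (𝓡 G.m) ((𝓡 G.n).prod (𝓡 1)) G.M total
  src_proj : ∀ r, G.str.src (proj r) = str.src r
  tgt_proj : ∀ r, G.str.tgt (proj r) = str.tgt r
  proj_one : ∀ x, proj (str.one x) = G.str.one x
  proj_mul : ∀ r r', str.src r = str.tgt r' →
    proj (str.mul r r') = G.str.mul (proj r) (proj r')
  smul_mul_smul : ∀ (s t : Circle) (r r' : total), str.src r = str.tgt r' →
    str.mul (s • r) (t • r') = (s * t) • str.mul r r'

namespace CentralExtension

variable {G G' : LieGroupoid.{u}}

/-- Isomorphism of central extensions: an equivariant diffeomorphism over `Γ` that is a morphism of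
groupoids. -/
def IsIso (R R' : CentralExtension G) : Prop :=
  ∃ e : R.total ≃ₘ^∞⟮(𝓡 G.n).prod (𝓡 1), (𝓡 G.n).prod (𝓡 1)⟯ R'.total,
    (∀ r, R'.proj (e r) = R.proj r) ∧ (∀ (z : Circle) (r : R.total), e (z • r) = z • e r) ∧
    ∀ r s, R.str.src r = R.str.tgt s → e (R.str.mul r s) = R'.str.mul (e r) (e s)

theorem IsIso.refl (R : CentralExtension G) : IsIso R R :=
  ⟨Diffeomorph.refl _ _ _, fun _ => rfl, fun _ _ => rfl, fun _ _ _ => rfl⟩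

theorem IsIso.symm {R R' : CentralExtension G} : IsIso R R' → IsIso R' R := by
  rintro ⟨e, h1, h2, h3⟩
  have hp : ∀ r, R.proj (e.symm r) = R'.proj r := fun r => by rw [← h1, e.apply_symm_apply]
  refine ⟨e.symm, hp, fun z r => e.injective ?_, fun r s h => e.injective ?_⟩ <;>
    change e _ = e _
  · rw [h2, e.apply_symm_apply, e.apply_symm_apply]
  · rw [h3, e.apply_symm_apply, e.apply_symm_apply, e.apply_symm_apply]
    rw [← R.src_proj, ← R.tgt_proj, hp, hp, R'.src_proj, R'.tgt_proj, h]

theorem IsIso.trans {R R' R'' : CentralExtension G} : IsIso R R' → IsIso R' R'' → IsIso R R'' := by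
  rintro ⟨e, h1, h2, h3⟩ ⟨e', h1', h2', h3'⟩
  refine ⟨e.trans e', fun r => (h1' _).trans (h1 r), fun z r => ?_, fun r s h => ?_⟩
  · exact (congrArg e' (h2 z r)).trans (h2' z (e r))
  · refine (congrArg e' (h3 r s h)).trans (h3' _ _ ?_)
    rw [← R'.src_proj, ← R'.tgt_proj, h1, h1, R.src_proj, R.tgt_proj, h]

instance setoid (G : LieGroupoid.{u}) : Setoid (CentralExtension G) :=
  ⟨IsIso, IsIso.refl, IsIso.symm, IsIso.trans⟩

/-- `R''` is the tensor product `R ⊗ R' = R ×_{S¹} R'`: there is a smooth multiplicative map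
`μ : R ×_Γ R' → R''` over `Γ` with `μ (s • x) (t • y) = st • μ x y`. (Only the values of `μ` on
`R ×_Γ R'` matter; such a `μ` is exactly an isomorphism from the associated bundle to `R''`.) -/
def IsTensor (R R' R'' : CentralExtension G) : Prop :=
  ∃ μ : R.total → R'.total → R''.total,
    ContMDiffOn (((𝓡 G.n).prod (𝓡 1)).prod ((𝓡 G.n).prod (𝓡 1))) ((𝓡 G.n).prod (𝓡 1)) ∞
      (fun p : R.total × R'.total => μ p.1 p.2) {p | R.proj p.1 = R'.proj p.2} ∧
    (∀ x y, R.proj x = R'.proj y → R''.proj (μ x y) = R.proj x) ∧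
    (∀ (s t : Circle) x y, R.proj x = R'.proj y → μ (s • x) (t • y) = (s * t) • μ x y) ∧
    (∀ x₁ x₂ y₁ y₂, R.proj x₁ = R'.proj y₁ → R.proj x₂ = R'.proj y₂ →
      R.str.src x₁ = R.str.tgt x₂ →
        μ (R.str.mul x₁ x₂) (R'.str.mul y₁ y₂) = R''.str.mul (μ x₁ y₁) (μ x₂ y₂))

/-- `R'` is the pullback of `R` along a morphism of Lie groupoids `φ`: there is an
equivariant morphism of Lie groupoids `R' → R` covering `φ`. -/
def IsPullback (φ : G'.Hom G) (R : CentralExtension G) (R' : CentralExtension G') : Prop :=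
  ∃ Φ : R'.total → R.total,
    ContMDiff ((𝓡 G'.n).prod (𝓡 1)) ((𝓡 G.n).prod (𝓡 1)) ∞ Φ ∧
    (∀ r, R.proj (Φ r) = φ.arr (R'.proj r)) ∧
    (∀ (z : Circle) (r : R'.total), Φ (z • r) = z • Φ r) ∧
    (∀ r s, R'.str.src r = R'.str.tgt s → Φ (R'.str.mul r s) = R.str.mul (Φ r) (Φ s))

/-- `R` is the central extension with fibres `R_g = Iso(L_{src g}, L_{tgt g})`, for an `S¹`-bundle
`L` on `M`: the groupoid `R` acts smoothly on `L`, by `S¹`-equivariant maps between the fibres, with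
the central `S¹` acting by scalars. (Only the values `α r l` with `src r = π l` matter.) -/
def IsGaugeExtension (R : CentralExtension G) (L : CircleBundle (n := G.m) G.M) : Prop :=
  ∃ α : R.total → L.total → L.total,
    ContMDiffOn (((𝓡 G.n).prod (𝓡 1)).prod ((𝓡 G.m).prod (𝓡 1))) ((𝓡 G.m).prod (𝓡 1)) ∞
      (fun p : R.total × L.total => α p.1 p.2) {p | R.str.src p.1 = L.proj p.2} ∧
    (∀ r l, R.str.src r = L.proj l → L.proj (α r l) = R.str.tgt r) ∧
    (∀ l, α (R.str.one (L.proj l)) l = l) ∧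
    (∀ r s l, R.str.src r = R.str.tgt s → R.str.src s = L.proj l →
      α (R.str.mul r s) l = α r (α s l)) ∧
    (∀ (z : Circle) r l, R.str.src r = L.proj l → α r (z • l) = z • α r l) ∧
    (∀ (z : Circle) r l, R.str.src r = L.proj l → α (z • r) l = z • α r l)

/-- A smooth section of `R`, over an open subset `U` of `Γ_p`, along the arrow from the `b`-th to
the `a`-th object. -/
structure Section (R : CentralExtension G) (U : G.SimplicialOpen)
    (a b : Fin (U.deg.len + 1)) where
  toFun : U.set → R.total
  smooth : LieGroupoid.SmoothOnNerve ((𝓡 G.n).prod (𝓡 1)) U.set toFun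
  proj_toFun : ∀ x, R.proj (toFun x) = x.1.arrow (a, b)

/-- The `a`-th vertex map `Γ_p ⊇ U → Γ_0 = M`. -/
def vertexHom (U : G.SimplicialOpen) (a : Fin (U.deg.len + 1)) :
    U ⟶ (⟨.mk 0, ⊤⟩ : G.SimplicialOpen) :=
  ⟨SimplexCategory.const (.mk 0) U.deg a, fun _ _ => trivial⟩

/-- A presentation of the `S¹`-gerbe on `Γ_•` given by a central extension `R`: a 2-extension
`0 → S¹ → E → P → ℤ → 0` of sheaves on `Γ_•` (split into `0 → S¹ → E → K → 0` and
`0 → K → P → ℤ → 0`), a trivialization of it over `M`, that is, a section `v` of `P` over `M = Γ_0`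
lifting `1 ∈ ℤ`, and an identification `ρ` of local sections of `R` with local lifts to `E` of the
difference of the two pullbacks of `v` to `Γ`, such that the multiplication of `R` corresponds to
the addition of `E`. -/
structure GerbePresentation (R : CentralExtension G) where
  E : AbSheaf G.topology
  K : AbSheaf G.topology
  P : AbSheaf G.topology
  i : G.simplicialCircleSheaf ⟶ E
  q : E ⟶ K
  j : K ⟶ P
  ε : P ⟶ ZSheaf G.topology
  w₁ : i ≫ q = 0
  w₂ : j ≫ ε = 0
  exact₁ : (ShortComplex.mk i q w₁).ShortExact
  exact₂ : (ShortComplex.mk j ε w₂).ShortExact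
  v : P.obj.obj (op ⟨.mk 0, ⊤⟩)
  ε_v : ε.hom.app _ v = ZSheaf.one _ _
  ρ : ∀ (U : G.SimplicialOpen) (a b : Fin (U.deg.len + 1)), R.Section U a b → E.obj.obj (op U)
  ρ_map : ∀ (U V : G.SimplicialOpen) (h : V ⟶ U) (a b : Fin (U.deg.len + 1))
    (σ : R.Section U a b)
    (τ : R.Section V (h.operator.toOrderHom a) (h.operator.toOrderHom b)),
    (∀ x, τ.toFun x = σ.toFun (LieGroupoid.SimplicialOpen.Hom.toFun h x)) →
      ρ V _ _ τ = E.obj.map h.op (ρ U a b σ)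
  ρ_smul : ∀ (U : G.SimplicialOpen) (a b : Fin (U.deg.len + 1))
    (f : LieGroupoid.circleSections U) (σ τ : R.Section U a b),
    (∀ x, τ.toFun x = f.1 x • σ.toFun x) →
      ρ U a b τ = i.hom.app (op U) (Additive.ofMul f : Additive (LieGroupoid.circleSections U)) +
        ρ U a b σ
  ρ_mul : ∀ (U : G.SimplicialOpen) (a b c : Fin (U.deg.len + 1)) (σ : R.Section U a b)
    (τ : R.Section U b c) (υ : R.Section U a c),
    (∀ x, υ.toFun x = R.str.mul (σ.toFun x) (τ.toFun x)) →
      ρ U a c υ = ρ U a b σ + ρ U b c τ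
  ρ_lift : ∀ (U : G.SimplicialOpen) (a b : Fin (U.deg.len + 1)) (σ : R.Section U a b),
    j.hom.app (op U) (q.hom.app (op U) (ρ U a b σ)) =
      P.obj.map (vertexHom U a).op v - P.obj.map (vertexHom U b).op v

/-- `c ∈ H^2(Γ_•, S¹) = Ext^2(ℤ, S¹)` is the class of the `S¹`-gerbe on `Γ_•` given by `R`: the
Yoneda class of a 2-extension presenting this gerbe. -/
def HasGerbeClass (R : CentralExtension G) (c : G.simplicialH 2) : Prop :=
  ∃ T : R.GerbePresentation, c = T.exact₂.extClass.comp T.exact₁.extClass rfl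

end CentralExtension

/-- The set of isomorphism classes of `S¹`-central extensions of `Γ ⇉ M`. -/
def ExtClasses (G : LieGroupoid.{u}) : Type (u + 1) :=
  Quotient (CentralExtension.setoid G)

/-- The isomorphism class of a central extension. -/
def CentralExtension.toClass {G : LieGroupoid.{u}} (R : CentralExtension G) : ExtClasses G :=
  Quotient.mk _ R

end

noncomputable section

/-! ### Naturality of the maps on `Ext` induced by exact functors -/

/-! The sequence is a piece of a long exact `Ext` sequence. On the site of `Γ_•` let `vertexSheaf`
be the free abelian sheaf on the object `Γ_0`: over an open subset of `Γ_p` it is locally generated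
by the `p + 1` vertices. The augmentation sends every vertex to `1`, and its kernel `edgeSheaf` is
generated by differences of vertices, that is, by edges. Applying `Ext(-, S¹)` to `0 → edgeSheaf →
vertexSheaf → ℤ → 0` gives an exact sequence `Ext¹(ℤ, S¹) → Ext¹(vertexSheaf, S¹) → Ext¹(edgeSheaf,
S¹) → Ext²(ℤ, S¹) → Ext²(vertexSheaf, S¹)`.

The terms with `ℤ` are the cohomology of `Γ_•` by definition. Morphisms out of `vertexSheaf` are
sections over `Γ_0 = M`, and injective sheaves on `Γ_•` restrict to flasque sheaves on `M`; hence
`Ext¹(vertexSheaf, S¹)` is `H¹(M, S¹)` and `Ext²(vertexSheaf, S¹)` embeds in `H²(M, S¹)`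
(`vertexComparison_one_bijective`, `vertexComparison_two_injective`). By `restriction_eq` the
augmentation induces restriction to `M`.

The geometric point is that `Ext¹(edgeSheaf, S¹)` classifies central extensions
(`edgeExtOf_bijective`). In an extension of `edgeSheaf` by `S¹` the local lifts of the universal
edge on `Γ_1` form an `S¹`-torsor, hence a circle bundle on `Γ`, and the relation `ab + bc = ac`
between the edges of a triangle is a multiplication on it. To make this precise, `S¹` is embedded in
an injective sheaf `inj` with quotient `injQuot`. Classes in `Ext¹(edgeSheaf, S¹)` are then
morphisms `n : edgeSheaf ⟶ injQuot` modulo morphisms to `inj` (`quotClass_eq_iff`), and the torsor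
in question is that of lifts to `inj` of a section of `injQuot`.

Sheaf torsors and manifolds are compared pointwise. The group `Fib x` consists of the sections of
`inj` modulo those that near `x` are smooth functions with value `1` at `x`; it contains the circle.
A potential (`IsPotential`) maps the fibre of a bundle over `f x` equivariantly to `Fib x`, so that
smooth local sections correspond to local lifts; by `IsPotential.exists_lift` smooth families of
lifts are smooth maps to the bundle. An `ExtPotential R n` is a compatible multiplicative system of
potentials on all edges, and its existence expresses that `R` has class `n`. Given `R`, such an `n`
is found by injectivity (`exists_sectionMap`); given `n`, the bundle of lifts is glued and its
groupoid structure is read off on `Γ_0`, `Γ_1`, `Γ_2` and `Γ_3` (`exists_centralExtension`).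
Isomorphism, tensor product, pullback, gauge extension and gerbe class each become a statement about
adding or transporting potentials.

Naturality holds because the inverse image functor of a morphism of groupoids is exact and comes
with a morphism between the two short exact sequences (`Hom.edgeMap_edgeι`,
`Hom.vertexMap_augmentation`). -/

theorem shortExact_map {A B : Type*} [Category A] [Abelian A]
    [Category B] [Abelian B] (F : A ⥤ B) [F.Additive]
    [PreservesFiniteLimits F] [PreservesFiniteColimits F] {X₁ X₂ X₃ : A} {f : X₁ ⟶ X₂}
    {g : X₂ ⟶ X₃} {w : f ≫ g = 0} (h : (ShortComplex.mk f g w).ShortExact) :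
    (ShortComplex.mk (F.map f) (F.map g)
      (by rw [← F.map_comp, w, F.map_zero])).ShortExact :=
  h.map_of_exact F

section ExtNaturality

universe w w' w'' v v' v'' u₁ u₂ u₃

variable {A : Type u₁} [Category.{v} A] [Abelian A] [HasExt.{w} A] [EnoughInjectives A]
  {B : Type u₂} [Category.{v'} B] [Abelian B] [HasExt.{w'} B]
  {D : Type u₃} [Category.{v''} D] [Abelian D] [HasExt.{w''} D]

/-- Spelled out on objects and morphisms, instead of for a morphism of short complexes, so that it
can rewrite the connecting classes of explicitly given sequences. -/
theorem extClass_naturality_mk {X₁ X₂ X₃ Y₁ Y₂ Y₃ : B} {f : X₁ ⟶ X₂} {g : X₂ ⟶ X₃} {w : f ≫ g = 0}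
    {f' : Y₁ ⟶ Y₂} {g' : Y₂ ⟶ Y₃} {w' : f' ≫ g' = 0} (h : (ShortComplex.mk f g w).ShortExact)
    (h' : (ShortComplex.mk f' g' w').ShortExact) (a : X₁ ⟶ Y₁) (b : X₂ ⟶ Y₂) (c : X₃ ⟶ Y₃)
    (h₁ : a ≫ f' = f ≫ b) (h₂ : b ≫ g' = g ≫ c) :
    Ext.comp (X := X₃) (Y := X₁) h.extClass (Ext.mk₀ a) (add_zero 1) =
      (Ext.mk₀ c).comp (Y := Y₃) (Z := Y₁) h'.extClass (zero_add 1) :=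
  ShortComplex.ShortExact.extClass_naturality h h' ⟨a, b, c, h₁, h₂⟩

theorem mapExactFunctor_extClass_mk {A : Type u₁} [Category.{v} A] [Abelian A] [HasExt.{w} A]
    (F : A ⥤ B) [F.Additive]
    [PreservesFiniteLimits F] [PreservesFiniteColimits F] {X₁ X₂ X₃ : A} {f : X₁ ⟶ X₂}
    {g : X₂ ⟶ X₃} {w : f ≫ g = 0} (h : (ShortComplex.mk f g w).ShortExact) :
    Ext.mapExactFunctor F (X := X₃) (Y := X₁) h.extClass = (shortExact_map F h).extClass :=
  Ext.mapExactFunctor_extClass F h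

/-- Induction principle for `Ext` groups. -/
theorem ext_induction {X : A} {P : ∀ (Y : A) (n : ℕ), Ext X Y n → Prop}
    (h0 : ∀ (Y : A) (f : X ⟶ Y), P Y 0 (Ext.mk₀ f))
    (h1 : ∀ (X₁ X₂ X₃ : A) (f : X₁ ⟶ X₂) (g : X₂ ⟶ X₃) (w : f ≫ g = 0)
      (hS : (ShortComplex.mk f g w).ShortExact) (n : ℕ) (y : Ext X X₃ n),
      P X₃ n y → P X₁ (n + 1) (y.comp (Y := X₃) (Z := X₁) hS.extClass rfl)) {Y : A} {n : ℕ}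
    (x : Ext X Y n) : P Y n x := by
  induction n generalizing Y with
  | zero =>
    obtain ⟨f, rfl⟩ := (Ext.mk₀_bijective X Y).2 x
    exact h0 Y f
  | succ n ih =>
    let I : InjectivePresentation Y := Classical.arbitrary _
    let S := ShortComplex.mk _ _ (cokernel.condition I.f)
    have : Injective S.X₂ := I.injective
    have hS : S.ShortExact := { exact := ShortComplex.exact_cokernel I.f }
    -- Dimension shift: positive `Ext` groups into an injective object vanish, so `x` is a class of
    -- degree `n` times the connecting class.
    obtain ⟨y, hy⟩ := Ext.covariant_sequence_exact₁ X hS x (Ext.eq_zero_of_injective _) rfl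
    exact hy ▸ h1 _ _ _ _ _ _ hS n y (ih y)

/-- In degree zero this is naturality of `θ`. In the inductive step `θ` is a morphism between the
two images of a short exact sequence, so the connecting classes correspond too. -/
theorem mapExactFunctor_natTrans {F₁ F₂ : A ⥤ B} [F₁.Additive] [F₂.Additive]
    [PreservesFiniteLimits F₁] [PreservesFiniteColimits F₁]
    [PreservesFiniteLimits F₂] [PreservesFiniteColimits F₂] (θ : F₁ ⟶ F₂) {X Y : A} {n : ℕ}
    (x : Ext X Y n) :
    (x.mapExactFunctor F₁).comp (Ext.mk₀ (θ.app Y)) (add_zero n) =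
      (Ext.mk₀ (θ.app X)).comp (x.mapExactFunctor F₂) (zero_add n) := by
  induction x using ext_induction with
  | h0 Y f => simp [Ext.mapExactFunctor_mk₀]
  | h1 X₁ X₂ X₃ f g w hS n y ih =>
    rw [Ext.mapExactFunctor_comp, Ext.mapExactFunctor_comp, mapExactFunctor_extClass_mk,
      mapExactFunctor_extClass_mk, Ext.comp_assoc_of_third_deg_zero,
      extClass_naturality_mk (shortExact_map F₁ hS) (shortExact_map F₂ hS) (θ.app X₁) (θ.app X₂)
        (θ.app X₃) (θ.naturality f).symm (θ.naturality g).symm,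
      ← Ext.comp_assoc_of_second_deg_zero, ih, Ext.comp_assoc _ _ _ (zero_add n) rfl (by lia)]

/-- Exact functors respect Yoneda products and connecting classes, so only degree zero has content.
-/
theorem mapExactFunctor_mapExactFunctor (F : A ⥤ B) (F' : B ⥤ D) [F.Additive] [F'.Additive]
    [PreservesFiniteLimits F] [PreservesFiniteColimits F]
    [PreservesFiniteLimits F'] [PreservesFiniteColimits F']
    [(F ⋙ F').Additive] [PreservesFiniteLimits (F ⋙ F')] [PreservesFiniteColimits (F ⋙ F')]
    {X Y : A} {n : ℕ} (x : Ext X Y n) :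
    (x.mapExactFunctor F).mapExactFunctor F' = x.mapExactFunctor (F ⋙ F') := by
  induction x using ext_induction with
  | h0 Y f => simp [Ext.mapExactFunctor_mk₀]
  | h1 X₁ X₂ X₃ f g w hS n y ih =>
    rw [Ext.mapExactFunctor_comp, Ext.mapExactFunctor_comp, Ext.mapExactFunctor_comp, ih,
      mapExactFunctor_extClass_mk, mapExactFunctor_extClass_mk, mapExactFunctor_extClass_mk]

end ExtNaturality

/-! ### Naturality of `extMap` in both variables -/

section ExtMapLemmas

universe w w' v v' u₁ u₂

variable {A : Type u₁} [Category.{v} A] [Abelian A] [HasExt.{w} A]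
  {B : Type u₂} [Category.{v'} B] [Abelian B] [HasExt.{w'} B]
  (T : A ⥤ B) [T.Additive] [PreservesFiniteLimits T] [PreservesFiniteColimits T]

theorem extMap_apply {Z F : A} {Z' F' : B} (ζ : Z' ⟶ T.obj Z) (α : T.obj F ⟶ F') {k : ℕ}
    (x : Ext Z F k) : extMap T ζ α k x =
      (Ext.mk₀ ζ).comp ((x.mapExactFunctor T).comp (Ext.mk₀ α) (add_zero k)) (zero_add k) := rfl

/-- `extMap` is natural in the first variable. -/
theorem extMap_precomp {Z Z₁ F : A} {Z' Z₁' F' : B} (ζ : Z' ⟶ T.obj Z) (ζ₁ : Z₁' ⟶ T.obj Z₁)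
    (α : T.obj F ⟶ F') {k : ℕ} (f : Z ⟶ Z₁) (f' : Z' ⟶ Z₁') (h : ζ ≫ T.map f = f' ≫ ζ₁)
    (x : Ext Z₁ F k) :
    extMap T ζ α k ((Ext.mk₀ f).comp x (zero_add k)) =
      (Ext.mk₀ f').comp (extMap T ζ₁ α k x) (zero_add k) := by
  rw [extMap_apply, extMap_apply, Ext.mapExactFunctor_comp, Ext.mapExactFunctor_mk₀,
    Ext.mk₀_comp_mk₀_assoc, ← h, ← Ext.mk₀_comp_mk₀_assoc, Ext.comp_assoc_of_third_deg_zero]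

/-- Compatibility of `extMap` with the connecting maps in the second variable. -/
theorem extMap_comp_extClass {X₁ X₂ X₃ : A} {Y₁ Y₂ Y₃ : B} {f : X₁ ⟶ X₂} {g : X₂ ⟶ X₃}
    {w : f ≫ g = 0} {f' : Y₁ ⟶ Y₂} {g' : Y₂ ⟶ Y₃} {w' : f' ≫ g' = 0}
    (h : (ShortComplex.mk f g w).ShortExact)
    (h' : (ShortComplex.mk f' g' w').ShortExact) (a : T.obj X₁ ⟶ Y₁) (b : T.obj X₂ ⟶ Y₂)
    (c : T.obj X₃ ⟶ Y₃) (h₁ : a ≫ f' = T.map f ≫ b) (h₂ : b ≫ g' = T.map g ≫ c)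
    {Z : A} {Z' : B} (ζ : Z' ⟶ T.obj Z) {k : ℕ} (x : Ext Z X₃ k) :
    extMap T ζ a (k + 1) (x.comp (Y := X₃) (Z := X₁) h.extClass rfl) =
      (extMap T ζ c k x).comp (Y := Y₃) (Z := Y₁) h'.extClass rfl := by
  rw [extMap_apply, extMap_apply, Ext.mapExactFunctor_comp, mapExactFunctor_extClass_mk,
    Ext.comp_assoc_of_third_deg_zero,
    extClass_naturality_mk (shortExact_map T h) h' a b c h₁ h₂,
    ← Ext.comp_assoc_of_second_deg_zero, Ext.comp_assoc _ _ _ (zero_add k) rfl (by lia)]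

/-- Compatibility of `extMap` with the connecting maps in the first variable. -/
theorem extMap_extClass_comp {X₁ X₂ X₃ : A} {Y₁ Y₂ Y₃ : B} {f : X₁ ⟶ X₂} {g : X₂ ⟶ X₃}
    {w : f ≫ g = 0} {f' : Y₁ ⟶ Y₂} {g' : Y₂ ⟶ Y₃} {w' : f' ≫ g' = 0}
    (h : (ShortComplex.mk f g w).ShortExact)
    (h' : (ShortComplex.mk f' g' w').ShortExact) (a : Y₁ ⟶ T.obj X₁) (b : Y₂ ⟶ T.obj X₂)
    (c : Y₃ ⟶ T.obj X₃) (h₁ : a ≫ T.map f = f' ≫ b) (h₂ : b ≫ T.map g = g' ≫ c)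
    {F : A} {F' : B} (α : T.obj F ⟶ F') {k : ℕ}
    (x : Ext X₁ F k) {k' : ℕ} (hk : 1 + k = k') :
    extMap T c α k' (Ext.comp (X := X₃) (Y := X₁) h.extClass x hk) =
      Ext.comp (X := Y₃) (Y := Y₁) h'.extClass (extMap T a α k x) hk := by
  rw [extMap_apply, extMap_apply, Ext.mapExactFunctor_comp, mapExactFunctor_extClass_mk,
    Ext.comp_assoc _ _ _ hk (add_zero k) (by lia),
    ← Ext.comp_assoc _ _ _ (zero_add 1) hk (by lia),
    ← extClass_naturality_mk h' (shortExact_map T h) a b c h₁ h₂,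
    Ext.comp_assoc _ _ _ (add_zero 1) (zero_add k) (by lia)]

theorem extMap_mk₀ {Z F : A} {Z' F' : B} (ζ : Z' ⟶ T.obj Z) (α : T.obj F ⟶ F') (f : Z ⟶ F) :
    extMap T ζ α 0 (Ext.mk₀ f) = Ext.mk₀ (ζ ≫ T.map f ≫ α) := by
  rw [extMap_apply, Ext.mapExactFunctor_mk₀, Ext.mk₀_comp_mk₀, Ext.mk₀_comp_mk₀]

end ExtMapLemmas

/-! ### Squares of exact functors -/

section ExtMapSquare

universe w w₁ w₂ w' v v₁ v₂ v' u₀ u₁ u₂ u'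

variable {A : Type u₀} [Category.{v} A] [Abelian A] [HasExt.{w} A] [EnoughInjectives A]
  {B₁ : Type u₁} [Category.{v₁} B₁] [Abelian B₁] [HasExt.{w₁} B₁]
  {B₂ : Type u₂} [Category.{v₂} B₂] [Abelian B₂] [HasExt.{w₂} B₂]
  {D : Type u'} [Category.{v'} D] [Abelian D] [HasExt.{w'} D]

/-- Commutation of a square of maps `extMap`, for functors commuting up to a natural
transformation. -/
theorem extMap_square (T₁ : A ⥤ B₁) (U₁ : B₁ ⥤ D) (T₂ : A ⥤ B₂) (U₂ : B₂ ⥤ D)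
    [T₁.Additive] [PreservesFiniteLimits T₁] [PreservesFiniteColimits T₁]
    [T₂.Additive] [PreservesFiniteLimits T₂] [PreservesFiniteColimits T₂]
    [U₁.Additive] [PreservesFiniteLimits U₁] [PreservesFiniteColimits U₁]
    [U₂.Additive] [PreservesFiniteLimits U₂] [PreservesFiniteColimits U₂]
    (θ : T₁ ⋙ U₁ ⟶ T₂ ⋙ U₂) {Z F : A} {Z₁ F₁ : B₁} {Z₂ F₂ : B₂} {Z' F' : D}
    (ζ₁ : Z₁ ⟶ T₁.obj Z) (α₁ : T₁.obj F ⟶ F₁) (ξ₁ : Z' ⟶ U₁.obj Z₁) (β₁ : U₁.obj F₁ ⟶ F')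
    (ζ₂ : Z₂ ⟶ T₂.obj Z) (α₂ : T₂.obj F ⟶ F₂) (ξ₂ : Z' ⟶ U₂.obj Z₂) (β₂ : U₂.obj F₂ ⟶ F')
    (hZ : ξ₁ ≫ U₁.map ζ₁ ≫ θ.app Z = ξ₂ ≫ U₂.map ζ₂)
    (hF : U₁.map α₁ ≫ β₁ = θ.app F ≫ U₂.map α₂ ≫ β₂) {k : ℕ} (x : Ext Z F k) :
    extMap U₁ ξ₁ β₁ k (extMap T₁ ζ₁ α₁ k x) = extMap U₂ ξ₂ β₂ k (extMap T₂ ζ₂ α₂ k x) := by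
  have h := mapExactFunctor_natTrans θ x
  rw [← mapExactFunctor_mapExactFunctor, ← mapExactFunctor_mapExactFunctor] at h
  have e₁ : extMap U₁ ξ₁ β₁ k (extMap T₁ ζ₁ α₁ k x) = (Ext.mk₀ (ξ₁ ≫ U₁.map ζ₁)).comp
      (((x.mapExactFunctor T₁).mapExactFunctor U₁).comp (Ext.mk₀ (U₁.map α₁ ≫ β₁)) (add_zero k))
      (zero_add k) := by
    simp only [extMap_apply, Ext.mapExactFunctor_comp, Ext.mapExactFunctor_mk₀,
      Ext.comp_assoc_of_third_deg_zero, ← Ext.mk₀_comp_mk₀, Ext.mk₀_comp_mk₀_assoc]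
  have e₂ : extMap U₂ ξ₂ β₂ k (extMap T₂ ζ₂ α₂ k x) = (Ext.mk₀ (ξ₂ ≫ U₂.map ζ₂)).comp
      (((x.mapExactFunctor T₂).mapExactFunctor U₂).comp (Ext.mk₀ (U₂.map α₂ ≫ β₂)) (add_zero k))
      (zero_add k) := by
    simp only [extMap_apply, Ext.mapExactFunctor_comp, Ext.mapExactFunctor_mk₀,
      Ext.comp_assoc_of_third_deg_zero, ← Ext.mk₀_comp_mk₀, Ext.mk₀_comp_mk₀_assoc]
  -- The components of `θ` are renamed with the composite functors unfolded in their types, so that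
  -- the rewriting below can recognize them.
  obtain ⟨tZ, htZ⟩ : ∃ t : U₁.obj (T₁.obj Z) ⟶ U₂.obj (T₂.obj Z), t = θ.app Z := ⟨_, rfl⟩
  obtain ⟨tF, htF⟩ : ∃ t : U₁.obj (T₁.obj F) ⟶ U₂.obj (T₂.obj F), t = θ.app F := ⟨_, rfl⟩
  have h' : ((x.mapExactFunctor T₁).mapExactFunctor U₁).comp (Ext.mk₀ tF) (add_zero k) =
      (Ext.mk₀ tZ).comp ((x.mapExactFunctor T₂).mapExactFunctor U₂) (zero_add k) := by
    rw [htF, htZ]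
    exact h
  have hZ' : (ξ₁ ≫ U₁.map ζ₁) ≫ tZ = ξ₂ ≫ U₂.map ζ₂ := by
    rw [htZ, ← hZ, Category.assoc]
  have hF' : U₁.map α₁ ≫ β₁ = tF ≫ U₂.map α₂ ≫ β₂ := by
    rw [htF, hF]
  rw [e₁, e₂, hF', ← hZ', ← Ext.mk₀_comp_mk₀ tF, ← Ext.comp_assoc_of_second_deg_zero, h',
    ← Ext.mk₀_comp_mk₀ _ tZ, Ext.comp_assoc_of_third_deg_zero,
    Ext.comp_assoc _ _ _ (zero_add 0) (zero_add k) (by lia)]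

end ExtMapSquare

/-! ### Base change of short exact sequences -/

/-- In an abelian category a pullback of an epimorphism is an epimorphism with the same kernel. This
is how a morphism `n` to the quotient term of `S` is turned into an actual extension of `N`, the one
whose class is the pullback of that of `S`. -/
theorem shortExact_of_isPullback {A : Type*} [Category A] [Abelian A] {S : ShortComplex A}
    (hS : S.ShortExact) {N E : A} {n : N ⟶ S.X₃} {p : E ⟶ S.X₂} {r : E ⟶ N}
    (h : CategoryTheory.IsPullback p r S.g n) {i : S.X₁ ⟶ E} (hp : i ≫ p = S.f) (hr : i ≫ r = 0) :
    (ShortComplex.mk i r hr).ShortExact := by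
  have hf := hS.mono_f
  have := hS.epi_g
  have : Mono i := by
    rw [← hp] at hf
    exact mono_of_mono i p
  have : Epi r := by
    have := Abelian.epi_snd_of_isLimit S.g n h.isLimit
    exact this
  refine { exact := ShortComplex.exact_of_f_is_kernel _ ?_ }
  refine KernelFork.IsLimit.ofι _ _ (fun {W} k hk => hS.exact.lift (k ≫ p) ?_) ?_ ?_
  · rw [Category.assoc, h.w, reassoc_of% hk, zero_comp]
  · intro W k hk
    refine h.hom_ext ?_ ?_
    · rw [Category.assoc, hp, ShortComplex.Exact.lift_f]
    · rw [Category.assoc, hr, comp_zero]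
      exact hk.symm
  · intro W k hk m hm
    rw [← cancel_mono i, hm]
    refine h.hom_ext ?_ ?_
    · rw [Category.assoc, hp, ShortComplex.Exact.lift_f]
    · rw [Category.assoc, hr, comp_zero]
      exact hk

end

noncomputable section

/-! ### Sections of sheaves of abelian groups -/

section Sections

variable {C : Type u} [SmallCategory C] {J : GrothendieckTopology C}

theorem section_naturality {A B : Cᵒᵖ ⥤ AddCommGrpCat.{u}} (f : A ⟶ B) {U V : C} (h : V ⟶ U)
    (x : A.obj (op U)) : f.app (op V) (A.map h.op x) = B.map h.op (f.app (op U) x) :=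
  NatTrans.naturality_apply f h.op x

theorem section_comp {A B D : AbSheaf J} (f : A ⟶ B) (g : B ⟶ D) {U : C} (x : A.obj.obj (op U)) :
    (f ≫ g).hom.app (op U) x = g.hom.app (op U) (f.hom.app (op U) x) :=
  rfl

theorem section_map_comp (A : Cᵒᵖ ⥤ AddCommGrpCat.{u}) {U V W : C} (f : V ⟶ U) (g : W ⟶ V)
    (x : A.obj (op U)) : A.map g.op (A.map f.op x) = A.map (g ≫ f).op x := by
  rw [op_comp, A.map_comp]
  rfl

theorem section_map_id (A : Cᵒᵖ ⥤ AddCommGrpCat.{u}) {U : C} (x : A.obj (op U)) :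
    A.map (𝟙 U).op x = x := by
  rw [op_id, A.map_id]
  rfl

theorem presheaf_hom_ext {A B : Cᵒᵖ ⥤ AddCommGrpCat.{u}} {f g : A ⟶ B}
    (h : ∀ (U : C) (x : A.obj (op U)), f.app (op U) x = g.app (op U) x) : f = g := by
  refine NatTrans.ext (funext fun U => AddCommGrpCat.hom_ext (AddMonoidHom.ext fun x => ?_))
  exact h U.unop x

theorem sheaf_hom_ext {A B : AbSheaf J} {f g : A ⟶ B}
    (h : ∀ (U : C) (x : A.obj.obj (op U)), f.hom.app (op U) x = g.hom.app (op U) x) : f = g :=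
  Sheaf.hom_ext (presheaf_hom_ext h)

theorem section_injective_of_mono {A B : AbSheaf J} (f : A ⟶ B) [Mono f] (U : C) :
    Function.Injective (f.hom.app (op U)) := by
  have : Mono (f.hom.app (op U)) := inferInstance
  exact (AddCommGrpCat.mono_iff_injective _).1 this

/-- Sections over a fixed object are left exact. This is the part of exactness that needs no passage
to a covering, in contrast to `section_locally_lifts`. -/
theorem section_exact {A B D : AbSheaf J} {f : A ⟶ B} {g : B ⟶ D} {w : f ≫ g = 0}
    (h : (ShortComplex.mk f g w).ShortExact) {U : C} (x : B.obj.obj (op U))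
    (hx : g.hom.app (op U) x = 0) : ∃ y : A.obj.obj (op U), f.hom.app (op U) y = x := by
  let F : AbSheaf J ⥤ AddCommGrpCat.{u} := sheafToPresheaf J _ ⋙ (evaluation _ _).obj (op U)
  have : F.Additive := { map_add := rfl }
  have h1 := (((Functor.preservesFiniteLimits_tfae F).out 1 3 rfl rfl).2
    (inferInstanceAs (PreservesFiniteLimits F)) (ShortComplex.mk f g w) ⟨h.exact, h.mono_f⟩).1
  exact (ShortComplex.ab_exact_iff _).1 h1 x hx

theorem section_locally_lifts {A B : AbSheaf J} (g : A ⟶ B) [Epi g] {U : C}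
    (x : B.obj.obj (op U)) : Presheaf.imageSieve g.hom x ∈ J U := by
  have := (Sheaf.isLocallySurjective_iff_epi' AddCommGrpCat.{u} g).2 inferInstance
  exact Presheaf.imageSieve_mem J g.hom x

theorem section_ext (A : AbSheaf J) {U : C} {S : Sieve U} (hS : S ∈ J U) {x y : A.obj.obj (op U)}
    (h : ∀ (V : C) (f : V ⟶ U), S f → A.obj.map f.op x = A.obj.map f.op y) : x = y := by
  have h1 := (isSheaf_iff_isSheaf_of_type J _).1
    ((Presheaf.isSheaf_iff_isSheaf_forget J _ (forget AddCommGrpCat)).1 A.property)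
  exact (h1 S hS).isSeparatedFor.ext fun V f hf => h V f hf

/-- Sections of the pullback of sheaves. -/
theorem section_isPullback {A B D E : AbSheaf J} {p : A ⟶ B} {r : A ⟶ D} {g : B ⟶ E} {n : D ⟶ E}
    (h : CategoryTheory.IsPullback p r g n) {U : C} (x : B.obj.obj (op U)) (y : D.obj.obj (op U))
    (hxy : g.hom.app (op U) x = n.hom.app (op U) y) :
    ∃ z : A.obj.obj (op U), p.hom.app (op U) z = x ∧ r.hom.app (op U) z = y := by
  have h1 := h.map (sheafToPresheaf J _ ⋙ (evaluation _ _).obj (op U) ⋙ forget AddCommGrpCat.{u})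
  obtain ⟨z, hz, hz'⟩ := (Types.isPullback_iff _ _ _ _).1 h1 |>.2.2 x y hxy
  exact ⟨z, hz, hz'⟩

/-- The inclusion into presheaves is right adjoint to sheafification, which preserves monomorphisms.
It allows morphisms into `I` to be extended along monomorphisms of mere presheaves, such as free
presheaves on representables and `trivPresheaf`. -/
instance (priority := low) (I : AbSheaf J) [Injective I] : Injective I.obj :=
  have := Functor.preservesInjectiveObjects_of_adjunction_of_preservesMonomorphisms
    (sheafificationAdjunction J AddCommGrpCat.{u})
  inferInstanceAs (Injective ((sheafToPresheaf J AddCommGrpCat.{u}).obj I))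

theorem presheaf_mono_of_injective {A B : Cᵒᵖ ⥤ AddCommGrpCat.{u}} (f : A ⟶ B)
    (h : ∀ (U : C), Function.Injective (f.app (op U))) : Mono f := by
  rw [NatTrans.mono_iff_mono_app]
  exact fun U => (AddCommGrpCat.mono_iff_injective _).2 (h U.unop)

theorem presheaf_epi_of_surjective {A B : Cᵒᵖ ⥤ AddCommGrpCat.{u}} (f : A ⟶ B)
    (h : ∀ (U : C), Function.Surjective (f.app (op U))) : Epi f := by
  rw [NatTrans.epi_iff_epi_app]
  exact fun U => (AddCommGrpCat.epi_iff_surjective _).2 (h U.unop)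

/-- A morphism out of a sheafification. -/
def sheafifyHom {P : Cᵒᵖ ⥤ AddCommGrpCat.{u}} {A : AbSheaf J} (s : P ⟶ A.obj) :
    (presheafToSheaf J AddCommGrpCat.{u}).obj P ⟶ A :=
  ((sheafificationAdjunction J AddCommGrpCat.{u}).homEquiv _ _).symm s

theorem toSheafify_sheafifyHom {P : Cᵒᵖ ⥤ AddCommGrpCat.{u}} {A : AbSheaf J} (s : P ⟶ A.obj) :
    toSheafify J P ≫ (sheafifyHom s).hom = s :=
  ((sheafificationAdjunction J AddCommGrpCat.{u}).homEquiv P A).apply_symm_apply s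

theorem sheafify_hom_ext' {P : Cᵒᵖ ⥤ AddCommGrpCat.{u}} {A : AbSheaf J}
    {f g : (presheafToSheaf J AddCommGrpCat.{u}).obj P ⟶ A}
    (h : toSheafify J P ≫ f.hom = toSheafify J P ≫ g.hom) : f = g :=
  ((sheafificationAdjunction J AddCommGrpCat.{u}).homEquiv P A).injective h

theorem sheafifyHom_apply {P : Cᵒᵖ ⥤ AddCommGrpCat.{u}} {A : AbSheaf J} (s : P ⟶ A.obj) {U : C}
    (x : P.obj (op U)) :
    (sheafifyHom s).hom.app (op U) ((toSheafify J P).app (op U) x) = s.app (op U) x :=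
  ConcreteCategory.congr_hom (NatTrans.congr_app (toSheafify_sheafifyHom s) (op U)) x

theorem ZSheaf.lift_one (A : AbSheaf J)
    (s : (Functor.const Cᵒᵖ).obj (AddCommGrpCat.of (ULift.{u} ℤ)) ⟶ A.obj) (U : C) :
    (ZSheaf.lift J A s).hom.app (op U) (ZSheaf.one J U) = s.app (op U) (ULift.up 1) :=
  sheafifyHom_apply s _

theorem ZSheaf.hom_ext {A : AbSheaf J} {f g : ZSheaf J ⟶ A}
    (h : ∀ U : C, f.hom.app (op U) (ZSheaf.one J U) = g.hom.app (op U) (ZSheaf.one J U)) :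
    f = g := by
  refine sheafify_hom_ext' (presheaf_hom_ext fun U x => ?_)
  obtain ⟨n⟩ := x
  have h1 : (ULift.up n : ULift.{u} ℤ) = n • ULift.up 1 := by
    ext
    simp
  have h2 : ∀ k : (Functor.const Cᵒᵖ).obj (AddCommGrpCat.of (ULift.{u} ℤ)) ⟶ A.obj,
      k.app (op U) (ULift.up n : ULift.{u} ℤ) = n • k.app (op U) (ULift.up 1 : ULift.{u} ℤ) := by
    intro k
    rw [h1]
    exact map_zsmul (k.app (op U)).hom n _
  rw [h2, h2]
  exact congrArg _ (h U)

theorem ZSheaf.map_one {U V : C} (h : V ⟶ U) :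
    (ZSheaf J).obj.map h.op (ZSheaf.one J U) = ZSheaf.one J V :=
  (section_naturality (ZSheaf.unit J) h _).symm

end Sections

end

noncomputable section

/-! ### The free sheaf on the vertices -/

namespace LieGroupoid

variable (G : LieGroupoid.{u})

/-- The presheaf of integral combinations of the vertices of the simplex. -/
def vertexPresheaf : G.SimplicialOpenᵒᵖ ⥤ AddCommGrpCat.{u} where
  obj U := AddCommGrpCat.of (ULift.{u} (Fin (U.unop.deg.len + 1)) →₀ ℤ)
  map h := AddCommGrpCat.ofHom
    (Finsupp.mapDomain.addMonoidHom (ULift.map h.unop.operator.toOrderHom))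
  map_id _ := AddCommGrpCat.hom_ext (AddMonoidHom.ext fun _ => Finsupp.mapDomain_id)
  map_comp f g := AddCommGrpCat.hom_ext (AddMonoidHom.ext fun _ =>
    Finsupp.mapDomain_comp (f := ULift.map f.unop.operator.toOrderHom)
      (g := ULift.map g.unop.operator.toOrderHom))

/-- The sum of the coefficients. -/
def vertexDegree : G.vertexPresheaf ⟶
    (Functor.const G.SimplicialOpenᵒᵖ).obj (AddCommGrpCat.of (ULift.{u} ℤ)) where
  app U := AddCommGrpCat.ofHom (AddEquiv.ulift.symm.toAddMonoidHom.comp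
    (Finsupp.liftAddHom fun _ => AddMonoidHom.id ℤ))
  naturality U V h := by
    refine AddCommGrpCat.hom_ext (Finsupp.addHom_ext fun i n => ?_)
    change AddEquiv.ulift.symm (Finsupp.liftAddHom (fun _ => AddMonoidHom.id ℤ)
      (Finsupp.mapDomain _ (Finsupp.single i n))) =
      AddEquiv.ulift.symm (Finsupp.liftAddHom (fun _ => AddMonoidHom.id ℤ) (Finsupp.single i n))
    rw [Finsupp.mapDomain_single]
    simp

variable {G}

/-- A vertex as a section. -/
def vertexSingle (U : G.SimplicialOpen) (a : Fin (U.deg.len + 1)) : G.vertexPresheaf.obj (op U) :=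
  (Finsupp.single (ULift.up a) (1 : ℤ) : ULift.{u} (Fin (U.deg.len + 1)) →₀ ℤ)

theorem vertexPresheaf_map_single {U V : G.SimplicialOpen} (h : V ⟶ U)
    (a : Fin (U.deg.len + 1)) : G.vertexPresheaf.map h.op (vertexSingle U a) =
      vertexSingle V (h.operator.toOrderHom a) :=
  Finsupp.mapDomain_single

theorem vertexDegree_single (U : G.SimplicialOpen) (a : Fin (U.deg.len + 1)) :
    G.vertexDegree.app (op U) (vertexSingle U a) = ULift.up 1 := by
  change AddEquiv.ulift.symm (Finsupp.liftAddHom (fun _ => AddMonoidHom.id ℤ)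
    (Finsupp.single (ULift.up a) (1 : ℤ))) = _
  simp
  rfl

theorem vertexPresheaf_hom_ext {W : G.SimplicialOpenᵒᵖ ⥤ AddCommGrpCat.{u}}
    {f g : G.vertexPresheaf ⟶ W}
    (h : ∀ U a, f.app (op U) (vertexSingle U a) = g.app (op U) (vertexSingle U a)) : f = g := by
  refine NatTrans.ext (funext fun U => AddCommGrpCat.hom_ext ?_)
  refine Finsupp.addHom_ext' fun i => AddMonoidHom.ext_int ?_
  exact h U.unop i.down

/-- The morphism out of the presheaf of combinations of vertices given by a natural family. -/
def vertexPresheafLift {W : G.SimplicialOpenᵒᵖ ⥤ AddCommGrpCat.{u}}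
    (c : ∀ (U : G.SimplicialOpen), Fin (U.deg.len + 1) → W.obj (op U))
    (hc : ∀ (U V : G.SimplicialOpen) (h : V ⟶ U) a,
      W.map h.op (c U a) = c V (h.operator.toOrderHom a)) : G.vertexPresheaf ⟶ W where
  app U := AddCommGrpCat.ofHom (Finsupp.liftAddHom fun i => zmultiplesHom _ (c U.unop i.down))
  naturality U V h := by
    refine AddCommGrpCat.hom_ext (Finsupp.addHom_ext' fun i => AddMonoidHom.ext_int ?_)
    change Finsupp.liftAddHom (fun i : ULift.{u} (Fin (V.unop.deg.len + 1)) => zmultiplesHom _ (c V.unop i.down))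
      (Finsupp.mapDomain _ (Finsupp.single i 1)) =
      W.map h (Finsupp.liftAddHom (fun i => zmultiplesHom _ (c U.unop i.down))
        (Finsupp.single i 1))
    rw [Finsupp.mapDomain_single]
    simp only [Finsupp.liftAddHom_apply_single, zmultiplesHom_apply, one_zsmul]
    exact (hc U.unop V.unop h.unop i.down).symm

theorem vertexPresheafLift_single {W : G.SimplicialOpenᵒᵖ ⥤ AddCommGrpCat.{u}}
    (c : ∀ (U : G.SimplicialOpen), Fin (U.deg.len + 1) → W.obj (op U)) (hc) (U : G.SimplicialOpen)
    (a : Fin (U.deg.len + 1)) :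
    (vertexPresheafLift c hc).app (op U) (vertexSingle U a) = c U a := by
  change Finsupp.liftAddHom (fun i : ULift.{u} (Fin (U.deg.len + 1)) => zmultiplesHom _ (c U i.down))
    (Finsupp.single _ 1) = _
  simp only [Finsupp.liftAddHom_apply_single, zmultiplesHom_apply, one_zsmul]

variable (G)

/-- The presheaf of combinations of vertices of degree zero. -/
def edgePresheaf : G.SimplicialOpenᵒᵖ ⥤ AddCommGrpCat.{u} where
  obj U := AddCommGrpCat.of (G.vertexDegree.app U).hom.ker
  map {U V} h := AddCommGrpCat.ofHom (((G.vertexPresheaf.map h).hom.comp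
    (G.vertexDegree.app U).hom.ker.subtype).codRestrict _ fun x => by
      have h1 := section_naturality G.vertexDegree h.unop x.1
      have h2 : G.vertexDegree.app U x.1 = 0 := x.2
      exact h1.trans h2)
  map_id U := by
    refine AddCommGrpCat.hom_ext (AddMonoidHom.ext fun x => Subtype.ext ?_)
    exact section_map_id G.vertexPresheaf x.1
  map_comp {U V W} f g := by
    refine AddCommGrpCat.hom_ext (AddMonoidHom.ext fun x => Subtype.ext ?_)
    exact (section_map_comp G.vertexPresheaf f.unop g.unop x.1).symm

def edgePresheafι : G.edgePresheaf ⟶ G.vertexPresheaf where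
  app U := AddCommGrpCat.ofHom (G.vertexDegree.app U).hom.ker.subtype
  naturality _ _ _ := rfl

theorem edgePresheaf_w : G.edgePresheafι ≫ G.vertexDegree = 0 :=
  presheaf_hom_ext fun _ x => x.2

theorem edgePresheaf_shortExact :
    (ShortComplex.mk _ _ G.edgePresheaf_w).ShortExact := by
  have : Mono G.edgePresheafι := presheaf_mono_of_injective _ fun U => Subtype.val_injective
  have : Epi G.vertexDegree := presheaf_epi_of_surjective _ fun U x => by
    -- Every simplex has a vertex `0`, so the augmentation is surjective already before
    -- sheafification.
    refine ⟨(Finsupp.single (ULift.up 0) x.down : ULift.{u} (Fin (U.deg.len + 1)) →₀ ℤ), ?_⟩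
    change AddEquiv.ulift.symm (Finsupp.liftAddHom (fun _ => AddMonoidHom.id ℤ)
      (Finsupp.single _ _)) = _
    simp
    rfl
  refine { exact := ShortComplex.exact_of_f_is_kernel _ ?_ }
  refine KernelFork.IsLimit.ofι' _ _ fun {W} k hk => ⟨
    { app := fun U => AddCommGrpCat.ofHom ((k.app U).hom.codRestrict _ fun x => ?_)
      naturality := fun U V h => ?_ }, ?_⟩
  · exact ConcreteCategory.congr_hom (NatTrans.congr_app hk U) x
  · refine AddCommGrpCat.hom_ext (AddMonoidHom.ext fun x => Subtype.ext ?_)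
    exact section_naturality k h.unop x
  · rfl

/-- The free sheaf on the representable sheaf of `Γ_0`. -/
def vertexSheaf : AbSheaf G.topology := (presheafToSheaf _ _).obj G.vertexPresheaf

/-- The kernel of the augmentation of the free sheaf on `Γ_0`. -/
def edgeSheaf : AbSheaf G.topology := (presheafToSheaf _ _).obj G.edgePresheaf

def edgeι : G.edgeSheaf ⟶ G.vertexSheaf := (presheafToSheaf _ _).map G.edgePresheafι

def augmentation : G.vertexSheaf ⟶ ZSheaf G.topology := (presheafToSheaf _ _).map G.vertexDegree

theorem edgeι_augmentation : G.edgeι ≫ G.augmentation = 0 := by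
  have : (presheafToSheaf G.topology AddCommGrpCat.{u}).Additive :=
    (sheafificationAdjunction G.topology AddCommGrpCat.{u}).left_adjoint_additive
  change (presheafToSheaf _ _).map _ ≫ (presheafToSheaf _ _).map _ = 0
  rw [← Functor.map_comp, edgePresheaf_w, Functor.map_zero]
  rfl

/-- Sheafification is exact. The contravariant long exact `Ext` sequence of this sequence is, after
identification of its terms, the sequence of the theorem. -/
theorem edge_shortExact : (ShortComplex.mk _ _ G.edgeι_augmentation).ShortExact := by
  have : (presheafToSheaf G.topology AddCommGrpCat.{u}).Additive :=
    (sheafificationAdjunction G.topology AddCommGrpCat.{u}).left_adjoint_additive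
  have : PreservesFiniteColimits (presheafToSheaf G.topology AddCommGrpCat.{u}) :=
    have := (sheafificationAdjunction G.topology AddCommGrpCat.{u}).leftAdjoint_preservesColimits
    inferInstance
  exact shortExact_map (presheafToSheaf G.topology AddCommGrpCat.{u}) G.edgePresheaf_shortExact

variable {G}

/-- The section of the free sheaf given by a vertex. -/
def vertexSec (U : G.SimplicialOpen) (a : Fin (U.deg.len + 1)) : G.vertexSheaf.obj.obj (op U) :=
  (toSheafify G.topology G.vertexPresheaf).app (op U) (vertexSingle U a)

theorem vertexSec_map {U V : G.SimplicialOpen} (h : V ⟶ U) (a : Fin (U.deg.len + 1)) :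
    G.vertexSheaf.obj.map h.op (vertexSec U a) = vertexSec V (h.operator.toOrderHom a) := by
  refine (section_naturality (toSheafify G.topology G.vertexPresheaf) h _).symm.trans ?_
  exact congrArg ((toSheafify G.topology G.vertexPresheaf).app (op V))
    (vertexPresheaf_map_single h a)

theorem augmentation_vertexSec (U : G.SimplicialOpen) (a : Fin (U.deg.len + 1)) :
    G.augmentation.hom.app (op U) (vertexSec U a) = ZSheaf.one _ U := by
  have h := toSheafify_naturality G.topology G.vertexDegree
  refine (ConcreteCategory.congr_hom (NatTrans.congr_app h (op U)) (vertexSingle U a)).symm.trans ?_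
  exact congrArg ((ZSheaf.unit G.topology).app (op U)) (vertexDegree_single U a)

theorem vertexSheaf_hom_ext {A : AbSheaf G.topology} {f g : G.vertexSheaf ⟶ A}
    (h : ∀ U a, f.hom.app (op U) (vertexSec U a) = g.hom.app (op U) (vertexSec U a)) : f = g :=
  sheafify_hom_ext' (vertexPresheaf_hom_ext h)

/-- The morphism out of the free sheaf given by a natural family of sections. -/
def vertexSheafLift {A : AbSheaf G.topology}
    (c : ∀ (U : G.SimplicialOpen), Fin (U.deg.len + 1) → A.obj.obj (op U))
    (hc : ∀ (U V : G.SimplicialOpen) (h : V ⟶ U) a,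
      A.obj.map h.op (c U a) = c V (h.operator.toOrderHom a)) : G.vertexSheaf ⟶ A :=
  sheafifyHom (vertexPresheafLift c hc)

theorem vertexSheafLift_vertexSec {A : AbSheaf G.topology}
    (c : ∀ (U : G.SimplicialOpen), Fin (U.deg.len + 1) → A.obj.obj (op U)) (hc)
    (U : G.SimplicialOpen) (a : Fin (U.deg.len + 1)) :
    (vertexSheafLift c hc).hom.app (op U) (vertexSec U a) = c U a :=
  (sheafifyHom_apply _ _).trans (vertexPresheafLift_single c hc U a)

/-- The total object of `Γ_0` in the site of `Γ_•`. -/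
abbrev objTop (G : LieGroupoid.{u}) : G.SimplicialOpen := ⟨.mk 0, ⊤⟩

/-- The morphism out of the free sheaf given by a section over `Γ_0`. -/
def vertexSheafLiftTop {A : AbSheaf G.topology} (v : A.obj.obj (op G.objTop)) :
    G.vertexSheaf ⟶ A :=
  vertexSheafLift (fun U a => A.obj.map (CentralExtension.vertexHom U a).op v) fun U V h a => by
    rw [section_map_comp]
    rfl

theorem vertexSheafLiftTop_vertexSec {A : AbSheaf G.topology} (v : A.obj.obj (op G.objTop))
    (U : G.SimplicialOpen) (a : Fin (U.deg.len + 1)) :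
    (vertexSheafLiftTop v).hom.app (op U) (vertexSec U a) =
      A.obj.map (CentralExtension.vertexHom U a).op v :=
  vertexSheafLift_vertexSec _ _ U a

/-- The difference of two vertices. -/
def edgeGen (U : G.SimplicialOpen) (a b : Fin (U.deg.len + 1)) : G.edgePresheaf.obj (op U) :=
  (⟨vertexSingle U a - vertexSingle U b, by
    rw [AddMonoidHom.mem_ker, map_sub]
    exact sub_eq_zero.2 ((vertexDegree_single U a).trans (vertexDegree_single U b).symm)⟩ :
      (G.vertexDegree.app (op U)).hom.ker)

/-- The section of `edgeSheaf` given by the edge from the `b`-th to the `a`-th vertex. -/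
def edgeSec (U : G.SimplicialOpen) (a b : Fin (U.deg.len + 1)) : G.edgeSheaf.obj.obj (op U) :=
  (toSheafify G.topology G.edgePresheaf).app (op U) (edgeGen U a b)

theorem edgeι_edgeSec (U : G.SimplicialOpen) (a b : Fin (U.deg.len + 1)) :
    G.edgeι.hom.app (op U) (edgeSec U a b) = vertexSec U a - vertexSec U b := by
  have h := toSheafify_naturality G.topology G.edgePresheafι
  refine (ConcreteCategory.congr_hom (NatTrans.congr_app h (op U)) _).symm.trans ?_
  exact map_sub ((toSheafify G.topology G.vertexPresheaf).app (op U)).hom _ _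

instance : Mono G.edgeι := G.edge_shortExact.mono_f

theorem edgeSec_map {U V : G.SimplicialOpen} (h : V ⟶ U) (a b : Fin (U.deg.len + 1)) :
    G.edgeSheaf.obj.map h.op (edgeSec U a b) =
      edgeSec V (h.operator.toOrderHom a) (h.operator.toOrderHom b) := by
  refine section_injective_of_mono G.edgeι V ?_
  rw [section_naturality, edgeι_edgeSec, edgeι_edgeSec, map_sub, vertexSec_map, vertexSec_map]

theorem edgeSec_add (U : G.SimplicialOpen) (a b c : Fin (U.deg.len + 1)) :
    edgeSec U a b + edgeSec U b c = edgeSec U a c := by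
  refine section_injective_of_mono G.edgeι U ?_
  rw [map_add, edgeι_edgeSec, edgeι_edgeSec, edgeι_edgeSec]
  abel

/-- A combination of degree zero does not change when `v₀` is subtracted from each vertex, so the
edges to the vertex `0` generate. -/
theorem edgePresheaf_hom_ext {W : G.SimplicialOpenᵒᵖ ⥤ AddCommGrpCat.{u}}
    {f g : G.edgePresheaf ⟶ W}
    (h : ∀ U a b, f.app (op U) (edgeGen U a b) = g.app (op U) (edgeGen U a b)) :
    f = g := by
  refine presheaf_hom_ext fun U x => ?_
  change (G.vertexDegree.app (op U)).hom.ker at x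
  let Ψ : (ULift.{u} (Fin (U.deg.len + 1)) →₀ ℤ) →+ (G.vertexDegree.app (op U)).hom.ker :=
    Finsupp.liftAddHom fun i => zmultiplesHom _ (edgeGen U i.down 0)
  have h4 : ∀ i, Ψ (Finsupp.single i 1) = edgeGen U i.down 0 := by
    intro i
    change Finsupp.liftAddHom (fun i => zmultiplesHom _ (edgeGen U i.down 0))
      (Finsupp.single i 1) = _
    rw [Finsupp.liftAddHom_apply_single, zmultiplesHom_apply, one_zsmul]
  -- On arbitrary combinations `Ψ` is `y ↦ y - deg(y) v₀`; this can be checked on single vertices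
  -- and is the identity in degree zero.
  have h1 : ((G.vertexDegree.app (op U)).hom.ker.subtype.comp Ψ : (_ →₀ ℤ) →+ (_ →₀ ℤ)) =
      AddMonoidHom.id _ - ((zmultiplesHom _ (vertexSingle U 0)).comp
        (AddEquiv.ulift.toAddMonoidHom.comp (G.vertexDegree.app (op U)).hom) :
          (_ →₀ ℤ) →+ (_ →₀ ℤ)) := by
    refine Finsupp.addHom_ext' fun i => AddMonoidHom.ext_int ?_
    change (Ψ (Finsupp.single i 1)).1 =
      vertexSingle U i.down - AddEquiv.ulift (G.vertexDegree.app (op U) (vertexSingle U i.down)) •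
        vertexSingle U 0
    rw [vertexDegree_single, h4]
    change _ = _ - (1 : ℤ) • _
    rw [one_zsmul]
    rfl
  have h2 : Ψ x.1 = x := by
    refine Subtype.ext ((DFunLike.congr_fun h1 x.1).trans ?_)
    change x.1 - AddEquiv.ulift (G.vertexDegree.app (op U) x.1) • vertexSingle U 0 = x.1
    have : G.vertexDegree.app (op U) x.1 = 0 := x.2
    rw [this, map_zero, zero_zsmul, sub_zero]
  have h3 : (f.app (op U)).hom.comp Ψ = (g.app (op U)).hom.comp Ψ := by
    refine Finsupp.addHom_ext' fun i => AddMonoidHom.ext_int ?_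
    change f.app (op U) (Ψ (Finsupp.single i 1)) = g.app (op U) (Ψ (Finsupp.single i 1))
    rw [h4]
    exact h U i.down 0
  have h5 : f.app (op U) (Ψ x.1) = g.app (op U) (Ψ x.1) := DFunLike.congr_fun h3 x.1
  rwa [h2] at h5

theorem edgeSheaf_hom_ext {A : AbSheaf G.topology} {f g : G.edgeSheaf ⟶ A}
    (h : ∀ U a b, f.hom.app (op U) (edgeSec U a b) = g.hom.app (op U) (edgeSec U a b)) :
    f = g :=
  sheafify_hom_ext' (edgePresheaf_hom_ext h)

/-- A natural additive family of sections indexed by the pairs of vertices. -/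
structure EdgeFamily (W : G.SimplicialOpenᵒᵖ ⥤ AddCommGrpCat.{u}) where
  val : ∀ (U : G.SimplicialOpen), Fin (U.deg.len + 1) → Fin (U.deg.len + 1) → W.obj (op U)
  map_val : ∀ (U V : G.SimplicialOpen) (h : V ⟶ U) a b,
    W.map h.op (val U a b) = val V (h.operator.toOrderHom a) (h.operator.toOrderHom b)
  add_val : ∀ U a b c, val U a b + val U b c = val U a c

/-- The morphism out of `edgePresheaf` given by a family. -/
def EdgeFamily.presheafHom {W : G.SimplicialOpenᵒᵖ ⥤ AddCommGrpCat.{u}} (c : EdgeFamily W) :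
    G.edgePresheaf ⟶ W where
  app U := AddCommGrpCat.ofHom ((Finsupp.liftAddHom fun i => zmultiplesHom (W.obj U)
    (c.val U.unop i.down 0)).comp (G.vertexDegree.app U).hom.ker.subtype)
  naturality U V h := by
    refine AddCommGrpCat.hom_ext (AddMonoidHom.ext fun x => ?_)
    -- The base vertex `0` used in the definition need not be mapped to `0` by a simplicial
    -- operator. Moving the base vertex costs the degree times a fixed value, and that correction
    -- vanishes in degree zero.
    have h1 : ((Finsupp.liftAddHom fun i : ULift.{u} (Fin (V.unop.deg.len + 1)) =>
        zmultiplesHom (W.obj V) (c.val V.unop i.down 0)).comp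
        (Finsupp.mapDomain.addMonoidHom (ULift.map h.unop.operator.toOrderHom)) :
          (ULift.{u} (Fin (U.unop.deg.len + 1)) →₀ ℤ) →+ W.obj V) =
        (W.map h).hom.comp (Finsupp.liftAddHom fun i => zmultiplesHom (W.obj U)
          (c.val U.unop i.down 0)) +
        ((zmultiplesHom _ (c.val V.unop (h.unop.operator.toOrderHom 0) 0)).comp
          (AddEquiv.ulift.toAddMonoidHom.comp (G.vertexDegree.app U).hom) :
            (ULift.{u} (Fin (U.unop.deg.len + 1)) →₀ ℤ) →+ W.obj V) := by
      refine Finsupp.addHom_ext' fun i => AddMonoidHom.ext_int ?_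
      change Finsupp.liftAddHom (fun i : ULift.{u} (Fin (V.unop.deg.len + 1)) =>
        zmultiplesHom (W.obj V) (c.val V.unop i.down 0))
        (Finsupp.mapDomain _ (Finsupp.single i 1)) =
        W.map h (Finsupp.liftAddHom (fun i => zmultiplesHom (W.obj U) (c.val U.unop i.down 0))
          (Finsupp.single i 1)) +
        AddEquiv.ulift (G.vertexDegree.app U (vertexSingle U.unop i.down)) •
          c.val V.unop (h.unop.operator.toOrderHom 0) 0
      rw [vertexDegree_single, Finsupp.mapDomain_single, Finsupp.liftAddHom_apply_single,
        Finsupp.liftAddHom_apply_single, zmultiplesHom_apply, zmultiplesHom_apply, one_zsmul,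
        one_zsmul]
      change _ = _ + (1 : ℤ) • _
      rw [one_zsmul]
      exact ((congrArg (· + _) (c.map_val U.unop V.unop h.unop i.down 0)).trans
        (c.add_val _ _ _ _)).symm
    refine (DFunLike.congr_fun h1 x.1).trans ?_
    change _ + zmultiplesHom (W.obj V) (c.val V.unop (h.unop.operator.toOrderHom 0) 0)
      (AddEquiv.ulift (G.vertexDegree.app U x.1)) = _
    have : G.vertexDegree.app U x.1 = 0 := x.2
    rw [this, map_zero AddEquiv.ulift, map_zero (zmultiplesHom (W.obj V) _), add_zero]
    rfl

/-- The morphism out of `edgeSheaf` given by a family. -/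
def EdgeFamily.hom {A : AbSheaf G.topology} (c : EdgeFamily A.obj) : G.edgeSheaf ⟶ A :=
  sheafifyHom c.presheafHom

theorem EdgeFamily.hom_edgeSec {A : AbSheaf G.topology} (c : EdgeFamily A.obj)
    (U : G.SimplicialOpen) (a b : Fin (U.deg.len + 1)) :
    c.hom.hom.app (op U) (edgeSec U a b) = c.val U a b := by
  refine (sheafifyHom_apply _ _).trans ?_
  change Finsupp.liftAddHom (fun i => zmultiplesHom (A.obj.obj (op U)) (c.val U i.down 0))
    (Finsupp.single (ULift.up a) 1 - Finsupp.single (ULift.up b) 1) = _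
  rw [map_sub, Finsupp.liftAddHom_apply_single, Finsupp.liftAddHom_apply_single,
    zmultiplesHom_apply, zmultiplesHom_apply, one_zsmul, one_zsmul, sub_eq_iff_eq_add]
  exact (c.add_val U a b 0).symm

end LieGroupoid

end

noncomputable section

/-! ### Comparison of the cohomology of `Γ_0` with that of `M` -/

section Injective

variable {C : Type u} [SmallCategory C] {J : GrothendieckTopology C}

/-- The morphism out of a free presheaf on a representable given by a section. -/
def freeYonedaLift (A : Cᵒᵖ ⥤ AddCommGrpCat.{u}) {X : C} (s : A.obj (op X)) :
    yoneda.obj X ⋙ AddCommGrpCat.free ⟶ A where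
  app W := AddCommGrpCat.ofHom (FreeAbelianGroup.lift fun f : W.unop ⟶ X => A.map f.op s)
  naturality W W' h := by
    refine AddCommGrpCat.hom_ext (FreeAbelianGroup.lift_ext _ _ fun f => ?_)
    change FreeAbelianGroup.lift (fun f : W'.unop ⟶ X => A.map f.op s)
      (FreeAbelianGroup.map (fun f : W.unop ⟶ X => h.unop ≫ f) (FreeAbelianGroup.of f)) =
      A.map h (FreeAbelianGroup.lift (fun f : W.unop ⟶ X => A.map f.op s) (FreeAbelianGroup.of f))
    rw [FreeAbelianGroup.map_of_apply, FreeAbelianGroup.lift_apply_of,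
      FreeAbelianGroup.lift_apply_of]
    exact (section_map_comp A f h.unop s).symm

theorem freeYonedaLift_of (A : Cᵒᵖ ⥤ AddCommGrpCat.{u}) {X W : C} (s : A.obj (op X)) (f : W ⟶ X) :
    (freeYonedaLift A s).app (op W) (FreeAbelianGroup.of f : FreeAbelianGroup (W ⟶ X)) =
      A.map f.op s :=
  FreeAbelianGroup.lift_apply_of _ _

/-- A section over `V` is a morphism out of the free presheaf on `V`. Since `i` is a monomorphism,
so is the induced map of free presheaves, and injectivity extends the morphism to the free presheaf
on `U`. -/
theorem injective_section_surjective (I : AbSheaf J) [Injective I] {U V : C} (i : V ⟶ U) [Mono i] :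
    Function.Surjective (I.obj.map i.op) := by
  intro s
  let m : yoneda.obj V ⋙ AddCommGrpCat.free.{u} ⟶ yoneda.obj U ⋙ AddCommGrpCat.free :=
    Functor.whiskerRight (yoneda.map i) _
  have : Mono m := by
    rw [NatTrans.mono_iff_mono_app]
    intro W
    have : Mono ((yoneda.map i).app W) := inferInstance
    exact inferInstanceAs (Mono (AddCommGrpCat.free.map ((yoneda.map i).app W)))
  let k := Injective.factorThru (freeYonedaLift I.obj s) m
  have hk : m ≫ k = freeYonedaLift I.obj s := Injective.comp_factorThru _ _
  refine ⟨k.app (op U) (FreeAbelianGroup.of (𝟙 U) : FreeAbelianGroup (U ⟶ U)), ?_⟩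
  refine (section_naturality k i _).symm.trans ?_
  have h1 := ConcreteCategory.congr_hom (NatTrans.congr_app hk (op V))
    (FreeAbelianGroup.of (𝟙 V) : FreeAbelianGroup (V ⟶ V))
  rw [freeYonedaLift_of, section_map_id] at h1
  rw [← h1]
  change k.app (op V) (FreeAbelianGroup.map (fun f : U ⟶ U => i ≫ f) (FreeAbelianGroup.of (𝟙 U))) =
    k.app (op V) (FreeAbelianGroup.map (fun f : V ⟶ V => f ≫ i) (FreeAbelianGroup.of (𝟙 V)))
  rw [FreeAbelianGroup.map_of_apply, FreeAbelianGroup.map_of_apply, Category.comp_id,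
    Category.id_comp]

/-- The morphism out of the constant sheaf given by a compatible family of sections. -/
def ZSheaf.liftSections (A : AbSheaf J) (s : ∀ U : C, A.obj.obj (op U))
    (hs : ∀ (U V : C) (h : V ⟶ U), A.obj.map h.op (s U) = s V) : ZSheaf J ⟶ A :=
  ZSheaf.lift J A
    { app := fun U => AddCommGrpCat.ofHom
        ((zmultiplesHom (A.obj.obj U) (s U.unop)).comp AddEquiv.ulift.toAddMonoidHom)
      naturality := fun U V h => by
        refine AddCommGrpCat.hom_ext (AddMonoidHom.ext fun n => ?_)
        change n.down • s V.unop = A.obj.map h (n.down • s U.unop)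
        rw [map_zsmul]
        exact congrArg _ (hs U.unop V.unop h.unop).symm }

theorem ZSheaf.liftSections_one (A : AbSheaf J) (s : ∀ U : C, A.obj.obj (op U)) (hs) (U : C) :
    (ZSheaf.liftSections A s hs).hom.app (op U) (ZSheaf.one J U) = s U :=
  (ZSheaf.lift_one _ _ U).trans (one_zsmul _)

end Injective

/-! ### Vanishing of the first cohomology of flasque sheaves -/

section Flasque

variable {M : Type u} [TopologicalSpace M]

/-- After embedding `F` in an injective sheaf, a class in degree one comes from a global section of
the quotient. As the kernel is flasque, this section lifts globally, so the class is zero. -/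
theorem ext_one_eq_zero_of_flasque (F : AbSheaf (Opens.grothendieckTopology M))
    (hF : ∀ (U V : Opens M) (i : V ⟶ U), Function.Surjective (F.obj.map i.op))
    (x : Ext.{u} (ZSheaf (Opens.grothendieckTopology M)) F 1) : x = 0 := by
  let P : InjectivePresentation F := Classical.arbitrary _
  let S := ShortComplex.mk _ _ (cokernel.condition P.f)
  have : Injective S.X₂ := P.injective
  have hS : S.ShortExact := { exact := ShortComplex.exact_cokernel P.f }
  obtain ⟨y, hy⟩ := Ext.covariant_sequence_exact₁ _ hS x (Ext.eq_zero_of_injective _) rfl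
  obtain ⟨c, rfl⟩ := (Ext.mk₀_bijective _ _).2 y
  have hfl : TopCat.Sheaf.IsFlasque (X := TopCat.of M) S.X₁ :=
    ⟨fun {U V} i => (AddCommGrpCat.epi_iff_surjective _).2 (hF U.unop V.unop i.unop)⟩
  have hsurj := (AddCommGrpCat.epi_iff_surjective _).1
    (TopCat.Sheaf.IsFlasque.epi_of_shortExact (X := TopCat.of M) (U := ⊤) hS)
  obtain ⟨j, hj⟩ := hsurj (c.hom.app (op ⊤) (ZSheaf.one _ ⊤))
  let k : ZSheaf (Opens.grothendieckTopology M) ⟶ S.X₂ :=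
    ZSheaf.liftSections S.X₂ (fun U => S.X₂.obj.map (homOfLE le_top : U ⟶ ⊤).op j)
      (fun U V h => section_map_comp _ _ _ _)
  have hk : k ≫ S.g = c := by
    refine ZSheaf.hom_ext fun U => ?_
    rw [section_comp, ZSheaf.liftSections_one, section_naturality]
    refine (congrArg _ hj).trans ?_
    rw [← section_naturality, ZSheaf.map_one]
  rw [← hy, ← hk, ← Ext.mk₀_comp_mk₀, Ext.comp_assoc_of_second_deg_zero,
    hS.comp_extClass, Ext.comp_zero]

end Flasque

/-! ### Cohomology of `M` as `Ext` from the free sheaf on the vertices -/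

namespace LieGroupoid

variable (G : LieGroupoid.{u})

/-- Restriction of sheaves on `Γ_•` to `M = Γ_0`. -/
abbrev baseFunctor : AbSheaf G.topology ⥤ AbSheaf (Opens.grothendieckTopology G.M) :=
  precompSheaf (Opens.grothendieckTopology G.M) G.topology G.baseInclusion

/-- The section `1 ↦` the vertex, over `Γ_0`. -/
def baseVertex : ZSheaf (Opens.grothendieckTopology G.M) ⟶ G.baseFunctor.obj G.vertexSheaf :=
  ZSheaf.liftSections _ (fun U => vertexSec (G.baseInclusion.obj U) 0)
    fun _ _ h => vertexSec_map (G.baseInclusion.map h) 0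

theorem baseVertex_one (U : Opens G.M) :
    G.baseVertex.hom.app (op U) (ZSheaf.one _ U) = vertexSec (G.baseInclusion.obj U) 0 :=
  ZSheaf.liftSections_one _ _ _ U

variable {G}

/-- Yoneda: both sides are the sections of `A` over `Γ_0`, since `vertexSheaf` is free on `Γ_0` and
a morphism out of the constant sheaf on `M` is a global section. -/
theorem baseVertex_comp (A : AbSheaf G.topology) :
    Function.Bijective (fun f : G.vertexSheaf ⟶ A => G.baseVertex ≫ G.baseFunctor.map f) := by
  have key : ∀ (f : G.vertexSheaf ⟶ A) (U : Opens G.M),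
      (G.baseVertex ≫ G.baseFunctor.map f).hom.app (op U) (ZSheaf.one _ U) =
        f.hom.app (op (G.baseInclusion.obj U)) (vertexSec (G.baseInclusion.obj U) 0) := by
    intro f U
    rw [section_comp, baseVertex_one]
    rfl
  -- The image of all of `M` under `baseInclusion` is a preimage of `⊤`, not literally `⊤`; `t`
  -- passes between the two.
  let t : G.objTop ⟶ G.baseInclusion.obj ⊤ := ⟨𝟙 _, fun _ _ => trivial⟩
  refine ⟨fun f g h => vertexSheaf_hom_ext fun U a => ?_, fun g => ?_⟩
  · have h1 := congrArg (fun k : ZSheaf (Opens.grothendieckTopology G.M) ⟶ G.baseFunctor.obj A =>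
      k.hom.app (op ⊤) (ZSheaf.one _ ⊤)) h
    simp only [key] at h1
    have h2 := congrArg (A.obj.map (CentralExtension.vertexHom U a ≫ t).op) h1
    rw [← section_naturality, ← section_naturality, vertexSec_map] at h2
    exact h2
  · let v : A.obj.obj (op G.objTop) := A.obj.map t.op (g.hom.app (op ⊤) (ZSheaf.one _ ⊤))
    refine ⟨vertexSheafLiftTop v, ZSheaf.hom_ext fun U => ?_⟩
    rw [key, vertexSheafLiftTop_vertexSec]
    refine (section_map_comp A.obj t _ _).trans ?_
    have h3 : CentralExtension.vertexHom (G.baseInclusion.obj U) 0 ≫ t =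
        G.baseInclusion.map (homOfLE le_top : U ⟶ ⊤) := by
      refine SimplicialOpen.Hom.ext ?_
      refine SimplexCategory.Hom.ext _ _ (OrderHom.ext _ _ (funext fun i => ?_))
      exact Subsingleton.elim (α := Fin 1) _ _
    rw [h3]
    refine (section_naturality g.hom (homOfLE le_top : U ⟶ ⊤) _).symm.trans ?_
    rw [ZSheaf.map_one]

/-- Dimension shift along an injective embedding of `A`. In degree zero the two sides agree by
`baseVertex_comp`, and the first `Ext` group into the injective sheaf vanishes on both sides, on `M`
because its restriction is flasque. -/
theorem vertexComparison_one_bijective (A : AbSheaf G.topology) :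
    Function.Bijective (extMap.{u, u} G.baseFunctor G.baseVertex (𝟙 (G.baseFunctor.obj A)) 1) := by
  let P : InjectivePresentation A := Classical.arbitrary _
  have hI : Injective P.J := P.injective
  have hS : (ShortComplex.mk _ _ (cokernel.condition P.f)).ShortExact :=
    { exact := ShortComplex.exact_cokernel P.f }
  have hT := shortExact_map G.baseFunctor hS
  -- The restriction to `M` need not be shown injective. It is flasque because inclusions of open
  -- subsets of `M` become monomorphisms of the site of `Γ_•`, all their operators being identities.
  have hfl : ∀ x : Ext.{u} (ZSheaf (Opens.grothendieckTopology G.M)) (G.baseFunctor.obj P.J) 1,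
      x = 0 := by
    refine ext_one_eq_zero_of_flasque _ fun U V i => ?_
    have : Mono (G.baseInclusion.map i) := ⟨fun f g h => SimplicialOpen.Hom.ext
      ((Category.id_comp _).symm.trans ((congrArg SimplicialOpen.Hom.operator h).trans
        (Category.id_comp _)))⟩
    exact injective_section_surjective P.J (G.baseInclusion.map i)
  have key : ∀ f : G.vertexSheaf ⟶ cokernel P.f,
      extMap.{u, u} G.baseFunctor G.baseVertex (𝟙 (G.baseFunctor.obj A)) 1
        ((Ext.mk₀ f).comp (Y := cokernel P.f) (Z := A) hS.extClass (zero_add 1)) =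
      (Ext.mk₀ (G.baseVertex ≫ G.baseFunctor.map f)).comp (Y := G.baseFunctor.obj (cokernel P.f))
        (Z := G.baseFunctor.obj A) hT.extClass (zero_add 1) := by
    intro f
    have := extMap_comp_extClass G.baseFunctor hS hT (𝟙 _) (𝟙 _) (𝟙 _) (by simp) (by simp)
      G.baseVertex (Ext.mk₀ f)
    rw [extMap_mk₀, Category.comp_id] at this
    exact this
  constructor
  · rw [injective_iff_map_eq_zero]
    intro x hx
    obtain ⟨y, rfl⟩ := Ext.covariant_sequence_exact₁ _ hS x (Ext.eq_zero_of_injective _) rfl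
    obtain ⟨f, rfl⟩ := (Ext.mk₀_bijective _ _).2 y
    rw [key] at hx
    obtain ⟨z, hz⟩ := Ext.covariant_sequence_exact₃ _ hT _ _ hx
    obtain ⟨k, rfl⟩ := (Ext.mk₀_bijective _ _).2 z
    obtain ⟨g, rfl⟩ := (baseVertex_comp P.J).2 k
    have h1 : f = g ≫ cokernel.π P.f := by
      refine (baseVertex_comp _).1 ((Ext.mk₀_bijective _ _).1 ?_)
      rw [← hz, Ext.mk₀_comp_mk₀]
      simp
    rw [h1, ← Ext.mk₀_comp_mk₀, Ext.comp_assoc_of_second_deg_zero]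
    refine (congrArg (fun e => (Ext.mk₀ g).comp e (zero_add 1)) hS.comp_extClass).trans ?_
    exact Ext.comp_zero ..
  · intro y
    obtain ⟨z, rfl⟩ := Ext.covariant_sequence_exact₁ _ hT y (hfl _) rfl
    obtain ⟨k, rfl⟩ := (Ext.mk₀_bijective _ _).2 z
    obtain ⟨g, rfl⟩ := (baseVertex_comp _).2 k
    exact ⟨_, key g⟩

/-- Shifting dimension once more, this follows from injectivity in degree one for the quotient and
surjectivity in degree one for the injective sheaf, whose first `Ext` group is zero. Exactness at
`H²(Γ_•, S¹)` requires nothing more in degree two. -/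
theorem vertexComparison_two_injective (A : AbSheaf G.topology) :
    Function.Injective (extMap.{u, u} G.baseFunctor G.baseVertex (𝟙 (G.baseFunctor.obj A)) 2) := by
  let P : InjectivePresentation A := Classical.arbitrary _
  have hI : Injective P.J := P.injective
  have hS : (ShortComplex.mk _ _ (cokernel.condition P.f)).ShortExact :=
    { exact := ShortComplex.exact_cokernel P.f }
  have hT := shortExact_map G.baseFunctor hS
  rw [injective_iff_map_eq_zero]
  intro x hx
  obtain ⟨y, rfl⟩ := Ext.covariant_sequence_exact₁ _ hS x (Ext.eq_zero_of_injective _) rfl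
  have key := extMap_comp_extClass G.baseFunctor hS hT (𝟙 _) (𝟙 _) (𝟙 _) (by simp) (by simp)
      G.baseVertex y
  obtain ⟨z, hz⟩ := Ext.covariant_sequence_exact₃ _ hT _ _ (key.symm.trans hx)
  obtain ⟨w, rfl⟩ := (vertexComparison_one_bijective P.J).2 z
  have : w = 0 := Ext.eq_zero_of_injective _
  rw [this, map_zero, Ext.zero_comp] at hz
  have hy : y = 0 := (vertexComparison_one_bijective _).1 (hz.symm.trans (map_zero _).symm)
  rw [hy, Ext.zero_comp]

theorem Nerve.const_vertex (y : G.Nerve (.mk 0)) : Nerve.const (.mk 0) (y.vertex 0) = y := by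
  refine Nerve.ext (funext fun ij => ?_)
  obtain ⟨i, j⟩ := ij
  have hi : i = 0 := Subsingleton.elim (α := Fin 1) _ _
  have hj : j = 0 := Subsingleton.elim (α := Fin 1) _ _
  subst hi hj
  exact (y.arrow_self 0).symm

/-- The maps `Nerve.const` and `Nerve.vertex` identify `M` with `Γ_0`, and both are restrictions of
smooth maps of the ambient manifolds. What has to be supplied is the ambient extension of a function
that `SmoothOnNerve` asks for. -/
instance : IsIso G.restrictCircle := by
  have : IsIso ((sheafToPresheaf _ _).map G.restrictCircle) := by
    refine @NatIso.isIso_of_isIso_app _ _ _ _ _ _ _ fun U => ?_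
    refine (ConcreteCategory.isIso_iff_bijective (C := AddCommGrpCat) _).2 ⟨?_, ?_⟩
    · intro f g h
      refine Subtype.ext (a1 := (f : circleSections (G.baseInclusion.obj U.unop))) (funext fun y => ?_)
      have h1 : y = ⟨Nerve.const (.mk 0) (y.1.vertex 0), by
          change (Nerve.const _ (y.1.vertex 0)).vertex 0 ∈ U.unop
          rw [Nerve.vertex_const]; exact y.2⟩ := Subtype.ext (Nerve.const_vertex y.1).symm
      rw [h1]
      exact DFunLike.congr_fun (F := C^∞⟮𝓡 G.m, U.unop; 𝓡 1, Circle⟯) h ⟨y.1.vertex 0, y.2⟩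
    · intro h
      change C^∞⟮𝓡 G.m, U.unop; 𝓡 1, Circle⟯ at h
      -- The value `1` outside the open subset is arbitrary: smoothness is claimed only on the
      -- subset.
      let k : G.M → Circle := Function.extend (Subtype.val : U.unop → G.M) h (fun _ => 1)
      have hk : ∀ y : U.unop, k y.1 = h y := fun y => Subtype.val_injective.extend_apply _ _ _
      have hs : ContMDiffOn (𝓡 G.m) (𝓡 1) ∞ k U.unop := by
        intro x hx
        refine ContMDiffAt.contMDiffWithinAt ((contMDiffAt_subtype_iff (x := ⟨x, hx⟩)).1 ?_)
        have : (fun y : U.unop => k y.1) = h := funext hk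
        rw [this]
        exact h.contMDiff _
      refine ⟨(⟨fun y => h ⟨y.1.vertex 0, y.2⟩, fun y => k (G.str.src (y (0, 0))), fun y =>
        hk ⟨y.1.vertex 0, y.2⟩, ?_⟩ : circleSections (G.baseInclusion.obj U.unop)), ?_⟩
      · refine hs.comp (G.str.src_submersion.contMDiff.comp
          (contMDiff_piManifold_apply (0, 0))).contMDiffOn ?_
        rintro _ ⟨y, hy, rfl⟩
        exact hy
      · refine ContMDiffMap.ext (f := (_ : C^∞⟮𝓡 G.m, U.unop; 𝓡 1, Circle⟯)) fun y => ?_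
        exact congrArg h (Subtype.ext (Nerve.vertex_const _ _ _))
  exact isIso_of_reflects_iso _ (sheafToPresheaf _ _)

variable (G)

/-- The comparison map `Ext^k(ℤ[Γ_0], S¹) → H^k(M, S¹)`. -/
def vertexComparison (k : ℕ) : Ext.{u} G.vertexSheaf G.simplicialCircleSheaf k →+ G.baseH k :=
  extMap G.baseFunctor G.baseVertex G.restrictCircle k

theorem vertexComparison_eq (k : ℕ) (x : Ext.{u} G.vertexSheaf G.simplicialCircleSheaf k) :
    G.vertexComparison k x = (extMap G.baseFunctor G.baseVertex
      (𝟙 (G.baseFunctor.obj G.simplicialCircleSheaf)) k x).comp (Ext.mk₀ G.restrictCircle)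
        (add_zero k) := by
  rw [vertexComparison, extMap_apply, extMap_apply, Ext.comp_mk₀_id,
    Ext.comp_assoc_of_third_deg_zero]

theorem postcomp_isIso_bijective {A : Type*} [Category A] [Abelian A] [HasExt.{u} A] (X : A)
    {Y Z : A} (f : Y ⟶ Z) [IsIso f] (k : ℕ) :
    Function.Bijective (fun x : Ext.{u} X Y k => x.comp (Ext.mk₀ f) (add_zero k)) := by
  refine Function.bijective_iff_has_inverse.2
    ⟨fun x => x.comp (Ext.mk₀ (inv f)) (add_zero k), fun x => ?_, fun x => ?_⟩ <;>
  · dsimp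
    rw [Ext.comp_assoc_of_third_deg_zero, Ext.mk₀_comp_mk₀]
    simp

theorem vertexComparison_bijective : Function.Bijective (G.vertexComparison 1) := by
  have := (postcomp_isIso_bijective _ G.restrictCircle 1).comp
    (vertexComparison_one_bijective G.simplicialCircleSheaf)
  convert this using 1
  exact funext fun x => G.vertexComparison_eq 1 x

theorem vertexComparison_injective : Function.Injective (G.vertexComparison 2) := by
  have := (postcomp_isIso_bijective _ G.restrictCircle 2).1.comp
    (vertexComparison_two_injective G.simplicialCircleSheaf)
  convert this using 1
  exact funext fun x => G.vertexComparison_eq 2 x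

/-- A vertex has augmentation `1`, so `baseVertex` followed by the augmentation is the map `ℤ → ℤ`
used to define restriction. Thus the outer maps of the long exact sequence are the restrictions to
`M`. -/
theorem restriction_eq (k : ℕ) (x : G.simplicialH k) :
    G.restriction k x = G.vertexComparison k ((Ext.mk₀ G.augmentation).comp x (zero_add k)) := by
  have h : G.baseVertex ≫ G.baseFunctor.map G.augmentation = 𝟙 _ ≫
      ZSheaf.lift (Opens.grothendieckTopology G.M) (G.baseFunctor.obj (ZSheaf G.topology))
        (Functor.whiskerLeft G.baseInclusion.op (ZSheaf.unit G.topology)) := by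
    rw [Category.id_comp]
    refine ZSheaf.hom_ext fun U => ?_
    rw [section_comp, baseVertex_one]
    refine (augmentation_vertexSec _ _).trans ?_
    exact (ZSheaf.lift_one (J := Opens.grothendieckTopology G.M)
      (G.baseFunctor.obj (ZSheaf G.topology))
      (Functor.whiskerLeft G.baseInclusion.op (ZSheaf.unit G.topology)) U).symm
  have := extMap_precomp G.baseFunctor _ _ G.restrictCircle G.augmentation _ h x
  rw [Ext.mk₀_id_comp] at this
  exact this.symm

end LieGroupoid

end

noncomputable section

/-! ### Functoriality along morphisms of Lie groupoids -/

/-! ### Sections of inverse image sheaves -/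

section InverseImage

variable {C D : Type u} [SmallCategory C] [SmallCategory D]
  {J : GrothendieckTopology C} {K : GrothendieckTopology D} {T : C ⥤ D} [T.IsContinuous J K]

/-- The section of the inverse image given by a section. -/
def unitSec {A : AbSheaf J} {U : C} (s : A.obj.obj (op U)) :
    ((inverseImage J K T).obj A).obj.obj (op (T.obj U)) :=
  ((inverseImageAdj J K T).unit.app A).hom.app (op U) s

theorem unitSec_map {A : AbSheaf J} {U V : C} (h : V ⟶ U) (s : A.obj.obj (op U)) :
    unitSec (K := K) (T := T) (A.obj.map h.op s) =
      ((inverseImage J K T).obj A).obj.map (T.map h).op (unitSec s) :=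
  section_naturality ((inverseImageAdj J K T).unit.app A).hom h s

theorem unitSec_naturality {A B : AbSheaf J} (f : A ⟶ B) {U : C} (s : A.obj.obj (op U)) :
    ((inverseImage J K T).map f).hom.app (op (T.obj U)) (unitSec s) =
      unitSec (f.hom.app (op U) s) := by
  have h := (inverseImageAdj J K T).unit.naturality f
  exact (ConcreteCategory.congr_hom (NatTrans.congr_app (congrArg (fun k => k.hom) h) (op U)) s).symm

theorem homEquiv_apply_unitSec {A : AbSheaf J} {B : AbSheaf K}
    (f : (inverseImage J K T).obj A ⟶ B) {U : C} (s : A.obj.obj (op U)) :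
    ((inverseImageAdj J K T).homEquiv A B f).hom.app (op U) s =
      f.hom.app (op (T.obj U)) (unitSec s) := by
  rw [Adjunction.homEquiv_unit]
  rfl

theorem homEquiv_symm_unitSec {A : AbSheaf J} {B : AbSheaf K}
    (f : A ⟶ (precompSheaf J K T).obj B) {U : C} (s : A.obj.obj (op U)) :
    (((inverseImageAdj J K T).homEquiv A B).symm f).hom.app (op (T.obj U)) (unitSec s) =
      f.hom.app (op U) s := by
  rw [← homEquiv_apply_unitSec, Equiv.apply_symm_apply]

theorem toInverseImage_one (S : D ⥤ C) (η : 𝟭 D ⟶ S ⋙ T) (U : D) :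
    (ZSheaf.toInverseImage (J := J) (K := K) T S η).hom.app (op U) (ZSheaf.one K U) =
      ((inverseImage J K T).obj (ZSheaf J)).obj.map (η.app U).op
        (unitSec (ZSheaf.one J (S.obj U))) :=
  ZSheaf.lift_one _ _ U

/-- By adjunction the sections `unitSec s` play the part of generators of the inverse image. -/
theorem inverseImage_hom_ext {A : AbSheaf J} {B : AbSheaf K} {f g : (inverseImage J K T).obj A ⟶ B}
    (h : ∀ (U : C) (s : A.obj.obj (op U)), f.hom.app (op (T.obj U)) (unitSec s) =
      g.hom.app (op (T.obj U)) (unitSec s)) : f = g := by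
  refine ((inverseImageAdj J K T).homEquiv A B).injective (sheaf_hom_ext fun U s => ?_)
  rw [homEquiv_apply_unitSec, homEquiv_apply_unitSec, h]

end InverseImage

namespace LieGroupoid

/-! ### The first step of an injective resolution, and classes of degree one -/

section Resolution

variable (G : LieGroupoid.{u})

/-- An embedding of the sheaf `S¹` into an injective sheaf. -/
def injPres : InjectivePresentation G.simplicialCircleSheaf := Classical.arbitrary _

/-- An injective sheaf containing `S¹`. -/
def inj : AbSheaf G.topology := G.injPres.J

instance : Injective G.inj := G.injPres.injective

def injι : G.simplicialCircleSheaf ⟶ G.inj := G.injPres.f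

instance : Mono G.injι := G.injPres.mono

/-- The quotient of the injective sheaf by `S¹`. -/
def injQuot : AbSheaf G.topology := cokernel G.injι

def injπ : G.inj ⟶ G.injQuot := cokernel.π G.injι

theorem injι_injπ : G.injι ≫ G.injπ = 0 := cokernel.condition _

theorem inj_shortExact : (ShortComplex.mk _ _ G.injι_injπ).ShortExact :=
  have : Epi G.injπ := inferInstanceAs (Epi (cokernel.π _))
  { exact := ShortComplex.exact_cokernel G.injι }

instance : Epi G.injπ := G.inj_shortExact.epi_g

variable {G}

/-- The extension class defined by a morphism to `injQuot`. -/
def quotClass {A : AbSheaf G.topology} (n : A ⟶ G.injQuot) :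
    Ext.{u} A G.simplicialCircleSheaf 1 :=
  (Ext.mk₀ n).comp (Y := G.injQuot) (Z := G.simplicialCircleSheaf) G.inj_shortExact.extClass
    (zero_add 1)

theorem quotClass_add {A : AbSheaf G.topology} (n n' : A ⟶ G.injQuot) :
    quotClass (n + n') = quotClass n + quotClass n' := by
  rw [quotClass, Ext.mk₀_add, Ext.add_comp]
  rfl

theorem quotClass_precomp {A B : AbSheaf G.topology} (f : A ⟶ B) (n : B ⟶ G.injQuot) :
    quotClass (f ≫ n) = (Ext.mk₀ f).comp (quotClass n) (zero_add 1) := by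
  rw [quotClass, ← Ext.mk₀_comp_mk₀, Ext.comp_assoc_of_second_deg_zero]
  rfl

/-- The first `Ext` group into `inj` vanishes, so the connecting map is onto. -/
theorem quotClass_surjective {A : AbSheaf G.topology} (x : Ext.{u} A G.simplicialCircleSheaf 1) :
    ∃ n : A ⟶ G.injQuot, quotClass n = x := by
  have : Injective (ShortComplex.mk _ _ G.injι_injπ).X₂ := inferInstanceAs (Injective G.inj)
  obtain ⟨y, hy⟩ := Ext.covariant_sequence_exact₁ A G.inj_shortExact x
    (Ext.eq_zero_of_injective _) (zero_add 1)
  obtain ⟨n, rfl⟩ := (Ext.mk₀_bijective _ _).2 y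
  exact ⟨n, hy⟩

theorem quotClass_comp_injπ {A : AbSheaf G.topology} (m : A ⟶ G.inj) :
    quotClass (m ≫ G.injπ) = 0 := by
  rw [quotClass, ← Ext.mk₀_comp_mk₀, Ext.comp_assoc_of_second_deg_zero]
  refine (congrArg (fun e => (Ext.mk₀ m).comp e (zero_add 1)) G.inj_shortExact.comp_extClass).trans
    ?_
  exact Ext.comp_zero ..

/-- Exactness at `Hom(A, injQuot)`. With `quotClass_surjective` it presents `Ext¹(A, S¹)` as `Hom(A,
injQuot)` modulo `Hom(A, inj)`, which is the form in which extension classes are handled from here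
on. -/
theorem quotClass_eq_iff {A : AbSheaf G.topology} {n n' : A ⟶ G.injQuot} :
    quotClass n = quotClass n' ↔ ∃ m : A ⟶ G.inj, n = n' + m ≫ G.injπ := by
  constructor
  · intro h
    have h1 : quotClass (n - n') = 0 := by
      have := quotClass_add (n - n') n'
      rw [sub_add_cancel, h] at this
      simpa using this.symm
    obtain ⟨y, hy⟩ := Ext.covariant_sequence_exact₃ A G.inj_shortExact _ (zero_add 1) h1
    obtain ⟨m, rfl⟩ := (Ext.mk₀_bijective _ _).2 y
    refine ⟨m, ?_⟩
    rw [Ext.mk₀_comp_mk₀] at hy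
    have := (Ext.mk₀_bijective _ _).1 hy
    exact (add_eq_of_eq_sub' this).symm
  · rintro ⟨m, rfl⟩
    rw [quotClass_add, quotClass_comp_injπ, add_zero]

end Resolution

/-! ### Inverse images of the resolution, the vertices and the edges -/

variable {G' G : LieGroupoid.{u}} (φ : Hom G' G)

namespace Hom

/-- The inverse image of sheaves along a morphism of Lie groupoids. -/
abbrev invImage : AbSheaf G.topology ⥤ AbSheaf G'.topology :=
  inverseImage G.topology G'.topology φ.preimage

abbrev directImage : AbSheaf G'.topology ⥤ AbSheaf G.topology :=
  precompSheaf G.topology G'.topology φ.preimage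

/-- The inverse image of sheaves along the map of objects. -/
abbrev baseInvImage : AbSheaf (Opens.grothendieckTopology G.M) ⥤
    AbSheaf (Opens.grothendieckTopology G'.M) :=
  inverseImage (Opens.grothendieckTopology G.M) (Opens.grothendieckTopology G'.M) φ.basePreimage

abbrev baseDirectImage : AbSheaf (Opens.grothendieckTopology G'.M) ⥤
    AbSheaf (Opens.grothendieckTopology G.M) :=
  precompSheaf (Opens.grothendieckTopology G.M) (Opens.grothendieckTopology G'.M) φ.basePreimage

/-- The morphism `φ⁻¹ S¹ ⟶ S¹`. -/
def invCircle : φ.invImage.obj G.simplicialCircleSheaf ⟶ G'.simplicialCircleSheaf :=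
  ((inverseImageAdj G.topology G'.topology φ.preimage).homEquiv _ _).symm φ.pullbackCircle

/-- A morphism of injective sheaves extending `φ⁻¹ S¹ ⟶ S¹`. -/
def invInj : φ.invImage.obj G.inj ⟶ G'.inj :=
  Injective.factorThru (φ.invCircle ≫ G'.injι) (φ.invImage.map G.injι)

theorem invInj_comp : φ.invImage.map G.injι ≫ φ.invInj = φ.invCircle ≫ G'.injι :=
  Injective.comp_factorThru _ _

theorem exists_invQuot : ∃ k : φ.invImage.obj G.injQuot ⟶ G'.injQuot,
    φ.invImage.map G.injπ ≫ k = φ.invInj ≫ G'.injπ := by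
  have h := shortExact_map φ.invImage G.inj_shortExact
  have : Epi (φ.invImage.map G.injπ) := h.epi_g
  refine ⟨h.exact.desc (φ.invInj ≫ G'.injπ) ?_, h.exact.g_desc _ _⟩
  change φ.invImage.map G.injι ≫ _ = 0
  rw [← Category.assoc, invInj_comp, Category.assoc, G'.injι_injπ, comp_zero]

def invQuot : φ.invImage.obj G.injQuot ⟶ G'.injQuot := φ.exists_invQuot.choose

theorem invQuot_comp : φ.invImage.map G.injπ ≫ φ.invQuot = φ.invInj ≫ G'.injπ :=
  φ.exists_invQuot.choose_spec

/-- The adjoint form of `invInj`. -/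
def pushInj : G.inj ⟶ φ.directImage.obj G'.inj :=
  (inverseImageAdj G.topology G'.topology φ.preimage).homEquiv _ _ φ.invInj

/-- The adjoint form of `invQuot`. -/
def pushQuot : G.injQuot ⟶ φ.directImage.obj G'.injQuot :=
  (inverseImageAdj G.topology G'.topology φ.preimage).homEquiv _ _ φ.invQuot

theorem pushInj_injι {U : G.SimplicialOpen} (f : G.simplicialCircleSheaf.obj.obj (op U)) :
    φ.pushInj.hom.app (op U) (G.injι.hom.app (op U) f) =
      G'.injι.hom.app (op (φ.preimage.obj U)) (φ.pullbackCircle.hom.app (op U) f) := by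
  refine (homEquiv_apply_unitSec _ _).trans ?_
  rw [← unitSec_naturality, ← section_comp, invInj_comp, section_comp]
  exact congrArg _ (homEquiv_symm_unitSec _ _)

theorem pushQuot_injπ {U : G.SimplicialOpen} (e : G.inj.obj.obj (op U)) :
    φ.pushQuot.hom.app (op U) (G.injπ.hom.app (op U) e) =
      G'.injπ.hom.app (op (φ.preimage.obj U)) (φ.pushInj.hom.app (op U) e) := by
  refine (homEquiv_apply_unitSec _ _).trans ?_
  rw [← unitSec_naturality, ← section_comp, invQuot_comp, section_comp]
  exact congrArg _ (homEquiv_apply_unitSec _ _).symm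

/-- The inclusion of an open subset into the preimage of the whole space. -/
abbrev enlargeHom (U : G'.SimplicialOpen) : U ⟶ φ.preimage.obj ⟨U.deg, ⊤⟩ := φ.toEnlarge.app U

/-- An open subset of `Γ'_p` need not be a preimage, but it lies in the preimage of all of `Γ_p`.
Sections defined by restriction from there are compatible with the site morphisms as soon as they
are compatible with the simplicial operators. -/
theorem map_enlargeHom_unitSec {A : AbSheaf G.topology} {U V : G'.SimplicialOpen} (h : V ⟶ U)
    (s : A.obj.obj (op ⟨U.deg, ⊤⟩)) :
    (φ.invImage.obj A).obj.map h.op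
      ((φ.invImage.obj A).obj.map (φ.enlargeHom U).op (unitSec s)) =
    (φ.invImage.obj A).obj.map (φ.enlargeHom V).op (unitSec (A.obj.map (Quiver.Hom.op
      (⟨h.operator, fun _ _ => trivial⟩ : (⟨V.deg, ⊤⟩ : G.SimplicialOpen) ⟶ ⟨U.deg, ⊤⟩)) s)) := by
  refine (section_map_comp _ _ _ _).trans ?_
  refine Eq.trans ?_ (congrArg _ (unitSec_map _ _)).symm
  refine Eq.trans ?_ (section_map_comp _ _ _ _).symm
  rfl

/-- The morphism of free sheaves on the vertices. -/
def vertexMap : G'.vertexSheaf ⟶ φ.invImage.obj G.vertexSheaf :=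
  vertexSheafLift
    (fun U a => (φ.invImage.obj G.vertexSheaf).obj.map (φ.enlargeHom U).op
      (unitSec (vertexSec (G := G) ⟨U.deg, ⊤⟩ a)))
    (fun U V h a => by
      rw [map_enlargeHom_unitSec, vertexSec_map])

theorem vertexMap_vertexSec (U : G'.SimplicialOpen) (a : Fin (U.deg.len + 1)) :
    φ.vertexMap.hom.app (op U) (vertexSec U a) =
      (φ.invImage.obj G.vertexSheaf).obj.map (φ.enlargeHom U).op
        (unitSec (vertexSec (G := G) ⟨U.deg, ⊤⟩ a)) :=
  vertexSheafLift_vertexSec _ _ U a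

theorem vertexMap_augmentation : φ.vertexMap ≫ φ.invImage.map G.augmentation =
    G'.augmentation ≫ ZSheaf.toInverseImage φ.preimage (SimplicialOpen.enlarge G' G)
      φ.toEnlarge := by
  refine vertexSheaf_hom_ext fun U a => ?_
  rw [section_comp, section_comp, vertexMap_vertexSec, augmentation_vertexSec]
  refine Eq.trans ?_ (toInverseImage_one _ _ U).symm
  rw [section_naturality, unitSec_naturality, augmentation_vertexSec]
  rfl

/-- The family of inverse images of the edges. -/
def edgeMapFamily : EdgeFamily (φ.invImage.obj G.edgeSheaf).obj where
  val U a b := (φ.invImage.obj G.edgeSheaf).obj.map (φ.enlargeHom U).op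
      (unitSec (edgeSec (G := G) ⟨U.deg, ⊤⟩ a b))
  map_val U V h a b := by
    rw [map_enlargeHom_unitSec, edgeSec_map]
  add_val U a b c := by
    rw [← map_add, ← edgeSec_add (G := G) ⟨U.deg, ⊤⟩ a b c]
    exact congrArg _ (map_add (ConcreteCategory.hom (((inverseImageAdj _ _ _).unit.app _).hom.app
      (op _))) _ _).symm

def edgeMap : G'.edgeSheaf ⟶ φ.invImage.obj G.edgeSheaf := φ.edgeMapFamily.hom

theorem edgeMap_edgeSec (U : G'.SimplicialOpen) (a b : Fin (U.deg.len + 1)) :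
    φ.edgeMap.hom.app (op U) (edgeSec U a b) =
      (φ.invImage.obj G.edgeSheaf).obj.map (φ.enlargeHom U).op
        (unitSec (edgeSec (G := G) ⟨U.deg, ⊤⟩ a b)) :=
  φ.edgeMapFamily.hom_edgeSec U a b

/-- Together with `vertexMap_augmentation` this is a morphism from the short exact sequence of `G'`
to the inverse image of that of `G`; the naturality squares for the long exact sequence rest on it.
-/
theorem edgeMap_edgeι : φ.edgeMap ≫ φ.invImage.map G.edgeι = G'.edgeι ≫ φ.vertexMap := by
  refine edgeSheaf_hom_ext fun U a b => ?_
  rw [section_comp, section_comp, edgeMap_edgeSec, edgeι_edgeSec, map_sub, vertexMap_vertexSec,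
    vertexMap_vertexSec, section_naturality, unitSec_naturality, edgeι_edgeSec, ← map_sub]
  exact congrArg _ (map_sub (ConcreteCategory.hom (((inverseImageAdj _ _ _).unit.app _).hom.app
      (op _))) _ _)

/-- Pullback of morphisms from `edgeSheaf` to `injQuot`. -/
def pullEdgeHom (n : G.edgeSheaf ⟶ G.injQuot) : G'.edgeSheaf ⟶ G'.injQuot :=
  φ.edgeMap ≫ φ.invImage.map n ≫ φ.invQuot

theorem pullEdgeHom_edgeSec (n : G.edgeSheaf ⟶ G.injQuot) (U : G'.SimplicialOpen)
    (a b : Fin (U.deg.len + 1)) :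
    (φ.pullEdgeHom n).hom.app (op U) (edgeSec U a b) = G'.injQuot.obj.map (φ.enlargeHom U).op
      (φ.pushQuot.hom.app (op ⟨U.deg, ⊤⟩)
        (n.hom.app (op ⟨U.deg, ⊤⟩) (edgeSec (G := G) ⟨U.deg, ⊤⟩ a b))) := by
  rw [pullEdgeHom, section_comp, section_comp, edgeMap_edgeSec, section_naturality,
    section_naturality, unitSec_naturality]
  exact congrArg _ (homEquiv_apply_unitSec _ _).symm

/-- Pullback of classes of central extensions, on the level of `Ext`. -/
def pullEdgeClass : Ext.{u} G.edgeSheaf G.simplicialCircleSheaf 1 →+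
    Ext.{u} G'.edgeSheaf G'.simplicialCircleSheaf 1 :=
  extMap φ.invImage φ.edgeMap φ.invCircle 1

/-- Makes the pullback explicit on representatives, so that it can be compared with potentials. The
choices of `invInj` and `invQuot` do not affect the class, because they extend the canonical map on
`S¹`. -/
theorem pullEdgeClass_quotClass (n : G.edgeSheaf ⟶ G.injQuot) :
    φ.pullEdgeClass (quotClass n) = quotClass (φ.pullEdgeHom n) := by
  have := extMap_comp_extClass φ.invImage G.inj_shortExact G'.inj_shortExact φ.invCircle φ.invInj
    φ.invQuot φ.invInj_comp.symm φ.invQuot_comp.symm φ.edgeMap (Ext.mk₀ n)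
  rw [extMap_mk₀] at this
  exact this

/-- Compatibility of the pullback maps with the connecting map `Ext¹(edgeSheaf, S¹) → H²`. -/
theorem pullbackH_extClass_comp (x : Ext.{u} G.edgeSheaf G.simplicialCircleSheaf 1) :
    φ.pullbackH 2 (Ext.comp (X := ZSheaf G.topology) (Y := G.edgeSheaf)
      G.edge_shortExact.extClass x (rfl : 1 + 1 = 2)) =
    Ext.comp (X := ZSheaf G'.topology) (Y := G'.edgeSheaf)
      G'.edge_shortExact.extClass (φ.pullEdgeClass x) (rfl : 1 + 1 = 2) :=
  extMap_extClass_comp φ.invImage G.edge_shortExact G'.edge_shortExact φ.edgeMap φ.vertexMap _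
    φ.edgeMap_edgeι φ.vertexMap_augmentation φ.invCircle x rfl

/-! #### Compatibility with restriction to the objects -/

/-- The base change morphism on direct images. -/
def baseChangeDirect (B : AbSheaf G'.topology) : G.baseFunctor.obj (φ.directImage.obj B) ⟶
    φ.baseDirectImage.obj (G'.baseFunctor.obj B) where
  hom :=
    { app := fun U => B.obj.map (Quiver.Hom.op (⟨𝟙 _, fun x hx => by
          change (φ.nerveMap x).vertex 0 ∈ U.unop
          have h1 : (φ.nerveMap x).vertex 0 = φ.obj (x.vertex 0) := φ.src_arr _
          rw [h1]
          exact hx⟩ : G'.baseInclusion.obj (φ.basePreimage.obj U.unop) ⟶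
            φ.preimage.obj (G.baseInclusion.obj U.unop)))
      naturality := fun U V h => by
        refine (B.obj.map_comp _ _).symm.trans (Eq.trans ?_ (B.obj.map_comp _ _))
        rfl }

/-- The base change morphism on inverse images. -/
def baseChange : G.baseFunctor ⋙ φ.baseInvImage ⟶ φ.invImage ⋙ G'.baseFunctor where
  app A := ((inverseImageAdj _ _ φ.basePreimage).homEquiv _ _).symm
    (G.baseFunctor.map ((inverseImageAdj _ _ φ.preimage).unit.app A) ≫
      φ.baseChangeDirect (φ.invImage.obj A))
  naturality A B f := by
    refine inverseImage_hom_ext fun U s => ?_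
    refine Eq.trans (section_comp _ _ _) (Eq.trans ?_ (section_comp _ _ _).symm)
    refine (congrArg _ (unitSec_naturality (G.baseFunctor.map f) s)).trans ?_
    refine (homEquiv_symm_unitSec _ _).trans ?_
    refine Eq.trans ?_ (congrArg _ (homEquiv_symm_unitSec _ _)).symm
    have h1 := (unitSec_naturality (K := G'.topology) (T := φ.preimage) f
      (U := G.baseInclusion.obj U) s).symm
    refine (congrArg ((φ.baseChangeDirect (φ.invImage.obj B)).hom.app (op U)) h1).trans ?_
    exact (section_naturality (φ.invImage.map f).hom _ _).symm

theorem baseChange_unitSec (A : AbSheaf G.topology) {U : Opens G.M}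
    (s : A.obj.obj (op (G.baseInclusion.obj U))) :
    (φ.baseChange.app A).hom.app (op (φ.basePreimage.obj U))
      (unitSec (A := G.baseFunctor.obj A) s) =
    (φ.baseChangeDirect (φ.invImage.obj A)).hom.app (op U) (unitSec s) :=
  homEquiv_symm_unitSec _ _

theorem nerveMap_const (p : SimplexCategory) (x : G'.M) :
    φ.nerveMap (Nerve.const p x) = Nerve.const p (φ.obj x) :=
  Nerve.ext (funext fun _ => φ.arr_one x)

/-- Restriction to objects and inverse image commute up to the natural transformation `baseChange`.
`extMap_square` does not require it to be invertible, only compatible with the chosen maps on `ℤ`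
and `S¹`. -/
theorem basePullbackH_vertexComparison (k : ℕ)
    (x : Ext.{u} G.vertexSheaf G.simplicialCircleSheaf k) :
    φ.basePullbackH k (G.vertexComparison k x) =
      G'.vertexComparison k (extMap φ.invImage φ.vertexMap φ.invCircle k x) := by
  refine extMap_square G.baseFunctor φ.baseInvImage φ.invImage G'.baseFunctor φ.baseChange
    G.baseVertex G.restrictCircle
    (ZSheaf.toInverseImage φ.basePreimage ((Functor.const _).obj (⊤ : Opens G.M))
      { app := fun _ => homOfLE le_top, naturality := fun _ _ _ => rfl })
    (((inverseImageAdj _ _ φ.basePreimage).homEquiv _ _).symm φ.basePullbackCircle)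
    φ.vertexMap φ.invCircle G'.baseVertex G'.restrictCircle ?_ ?_ x
  -- On the section `1` both composites give the restricted inverse image of the vertex of `Γ_0`.
  · refine ZSheaf.hom_ext fun U => ?_
    refine (congrArg (fun y => (φ.baseChange.app G.vertexSheaf).hom.app (op U)
      ((φ.baseInvImage.map G.baseVertex).hom.app (op U) y)) (toInverseImage_one _ _ U)).trans ?_
    let l : U ⟶ φ.basePreimage.obj ⊤ := homOfLE le_top
    refine (congrArg ((φ.baseChange.app G.vertexSheaf).hom.app (op U))
      ((section_naturality (φ.baseInvImage.map G.baseVertex).hom l _).trans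
        (congrArg _ ((unitSec_naturality _ _).trans
          (congrArg unitSec (G.baseVertex_one ⊤)))))).trans ?_
    refine (section_naturality (φ.baseChange.app G.vertexSheaf).hom l _).trans ?_
    refine (congrArg _ (φ.baseChange_unitSec G.vertexSheaf _)).trans ?_
    refine (section_map_comp (φ.invImage.obj G.vertexSheaf).obj _ (G'.baseInclusion.map l) _).trans
      ?_
    refine Eq.trans ?_ (congrArg (φ.vertexMap.hom.app (op (G'.baseInclusion.obj U)))
      (G'.baseVertex_one U)).symm
    exact (φ.vertexMap_vertexSec (G'.baseInclusion.obj U) 0).symm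
  · refine inverseImage_hom_ext fun U s => ?_
    refine (congrArg ((((inverseImageAdj (Opens.grothendieckTopology G.M)
      (Opens.grothendieckTopology G'.M) φ.basePreimage).homEquiv _ _).symm
        φ.basePullbackCircle).hom.app (op (φ.basePreimage.obj U)))
      (unitSec_naturality (K := Opens.grothendieckTopology G'.M) (T := φ.basePreimage)
        G.restrictCircle s)).trans ?_
    refine (homEquiv_symm_unitSec _ _).trans ?_
    refine Eq.trans ?_ (congrArg (fun y => G'.restrictCircle.hom.app (op (φ.basePreimage.obj U))
      ((G'.baseFunctor.map φ.invCircle).hom.app (op (φ.basePreimage.obj U)) y))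
      (φ.baseChange_unitSec _ s)).symm
    refine Eq.trans ?_ (congrArg (G'.restrictCircle.hom.app (op (φ.basePreimage.obj U)))
      ((section_naturality φ.invCircle.hom _ _).trans
        (congrArg _ (homEquiv_symm_unitSec φ.pullbackCircle s)))).symm
    -- After unfolding the adjunctions both sides are pullbacks of the function `s`, evaluated at
    -- the constant sequence at `φ.obj x`.
    refine ContMDiffMap.ext (f := (_ : C^∞⟮𝓡 G'.m, φ.basePreimage.obj U; 𝓡 1, Circle⟯)) fun x => ?_
    exact congrArg (show circleSections (G.baseInclusion.obj U) from s).1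
      (Subtype.ext (φ.nerveMap_const _ x.1).symm)

theorem restriction_pullbackH (k : ℕ) (x : G.simplicialH k) :
    G'.restriction k (φ.pullbackH k x) = φ.basePullbackH k (G.restriction k x) := by
  rw [restriction_eq, restriction_eq, basePullbackH_vertexComparison]
  refine congrArg _ ?_
  exact (extMap_precomp φ.invImage _ _ φ.invCircle _ _ φ.vertexMap_augmentation x).symm

end Hom

end LieGroupoid

end

noncomputable section

/-! ### Fibres of the injective sheaf modulo smooth functions -/

namespace LieGroupoid

variable {G : LieGroupoid.{u}} {p q : SimplexCategory}

/-- Restriction of sections to a smaller open subset of the same `Γ_p`. -/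
def secRes (A : AbSheaf G.topology) {V U : Opens (G.Nerve p)} (h : V ≤ U) :
    A.obj.obj (op ⟨p, U⟩) →+ A.obj.obj (op ⟨p, V⟩) :=
  (A.obj.map (SimplicialOpen.incl h).op).hom

theorem secRes_secRes (A : AbSheaf G.topology) {W V U : Opens (G.Nerve p)} (h : V ≤ U)
    (h' : W ≤ V) (s : A.obj.obj (op ⟨p, U⟩)) :
    secRes A h' (secRes A h s) = secRes A (h'.trans h) s :=
  section_map_comp A.obj (SimplicialOpen.incl h) (SimplicialOpen.incl h') s

theorem secRes_self (A : AbSheaf G.topology) {U : Opens (G.Nerve p)} (h : U ≤ U)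
    (s : A.obj.obj (op ⟨p, U⟩)) : secRes A h s = s :=
  section_map_id A.obj s

theorem secRes_naturality {A B : AbSheaf G.topology} (f : A ⟶ B) {V U : Opens (G.Nerve p)}
    (h : V ≤ U) (s : A.obj.obj (op ⟨p, U⟩)) :
    f.hom.app (op ⟨p, V⟩) (secRes A h s) = secRes B h (f.hom.app (op ⟨p, U⟩) s) :=
  section_naturality f.hom _ s

theorem secRes_ext (A : AbSheaf G.topology) {U : Opens (G.Nerve p)}
    {s t : A.obj.obj (op ⟨p, U⟩)}
    (h : ∀ x ∈ U, ∃ (V : Opens (G.Nerve p)) (hV : V ≤ U), x ∈ V ∧ secRes A hV s = secRes A hV t) :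
    s = t := by
  let S : Sieve (⟨p, U⟩ : G.SimplicialOpen) :=
    { arrows := fun W f => A.obj.map f.op s = A.obj.map f.op t
      downward_closed := fun {Y Z f} hf g => by
        rw [← section_map_comp, ← section_map_comp]
        exact congrArg _ hf }
  exact section_ext A (S := S) h fun V f hf => hf

/-- A property that is stable under restriction and determines a section makes local solutions agree
on overlaps by itself, so no compatibility has to be verified in applications. -/
theorem exists_glue (A : AbSheaf G.topology) (U : Opens (G.Nerve p))
    (P : ∀ V : Opens (G.Nerve p), A.obj.obj (op ⟨p, V⟩) → Prop)
    (hres : ∀ (V W : Opens (G.Nerve p)) (h : W ≤ V) s, P V s → P W (secRes A h s))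
    (huniq : ∀ (V : Opens (G.Nerve p)) s t, V ≤ U → P V s → P V t → s = t)
    (hloc : ∀ x ∈ U, ∃ V : Opens (G.Nerve p), V ≤ U ∧ x ∈ V ∧ ∃ s, P V s) :
    ∃ s : A.obj.obj (op ⟨p, U⟩), ∀ (V : Opens (G.Nerve p)) (h : V ≤ U) t, P V t →
      secRes A h s = t := by
  choose V hVU hxV t ht using fun x : U => hloc x.1 x.2
  let X : U → G.SimplicialOpen := fun x => ⟨p, V x⟩
  let π : ∀ x : U, X x ⟶ (⟨p, U⟩ : G.SimplicialOpen) := fun x => SimplicialOpen.incl (hVU x)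
  have hsh := (isSheaf_iff_isSheaf_of_type _ _).1
    ((Presheaf.isSheaf_iff_isSheaf_forget G.topology _ (forget AddCommGrpCat)).1 A.property)
  have h1 := hsh (Sieve.generate (Presieve.ofArrows X π)) (fun x hx =>
    ⟨V ⟨x, hx⟩, hVU ⟨x, hx⟩, hxV ⟨x, hx⟩, Sieve.le_generate _ _ _ (Presieve.ofArrows.mk (⟨x, hx⟩ : U))⟩)
  rw [← Presieve.isSheafFor_iff_generate, Presieve.isSheafFor_arrows_iff] at h1
  obtain ⟨s, hs, -⟩ := h1 t (by
    intro x y Z f g hfg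
    -- Inclusions carry the identity operator, so two arrows with the same composite to `U` have the
    -- same operator and factor through the intersection.
    have h0 : f.operator = g.operator := by
      have := congrArg SimplicialOpen.Hom.operator hfg
      exact (Category.id_comp _).symm.trans (this.trans (Category.id_comp _))
    let k : Z ⟶ ⟨p, V x ⊓ V y⟩ := ⟨f.operator, fun z hz => ⟨f.mem z hz, by
      have := g.mem z hz
      rw [← h0] at this
      exact this⟩⟩
    have e₁ : f = k ≫ SimplicialOpen.incl inf_le_left :=
      SimplicialOpen.Hom.ext (Category.id_comp _).symm
    have e₂ : g = k ≫ SimplicialOpen.incl inf_le_right :=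
      SimplicialOpen.Hom.ext (h0.symm.trans (Category.id_comp _).symm)
    have h2 : secRes A inf_le_left (t x) = secRes A inf_le_right (t y) :=
      huniq (V x ⊓ V y) _ _ (inf_le_left.trans (hVU x)) (hres _ _ _ _ (ht x)) (hres _ _ _ _ (ht y))
    change A.obj.map f.op (t x) = A.obj.map g.op (t y)
    rw [e₁, e₂, ← section_map_comp, ← section_map_comp]
    exact congrArg (A.obj.map k.op) h2)
  refine ⟨s, fun W h w hw => secRes_ext A fun x hx => ⟨W ⊓ V ⟨x, h hx⟩, inf_le_left,
    ⟨hx, hxV _⟩, ?_⟩⟩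
  have h2 : secRes A (hVU ⟨x, h hx⟩) s = t ⟨x, h hx⟩ := hs ⟨x, h hx⟩
  have h3 : secRes A (inf_le_right : W ⊓ V ⟨x, h hx⟩ ≤ _) (t ⟨x, h hx⟩) = secRes A inf_le_left w :=
    huniq _ _ _ (inf_le_left.trans h) (hres _ _ _ _ (ht _)) (hres _ _ _ _ hw)
  rw [← h3, ← h2, secRes_secRes, secRes_secRes]

/-- Sections over all of `Γ_p`. -/
abbrev TopSec (A : AbSheaf G.topology) (p : SimplexCategory) : Type u := A.obj.obj (op ⟨p, ⊤⟩)

/-- The morphism of the site given by a simplicial operator. -/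
def topHom (φ : q ⟶ p) : (⟨p, ⊤⟩ : G.SimplicialOpen) ⟶ ⟨q, ⊤⟩ := ⟨φ, fun _ _ => trivial⟩

def topMap (A : AbSheaf G.topology) (φ : q ⟶ p) : TopSec A q →+ TopSec A p :=
  (A.obj.map (topHom φ).op).hom

theorem topMap_naturality {A B : AbSheaf G.topology} (f : A ⟶ B) (φ : q ⟶ p) (s : TopSec A q) :
    f.hom.app (op ⟨p, ⊤⟩) (topMap A φ s) = topMap B φ (f.hom.app (op ⟨q, ⊤⟩) s) :=
  section_naturality f.hom _ s

/-- The preimage of an open subset under a simplicial operator. -/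
def opensMap (φ : q ⟶ p) (W : Opens (G.Nerve q)) : Opens (G.Nerve p) :=
  W.comap ⟨_, Nerve.continuous_map φ⟩

def overHom (φ : q ⟶ p) (W : Opens (G.Nerve q)) :
    (⟨p, opensMap φ W⟩ : G.SimplicialOpen) ⟶ ⟨q, W⟩ := ⟨φ, fun _ hx => hx⟩

theorem secRes_topMap (A : AbSheaf G.topology) (φ : q ⟶ p) (W : Opens (G.Nerve q))
    (s : TopSec A q) : secRes A (le_top : opensMap φ W ≤ ⊤) (topMap A φ s) =
      A.obj.map (overHom φ W).op (secRes A le_top s) := by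
  refine (section_map_comp A.obj (topHom φ) (SimplicialOpen.incl le_top) s).trans ?_
  exact (section_map_comp A.obj (SimplicialOpen.incl le_top) (overHom φ W) s).symm

/-- The sections agree near a point. -/
def NearEq (A : AbSheaf G.topology) (x : G.Nerve p) (s t : TopSec A p) : Prop :=
  ∃ W : Opens (G.Nerve p), x ∈ W ∧ secRes A (le_top : W ≤ ⊤) s = secRes A le_top t

/-! ### Calculus of agreement near a point -/

section NearEq

variable {A B : AbSheaf G.topology} {x : G.Nerve p} {s t r s' t' : TopSec A p}

theorem NearEq.rfl : NearEq A x s s := ⟨⊤, trivial, Eq.refl _⟩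

theorem NearEq.symm (h : NearEq A x s t) : NearEq A x t s :=
  let ⟨W, hx, h⟩ := h
  ⟨W, hx, h.symm⟩

theorem secRes_congr {W V : Opens (G.Nerve p)} (h : W ≤ V)
    (hV : secRes A (le_top : V ≤ ⊤) s = secRes A le_top t) :
    secRes A (le_top : W ≤ ⊤) s = secRes A le_top t := by
  rw [← secRes_secRes A le_top h, hV, secRes_secRes]

theorem NearEq.trans (h : NearEq A x s t) (h' : NearEq A x t r) : NearEq A x s r := by
  obtain ⟨W, hx, h⟩ := h
  obtain ⟨W', hx', h'⟩ := h'
  exact ⟨W ⊓ W', ⟨hx, hx'⟩, (secRes_congr inf_le_left h).trans (secRes_congr inf_le_right h')⟩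

theorem NearEq.add (h : NearEq A x s t) (h' : NearEq A x s' t') :
    NearEq A x (s + s') (t + t') := by
  obtain ⟨W, hx, h⟩ := h
  obtain ⟨W', hx', h'⟩ := h'
  refine ⟨W ⊓ W', ⟨hx, hx'⟩, ?_⟩
  rw [map_add, map_add, secRes_congr inf_le_left h, secRes_congr inf_le_right h']

theorem NearEq.neg (h : NearEq A x s t) : NearEq A x (-s) (-t) := by
  obtain ⟨W, hx, h⟩ := h
  exact ⟨W, hx, by rw [map_neg, map_neg, h]⟩

theorem NearEq.topMap {φ : q ⟶ p} {s t : TopSec A q} (h : NearEq A (x.map φ) s t) :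
    NearEq A x (topMap A φ s) (topMap A φ t) := by
  obtain ⟨W, hx, h⟩ := h
  exact ⟨opensMap φ W, hx, by rw [secRes_topMap, secRes_topMap, h]⟩

end NearEq

/-- The value at a point of a section of the sheaf `S¹`. -/
def circleVal {U : G.SimplicialOpen} (f : G.simplicialCircleSheaf.obj.obj (op U)) (x : U.set) :
    Circle :=
  (show circleSections U from Additive.toMul f).1 x

/-- The section of the sheaf `S¹` given by a smooth function. -/
def circleSec {U : G.SimplicialOpen} (f : circleSections U) :
    G.simplicialCircleSheaf.obj.obj (op U) :=
  (Additive.ofMul f : Additive (circleSections U))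

/-- The constant section of the sheaf `S¹`. -/
def circleConst (U : G.SimplicialOpen) (z : Circle) : G.simplicialCircleSheaf.obj.obj (op U) :=
  circleSec ⟨fun _ => z, fun _ => z, fun _ => rfl, contMDiffOn_const⟩

theorem circleVal_ext {U : G.SimplicialOpen} {f g : G.simplicialCircleSheaf.obj.obj (op U)}
    (h : ∀ x, circleVal f x = circleVal g x) : f = g :=
  Subtype.ext (a1 := (show circleSections U from f)) (funext h)

theorem circleVal_add {U : G.SimplicialOpen} (f g : G.simplicialCircleSheaf.obj.obj (op U))
    (x : U.set) : circleVal (f + g) x = circleVal f x * circleVal g x := rfl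

theorem circleVal_neg {U : G.SimplicialOpen} (f : G.simplicialCircleSheaf.obj.obj (op U))
    (x : U.set) : circleVal (-f) x = (circleVal f x)⁻¹ := rfl

theorem circleVal_secRes {V U : Opens (G.Nerve p)} (h : V ≤ U)
    (f : G.simplicialCircleSheaf.obj.obj (op ⟨p, U⟩)) (x : V) :
    circleVal (secRes _ h f) x = circleVal f ⟨x.1, h x.2⟩ := rfl

theorem circleVal_const (U : G.SimplicialOpen) (z : Circle) (x : U.set) :
    circleVal (circleConst U z) x = z := rfl

/-- The morphism `S¹ ⟶ inj` on sections. -/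
abbrev injι' {U : G.SimplicialOpen} (f : G.simplicialCircleSheaf.obj.obj (op U)) :
    G.inj.obj.obj (op U) := G.injι.hom.app (op U) f

abbrev injπ' {U : G.SimplicialOpen} (e : G.inj.obj.obj (op U)) :
    G.injQuot.obj.obj (op U) := G.injπ.hom.app (op U) e

theorem injπ'_injι' {U : G.SimplicialOpen} (f : G.simplicialCircleSheaf.obj.obj (op U)) :
    injπ' (injι' f) = 0 := by
  change (G.injι ≫ G.injπ).hom.app (op U) f = 0
  rw [injι_injπ]
  rfl

theorem exists_injι' {U : G.SimplicialOpen} (e : G.inj.obj.obj (op U)) (he : injπ' e = 0) :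
    ∃ f, injι' f = e :=
  section_exact G.inj_shortExact e he

theorem injι'_injective {U : G.SimplicialOpen} :
    Function.Injective (injι' : G.simplicialCircleSheaf.obj.obj (op U) → _) :=
  section_injective_of_mono G.injι U

/-- The sections that are near `x` a smooth function with value `1` at `x`. -/
def fibKer (x : G.Nerve p) : AddSubgroup (TopSec G.inj p) where
  carrier := {s | ∃ (W : Opens (G.Nerve p)) (hx : x ∈ W)
    (f : G.simplicialCircleSheaf.obj.obj (op ⟨p, W⟩)), circleVal f ⟨x, hx⟩ = 1 ∧
      secRes G.inj le_top s = injι' f}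
  zero_mem' := ⟨⊤, trivial, 0, rfl, by rw [map_zero, injι', map_zero]⟩
  add_mem' := by
    rintro s t ⟨W, hx, f, hf, hs⟩ ⟨W', hx', f', hf', hs'⟩
    refine ⟨W ⊓ W', ⟨hx, hx'⟩, secRes _ inf_le_left f + secRes _ inf_le_right f', ?_, ?_⟩
    · rw [circleVal_add, circleVal_secRes, circleVal_secRes, hf, hf', mul_one]
    · rw [map_add, injι', map_add, secRes_naturality, secRes_naturality]
      change _ = secRes _ _ (injι' f) + secRes _ _ (injι' f')
      rw [← hs, ← hs', secRes_secRes, secRes_secRes]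
  neg_mem' := by
    rintro s ⟨W, hx, f, hf, hs⟩
    refine ⟨W, hx, -f, ?_, ?_⟩
    · rw [circleVal_neg, hf, inv_one]
    · rw [map_neg, hs, injι', injι', map_neg]

/-- The fibre at `x` of the injective sheaf, modulo the functions with value `1`. -/
def Fib (x : G.Nerve p) : Type u := TopSec G.inj p ⧸ fibKer x

instance (x : G.Nerve p) : AddCommGroup (Fib x) :=
  inferInstanceAs (AddCommGroup (TopSec G.inj p ⧸ fibKer x))

def fibMk (x : G.Nerve p) : TopSec G.inj p →+ Fib x := QuotientAddGroup.mk' _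

theorem fibMk_surjective (x : G.Nerve p) : Function.Surjective (fibMk x) :=
  QuotientAddGroup.mk'_surjective _

theorem fibMk_eq_zero {x : G.Nerve p} {s : TopSec G.inj p} : fibMk x s = 0 ↔ s ∈ fibKer x :=
  QuotientAddGroup.eq_zero_iff s

theorem fibMk_congr {x : G.Nerve p} {s t : TopSec G.inj p} (h : NearEq G.inj x s t) :
    fibMk x s = fibMk x t := by
  obtain ⟨W, hx, h⟩ := h
  rw [← sub_eq_zero, ← map_sub, fibMk_eq_zero]
  exact ⟨W, hx, 0, rfl, by rw [map_sub, h, sub_self, injι', map_zero]⟩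

/-- The embedding of the circle in the fibre. -/
def fibι (x : G.Nerve p) (z : Circle) : Fib x := fibMk x (injι' (circleConst ⟨p, ⊤⟩ z))

theorem circleConst_mul (U : G.SimplicialOpen) (z w : Circle) :
    circleConst U (z * w) = circleConst U z + circleConst U w := rfl

theorem fibι_mul (x : G.Nerve p) (z w : Circle) : fibι x (z * w) = fibι x z + fibι x w := by
  rw [fibι, circleConst_mul, injι', map_add, map_add]
  rfl

theorem fibι_one (x : G.Nerve p) : fibι x 1 = 0 := by
  have := fibι_mul x 1 1
  rw [mul_one] at this
  simpa using this

theorem fibι_inv (x : G.Nerve p) (z : Circle) : fibι x z⁻¹ = -fibι x z := by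
  have := fibι_mul x z⁻¹ z
  rw [inv_mul_cancel, fibι_one] at this
  exact eq_neg_of_add_eq_zero_left this.symm

theorem secRes_circleConst {V U : Opens (G.Nerve p)} (h : V ≤ U) (z : Circle) :
    secRes G.simplicialCircleSheaf h (circleConst ⟨p, U⟩ z) = circleConst ⟨p, V⟩ z := rfl

/-- If the constant `z` agrees in `inj` with a smooth function of value `1` at `x`, then they agree
as functions because `injι` is injective on sections; evaluation at `x` gives `z = 1`. -/
theorem fibι_eq_zero {x : G.Nerve p} {z : Circle} (h : fibι x z = 0) : z = 1 := by
  obtain ⟨W, hx, f, hf, hs⟩ := fibMk_eq_zero.1 h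
  rw [injι', ← secRes_naturality, secRes_circleConst] at hs
  rw [← hf, ← injι'_injective hs]
  rfl

theorem fibι_injective (x : G.Nerve p) : Function.Injective (fibι x) := by
  intro z w h
  have h1 : fibι x (z * w⁻¹) = 0 := by rw [fibι_mul, fibι_inv, h, add_neg_cancel]
  exact mul_inv_eq_one.1 (fibι_eq_zero h1)

/-- A smooth function divided by its value at `x` has value `1` there and is killed in the fibre.
Hence only the value at `x` is visible in `Fib x`. -/
theorem fibMk_eq_of_secRes {W : Opens (G.Nerve p)} {x : G.Nerve p} (hx : x ∈ W)
    {e e' : TopSec G.inj p} {f : G.simplicialCircleSheaf.obj.obj (op ⟨p, W⟩)}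
    (h : secRes G.inj le_top e = injι' f + secRes G.inj le_top e') :
    fibMk x e = fibι x (circleVal f ⟨x, hx⟩) + fibMk x e' := by
  rw [fibι, ← map_add, ← sub_eq_zero, ← map_sub, fibMk_eq_zero]
  refine ⟨W, hx, f - circleConst _ (circleVal f ⟨x, hx⟩), ?_, ?_⟩
  · rw [sub_eq_add_neg, circleVal_add, circleVal_neg, circleVal_const, mul_inv_cancel]
  · rw [map_sub, map_add, h, injι', injι', injι', map_sub, ← secRes_naturality, secRes_circleConst]
    abel

/-- Sections with the same image in the quotient near a point differ by a smooth function. -/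
theorem NearEq.exists_circle {x : G.Nerve p} {e e' : TopSec G.inj p}
    (h : NearEq G.injQuot x (injπ' e) (injπ' e')) :
    ∃ (W : Opens (G.Nerve p)) (f : G.simplicialCircleSheaf.obj.obj (op ⟨p, W⟩)), x ∈ W ∧
      secRes G.inj le_top e = injι' f + secRes G.inj le_top e' := by
  obtain ⟨W, hx, h⟩ := h
  obtain ⟨f, hf⟩ := exists_injι' (secRes G.inj (le_top : W ≤ ⊤) (e - e')) (by
    rw [injπ', secRes_naturality, map_sub, map_sub, h, sub_self])
  refine ⟨W, f, hx, ?_⟩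
  rw [hf, map_sub, sub_add_cancel]

/-- The inclusion of an open subset is a monomorphism of the site. -/
instance {V U : Opens (G.Nerve p)} (h : V ≤ U) : Mono (SimplicialOpen.incl h) :=
  ⟨fun _ _ e => SimplicialOpen.Hom.ext ((Category.id_comp _).symm.trans
    ((congrArg SimplicialOpen.Hom.operator e).trans (Category.id_comp _)))⟩

/-- Flasqueness of injective sheaves. This is why `Fib x` can be a quotient of global sections
rather than of germs. -/
theorem exists_secRes_eq {U : Opens (G.Nerve p)} (s : G.inj.obj.obj (op ⟨p, U⟩)) :
    ∃ e : TopSec G.inj p, secRes G.inj le_top e = s :=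
  injective_section_surjective G.inj (SimplicialOpen.incl le_top) s

/-- A lift exists locally and is then extended arbitrarily; only near `x` does the extension still
lift `c`. -/
theorem exists_nearEq_lift (x : G.Nerve p) (c : TopSec G.injQuot p) :
    ∃ e : TopSec G.inj p, NearEq G.injQuot x (injπ' e) c := by
  obtain ⟨W, hW, hxW, s, hs⟩ := section_locally_lifts G.injπ c x trivial
  obtain ⟨e, rfl⟩ := exists_secRes_eq s
  refine ⟨e, W, hxW, ?_⟩
  rw [← secRes_naturality]
  exact hs

/-- The value of a section in the fibre. -/
def fibEv {U : Opens (G.Nerve p)} (x : G.Nerve p) (s : G.inj.obj.obj (op ⟨p, U⟩)) : Fib x :=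
  fibMk x (exists_secRes_eq s).choose

theorem fibEv_eq {U V : Opens (G.Nerve p)} {x : G.Nerve p} (hx : x ∈ V) (hV : V ≤ U)
    {s : G.inj.obj.obj (op ⟨p, U⟩)} {e : TopSec G.inj p}
    (h : secRes G.inj le_top e = secRes G.inj hV s) : fibEv x s = fibMk x e := by
  refine fibMk_congr ⟨V, hx, ?_⟩
  rw [h, ← secRes_secRes G.inj le_top hV, (exists_secRes_eq s).choose_spec]

theorem fibEv_secRes {U V : Opens (G.Nerve p)} {x : G.Nerve p} (hx : x ∈ V) (hV : V ≤ U)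
    (s : G.inj.obj.obj (op ⟨p, U⟩)) : fibEv x (secRes G.inj hV s) = fibEv x s := by
  obtain ⟨e, rfl⟩ := exists_secRes_eq s
  rw [fibEv_eq hx le_rfl (e := e), fibEv_eq (hV hx) le_rfl (e := e)]
  · rw [secRes_secRes]
  · rw [secRes_secRes, secRes_secRes]

theorem fibEv_secRes_top {U : Opens (G.Nerve p)} {x : G.Nerve p} (hx : x ∈ U)
    (e : TopSec G.inj p) : fibEv x (secRes G.inj (le_top : U ≤ ⊤) e) = fibMk x e :=
  fibEv_eq hx le_rfl (by rw [secRes_secRes])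

theorem fibEv_add {U : Opens (G.Nerve p)} {x : G.Nerve p} (hx : x ∈ U)
    (s t : G.inj.obj.obj (op ⟨p, U⟩)) : fibEv x (s + t) = fibEv x s + fibEv x t := by
  obtain ⟨e, rfl⟩ := exists_secRes_eq s
  obtain ⟨e', rfl⟩ := exists_secRes_eq t
  rw [← map_add, fibEv_secRes_top hx, fibEv_secRes_top hx, fibEv_secRes_top hx, map_add]

theorem fibEv_injι' {U : Opens (G.Nerve p)} {x : G.Nerve p} (hx : x ∈ U)
    (f : G.simplicialCircleSheaf.obj.obj (op ⟨p, U⟩)) :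
    fibEv x (injι' f) = fibι x (circleVal f ⟨x, hx⟩) := by
  obtain ⟨e, he⟩ := exists_secRes_eq (injι' f)
  rw [← he, fibEv_secRes_top hx, fibMk_eq_of_secRes hx (e' := 0) (f := f), map_zero, add_zero]
  rw [he, map_zero, add_zero]

/-- A section is determined by its image in the quotient and its values. -/
theorem fibEv_ext {U : Opens (G.Nerve p)} {s t : G.inj.obj.obj (op ⟨p, U⟩)}
    (hq : injπ' s = injπ' t) (h : ∀ x ∈ U, fibEv x s = fibEv x t) : s = t := by
  obtain ⟨f, hf⟩ := exists_injι' (s - t) (by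
    rw [injπ', map_sub]
    exact sub_eq_zero.2 hq)
  have h1 : s = injι' f + t := by rw [hf, sub_add_cancel]
  have h2 : f = 0 := by
    refine circleVal_ext fun x => ?_
    have h3 := h x.1 x.2
    rw [h1, fibEv_add x.2, fibEv_injι' x.2, add_eq_right] at h3
    exact fibι_eq_zero h3
  rw [h1, h2, injι', map_zero, zero_add]

/-- A family of elements of the fibres that is locally given by lifts of `c` is given by a lift
of `c`. -/
theorem exists_fibEv_eq (U : Opens (G.Nerve p)) (c : G.injQuot.obj.obj (op ⟨p, U⟩))
    (t : ∀ x : G.Nerve p, Fib x)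
    (h : ∀ x ∈ U, ∃ (V : Opens (G.Nerve p)) (hV : V ≤ U) (s : G.inj.obj.obj (op ⟨p, V⟩)), x ∈ V ∧
      injπ' s = secRes _ hV c ∧ ∀ y ∈ V, t y = fibEv y s) :
    ∃ s : G.inj.obj.obj (op ⟨p, U⟩), injπ' s = c ∧ ∀ y ∈ U, t y = fibEv y s := by
  -- Image in the quotient and values in the fibres determine a section by `fibEv_ext`, so the
  -- prescribed local lifts glue.
  obtain ⟨s, hs⟩ := exists_glue G.inj U
    (fun V s => ∃ hV : V ≤ U, injπ' s = secRes _ hV c ∧ ∀ y ∈ V, t y = fibEv y s)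
    (fun V W h s hs => ⟨h.trans hs.1, by
        rw [injπ', secRes_naturality]
        change secRes _ _ (injπ' s) = _
        rw [hs.2.1, secRes_secRes],
      fun y hy => by rw [fibEv_secRes hy, hs.2.2 y (h hy)]⟩)
    (fun V s s' hV hs hs' => fibEv_ext (hs.2.1.trans hs'.2.1.symm)
      fun x hx => (hs.2.2 x hx).symm.trans (hs'.2.2 x hx))
    (fun x hx => by
      obtain ⟨V, hV, s, hxV, h1, h2⟩ := h x hx
      exact ⟨V, hV, hxV, s, hV, h1, h2⟩)
  refine ⟨s, secRes_ext _ fun x hx => ?_, fun y hy => ?_⟩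
  · obtain ⟨V, hV, s', hxV, h1, h2⟩ := h x hx
    refine ⟨V, hV, hxV, ?_⟩
    rw [← secRes_naturality, hs V hV s' ⟨hV, h1, h2⟩, ← h1]
  · obtain ⟨V, hV, s', hxV, h1, h2⟩ := h y hy
    rw [← fibEv_secRes hxV hV s, hs V hV s' ⟨hV, h1, h2⟩, h2 y hxV]

/-- The map on fibres given by a simplicial operator. -/
def fibPull (φ : q ⟶ p) (x : G.Nerve p) : Fib (x.map φ) →+ Fib x :=
  QuotientAddGroup.map _ _ (topMap G.inj φ) (by
    rintro s ⟨W, hx, f, hf, hs⟩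
    refine ⟨opensMap φ W, hx, G.simplicialCircleSheaf.obj.map (overHom φ W).op f, hf, ?_⟩
    rw [secRes_topMap, hs]
    exact (section_naturality G.injι.hom _ f).symm)

theorem fibPull_mk (φ : q ⟶ p) (x : G.Nerve p) (s : TopSec G.inj q) :
    fibPull φ x (fibMk _ s) = fibMk x (topMap G.inj φ s) := rfl

theorem fibPull_ι (φ : q ⟶ p) (x : G.Nerve p) (z : Circle) :
    fibPull φ x (fibι _ z) = fibι x z := by
  rw [fibι, fibPull_mk, ← topMap_naturality]
  rfl

theorem fibPull_fibPull {r : SimplexCategory} (φ : q ⟶ p) (ψ : r ⟶ q) (x : G.Nerve p)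
    (t : Fib ((x.map φ).map ψ)) : fibPull φ x (fibPull ψ (x.map φ) t) = fibPull (ψ ≫ φ) x t := by
  obtain ⟨s, rfl⟩ := fibMk_surjective _ t
  exact congrArg (fibMk x) (section_map_comp G.inj.obj (topHom ψ) (topHom φ) s)

/-! ### The fibres under a morphism of Lie groupoids -/

variable {G' : LieGroupoid.{u}} (φ : Hom G' G)

namespace Hom

/-- The map on sections of the injective sheaves induced by a morphism of Lie groupoids. -/
def topInj : TopSec G.inj p →+ TopSec G'.inj p :=
  (G'.inj.obj.map (φ.enlargeHom ⟨p, ⊤⟩).op).hom.comp (φ.pushInj.hom.app (op ⟨p, ⊤⟩)).hom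

def topQuot : TopSec G.injQuot p →+ TopSec G'.injQuot p :=
  (G'.injQuot.obj.map (φ.enlargeHom ⟨p, ⊤⟩).op).hom.comp (φ.pushQuot.hom.app (op ⟨p, ⊤⟩)).hom

theorem injπ'_topInj (s : TopSec G.inj p) : injπ' (φ.topInj s) = φ.topQuot (injπ' s) :=
  (section_naturality G'.injπ.hom (φ.enlargeHom ⟨p, ⊤⟩) _).trans
    (congrArg _ (φ.pushQuot_injπ s).symm)

/-- The preimage of an open subset under a morphism of Lie groupoids. -/
def opensMap (W : Opens (G.Nerve p)) : Opens (G'.Nerve p) := W.comap ⟨_, φ.continuous_nerveMap⟩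

theorem secRes_topInj (W : Opens (G.Nerve p)) (s : TopSec G.inj p) :
    secRes G'.inj (le_top : φ.opensMap W ≤ ⊤) (φ.topInj s) =
      φ.pushInj.hom.app (op ⟨p, W⟩) (secRes G.inj le_top s) := by
  refine (section_map_comp G'.inj.obj (φ.enlargeHom ⟨p, ⊤⟩) (SimplicialOpen.incl le_top) _).trans ?_
  exact (section_naturality φ.pushInj.hom (SimplicialOpen.incl le_top) s).symm

theorem secRes_topQuot (W : Opens (G.Nerve p)) (s : TopSec G.injQuot p) :
    secRes G'.injQuot (le_top : φ.opensMap W ≤ ⊤) (φ.topQuot s) =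
      φ.pushQuot.hom.app (op ⟨p, W⟩) (secRes G.injQuot le_top s) := by
  refine (section_map_comp G'.injQuot.obj (φ.enlargeHom ⟨p, ⊤⟩) (SimplicialOpen.incl le_top)
    _).trans ?_
  exact (section_naturality φ.pushQuot.hom (SimplicialOpen.incl le_top) s).symm

theorem nearEq_topQuot {x : G'.Nerve p} {s t : TopSec G.injQuot p}
    (h : NearEq G.injQuot (φ.nerveMap x) s t) : NearEq G'.injQuot x (φ.topQuot s) (φ.topQuot t) := by
  obtain ⟨W, hx, h⟩ := h
  exact ⟨φ.opensMap W, hx, by rw [secRes_topQuot, secRes_topQuot, h]⟩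

/-- The map on fibres induced by a morphism of Lie groupoids. -/
def fibMap (x : G'.Nerve p) : Fib (φ.nerveMap x) →+ Fib x :=
  QuotientAddGroup.map _ _ φ.topInj (by
    rintro s ⟨W, hx, f, hf, hs⟩
    refine ⟨φ.opensMap W, hx, φ.pullbackCircle.hom.app (op ⟨p, W⟩) f, hf, ?_⟩
    rw [secRes_topInj, hs]
    exact φ.pushInj_injι f)

theorem fibMap_mk (x : G'.Nerve p) (s : TopSec G.inj p) :
    φ.fibMap x (fibMk _ s) = fibMk x (φ.topInj s) := rfl

theorem topInj_injι' (f : G.simplicialCircleSheaf.obj.obj (op ⟨p, ⊤⟩)) :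
    φ.topInj (injι' f) = injι' (G'.simplicialCircleSheaf.obj.map (φ.enlargeHom ⟨p, ⊤⟩).op
      (φ.pullbackCircle.hom.app (op ⟨p, ⊤⟩) f)) :=
  (congrArg _ (φ.pushInj_injι f)).trans (section_naturality G'.injι.hom _ _).symm

theorem fibMap_ι (x : G'.Nerve p) (z : Circle) : φ.fibMap x (fibι _ z) = fibι x z := by
  rw [fibι, fibMap_mk, topInj_injι']
  rfl

theorem topInj_topMap (ψ : q ⟶ p) (s : TopSec G.inj q) :
    φ.topInj (topMap G.inj ψ s) = topMap G'.inj ψ (φ.topInj s) := by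
  refine (congrArg _ (section_naturality φ.pushInj.hom (topHom ψ) s)).trans ?_
  refine (section_map_comp G'.inj.obj _ (φ.enlargeHom ⟨p, ⊤⟩) _).trans ?_
  exact (section_map_comp G'.inj.obj (φ.enlargeHom ⟨q, ⊤⟩) (topHom ψ) _).symm

theorem fibMap_fibPull (ψ : q ⟶ p) (x : G'.Nerve p) (t : Fib ((φ.nerveMap x).map ψ)) :
    φ.fibMap x (fibPull ψ (φ.nerveMap x) t) = fibPull ψ x (φ.fibMap (x.map ψ) t) := by
  obtain ⟨s, rfl⟩ := fibMk_surjective _ t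
  exact congrArg (fibMk x) (φ.topInj_topMap ψ s)

end Hom

end LieGroupoid

end

noncomputable section

/-! ### Circle bundles -/

namespace CircleBundle

variable {n : ℕ} {B : Type u} [TopologicalSpace B] [ChartedSpace (EuclideanSpace ℝ (Fin n)) B]
  (P : CircleBundle (n := n) B)
  {EX HX X : Type*} [NormedAddCommGroup EX] [NormedSpace ℝ EX] [TopologicalSpace HX]
  {IX : ModelWithCorners ℝ EX HX} [TopologicalSpace X] [ChartedSpace HX X]

theorem exists_proj_eq (b : B) : ∃ r, P.proj r = b := by
  obtain ⟨U, e, hb, hs, ht, h1, -, -, -⟩ := P.locally_trivial b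
  have hm : (b, (1 : Circle)) ∈ e.target := by rw [ht]; exact ⟨hb, trivial⟩
  exact ⟨e.symm (b, 1), by rw [← h1 _ (e.map_target hm), e.right_inv hm]⟩

variable {P}

theorem exists_smul_eq {r s : P.total} (h : P.proj r = P.proj s) : ∃ z : Circle, z • s = r := by
  obtain ⟨U, e, hb, hs, ht, h1, h2, -, -⟩ := P.locally_trivial (P.proj s)
  have hsm : s ∈ e.source := by rw [hs]; exact hb
  have hrm : r ∈ e.source := by rw [hs, Set.mem_preimage, h]; exact hb
  have hzm : ∀ z : Circle, z • s ∈ e.source := fun z => by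
    rw [hs, Set.mem_preimage, P.proj_smul]; exact hb
  refine ⟨(e r).2 * (e s).2⁻¹, e.injOn (hzm _) hrm (Prod.ext ?_ ?_)⟩
  · rw [h1 _ (hzm _), h1 _ hrm, P.proj_smul, h]
  · rw [h2 _ _ hsm, inv_mul_cancel_right]

theorem smul_right_cancel {z w : Circle} {r : P.total} (h : z • r = w • r) : z = w := by
  obtain ⟨U, e, hb, hs, ht, h1, h2, -, -⟩ := P.locally_trivial (P.proj r)
  have hr : r ∈ e.source := by rw [hs]; exact hb
  have := congrArg (fun s => (e s).2) h
  simp only [h2 _ _ hr] at this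
  exact mul_right_cancel this

theorem exists_localSection (r : P.total) : ∃ (U : Opens B) (σ : B → P.total), P.proj r ∈ U ∧
    ContMDiffOn (𝓡 n) ((𝓡 n).prod (𝓡 1)) ∞ σ U ∧ (∀ b ∈ U, P.proj (σ b) = b) ∧
      σ (P.proj r) = r := by
  obtain ⟨U, e, hb, hs, ht, h1, h2, -, h4⟩ := P.locally_trivial (P.proj r)
  have hm : ∀ b ∈ U, (b, (e r).2) ∈ e.target := fun b hb => by rw [ht]; exact ⟨hb, trivial⟩
  have hr : r ∈ e.source := by rw [hs]; exact hb
  refine ⟨U, fun b => e.symm (b, (e r).2), hb, ?_, fun b hb => ?_, ?_⟩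
  · exact h4.comp (contMDiff_id.prodMk contMDiff_const).contMDiffOn hm
  · rw [← h1 _ (e.map_target (hm b hb)), e.right_inv (hm b hb)]
  · have : (P.proj r, (e r).2) = e r := Prod.ext (h1 r hr).symm rfl
    change e.symm (P.proj r, (e r).2) = r
    rw [this, e.left_inv hr]

theorem contMDiffWithinAt_smul {z : X → Circle} {F : X → P.total} {D : Set X} {d : X}
    (hz : ContMDiffWithinAt IX (𝓡 1) ∞ z D d)
    (hF : ContMDiffWithinAt IX ((𝓡 n).prod (𝓡 1)) ∞ F D d) :
    ContMDiffWithinAt IX ((𝓡 n).prod (𝓡 1)) ∞ (fun d => z d • F d) D d :=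
  (P.contMDiff_smul (z d, F d)).comp_contMDiffWithinAt d (hz.prodMk hF)

/-- Two smooth maps with the same projection differ by a smooth function. -/
theorem exists_smooth_div {F F' : X → P.total} {D : Set X} {d : X}
    (hF : ContMDiffWithinAt IX ((𝓡 n).prod (𝓡 1)) ∞ F D d)
    (hF' : ContMDiffWithinAt IX ((𝓡 n).prod (𝓡 1)) ∞ F' D d)
    (h : ∀ᶠ x in nhdsWithin d D, P.proj (F x) = P.proj (F' x)) (hd : d ∈ D) :
    ∃ z : X → Circle, ContMDiffWithinAt IX (𝓡 1) ∞ z D d ∧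
      ∀ᶠ x in nhdsWithin d D, F x = z x • F' x := by
  obtain ⟨U, e, hb, hs, ht, h1, h2, h3, -⟩ := P.locally_trivial (P.proj (F' d))
  have hopen : e.source ∈ nhds (F' d) := e.open_source.mem_nhds (by rw [hs]; exact hb)
  have hbF : F d ∈ e.source := by
    rw [hs, Set.mem_preimage, h.self_of_nhdsWithin hd]; exact hb
  have hopen' : e.source ∈ nhds (F d) := e.open_source.mem_nhds hbF
  have key : ∀ {K : X → P.total}, ContMDiffWithinAt IX ((𝓡 n).prod (𝓡 1)) ∞ K D d →
      e.source ∈ nhds (K d) → ContMDiffWithinAt IX (𝓡 1) ∞ (fun x => (e (K x)).2) D d := by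
    intro K hK hm
    have h5 := (h3.contMDiffAt hm).comp_contMDiffWithinAt d hK
    exact contMDiffAt_snd.comp_contMDiffWithinAt d h5
  -- The quotient of the fibre coordinates in one trivialization; near `d` both maps take values in
  -- its domain.
  refine ⟨fun x => (e (F x)).2 * (e (F' x)).2⁻¹, (key hF hopen').mul (key hF' hopen).inv, ?_⟩
  filter_upwards [h, hF'.continuousWithinAt.preimage_mem_nhdsWithin hopen,
    hF.continuousWithinAt.preimage_mem_nhdsWithin hopen'] with x hx hx' hx''
  refine e.injOn hx'' ?_ (Prod.ext ?_ ?_)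
  · rw [hs, Set.mem_preimage, P.proj_smul]
    rw [Set.mem_preimage, hs, Set.mem_preimage] at hx'
    exact hx'
  · rw [h1 _ hx'', h1, P.proj_smul, hx]
    rw [hs, Set.mem_preimage, P.proj_smul]
    rw [Set.mem_preimage, hs, Set.mem_preimage] at hx'
    exact hx'
  · rw [h2 _ _ hx', inv_mul_cancel_right]

end CircleBundle

/-! ### Smooth families of elements of the fibres -/

namespace LieGroupoid

variable {G G' : LieGroupoid.{u}} {p q : SimplexCategory}
  {EX HX X : Type*} [NormedAddCommGroup EX] [NormedSpace ℝ EX] [TopologicalSpace HX]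
  {IX : ModelWithCorners ℝ EX HX} [TopologicalSpace X] [ChartedSpace HX X]
  {D : Set X} {y : X → G.Nerve p} {d : X}

section

variable (IX D)

/-- Smoothness of a map into `Γ_p` on a subset. -/
def SmoothInto (y : X → G.Nerve p) : Prop :=
  ContMDiffOn IX (G.pairsModel p) ∞ (fun d => (y d).arrow) D

/-- The family `t` of elements of fibres is smooth at `d` in the following sense: it is near `d`
the product of a smooth function and a lift of the section `c`. -/
def SmoothVal (y : X → G.Nerve p) (t : ∀ d, Fib (y d)) (c : TopSec G.injQuot p) (d : X) : Prop :=
  ∃ z : X → Circle, ContMDiffWithinAt IX (𝓡 1) ∞ z D d ∧ ∃ e : TopSec G.inj p,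
    NearEq G.injQuot (y d) (injπ' e) c ∧
      ∀ᶠ x in nhdsWithin d D, t x = fibι (y x) (z x) + fibMk (y x) e

end

theorem SmoothInto.of_components (h : ∀ ij, ContMDiffOn IX (𝓡 G.n) ∞ (fun d => (y d).arrow ij) D) :
    SmoothInto IX D y :=
  fun x hx => contMDiffWithinAt_piManifold fun ij => h ij x hx

theorem SmoothInto.continuousWithinAt (h : SmoothInto IX D y) (hd : d ∈ D) :
    ContinuousWithinAt y D d :=
  (Topology.IsInducing.mk rfl : Topology.IsInducing
    (Nerve.arrow : G.Nerve p → _)).continuousWithinAt_iff.2 (h d hd).continuousWithinAt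

/-- Smoothness on `Γ_p` means smoothness of an ambient function on a subset, so one composes after
shrinking `D` to the preimage of `W`, which by continuity is a neighbourhood of `d` within `D`. -/
theorem SmoothInto.comp_smooth (h : SmoothInto IX D y) (hd : d ∈ D) {E H N : Type*}
    [NormedAddCommGroup E] [NormedSpace ℝ E] [TopologicalSpace H] {J : ModelWithCorners ℝ E H}
    [TopologicalSpace N] [ChartedSpace H N] {W : Opens (G.Nerve p)} (hW : y d ∈ W)
    {g : (Pairs p → G.Γ) → N}
    (hg : ContMDiffOn (G.pairsModel p) J ∞ g {a | ∃ x ∈ W, x.arrow = a}) :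
    ContMDiffWithinAt IX J ∞ (fun d => g (y d).arrow) D d := by
  have h1 : y ⁻¹' W ∈ nhdsWithin d D :=
    (h.continuousWithinAt hd).preimage_mem_nhdsWithin (W.isOpen.mem_nhds hW)
  refine ContMDiffWithinAt.mono_of_mem_nhdsWithin (s := D ∩ y ⁻¹' W) ?_
    (Filter.inter_mem self_mem_nhdsWithin h1)
  have h2 : ContMDiffWithinAt (G.pairsModel p) J ∞ g {a | ∃ x ∈ W, x.arrow = a} (y d).arrow :=
    hg _ ⟨_, hW, rfl⟩
  refine h2.comp d ((h d hd).mono Set.inter_subset_left) ?_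
  rintro x ⟨-, hx⟩
  exact ⟨_, hx, rfl⟩

section SmoothVal

variable {t t' : ∀ d, Fib (y d)} {c c' : TopSec G.injQuot p}

theorem SmoothVal.congr (h : SmoothVal IX D y t c d)
    (ht : ∀ᶠ x in nhdsWithin d D, t' x = t x) : SmoothVal IX D y t' c d := by
  obtain ⟨z, hz, e, he, h⟩ := h
  exact ⟨z, hz, e, he, by filter_upwards [h, ht] with x h1 h2 using h2.trans h1⟩

theorem SmoothVal.add (h : SmoothVal IX D y t c d) (h' : SmoothVal IX D y t' c' d) :
    SmoothVal IX D y (fun x => t x + t' x) (c + c') d := by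
  obtain ⟨z, hz, e, he, h⟩ := h
  obtain ⟨z', hz', e', he', h'⟩ := h'
  refine ⟨fun x => z x * z' x, hz.mul hz', e + e', ?_, ?_⟩
  · rw [injπ', map_add]
    exact he.add he'
  · filter_upwards [h, h'] with x h1 h2
    rw [h1, h2, fibι_mul, map_add]
    abel

theorem SmoothVal.neg (h : SmoothVal IX D y t c d) :
    SmoothVal IX D y (fun x => -t x) (-c) d := by
  obtain ⟨z, hz, e, he, h⟩ := h
  refine ⟨fun x => (z x)⁻¹, hz.inv, -e, ?_, ?_⟩
  · rw [injπ', map_neg]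
    exact he.neg
  · filter_upwards [h] with x h1
    rw [h1, fibι_inv, map_neg, neg_add]

theorem SmoothVal.sub (h : SmoothVal IX D y t c d) (h' : SmoothVal IX D y t' c' d) :
    SmoothVal IX D y (fun x => t x - t' x) (c - c') d := by
  simp only [sub_eq_add_neg]
  exact h.add h'.neg

/-- The two lifts of `c` near `y d` differ by a smooth function on an open subset of `Γ_p`, and its
pullback along `y` is smooth. This is the counterpart for families of lifts of
`CircleBundle.exists_smooth_div`. -/
theorem SmoothVal.exists_eq_add (hy : SmoothInto IX D y) (hd : d ∈ D)
    (h : SmoothVal IX D y t c d) (h' : SmoothVal IX D y t' c d) :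
    ∃ z : X → Circle, ContMDiffWithinAt IX (𝓡 1) ∞ z D d ∧
      ∀ᶠ x in nhdsWithin d D, t x = fibι (y x) (z x) + t' x := by
  obtain ⟨z, hz, e, he, h⟩ := h
  obtain ⟨z', hz', e', he', h'⟩ := h'
  obtain ⟨W, f, hW, hf⟩ := (he.trans he'.symm).exists_circle
  obtain ⟨g, hg, hs⟩ := (show circleSections ⟨p, W⟩ from Additive.toMul f).2
  refine ⟨fun x => z x * g (y x).arrow * (z' x)⁻¹,
    (hz.mul (hy.comp_smooth hd hW hs)).mul hz'.inv, ?_⟩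
  filter_upwards [h, h',
    (hy.continuousWithinAt hd).preimage_mem_nhdsWithin (W.isOpen.mem_nhds hW)] with x h1 h2 h3
  have h4 : circleVal f ⟨y x, h3⟩ = g (y x).arrow := (hg ⟨y x, h3⟩).symm
  rw [h1, h2, fibMk_eq_of_secRes h3 hf, h4, fibι_mul, fibι_mul, fibι_inv]
  abel

end SmoothVal

/-! ### Potentials -/

section Potential

variable {n : ℕ} {B : Type u} [TopologicalSpace B] [ChartedSpace (EuclideanSpace ℝ (Fin n)) B]
  {P : CircleBundle (n := n) B} {f : G.Nerve p → B} {c : TopSec G.injQuot p}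
  {w : ∀ x : G.Nerve p, P.total → Fib x}

variable (P f c w) in
/-- The maps `w x`, defined on the fibre of `P` over `f x`, identify the pullback of `P` along `f`
with the torsor of lifts of `c`. -/
structure IsPotential : Prop where
  smul : ∀ x (z : Circle) r, P.proj r = f x → w x (z • r) = fibι x z + w x r
  smooth : ∀ x, ∃ (W : Opens (G.Nerve p)) (g : (Pairs p → G.Γ) → P.total) (e : TopSec G.inj p),
    x ∈ W ∧ ContMDiffOn (G.pairsModel p) ((𝓡 n).prod (𝓡 1)) ∞ g {a | ∃ x ∈ W, x.arrow = a} ∧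
      (∀ x ∈ W, P.proj (g x.arrow) = f x) ∧ NearEq G.injQuot x (injπ' e) c ∧
        ∀ x ∈ W, w x (g x.arrow) = fibMk x e

namespace IsPotential

/-- The circle acts transitively on the fibre of `P` and freely on the fibre `Fib x`. -/
theorem injective (h : IsPotential P f c w) {x : G.Nerve p} {r s : P.total} (hr : P.proj r = f x)
    (hs : P.proj s = f x) (hw : w x r = w x s) : r = s := by
  obtain ⟨z, rfl⟩ := CircleBundle.exists_smul_eq (hr.trans hs.symm)
  rw [h.smul _ _ _ hs, add_eq_right] at hw
  rw [fibι_eq_zero hw, one_smul]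

/-- A lift differs from the lift attached to the reference section `g` by a smooth function, and
acting by its value at `x` moves `g` to the required point. -/
theorem exists_eq_fibMk (h : IsPotential P f c w) {x : G.Nerve p} {e : TopSec G.inj p}
    (he : NearEq G.injQuot x (injπ' e) c) : ∃ r, P.proj r = f x ∧ w x r = fibMk x e := by
  obtain ⟨W, g, e', hx, -, h2, h3, h4⟩ := h.smooth x
  obtain ⟨W', k, hx', hk⟩ := (he.trans h3.symm).exists_circle
  refine ⟨circleVal k ⟨x, hx'⟩ • g x.arrow, ?_, ?_⟩
  · rw [P.proj_smul, h2 x hx]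
  · rw [h.smul _ _ _ (h2 x hx), h4 x hx, fibMk_eq_of_secRes hx' hk]

/-- A smooth map into `P` is locally a smooth function times the reference section, which the
potential turns into a smooth multiple of a fixed lift. -/
theorem smoothVal (h : IsPotential P f c w) (hy : SmoothInto IX D y) (hd : d ∈ D)
    {F : X → P.total} (hF : ContMDiffWithinAt IX ((𝓡 n).prod (𝓡 1)) ∞ F D d)
    (hFf : ∀ x ∈ D, P.proj (F x) = f (y x)) :
    SmoothVal IX D y (fun x => w (y x) (F x)) c d := by
  obtain ⟨W, g, e, hx, h1, h2, h3, h4⟩ := h.smooth (y d)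
  have hm := (hy.continuousWithinAt hd).preimage_mem_nhdsWithin (W.isOpen.mem_nhds hx)
  obtain ⟨z, hz, hzF⟩ := CircleBundle.exists_smooth_div hF (hy.comp_smooth hd hx h1) (by
    filter_upwards [hm, self_mem_nhdsWithin] with x hx hxD
    rw [hFf x hxD, h2 _ hx]) hd
  refine ⟨z, hz, e, h3, ?_⟩
  filter_upwards [hm, hzF] with x hx hxz
  rw [hxz, h.smul _ _ _ (h2 _ hx), h4 _ hx]

/-- Converse of `smoothVal`: the smooth ratio of the two families of lifts is, by injectivity of the
potential, also the ratio of `F` to the smooth reference section. -/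
theorem contMDiffWithinAt (h : IsPotential P f c w) (hy : SmoothInto IX D y) (hd : d ∈ D)
    {F : X → P.total} (hFf : ∀ x ∈ D, P.proj (F x) = f (y x))
    (hF : SmoothVal IX D y (fun x => w (y x) (F x)) c d) :
    ContMDiffWithinAt IX ((𝓡 n).prod (𝓡 1)) ∞ F D d := by
  obtain ⟨W, g, e, hx, h1, h2, h3, h4⟩ := h.smooth (y d)
  have hm := (hy.continuousWithinAt hd).preimage_mem_nhdsWithin (W.isOpen.mem_nhds hx)
  have hg := hy.comp_smooth hd hx h1
  have hv : SmoothVal IX D y (fun x => w (y x) (g (y x).arrow)) c d := by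
    refine ⟨fun _ => 1, contMDiffWithinAt_const, e, h3, ?_⟩
    filter_upwards [hm] with x hx
    rw [h4 _ hx, fibι_one, zero_add]
  obtain ⟨z, hz, hzF⟩ := hF.exists_eq_add hy hd hv
  have h5 : ∀ᶠ x in nhdsWithin d D, F x = z x • g (y x).arrow := by
    filter_upwards [hm, hzF, self_mem_nhdsWithin] with x hx hxz hxD
    refine h.injective (hFf x hxD) (by rw [P.proj_smul, h2 _ hx]) ?_
    rw [hxz, h.smul _ _ _ (h2 _ hx)]
  exact (CircleBundle.contMDiffWithinAt_smul hz hg).congr_of_eventuallyEq h5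
    (h5.self_of_nhdsWithin hd)

/-- Smooth families of lifts of `c` define smooth maps to `P`. -/
theorem exists_lift (h : IsPotential P f c w) (hy : SmoothInto IX D y) (F₀ : X → P.total)
    {t : ∀ d, Fib (y d)} (ht : ∀ d ∈ D, SmoothVal IX D y t c d) :
    ∃ F : X → P.total, ContMDiffOn IX ((𝓡 n).prod (𝓡 1)) ∞ F D ∧
      ∀ d ∈ D, P.proj (F d) = f (y d) ∧ w (y d) (F d) = t d := by
  have h1 : ∀ d, ∃ r, d ∈ D → P.proj r = f (y d) ∧ w (y d) r = t d := by
    intro d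
    by_cases hd : d ∈ D
    · obtain ⟨z, -, e, he, hz⟩ := ht d hd
      -- Correcting `e` by the constant `z d` gives a lift of `c` whose value at `y d` is exactly `t
      -- d`.
      obtain ⟨r, hr, hr'⟩ := h.exists_eq_fibMk (x := y d) (e := injι' (circleConst _ (z d)) + e) (by
        rw [injπ', map_add]
        change NearEq _ _ (injπ' (injι' _) + _) _
        rw [injπ'_injι', zero_add]
        exact he)
      refine ⟨r, fun _ => ⟨hr, ?_⟩⟩
      rw [hr', map_add, hz.self_of_nhdsWithin hd]
      rfl
    -- Outside `D` nothing is required; `F₀` only supplies values there.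
    · exact ⟨F₀ d, fun h => absurd h hd⟩
  choose F hF using h1
  refine ⟨F, fun d hd => h.contMDiffWithinAt hy hd (fun x hx => (hF x hx).1) ?_, hF⟩
  refine (ht d hd).congr ?_
  filter_upwards [self_mem_nhdsWithin] with x hx using (hF x hx).2

theorem pull (h : IsPotential P f c w) (φ : p ⟶ q) :
    IsPotential P (fun x : G.Nerve q => f (x.map φ)) (topMap G.injQuot φ c)
      (fun x r => fibPull φ x (w (x.map φ) r)) where
  smul x z r hr := by rw [h.smul _ _ _ hr, map_add, fibPull_ι]
  smooth x := by
    obtain ⟨W, g, e, hx, h1, h2, h3, h4⟩ := h.smooth (x.map φ)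
    refine ⟨opensMap φ W, fun a => g fun k => a (φ.toOrderHom k.1, φ.toOrderHom k.2),
      topMap G.inj φ e, hx, ?_, fun x hx => h2 _ hx, ?_, fun x hx => ?_⟩
    · refine h1.comp (contMDiff_reindex (G := G)
        (fun k : Pairs p => (φ.toOrderHom k.1, φ.toOrderHom k.2))).contMDiffOn ?_
      rintro _ ⟨x, hx, rfl⟩
      exact ⟨_, hx, rfl⟩
    · rw [injπ', topMap_naturality]
      exact h3.topMap
    · exact congrArg (fibPull φ x) (h4 _ hx)

theorem fibMap (h : IsPotential P f c w) (φ : Hom G' G) :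
    IsPotential P (fun x : G'.Nerve p => f (φ.nerveMap x)) (φ.topQuot c)
      (fun x r => φ.fibMap x (w (φ.nerveMap x) r)) where
  smul x z r hr := by rw [h.smul _ _ _ hr, map_add, φ.fibMap_ι]
  smooth x := by
    obtain ⟨W, g, e, hx, h1, h2, h3, h4⟩ := h.smooth (φ.nerveMap x)
    refine ⟨φ.opensMap W, fun a => g fun k => φ.arr (a k), φ.topInj e, hx, ?_,
      fun x hx => h2 _ hx, ?_, fun x hx => ?_⟩
    · have h5 : ContMDiff (G'.pairsModel p) (G.pairsModel p) ∞
          (fun (a : Pairs p → G'.Γ) ij => φ.arr (a ij)) := fun a =>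
        contMDiffWithinAt_piManifold fun ij =>
          (φ.contMDiff_arr.comp (contMDiff_piManifold_apply ij)) a
      refine h1.comp h5.contMDiffOn ?_
      rintro _ ⟨x, hx, rfl⟩
      exact ⟨_, hx, rfl⟩
    · rw [φ.injπ'_topInj]
      exact φ.nearEq_topQuot h3
    · exact congrArg (φ.fibMap x) (h4 _ hx)

/-- A global section of `inj` translates all lifts at once. This is the effect on potentials of
changing the representative of an extension class. -/
theorem add_section (h : IsPotential P f c w) (e : TopSec G.inj p) :
    IsPotential P f (c + injπ' e) (fun x r => w x r + fibMk x e) where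
  smul x z r hr := by rw [h.smul _ _ _ hr, add_assoc]
  smooth x := by
    obtain ⟨W, g, e', hx, h1, h2, h3, h4⟩ := h.smooth x
    refine ⟨W, g, e' + e, hx, h1, h2, ?_, fun x hx => ?_⟩
    · rw [injπ', map_add]
      exact h3.add NearEq.rfl
    · rw [h4 x hx, map_add]

end IsPotential

end Potential

end LieGroupoid

end

noncomputable section

/-! ### Composable sequences -/

namespace LieGroupoidStr

variable {EM HM EΓ HΓ : Type*} [NormedAddCommGroup EM] [NormedSpace ℝ EM]
  [TopologicalSpace HM] [NormedAddCommGroup EΓ] [NormedSpace ℝ EΓ] [TopologicalSpace HΓ]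
  {IM : ModelWithCorners ℝ EM HM} {IΓ : ModelWithCorners ℝ EΓ HΓ}
  {M Γ : Type*} [TopologicalSpace M] [ChartedSpace HM M]
  [TopologicalSpace Γ] [ChartedSpace HΓ Γ] (S : LieGroupoidStr IM IΓ M Γ)

theorem mul_inv_cancel_right {g h : Γ} (e : S.src g = S.tgt h) :
    S.mul (S.mul g h) (S.inv h) = g := by
  rw [S.mul_assoc _ _ _ e (S.tgt_inv h).symm, S.mul_inv, ← e, S.mul_one]

theorem inv_mul_cancel_left {g h : Γ} (e : S.src g = S.tgt h) :
    S.mul (S.inv g) (S.mul g h) = h := by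
  rw [← S.mul_assoc _ _ _ (S.src_inv g) e, S.inv_mul, e, S.one_mul]

theorem eq_inv_of_mul_eq_one {g h : Γ} (e : S.src g = S.tgt h)
    (h1 : S.mul g h = S.one (S.src h)) : g = S.inv h := by
  rw [← S.mul_inv_cancel_right e, h1, ← S.tgt_inv h, S.one_mul]

theorem inv_one (x : M) : S.inv (S.one x) = S.one x := by
  refine (S.eq_inv_of_mul_eq_one (by rw [S.src_one, S.tgt_one]) ?_).symm
  have := S.one_mul (S.one x)
  rw [S.tgt_one] at this
  rw [this, S.src_one]

end LieGroupoidStr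

namespace LieGroupoid

variable {G G' : LieGroupoid.{u}} {p q : SimplexCategory}
  {EX HX X : Type*} [NormedAddCommGroup EX] [NormedSpace ℝ EX] [TopologicalSpace HX]
  {IX : ModelWithCorners ℝ EX HX} [TopologicalSpace X] [ChartedSpace HX X]
  {D : Set X}

namespace Nerve

theorem src_arrow (x : G.Nerve p) (i j) : G.str.src (x.arrow (i, j)) = x.vertex j := by
  rw [vertex, x.composable i j j, x.arrow_self j, G.str.tgt_one, G.str.src_one]

theorem tgt_arrow (x : G.Nerve p) (i j) : G.str.tgt (x.arrow (i, j)) = x.vertex i :=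
  (x.composable i i j).symm

theorem arrow_inv (x : G.Nerve p) (i j) : x.arrow (j, i) = G.str.inv (x.arrow (i, j)) := by
  refine G.str.eq_inv_of_mul_eq_one (x.composable _ _ _) ?_
  rw [x.mul_arrow, x.arrow_self j, src_arrow, src_arrow]

/-- The arrow `(i, j)` is the arrow `(i, l)` followed backwards along `(j, l)`, so the arrows from
one vertex determine the sequence. -/
theorem ext_last {x y : G.Nerve p} (l : Fin (p.len + 1))
    (h : ∀ i, x.arrow (i, l) = y.arrow (i, l)) : x = y := by
  refine Nerve.ext (funext fun ⟨i, j⟩ => ?_)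
  rw [← x.mul_arrow i l j, ← y.mul_arrow i l j, x.arrow_inv j l, y.arrow_inv j l, h i, h j]

open Classical in
/-- The composable sequence with prescribed arrows from a common source. -/
def star (a : Fin (p.len + 1) → G.Γ) : G.Nerve p :=
  if h : ∀ i j, G.str.src (a i) = G.str.src (a j) then
    { arrow := fun ij => G.str.mul (a ij.1) (G.str.inv (a ij.2))
      arrow_self := fun i => by rw [G.str.mul_inv, G.str.src_one]
      composable := fun i j k => by
        rw [G.str.src_mul _ _ ((h i j).trans (G.str.tgt_inv _).symm), G.str.src_inv,
          G.str.tgt_mul _ _ ((h j k).trans (G.str.tgt_inv _).symm)]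
      mul_arrow := fun i j k => by
        have h1 := (h i j).trans (G.str.tgt_inv (a j)).symm
        have h2 := (h j k).trans (G.str.tgt_inv (a k)).symm
        rw [G.str.mul_assoc _ _ _ h1 (by rw [G.str.src_inv, G.str.tgt_mul _ _ h2]),
          G.str.inv_mul_cancel_left h2] }
  -- A junk value, so that `star` is defined on all families of arrows and can be applied off the
  -- set of composable ones.
  else Nerve.const p (G.str.src (a 0))

theorem star_arrow {a : Fin (p.len + 1) → G.Γ} (h : ∀ i j, G.str.src (a i) = G.str.src (a j))
    (i j) : (star a).arrow (i, j) = G.str.mul (a i) (G.str.inv (a j)) := by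
  rw [star, dif_pos h]

theorem star_arrow_last {a : Fin (p.len + 1) → G.Γ}
    (h : ∀ i j, G.str.src (a i) = G.str.src (a j)) {l : Fin (p.len + 1)}
    (hl : a l = G.str.one (G.str.src (a l))) (i) : (star a).arrow (i, l) = a i := by
  rw [star_arrow h, hl, G.str.inv_one, h l i, G.str.mul_one]

end Nerve

theorem SmoothInto.star {a : X → Fin (p.len + 1) → G.Γ}
    (h : ∀ d ∈ D, ∀ i j, G.str.src (a d i) = G.str.src (a d j))
    (ha : ∀ i, ContMDiffOn IX (𝓡 G.n) ∞ (fun d => a d i) D) :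
    SmoothInto IX D (fun d => Nerve.star (a d)) := by
  refine SmoothInto.of_components fun ⟨i, j⟩ => ?_
  have h1 : ContMDiffOn IX (𝓡 G.n) ∞ (fun d => G.str.mul (a d i) (G.str.inv (a d j))) D :=
    G.str.contMDiffOn_mul.comp
      ((ha i).prodMk (G.str.contMDiff_inv.comp_contMDiffOn (ha j)))
      fun d hd => (h d hd i j).trans (G.str.tgt_inv _).symm
  exact h1.congr fun d hd => Nerve.star_arrow (h d hd) i j

/-- The operator selecting an edge. -/
def edgeOp {p : SimplexCategory} (a b : Fin (p.len + 1)) (h : a ≤ b) : SimplexCategory.mk 1 ⟶ p :=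
  SimplexCategory.Hom.mk ⟨![a, b], by
    intro i j hij
    fin_cases i <;> fin_cases j
    · exact le_rfl
    · exact h
    · exact absurd hij (by decide)
    · exact le_rfl⟩

/-- The operator selecting a triangle. -/
def triOp {p : SimplexCategory} (a b c : Fin (p.len + 1)) (h : a ≤ b) (h' : b ≤ c) :
    SimplexCategory.mk 2 ⟶ p :=
  SimplexCategory.Hom.mk ⟨![a, b, c], by
    intro i j hij
    fin_cases i <;> fin_cases j
    · exact le_rfl
    · exact h
    · exact h.trans h'
    · exact absurd hij (by decide)
    · exact le_rfl
    · exact h'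
    · exact absurd hij (by decide)
    · exact absurd hij (by decide)
    · exact le_rfl⟩

/-- The sequence consisting of one arrow. -/
def nerve₁ (g : G.Γ) : G.Nerve (.mk 1) := Nerve.star (p := .mk 1) ![g, G.str.one (G.str.src g)]

theorem nerve₁_compat (g : G.Γ) (i j : Fin 2) :
    G.str.src ((![g, G.str.one (G.str.src g)] : Fin 2 → G.Γ) i) =
      G.str.src ((![g, G.str.one (G.str.src g)] : Fin 2 → G.Γ) j) := by
  have h : ∀ i, G.str.src ((![g, G.str.one (G.str.src g)] : Fin 2 → G.Γ) i) = G.str.src g := by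
    intro i
    fin_cases i
    · rfl
    · exact G.str.src_one _
  rw [h, h]

theorem nerve₁_arrow (g : G.Γ) : (nerve₁ g).arrow (0, 1) = g :=
  Nerve.star_arrow_last (p := .mk 1) (nerve₁_compat g) (l := 1)
    (congrArg G.str.one (G.str.src_one _).symm) 0

theorem eq_nerve₁ {x : G.Nerve (.mk 1)} {g : G.Γ} (h : g = x.arrow (0, 1)) : x = nerve₁ g := by
  refine Nerve.ext_last 1 fun i => ?_
  rw [nerve₁, Nerve.star_arrow_last (p := .mk 1) (nerve₁_compat g) (l := 1)
    (congrArg G.str.one (G.str.src_one _).symm) i]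
  fin_cases i
  · exact h.symm
  · exact (x.arrow_self 1).trans (congrArg G.str.one
      ((x.src_arrow 1 1).trans ((x.src_arrow 0 1).symm.trans (congrArg G.str.src h.symm))))

theorem smoothInto_nerve₁ {F : X → G.Γ} (hF : ContMDiffOn IX (𝓡 G.n) ∞ F D) :
    SmoothInto IX D (fun d => nerve₁ (F d)) := by
  refine SmoothInto.star (p := .mk 1) (fun d _ => nerve₁_compat (F d)) fun i => ?_
  fin_cases i
  · exact hF
  · exact G.str.contMDiff_one.comp_contMDiffOn
      (G.str.src_submersion.contMDiff.comp_contMDiffOn hF)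

/-- The sequence consisting of two arrows. -/
def nerve₂ (g h : G.Γ) : G.Nerve (.mk 2) :=
  Nerve.star (p := .mk 2) ![G.str.mul g h, h, G.str.one (G.str.src h)]

theorem nerve₂_compat {g h : G.Γ} (e : G.str.src g = G.str.tgt h) (i j : Fin 3) :
    G.str.src ((![G.str.mul g h, h, G.str.one (G.str.src h)] : Fin 3 → G.Γ) i) =
      G.str.src ((![G.str.mul g h, h, G.str.one (G.str.src h)] : Fin 3 → G.Γ) j) := by
  have h : ∀ i, G.str.src ((![G.str.mul g h, h, G.str.one (G.str.src h)] : Fin 3 → G.Γ) i) =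
      G.str.src h := by
    intro i
    fin_cases i
    · exact G.str.src_mul _ _ e
    · rfl
    · exact G.str.src_one _
  rw [h, h]

theorem nerve₂_arrow₀₁ {g h : G.Γ} (e : G.str.src g = G.str.tgt h) :
    (nerve₂ g h).arrow (0, 1) = g :=
  (Nerve.star_arrow (p := .mk 2) (nerve₂_compat e) 0 1).trans (G.str.mul_inv_cancel_right e)

theorem nerve₂_arrow₁₂ {g h : G.Γ} (e : G.str.src g = G.str.tgt h) :
    (nerve₂ g h).arrow (1, 2) = h :=
  Nerve.star_arrow_last (p := .mk 2) (nerve₂_compat e) (l := 2)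
    (congrArg G.str.one (G.str.src_one _).symm) 1

theorem nerve₂_arrow₀₂ {g h : G.Γ} (e : G.str.src g = G.str.tgt h) :
    (nerve₂ g h).arrow (0, 2) = G.str.mul g h :=
  Nerve.star_arrow_last (p := .mk 2) (nerve₂_compat e) (l := 2)
    (congrArg G.str.one (G.str.src_one _).symm) 0

theorem smoothInto_nerve₂ {F F' : X → G.Γ} (hF : ContMDiffOn IX (𝓡 G.n) ∞ F D)
    (hF' : ContMDiffOn IX (𝓡 G.n) ∞ F' D) (h : ∀ d ∈ D, G.str.src (F d) = G.str.tgt (F' d)) :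
    SmoothInto IX D (fun d => nerve₂ (F d) (F' d)) := by
  refine SmoothInto.star (p := .mk 2) (fun d hd => nerve₂_compat (h d hd)) fun i => ?_
  fin_cases i
  · exact G.str.contMDiffOn_mul.comp (hF.prodMk hF') h
  · exact hF'
  · exact G.str.contMDiff_one.comp_contMDiffOn
      (G.str.src_submersion.contMDiff.comp_contMDiffOn hF')

/-- The sequence consisting of three arrows. -/
theorem exists_nerve₃ {g h k : G.Γ} (e : G.str.src g = G.str.tgt h)
    (e' : G.str.src h = G.str.tgt k) : ∃ x : G.Nerve (.mk 3), x.arrow (0, 1) = g ∧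
      x.arrow (1, 2) = h ∧ x.arrow (2, 3) = k := by
  have e₁ : G.str.src g = G.str.tgt (G.str.mul h k) := by rw [G.str.tgt_mul _ _ e', e]
  have hc : ∀ i : Fin 4, G.str.src ((![G.str.mul g (G.str.mul h k), G.str.mul h k, k,
      G.str.one (G.str.src k)] : Fin 4 → G.Γ) i) = G.str.src k := by
    intro i
    fin_cases i
    · exact (G.str.src_mul _ _ e₁).trans (G.str.src_mul _ _ e')
    · exact G.str.src_mul _ _ e'
    · rfl
    · exact G.str.src_one _
  have hc' := fun i j => (hc i).trans (hc j).symm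
  refine ⟨Nerve.star (p := .mk 3) ![G.str.mul g (G.str.mul h k), G.str.mul h k, k,
    G.str.one (G.str.src k)], ?_, ?_, ?_⟩
  · exact (Nerve.star_arrow (p := .mk 3) hc' 0 1).trans (G.str.mul_inv_cancel_right e₁)
  · exact (Nerve.star_arrow (p := .mk 3) hc' 1 2).trans (G.str.mul_inv_cancel_right e')
  · exact Nerve.star_arrow_last (p := .mk 3) hc' (l := 3)
      (congrArg G.str.one (G.str.src_one _).symm) 2

theorem smoothInto_const {F : X → G.M} (hF : ContMDiffOn IX (𝓡 G.m) ∞ F D) (p : SimplexCategory) :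
    SmoothInto IX D (fun d => Nerve.const p (F d)) :=
  SmoothInto.of_components fun _ => G.str.contMDiff_one.comp_contMDiffOn hF

/-! ### Potentials and local sections -/

section LocalSections

variable {n : ℕ} {B : Type u} [TopologicalSpace B] [ChartedSpace (EuclideanSpace ℝ (Fin n)) B]
  {P : CircleBundle (n := n) B}

theorem SmoothOnNerve.of_local' {E H N : Type*}
    [NormedAddCommGroup E] [NormedSpace ℝ E] [TopologicalSpace H] {J : ModelWithCorners ℝ E H}
    [TopologicalSpace N] [ChartedSpace H N] {V : Opens (G.Nerve p)} {σ : V → N}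
    {g : (Pairs p → G.Γ) → N} (hg : ∀ x : V, g x.1.arrow = σ x)
    (h : ∀ x : V, ContMDiffWithinAt (G.pairsModel p) J ∞ g {a | ∃ x ∈ V, x.arrow = a} x.1.arrow) :
    SmoothOnNerve J V σ := by
  refine ⟨g, hg, ?_⟩
  rintro _ ⟨x, hx, rfl⟩
  exact h ⟨x, hx⟩

theorem SmoothOnNerve.restrict {E H N : Type*}
    [NormedAddCommGroup E] [NormedSpace ℝ E] [TopologicalSpace H] {J : ModelWithCorners ℝ E H}
    [TopologicalSpace N] [ChartedSpace H N] {U V : Opens (G.Nerve p)} (hV : V ≤ U) {σ : U → N}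
    (hσ : SmoothOnNerve J U σ) : SmoothOnNerve J V (fun x => σ ⟨x.1, hV x.2⟩) := by
  obtain ⟨g, h1, h2⟩ := hσ
  refine ⟨g, fun x => h1 ⟨x.1, hV x.2⟩, h2.mono ?_⟩
  rintro _ ⟨x, hx, rfl⟩
  exact ⟨x, hV hx, rfl⟩

theorem SmoothOnNerve.comp_operator {E H N : Type*}
    [NormedAddCommGroup E] [NormedSpace ℝ E] [TopologicalSpace H] {J : ModelWithCorners ℝ E H}
    [TopologicalSpace N] [ChartedSpace H N] {U : Opens (G.Nerve q)} (φ : q ⟶ p) {σ : U → N}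
    (hσ : SmoothOnNerve J U σ) :
    SmoothOnNerve J (opensMap φ U) (fun x => σ ⟨x.1.map φ, x.2⟩) := by
  obtain ⟨g, h1, h2⟩ := hσ
  refine ⟨fun a => g fun k => a (φ.toOrderHom k.1, φ.toOrderHom k.2),
    fun x => h1 ⟨x.1.map φ, x.2⟩, ?_⟩
  refine h2.comp (contMDiff_reindex (G := G)
    (fun k : Pairs q => (φ.toOrderHom k.1, φ.toOrderHom k.2))).contMDiffOn ?_
  rintro _ ⟨x, hx, rfl⟩
  exact ⟨_, hx, rfl⟩

/-- Two local sections with the same projection differ by a smooth function. -/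
theorem exists_circleSection_smul {V : Opens (G.Nerve p)} {σ σ' : V → P.total}
    (hσ : SmoothOnNerve ((𝓡 n).prod (𝓡 1)) V σ) (hσ' : SmoothOnNerve ((𝓡 n).prod (𝓡 1)) V σ')
    (h : ∀ x, P.proj (σ' x) = P.proj (σ x)) :
    ∃ f : circleSections ⟨p, V⟩, ∀ x, σ' x = f.1 x • σ x := by
  choose f hf using fun x => CircleBundle.exists_smul_eq (h x)
  obtain ⟨g, h1, h2⟩ := hσ
  obtain ⟨g', h1', h2'⟩ := hσ'
  have hinj : Function.Injective (fun y : V => y.1.arrow) :=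
    Nerve.arrow_injective.comp Subtype.val_injective
  let k : (Pairs p → G.Γ) → Circle := Function.extend (fun y : V => y.1.arrow) f (fun _ => 1)
  have hk : ∀ y : V, k y.1.arrow = f y := fun y => hinj.extend_apply _ _ _
  refine ⟨⟨f, SmoothOnNerve.of_local' hk fun x => ?_⟩, fun x => (hf x).symm⟩
  have hx : x.1.arrow ∈ {a | ∃ x ∈ V, x.arrow = a} := ⟨x.1, x.2, rfl⟩
  have key : ∀ a ∈ {a | ∃ x ∈ V, x.arrow = a}, g' a = k a • g a := by
    rintro _ ⟨y, hy, rfl⟩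
    rw [h1 ⟨y, hy⟩, h1' ⟨y, hy⟩, hk ⟨y, hy⟩, hf]
  obtain ⟨z, hz, hz'⟩ := CircleBundle.exists_smooth_div (h2' _ hx) (h2 _ hx) (by
    filter_upwards [self_mem_nhdsWithin] with a ha
    rw [key a ha, P.proj_smul]) hx
  have h3 : ∀ᶠ a in nhdsWithin x.1.arrow {a | ∃ x ∈ V, x.arrow = a}, k a = z a := by
    filter_upwards [hz', self_mem_nhdsWithin] with a ha ha'
    exact CircleBundle.smul_right_cancel ((key a ha').symm.trans ha)
  exact hz.congr_of_eventuallyEq h3 (h3.self_of_nhdsWithin hx)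

variable {f : G.Nerve p → B} {c : TopSec G.injQuot p} {w : ∀ x : G.Nerve p, P.total → Fib x}

/-- Near each point `σ` is a smooth function `k` times the reference section, so its values come
from the section `injι' k + e` of `inj`. Such local lifts are determined by their values and glue.
-/
theorem IsPotential.exists_section (h : IsPotential P f c w) (U : Opens (G.Nerve p))
    (σ : U → P.total) (hσ : SmoothOnNerve ((𝓡 n).prod (𝓡 1)) U σ)
    (hf : ∀ x, P.proj (σ x) = f x.1) :
    ∃ s : G.inj.obj.obj (op ⟨p, U⟩), injπ' s = secRes _ le_top c ∧
      ∀ x : U, w x.1 (σ x) = fibEv x.1 s := by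
  classical
  let t : ∀ x : G.Nerve p, Fib x := fun x => if hx : x ∈ U then w x (σ ⟨x, hx⟩) else 0
  have ht : ∀ x (hx : x ∈ U), t x = w x (σ ⟨x, hx⟩) := fun x hx => dif_pos hx
  obtain ⟨s, hs, hs'⟩ := exists_fibEv_eq U (secRes _ le_top c) t (by
    intro x hx
    obtain ⟨W, g, e, hxW, h1, h2, ⟨W', hxW', h3⟩, h4⟩ := h.smooth x
    obtain ⟨k, hk⟩ := exists_circleSection_smul (V := U ⊓ W)
      (σ := fun y => g y.1.arrow) (σ' := fun y => σ ⟨y.1, y.2.1⟩) (P := P)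
      ⟨g, fun _ => rfl, h1.mono (by rintro _ ⟨y, hy, rfl⟩; exact ⟨y, hy.2, rfl⟩)⟩
      (hσ.restrict inf_le_left) (fun y => by rw [hf, h2 _ y.2.2])
    refine ⟨U ⊓ W ⊓ W', inf_le_left.trans inf_le_left, injι' (secRes _ inf_le_left (circleSec k)) +
      secRes _ le_top e, ⟨⟨hx, hxW⟩, hxW'⟩, ?_, fun y hy => ?_⟩
    · rw [injπ', map_add]
      change injπ' (injι' _) + _ = _
      rw [injπ'_injι', zero_add, secRes_naturality, secRes_secRes]
      exact secRes_congr inf_le_right h3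
    · rw [ht y hy.1.1, fibEv_add hy, fibEv_secRes_top hy, fibEv_injι' hy, circleVal_secRes,
        hk ⟨y, hy.1⟩, h.smul _ _ _ (h2 y hy.1.2), h4 y hy.1.2]
      rfl)
  exact ⟨s, hs, fun x => (ht x.1 x.2).symm.trans (hs' x.1 x.2)⟩

/-- A smooth section of `P` along `f`. -/
structure SectionAlong (P : CircleBundle (n := n) B) (f : G.Nerve p → B)
    (V : Opens (G.Nerve p)) where
  toFun : V → P.total
  smooth : SmoothOnNerve ((𝓡 n).prod (𝓡 1)) V toFun
  proj_toFun : ∀ x, P.proj (toFun x) = f x.1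

def SectionAlong.restrict {V W : Opens (G.Nerve p)} (σ : SectionAlong P f V) (h : W ≤ V) :
    SectionAlong P f W :=
  ⟨fun x => σ.toFun ⟨x.1, h x.2⟩, σ.smooth.restrict h, fun _ => σ.proj_toFun _⟩

theorem exists_sectionAlong {k : (Pairs p → G.Γ) → B} (hk : ContMDiff (G.pairsModel p) (𝓡 n) ∞ k)
    (hf : ∀ x, f x = k x.arrow) {x : G.Nerve p} {r : P.total} (hr : P.proj r = f x) :
    ∃ (V : Opens (G.Nerve p)) (hx : x ∈ V) (σ : SectionAlong P f V), σ.toFun ⟨x, hx⟩ = r := by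
  obtain ⟨U, σ, hU, h1, h2, h3⟩ := CircleBundle.exists_localSection r
  let V : Opens (G.Nerve p) := U.comap ⟨_, hk.continuous.comp Nerve.continuous_arrow⟩
  have hV : ∀ y ∈ V, k y.arrow ∈ U := fun y hy => hy
  refine ⟨V, ?_, ⟨fun y => σ (k y.1.arrow), ⟨fun a => σ (k a), fun _ => rfl, ?_⟩, fun y => ?_⟩, ?_⟩
  · rw [hr, hf] at hU
    exact hU
  · refine h1.comp hk.contMDiffOn ?_
    rintro _ ⟨y, hy, rfl⟩
    exact hV y hy
  · rw [h2 _ (hV y.1 y.2), hf]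
  · change σ (k x.arrow) = r
    rw [← hf, ← hr, h3]

/-- A compatible family of maps from local sections to local lifts of `c` gives a potential. -/
theorem exists_isPotential {k : (Pairs p → G.Γ) → B} (hk : ContMDiff (G.pairsModel p) (𝓡 n) ∞ k)
    (hf : ∀ x, f x = k x.arrow) (c : TopSec G.injQuot p)
    (ρ : ∀ V : Opens (G.Nerve p), SectionAlong P f V → G.inj.obj.obj (op ⟨p, V⟩))
    (hres : ∀ (V W : Opens (G.Nerve p)) (h : W ≤ V) (σ : SectionAlong P f V),
      ρ W (σ.restrict h) = secRes _ h (ρ V σ))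
    (hsmul : ∀ (V : Opens (G.Nerve p)) (z : circleSections ⟨p, V⟩) (σ τ : SectionAlong P f V),
      (∀ x, τ.toFun x = z.1 x • σ.toFun x) → ρ V τ = injι' (circleSec z) + ρ V σ)
    (hπ : ∀ V σ, injπ' (ρ V σ) = secRes _ le_top c) :
    ∃ w : ∀ x : G.Nerve p, P.total → Fib x, IsPotential P f c w ∧
      ∀ (V : Opens (G.Nerve p)) (σ : SectionAlong P f V) (x : V),
        w x.1 (σ.toFun x) = fibEv x.1 (ρ V σ) := by
  classical
  -- The value at `r` is read off from any local section through `r`; it is `0` if there is none,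
  -- which happens when `r` does not lie over `f x`.
  let w : ∀ x : G.Nerve p, P.total → Fib x := fun x r =>
    if h : ∃ t : Fib x, ∃ (V : Opens (G.Nerve p)) (hx : x ∈ V) (σ : SectionAlong P f V),
      σ.toFun ⟨x, hx⟩ = r ∧ t = fibEv x (ρ V σ) then h.choose else 0
  have hw : ∀ (V : Opens (G.Nerve p)) (σ : SectionAlong P f V) (x : V),
      w x.1 (σ.toFun x) = fibEv x.1 (ρ V σ) := by
    rintro V σ ⟨x, hx⟩
    have h : ∃ t : Fib x, ∃ (V' : Opens (G.Nerve p)) (hx' : x ∈ V') (σ' : SectionAlong P f V'),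
      σ'.toFun ⟨x, hx'⟩ = σ.toFun ⟨x, hx⟩ ∧ t = fibEv x (ρ V' σ') := ⟨_, V, hx, σ, rfl, rfl⟩
    have h1 : w x (σ.toFun ⟨x, hx⟩) = h.choose := dif_pos h
    obtain ⟨V', hx', σ', h2, h3⟩ := h.choose_spec
    rw [h1, h3]
    have hxW : x ∈ V ⊓ V' := ⟨hx, hx'⟩
    obtain ⟨z, hz⟩ := exists_circleSection_smul (σ.restrict (inf_le_left : V ⊓ V' ≤ V)).smooth
      (σ'.restrict (inf_le_right : V ⊓ V' ≤ V')).smooth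
      (fun y => ((σ'.restrict _).proj_toFun y).trans ((σ.restrict _).proj_toFun y).symm)
    -- Two sections through the same point differ by a function with value `1` there, which is
    -- invisible in `Fib x`; so the value does not depend on the section.
    have h4 : z.1 ⟨x, hxW⟩ = 1 := by
      refine CircleBundle.smul_right_cancel (P := P) (r := σ.toFun ⟨x, hx⟩) ?_
      rw [one_smul]
      exact (hz ⟨x, hxW⟩).symm.trans h2
    have h5 := hsmul _ z _ _ hz
    rw [hres, hres] at h5
    rw [← fibEv_secRes hxW inf_le_right, h5, fibEv_add hxW, fibEv_injι' hxW, fibEv_secRes hxW]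
    have h6 : circleVal (circleSec z) ⟨x, hxW⟩ = 1 := h4
    rw [h6, fibι_one, zero_add]
  refine ⟨w, ⟨fun x z r hr => ?_, fun x => ?_⟩, hw⟩
  · obtain ⟨V, hx, σ, rfl⟩ := exists_sectionAlong hk hf hr
    let τ : SectionAlong P f V := ⟨fun y => z • σ.toFun y, by
      obtain ⟨g, hg, hs⟩ := σ.smooth
      exact ⟨fun a => z • g a, fun y => congrArg _ (hg y), fun a ha =>
        CircleBundle.contMDiffWithinAt_smul contMDiffWithinAt_const (hs a ha)⟩,
      fun y => by rw [P.proj_smul, σ.proj_toFun]⟩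
    have h1 := hsmul V ⟨fun _ => z, fun _ => z, fun _ => rfl, contMDiffOn_const⟩ σ τ fun _ => rfl
    have h2 : w x (z • σ.toFun ⟨x, hx⟩) = fibEv x (ρ V τ) := hw V τ ⟨x, hx⟩
    rw [h2, h1, fibEv_add hx, fibEv_injι' hx, hw V σ ⟨x, hx⟩]
    rfl
  · obtain ⟨r, hr⟩ := P.exists_proj_eq (f x)
    obtain ⟨V, hx, σ, rfl⟩ := exists_sectionAlong hk hf hr
    obtain ⟨g, hg, hs⟩ := σ.smooth
    obtain ⟨e, he⟩ := exists_secRes_eq (ρ V σ)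
    refine ⟨V, g, e, hx, hs, fun y hy => ?_, ⟨V, hx, ?_⟩, fun y hy => ?_⟩
    · rw [hg ⟨y, hy⟩, σ.proj_toFun]
    · rw [← hπ V σ, ← he, ← secRes_naturality]
    · rw [hg ⟨y, hy⟩, hw V σ ⟨y, hy⟩, ← he, fibEv_secRes_top hy]

end LocalSections

end LieGroupoid

end

noncomputable section

/-! ### Potentials of central extensions -/

namespace LieGroupoid

variable {G G' : LieGroupoid.{u}} {p q : SimplexCategory}

/-- The value of a morphism on an edge. -/
def edgeVal (n : G.edgeSheaf ⟶ G.injQuot) (p : SimplexCategory) (a b : Fin (p.len + 1)) :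
    TopSec G.injQuot p := n.hom.app (op ⟨p, ⊤⟩) (edgeSec ⟨p, ⊤⟩ a b)

/-- The value of a morphism on a vertex. -/
def vertexVal (n : G.vertexSheaf ⟶ G.injQuot) (p : SimplexCategory) (a : Fin (p.len + 1)) :
    TopSec G.injQuot p := n.hom.app (op ⟨p, ⊤⟩) (vertexSec ⟨p, ⊤⟩ a)

theorem topMap_edgeVal (n : G.edgeSheaf ⟶ G.injQuot) (φ : q ⟶ p) (a b : Fin (q.len + 1)) :
    topMap _ φ (edgeVal n q a b) = edgeVal n p (φ.toOrderHom a) (φ.toOrderHom b) := by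
  rw [edgeVal, ← topMap_naturality]
  exact congrArg _ (edgeSec_map (topHom φ) a b)

theorem topMap_vertexVal (n : G.vertexSheaf ⟶ G.injQuot) (φ : q ⟶ p) (a : Fin (q.len + 1)) :
    topMap _ φ (vertexVal n q a) = vertexVal n p (φ.toOrderHom a) := by
  rw [vertexVal, ← topMap_naturality]
  exact congrArg _ (vertexSec_map (topHom φ) a)

theorem edgeVal_add_edgeVal (n : G.edgeSheaf ⟶ G.injQuot) (p : SimplexCategory)
    (a b c : Fin (p.len + 1)) : edgeVal n p a b + edgeVal n p b c = edgeVal n p a c := by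
  rw [edgeVal, edgeVal, ← map_add, edgeSec_add]
  rfl

theorem edgeVal_add (n n' : G.edgeSheaf ⟶ G.injQuot) (p : SimplexCategory)
    (a b : Fin (p.len + 1)) : edgeVal (n + n') p a b = edgeVal n p a b + edgeVal n' p a b := rfl

theorem edgeVal_injπ (m : G.edgeSheaf ⟶ G.inj) (p : SimplexCategory) (a b : Fin (p.len + 1)) :
    edgeVal (m ≫ G.injπ) p a b = injπ' (m.hom.app (op ⟨p, ⊤⟩) (edgeSec ⟨p, ⊤⟩ a b)) := rfl

theorem edgeVal_edgeι (n : G.vertexSheaf ⟶ G.injQuot) (p : SimplexCategory)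
    (a b : Fin (p.len + 1)) : edgeVal (G.edgeι ≫ n) p a b = vertexVal n p a - vertexVal n p b := by
  rw [edgeVal, section_comp, edgeι_edgeSec, map_sub]
  rfl

theorem edgeVal_pullEdgeHom (φ : Hom G' G) (n : G.edgeSheaf ⟶ G.injQuot) (p : SimplexCategory)
    (a b : Fin (p.len + 1)) : edgeVal (φ.pullEdgeHom n) p a b = φ.topQuot (edgeVal n p a b) :=
  φ.pullEdgeHom_edgeSec n ⟨p, ⊤⟩ a b

theorem map_secRes_top (A : AbSheaf G.topology) {U : Opens (G.Nerve q)} {V : Opens (G.Nerve p)}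
    (h : (⟨p, V⟩ : G.SimplicialOpen) ⟶ ⟨q, U⟩) (s : TopSec A q) :
    A.obj.map h.op (secRes A le_top s) = secRes A le_top (topMap A h.operator s) :=
  (section_map_comp A.obj (SimplicialOpen.incl le_top) h s).trans
    (section_map_comp A.obj (topHom h.operator) (SimplicialOpen.incl le_top) s).symm

theorem map_secRes_top_eq (A : AbSheaf G.topology) {U : Opens (G.Nerve q)} {V : Opens (G.Nerve p)}
    (h : (⟨p, V⟩ : G.SimplicialOpen) ⟶ ⟨q, U⟩) {s : TopSec A q} {t : TopSec A p}
    (ht : topMap A h.operator s = t) : A.obj.map h.op (secRes A le_top s) = secRes A le_top t := by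
  rw [map_secRes_top, ht]

theorem secRes_add (A : AbSheaf G.topology) {V U : Opens (G.Nerve p)} (h : V ≤ U)
    {s t r : A.obj.obj (op ⟨p, U⟩)} (hr : s + t = r) :
    secRes A h s + secRes A h t = secRes A h r := by
  rw [← hr, map_add]

/-- Sections over the spaces `Γ_p` form a family on all open subsets. -/
def EdgeFamily.ofTop {A : AbSheaf G.topology}
    (e : ∀ (p : SimplexCategory) (_ _ : Fin (p.len + 1)), TopSec A p)
    (he : ∀ {p q : SimplexCategory} (φ : q ⟶ p) a b,
      topMap A φ (e q a b) = e p (φ.toOrderHom a) (φ.toOrderHom b))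
    (he' : ∀ p a b c, e p a b + e p b c = e p a c) : EdgeFamily A.obj where
  val
    | ⟨p, _⟩, a, b => secRes A le_top (e p a b)
  map_val := fun ⟨p, U⟩ ⟨q, V⟩ h a b => by
    exact map_secRes_top_eq A h (he (p := q) (q := p) h.operator a b)
  add_val := fun ⟨p, _⟩ a b c => secRes_add A le_top (he' p a b c)

theorem EdgeFamily.ofTop_hom {A : AbSheaf G.topology}
    (e : ∀ (p : SimplexCategory) (_ _ : Fin (p.len + 1)), TopSec A p) (he) (he')
    (p : SimplexCategory) (a b : Fin (p.len + 1)) :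
    (EdgeFamily.ofTop e he he').hom.hom.app (op ⟨p, ⊤⟩) (edgeSec ⟨p, ⊤⟩ a b) = e p a b :=
  (EdgeFamily.hom_edgeSec _ _ _ _).trans (section_map_id A.obj _)

theorem secRes_edgeSec {V U : Opens (G.Nerve p)} (h : V ≤ U) (a b : Fin (p.len + 1)) :
    secRes G.edgeSheaf h (edgeSec ⟨p, U⟩ a b) = edgeSec ⟨p, V⟩ a b :=
  edgeSec_map (SimplicialOpen.incl h) a b

theorem edgeSheaf_hom_ext_top {A : AbSheaf G.topology} {f g : G.edgeSheaf ⟶ A}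
    (h : ∀ (p : SimplexCategory) (a b : Fin (p.len + 1)),
      f.hom.app (op ⟨p, ⊤⟩) (edgeSec ⟨p, ⊤⟩ a b) = g.hom.app (op ⟨p, ⊤⟩) (edgeSec ⟨p, ⊤⟩ a b)) :
    f = g := by
  refine edgeSheaf_hom_ext fun ⟨p, U⟩ a b => ?_
  rw [← secRes_edgeSec (le_top : U ≤ ⊤), secRes_naturality, secRes_naturality, h]

theorem fibEv_top (x : G.Nerve p) (e : TopSec G.inj p) : fibEv x e = fibMk x e := by
  have := fibEv_secRes_top (U := ⊤) (x := x) trivial e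
  rwa [secRes_self] at this

theorem fibMk_ext {s t : TopSec G.inj p} (hq : injπ' s = injπ' t)
    (h : ∀ x, fibMk x s = fibMk x t) : s = t :=
  fibEv_ext hq fun x _ => by rw [fibEv_top, fibEv_top, h]

theorem fibEv_sub {U : Opens (G.Nerve p)} {x : G.Nerve p} (hx : x ∈ U)
    (s t : G.inj.obj.obj (op ⟨p, U⟩)) : fibEv x (s - t) = fibEv x s - fibEv x t := by
  rw [eq_sub_iff_add_eq, ← fibEv_add hx, sub_add_cancel]

section

variable {n : ℕ} {B : Type u} [TopologicalSpace B] [ChartedSpace (EuclideanSpace ℝ (Fin n)) B]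
  {P : CircleBundle (n := n) B} {f : G.Nerve p → B} {c c' : TopSec G.injQuot p}
  {w w' : ∀ x : G.Nerve p, P.total → Fib x}

/-- One section with a known lift near each point suffices: equivariance then determines the
potential on whole fibres. -/
theorem IsPotential.of_sections
    (h : ∀ x (z : Circle) r, P.proj r = f x → w x (z • r) = fibι x z + w x r)
    (h' : ∀ x, ∃ (V : Opens (G.Nerve p)) (σ : SectionAlong P f V) (s : G.inj.obj.obj (op ⟨p, V⟩)),
      x ∈ V ∧ injπ' s = secRes _ le_top c ∧ ∀ y : V, w y.1 (σ.toFun y) = fibEv y.1 s) :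
    IsPotential P f c w where
  smul := h
  smooth x := by
    obtain ⟨V, σ, s, hx, hs, h⟩ := h' x
    obtain ⟨g, h1, h2⟩ := σ.smooth
    obtain ⟨e, rfl⟩ := exists_secRes_eq s
    refine ⟨V, g, e, hx, h2, fun y hy => by rw [h1 ⟨y, hy⟩, σ.proj_toFun], ⟨V, hx, ?_⟩,
      fun y hy => ?_⟩
    · rw [← hs, ← secRes_naturality]
    · rw [h1 ⟨y, hy⟩, h ⟨y, hy⟩, fibEv_secRes_top hy]

theorem IsPotential.exists_sectionAlong (h : IsPotential P f c w) (x : G.Nerve p) :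
    ∃ (V : Opens (G.Nerve p)) (_ : SectionAlong P f V), x ∈ V := by
  obtain ⟨W, g, e, hx, h1, h2, -, -⟩ := h.smooth x
  exact ⟨W, ⟨fun y => g y.1.arrow, ⟨g, fun _ => rfl, h1⟩, fun y => h2 _ y.2⟩, hx⟩

/-- The difference of two potentials on the same bundle is given by a section. -/
theorem IsPotential.exists_sub_eq (h : IsPotential P f c w) (h' : IsPotential P f c' w') :
    ∃ e : TopSec G.inj p, injπ' e = c - c' ∧
      ∀ x r, P.proj r = f x → w x r - w' x r = fibMk x e := by
  choose r hr using fun x : G.Nerve p => P.exists_proj_eq (f x)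
  -- The circle acts in the same way through both potentials, so the difference is constant along
  -- the fibres of `P`.
  have key : ∀ x s, P.proj s = f x → w x s - w' x s = w x (r x) - w' x (r x) := by
    intro x s hs
    obtain ⟨z, rfl⟩ := CircleBundle.exists_smul_eq (hs.trans (hr x).symm)
    rw [h.smul _ _ _ (hr x), h'.smul _ _ _ (hr x)]
    abel
  obtain ⟨e, he, he'⟩ := exists_fibEv_eq ⊤ (c - c') (fun x => w x (r x) - w' x (r x)) (by
    intro x _
    obtain ⟨V, σ, hx⟩ := h.exists_sectionAlong x
    obtain ⟨s, hs, hs'⟩ := h.exists_section V σ.toFun σ.smooth σ.proj_toFun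
    obtain ⟨t, ht, ht'⟩ := h'.exists_section V σ.toFun σ.smooth σ.proj_toFun
    refine ⟨V, le_top, s - t, hx, ?_, fun y hy => ?_⟩
    · rw [injπ', map_sub, map_sub]
      exact congrArg₂ _ hs ht
    · rw [fibEv_sub hy, ← hs' ⟨y, hy⟩, ← ht' ⟨y, hy⟩, key _ _ (σ.proj_toFun ⟨y, hy⟩)])
  refine ⟨e, he, fun x s hs => ?_⟩
  rw [key x s hs, he' x trivial, fibEv_top]

end

/-- Compatible potentials for a central extension, on all pairs of vertices. They identify the
local sections of `R` with the local lifts of the values of `n` on the edges. -/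
structure ExtPotential (R : CentralExtension G) (n : G.edgeSheaf ⟶ G.injQuot) where
  val : ∀ {p : SimplexCategory} (x : G.Nerve p) (_ _ : Fin (p.len + 1)), R.total → Fib x
  isPotential : ∀ (p : SimplexCategory) (a b : Fin (p.len + 1)),
    IsPotential R.toCircleBundle (fun x : G.Nerve p => x.arrow (a, b)) (edgeVal n p a b)
      (fun x => val x a b)
  val_map : ∀ {p q : SimplexCategory} (φ : q ⟶ p) (x : G.Nerve p) (a b : Fin (q.len + 1))
    (r : R.total), R.proj r = x.arrow (φ.toOrderHom a, φ.toOrderHom b) →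
      fibPull φ x (val (x.map φ) a b r) = val x (φ.toOrderHom a) (φ.toOrderHom b) r
  val_mul : ∀ {p : SimplexCategory} (x : G.Nerve p) (a b c : Fin (p.len + 1)) (r s : R.total),
    R.proj r = x.arrow (a, b) → R.proj s = x.arrow (b, c) →
      val x a c (R.str.mul r s) = val x a b r + val x b c s

/-- Compatible potentials for a circle bundle on `M`, on all vertices. -/
structure BundlePotential (L : CircleBundle (n := G.m) G.M) (n : G.vertexSheaf ⟶ G.injQuot) where
  val : ∀ {p : SimplexCategory} (x : G.Nerve p) (_ : Fin (p.len + 1)), L.total → Fib x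
  isPotential : ∀ (p : SimplexCategory) (a : Fin (p.len + 1)),
    IsPotential L (fun x : G.Nerve p => x.vertex a) (vertexVal n p a) (fun x => val x a)
  val_map : ∀ {p q : SimplexCategory} (φ : q ⟶ p) (x : G.Nerve p) (a : Fin (q.len + 1))
    (l : L.total), L.proj l = x.vertex (φ.toOrderHom a) →
      fibPull φ x (val (x.map φ) a l) = val x (φ.toOrderHom a) l

/-- A potential on `Γ_0` determines the potentials on all vertices. -/
def BundlePotential.ofZero {L : CircleBundle (n := G.m) G.M} {n : G.vertexSheaf ⟶ G.injQuot}
    {w : ∀ x : G.Nerve (.mk 0), L.total → Fib x}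
    (h : IsPotential L (fun x => x.vertex 0) (vertexVal n (.mk 0) 0) w) : BundlePotential L n where
  val {p} x a l := fibPull (SimplexCategory.const (.mk 0) p a) x (w _ l)
  isPotential p a := by
    have := h.pull (SimplexCategory.const (.mk 0) p a)
    rw [topMap_vertexVal] at this
    exact this
  val_map φ x a l _ := fibPull_fibPull φ (SimplexCategory.const (.mk 0) _ a) x _

/-- An equality of elements of fibres over all edges follows from one on `Γ_1`. -/
theorem edge_induction {motive : ∀ {p : SimplexCategory} (_ : G.Nerve p) (_ _ : Fin (p.len + 1)),
    Prop} {g : G.Γ} (h1 : motive (nerve₁ g) 0 1)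
    (h2 : ∀ {p q : SimplexCategory} (φ : q ⟶ p) (x : G.Nerve p) a b,
      (x.map φ).arrow (a, b) = g → motive (x.map φ) a b →
        motive x (φ.toOrderHom a) (φ.toOrderHom b))
    {p : SimplexCategory} (x : G.Nerve p) (a b : Fin (p.len + 1)) (hab : a ≤ b)
    (hg : g = x.arrow (a, b)) : motive x a b := by
  have h3 : x.map (edgeOp a b hab) = nerve₁ g := eq_nerve₁ hg
  refine h2 (edgeOp a b hab) x 0 1 ?_ ?_
  · rw [h3, nerve₁_arrow]
  · rw [h3]
    exact h1

theorem proj_mul_eq {R : CentralExtension G} {x : G.Nerve p} {a b c : Fin (p.len + 1)}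
    {r s : R.total} (hr : R.proj r = x.arrow (a, b)) (hs : R.proj s = x.arrow (b, c)) :
    R.proj (R.str.mul r s) = x.arrow (a, c) := by
  rw [R.proj_mul, hr, hs, x.mul_arrow]
  rw [← R.src_proj, ← R.tgt_proj, hr, hs, x.composable]

theorem contMDiff_arrow (p : SimplexCategory) (ij : Pairs p) :
    ContMDiff (G.pairsModel p) (𝓡 G.n) ∞ (fun a : Pairs p → G.Γ => a ij) :=
  contMDiff_piManifold_apply ij

namespace ExtPotential

variable {R R' R'' : CentralExtension G} {n n' : G.edgeSheaf ⟶ G.injQuot}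

/-- Changing a potential by a morphism to the injective sheaf. -/
def addHom (v : ExtPotential R n) (m : G.edgeSheaf ⟶ G.inj) :
    ExtPotential R (n + m ≫ G.injπ) where
  val {p} x a b r := v.val x a b r + fibMk x (m.hom.app (op ⟨p, ⊤⟩) (edgeSec ⟨p, ⊤⟩ a b))
  isPotential p a b := (v.isPotential p a b).add_section _
  val_map {p q} φ x a b r hr := by
    rw [map_add, v.val_map φ x a b r hr, fibPull_mk, ← topMap_naturality]
    exact congrArg (fun s => _ + fibMk x (m.hom.app _ s)) (edgeSec_map (topHom φ) a b)
  val_mul {p} x a b c r s hr hs := by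
    have h : fibMk x (m.hom.app (op ⟨p, ⊤⟩) (edgeSec ⟨p, ⊤⟩ a c)) =
        fibMk x (m.hom.app (op ⟨p, ⊤⟩) (edgeSec ⟨p, ⊤⟩ a b)) +
          fibMk x (m.hom.app (op ⟨p, ⊤⟩) (edgeSec ⟨p, ⊤⟩ b c)) := by
      rw [← map_add, ← map_add]
      exact congrArg (fun s => fibMk x (m.hom.app (op ⟨p, ⊤⟩) s)) (edgeSec_add ⟨p, ⊤⟩ a b c).symm
    rw [v.val_mul x a b c r s hr hs, h]
    abel

/-- On each edge the difference of the two potentials is a global section of `inj`. Compatibility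
and multiplicativity of the potentials make these sections natural and additive, hence a morphism
out of `edgeSheaf`. Therefore `R` determines the class of `n`. -/
theorem exists_eq_add (v : ExtPotential R n) (v' : ExtPotential R n') :
    ∃ m : G.edgeSheaf ⟶ G.inj, n = n' + m ≫ G.injπ := by
  choose e he he' using fun (p : SimplexCategory) (a b : Fin (p.len + 1)) =>
    (v.isPotential p a b).exists_sub_eq (v'.isPotential p a b)
  let m : G.edgeSheaf ⟶ G.inj := (EdgeFamily.ofTop (A := G.inj) e (by
    intro p q φ a b
    refine fibMk_ext ?_ fun x => ?_
    · rw [injπ', topMap_naturality]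
      change topMap _ φ (injπ' (e q a b)) = injπ' _
      rw [he, he, map_sub, topMap_edgeVal, topMap_edgeVal]
    · obtain ⟨r, hr⟩ := R.exists_proj_eq (x.arrow (φ.toOrderHom a, φ.toOrderHom b))
      rw [← fibPull_mk, ← he' q a b (x.map φ) r hr, ← he' p _ _ x r hr, map_sub,
        v.val_map φ x a b r hr, v'.val_map φ x a b r hr]) (by
    intro p a b c
    refine fibMk_ext ?_ fun x => ?_
    · rw [injπ', map_add]
      change injπ' (e p a b) + injπ' (e p b c) = injπ' _
      rw [he, he, he, ← edgeVal_add_edgeVal n p a b c, ← edgeVal_add_edgeVal n' p a b c]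
      abel
    · obtain ⟨r, hr⟩ := R.exists_proj_eq (x.arrow (a, b))
      obtain ⟨s, hs⟩ := R.exists_proj_eq (x.arrow (b, c))
      rw [map_add, ← he' p a b x r hr, ← he' p b c x s hs,
        ← he' p a c x _ (proj_mul_eq hr hs), v.val_mul x a b c r s hr hs,
        v'.val_mul x a b c r s hr hs]
      abel)).hom
  refine ⟨m, edgeSheaf_hom_ext_top fun p a b => ?_⟩
  change edgeVal n p a b = edgeVal (n' + m ≫ G.injπ) p a b
  rw [edgeVal_add, edgeVal_injπ, EdgeFamily.ofTop_hom, he, add_sub_cancel]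

/-! #### Isomorphisms -/

/-- Over `Γ_1` both bundles are the torsor of lifts of the same section, so a point is sent to the
one with the same potential. The other edges `a ≤ b` are pulled back from `Γ_1`; the order matters
because simplicial operators are monotone. -/
theorem exists_iso_map (v : ExtPotential R n) (v' : ExtPotential R' n) :
    ∃ F : R.total → R'.total,
      ContMDiff ((𝓡 G.n).prod (𝓡 1)) ((𝓡 G.n).prod (𝓡 1)) ∞ F ∧
      (∀ r, R'.proj (F r) = R.proj r) ∧ ∀ {p : SimplexCategory} (x : G.Nerve p) a b r, a ≤ b →
        R.proj r = x.arrow (a, b) → v'.val x a b (F r) = v.val x a b r := by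
  have hy : SmoothInto ((𝓡 G.n).prod (𝓡 1)) Set.univ (fun r : R.total => nerve₁ (R.proj r)) :=
    smoothInto_nerve₁ R.contMDiff_proj.contMDiffOn
  -- Produces some function `F₀` as the default argument of `exists_lift`; its values play no role.
  have hne : ∀ r : R.total, ∃ _ : R'.total, True := fun r =>
    ⟨(R'.exists_proj_eq (R.proj r)).choose, trivial⟩
  choose F₀ _ using hne
  obtain ⟨F, h1, h2⟩ := (v'.isPotential (.mk 1) 0 1).exists_lift hy F₀
    (fun r hr => (v.isPotential (.mk 1) 0 1).smoothVal hy hr (F := id) contMDiffWithinAt_id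
      fun r _ => (nerve₁_arrow _).symm)
  have h3 : ∀ r, R'.proj (F r) = R.proj r := fun r => (h2 r trivial).1.trans (nerve₁_arrow _)
  refine ⟨F, contMDiffOn_univ.1 h1, h3, fun x a b r hab hr => ?_⟩
  refine edge_induction (motive := fun x a b => v'.val x a b (F r) = v.val x a b r)
    (h2 r trivial).2 ?_ x a b hab hr
  intro p q φ x a b hg h
  rw [← v'.val_map φ x a b _ ((h3 r).trans hg.symm), ← v.val_map φ x a b _ hg.symm, h]

/-- All identities are tested with the potentials, which are injective on fibres: inverses and
equivariance over `Γ_1`, multiplicativity on the long edge of a triangle in `Γ_2`. -/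
theorem isIso (v : ExtPotential R n) (v' : ExtPotential R' n) : R.IsIso R' := by
  obtain ⟨F, hF, hp, hv⟩ := v.exists_iso_map v'
  obtain ⟨F', hF', hp', hv'⟩ := v'.exists_iso_map v
  refine ⟨{ toFun := F, invFun := F', left_inv := fun r => ?_, right_inv := fun r => ?_,
            contMDiff_toFun := hF, contMDiff_invFun := hF' }, hp, fun z r => ?_, fun r s h => ?_⟩
  · have h1 := nerve₁_arrow (R.proj r)
    refine (v.isPotential (.mk 1) 0 1).injective (x := nerve₁ (R.proj r))
      ((hp' _).trans ((hp r).trans h1.symm)) h1.symm ?_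
    rw [hv' _ 0 1 _ (by decide) ((hp r).trans h1.symm), hv _ 0 1 _ (by decide) h1.symm]
  · have h1 := nerve₁_arrow (R'.proj r)
    refine (v'.isPotential (.mk 1) 0 1).injective (x := nerve₁ (R'.proj r))
      ((hp _).trans ((hp' r).trans h1.symm)) h1.symm ?_
    rw [hv _ 0 1 _ (by decide) ((hp' r).trans h1.symm), hv' _ 0 1 _ (by decide) h1.symm]
  · have h1 := nerve₁_arrow (R.proj r)
    have h2 := (hp r).trans h1.symm
    have h3 := (R.proj_smul z r).trans h1.symm
    refine (v'.isPotential (.mk 1) 0 1).injective (x := nerve₁ (R.proj r))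
      ((hp _).trans h3) ((R'.proj_smul _ _).trans h2) ?_
    refine (hv _ 0 1 _ (by decide) h3).trans ?_
    refine ((v.isPotential (.mk 1) 0 1).smul _ z r h1.symm).trans ?_
    refine Eq.trans ?_ ((v'.isPotential (.mk 1) 0 1).smul _ z (F r) h2).symm
    exact congrArg _ (hv _ 0 1 _ (by decide) h1.symm).symm
  · have e : G.str.src (R.proj r) = G.str.tgt (R.proj s) := by rw [R.src_proj, R.tgt_proj, h]
    have hr := (nerve₂_arrow₀₁ e).symm
    have hs := (nerve₂_arrow₁₂ e).symm
    have hr' := (hp r).trans hr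
    have hs' := (hp s).trans hs
    refine (v'.isPotential (.mk 2) 0 2).injective (x := nerve₂ (R.proj r) (R.proj s))
      ((hp _).trans (proj_mul_eq hr hs)) (proj_mul_eq hr' hs') ?_
    refine (hv _ 0 2 _ (by decide) (proj_mul_eq hr hs)).trans ?_
    refine (v.val_mul _ 0 1 2 r s hr hs).trans ?_
    refine Eq.trans ?_ (v'.val_mul _ 0 1 2 (F r) (F s) hr' hs').symm
    exact congrArg₂ _ (hv _ 0 1 _ (by decide) hr).symm (hv _ 1 2 _ (by decide) hs).symm

theorem of_isIso (v : ExtPotential R n) (h : R.IsIso R') : Nonempty (ExtPotential R' n) := by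
  obtain ⟨e, h1, h2, h3⟩ := h.symm
  exact ⟨{
    val := fun x a b r => v.val x a b (e r)
    isPotential := fun p a b => by
      refine IsPotential.of_sections (fun x z r hr => ?_) fun x => ?_
      · rw [h2, (v.isPotential p a b).smul _ _ _ ((h1 r).trans hr)]
      · obtain ⟨r, hr⟩ := R'.exists_proj_eq (x.arrow (a, b))
        obtain ⟨V, hx, σ, -⟩ := exists_sectionAlong (P := R'.toCircleBundle)
          (contMDiff_arrow p (a, b)) (fun _ => rfl) hr
        obtain ⟨g, hg, hs⟩ := σ.smooth
        obtain ⟨s, hs, hs'⟩ := (v.isPotential p a b).exists_section V (fun x => e (σ.toFun x))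
          ⟨fun a => e (g a), fun x => congrArg e (hg x), e.contMDiff.comp_contMDiffOn hs⟩
          fun x => (h1 _).trans (σ.proj_toFun x)
        exact ⟨V, σ, s, hx, hs, hs'⟩
    val_map := fun φ x a b r hr => v.val_map φ x a b _ ((h1 r).trans hr)
    val_mul := fun x a b c r s hr hs => by
      rw [h3, v.val_mul x a b c _ _ ((h1 r).trans hr) ((h1 s).trans hs)]
      rw [← R'.src_proj, ← R'.tgt_proj, hr, hs, x.composable] }⟩

/-! #### Tensor products -/

/-- The product of `r` and `r'` is the point of `R''` whose potential is the sum of theirs. -/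
theorem isTensor (v : ExtPotential R n) (v' : ExtPotential R' n')
    (v'' : ExtPotential R'' (n + n')) : R.IsTensor R' R'' := by
  let D : Set (R.total × R'.total) := {z | R.proj z.1 = R'.proj z.2}
  have hy : SmoothInto (((𝓡 G.n).prod (𝓡 1)).prod ((𝓡 G.n).prod (𝓡 1))) D
      (fun z : R.total × R'.total => nerve₁ (R.proj z.1)) :=
    smoothInto_nerve₁ (R.contMDiff_proj.comp contMDiff_fst).contMDiffOn
  have hne : ∀ z : R.total × R'.total, ∃ _ : R''.total, True := fun z =>
    ⟨(R''.exists_proj_eq (R.proj z.1)).choose, trivial⟩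
  choose F₀ _ using hne
  obtain ⟨F, h1, h2⟩ := (v''.isPotential (.mk 1) 0 1).exists_lift hy F₀
    (fun z hz => ((v.isPotential (.mk 1) 0 1).smoothVal hy hz (F := Prod.fst)
      contMDiffWithinAt_fst fun r _ => (nerve₁_arrow _).symm).add
        ((v'.isPotential (.mk 1) 0 1).smoothVal hy hz (F := Prod.snd)
      contMDiffWithinAt_snd fun r hr => Eq.trans (Eq.symm hr) (nerve₁_arrow _).symm))
  have hp : ∀ r r', R.proj r = R'.proj r' → R''.proj (F (r, r')) = R.proj r :=
    fun r r' h => (h2 (r, r') h).1.trans (nerve₁_arrow _)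
  have hv : ∀ {p : SimplexCategory} (x : G.Nerve p) a b r r', a ≤ b → R.proj r = R'.proj r' →
      R.proj r = x.arrow (a, b) →
        v''.val x a b (F (r, r')) = v.val x a b r + v'.val x a b r' := by
    intro p x a b r r' hab h hr
    refine edge_induction (motive := fun x a b => v''.val x a b (F (r, r')) =
      v.val x a b r + v'.val x a b r') (h2 (r, r') h).2 ?_ x a b hab hr
    intro p q φ x a b hg h'
    rw [← v''.val_map φ x a b _ ((hp r r' h).trans hg.symm), ← v.val_map φ x a b _ hg.symm,
      ← v'.val_map φ x a b _ (h.symm.trans hg.symm), h', map_add]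
  refine ⟨fun r r' => F (r, r'), h1, hp, fun z w r r' h => ?_, fun r s r' s' h h' e => ?_⟩
  · have e1 := (nerve₁_arrow (R.proj r)).symm
    have e2 := h.symm.trans e1
    have h3 : R.proj (z • r) = R'.proj (w • r') := by rw [R.proj_smul, R'.proj_smul, h]
    have e3 := (R.proj_smul z r).trans e1
    refine (v''.isPotential (.mk 1) 0 1).injective (x := nerve₁ (R.proj r))
      ((hp _ _ h3).trans e3) (((R''.proj_smul _ _).trans (hp _ _ h)).trans e1) ?_
    refine (hv _ 0 1 _ _ (by decide) h3 e3).trans ?_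
    refine Eq.trans ?_ ((v''.isPotential (.mk 1) 0 1).smul _ (z * w) _ ((hp _ _ h).trans e1)).symm
    rw [(v.isPotential (.mk 1) 0 1).smul _ z r e1, (v'.isPotential (.mk 1) 0 1).smul _ w r' e2,
      hv _ 0 1 _ _ (by decide) h e1, fibι_mul]
    abel
  · have e' : G.str.src (R.proj r) = G.str.tgt (R.proj s) := by rw [R.src_proj, R.tgt_proj, e]
    have hr := (nerve₂_arrow₀₁ e').symm
    have hs := (nerve₂_arrow₁₂ e').symm
    have hr' := h.symm.trans hr
    have hs' := h'.symm.trans hs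
    have h3 : R.proj (R.str.mul r s) = R'.proj (R'.str.mul r' s') := by
      rw [proj_mul_eq hr hs, proj_mul_eq hr' hs']
    have hr'' := (hp _ _ h).trans hr
    have hs'' := (hp _ _ h').trans hs
    refine (v''.isPotential (.mk 2) 0 2).injective (x := nerve₂ (R.proj r) (R.proj s))
      ((hp _ _ h3).trans (proj_mul_eq hr hs)) (proj_mul_eq hr'' hs'') ?_
    refine (hv _ 0 2 _ _ (by decide) h3 (proj_mul_eq hr hs)).trans ?_
    refine Eq.trans ?_ (v''.val_mul _ 0 1 2 _ _ hr'' hs'').symm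
    rw [v.val_mul _ 0 1 2 r s hr hs, v'.val_mul _ 0 1 2 r' s' hr' hs',
      hv _ 0 1 _ _ (by decide) h hr, hv _ 1 2 _ _ (by decide) h' hs]
    abel

/-- Each point of `R''` is some `μ r r'`, and its potential is declared to be the sum of those of
`r` and `r'`. -/
theorem of_isTensor (v : ExtPotential R n) (v' : ExtPotential R' n') (h : R.IsTensor R' R'') :
    Nonempty (ExtPotential R'' (n + n')) := by
  classical
  obtain ⟨μ, hμ, h1, h2, h3⟩ := h
  have hex : ∀ r'' : R''.total, ∃ (r : R.total) (r' : R'.total), R.proj r = R''.proj r'' ∧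
      R'.proj r' = R''.proj r'' ∧ μ r r' = r'' := by
    intro r''
    obtain ⟨r, hr⟩ := R.exists_proj_eq (R''.proj r'')
    obtain ⟨r', hr'⟩ := R'.exists_proj_eq (R''.proj r'')
    obtain ⟨z, hz⟩ := CircleBundle.exists_smul_eq
      (((h1 r r' (hr.trans hr'.symm)).trans hr).symm : R''.proj r'' = R''.proj (μ r r'))
    refine ⟨z • r, r', (R.proj_smul _ _).trans hr, hr', ?_⟩
    rw [← one_smul Circle r', h2 z 1 r r' (hr.trans hr'.symm), mul_one, hz]
  choose F F' hF hF' hFF' using hex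
  -- Two factorizations of a point differ by `z` on one factor and its inverse on the other, so the
  -- sum of the potentials is unchanged.
  have key : ∀ {p : SimplexCategory} (x : G.Nerve p) a b r r', R.proj r = x.arrow (a, b) →
      R'.proj r' = x.arrow (a, b) → v.val x a b (F (μ r r')) + v'.val x a b (F' (μ r r')) =
        v.val x a b r + v'.val x a b r' := by
    intro p x a b r r' hr hr'
    have h4 := hr.trans hr'.symm
    obtain ⟨z, hz⟩ := CircleBundle.exists_smul_eq ((hF (μ r r')).trans (h1 r r' h4))
    obtain ⟨z', hz'⟩ := CircleBundle.exists_smul_eq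
      ((hF' (μ r r')).trans ((h1 r r' h4).trans h4))
    have h5 := hFF' (μ r r')
    rw [← hz, ← hz', h2 _ _ _ _ h4] at h5
    have h6 : z * z' = 1 := CircleBundle.smul_right_cancel (h5.trans (one_smul _ _).symm)
    rw [← hz, ← hz', (v.isPotential p a b).smul _ _ _ hr, (v'.isPotential p a b).smul _ _ _ hr',
      add_add_add_comm, ← fibι_mul, h6, fibι_one, zero_add]
  exact ⟨{
    val := fun x a b r => v.val x a b (F r) + v'.val x a b (F' r)
    isPotential := fun p a b => by
      refine IsPotential.of_sections (fun x z r hr => ?_) fun x => ?_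
      · have h4 := (hF r).trans hr
        have h5 := (hF' r).trans hr
        have h6 : z • r = μ (z • F r) (F' r) := by
          have := h2 z 1 (F r) (F' r) (h4.trans h5.symm)
          rw [one_smul, mul_one, hFF'] at this
          exact this.symm
        rw [h6, key x a b _ _ ((R.proj_smul _ _).trans h4) h5,
          (v.isPotential p a b).smul _ _ _ h4, add_assoc]
      · obtain ⟨r, hr⟩ := R.exists_proj_eq (x.arrow (a, b))
        obtain ⟨V, hx, σ, -⟩ := exists_sectionAlong (P := R.toCircleBundle)
          (contMDiff_arrow p (a, b)) (fun _ => rfl) hr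
        obtain ⟨r', hr'⟩ := R'.exists_proj_eq (x.arrow (a, b))
        obtain ⟨V', hx', σ', -⟩ := exists_sectionAlong (P := R'.toCircleBundle)
          (contMDiff_arrow p (a, b)) (fun _ => rfl) hr'
        let τ := σ.restrict (inf_le_left : V ⊓ V' ≤ V)
        let τ' := σ'.restrict (inf_le_right : V ⊓ V' ≤ V')
        obtain ⟨g, hg, hgs⟩ := τ.smooth
        obtain ⟨g', hg', hgs'⟩ := τ'.smooth
        obtain ⟨s, hs, hs'⟩ := (v.isPotential p a b).exists_section _ _ τ.smooth τ.proj_toFun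
        obtain ⟨t, ht, ht'⟩ := (v'.isPotential p a b).exists_section _ _ τ'.smooth τ'.proj_toFun
        refine ⟨V ⊓ V', ⟨fun y => μ (τ.toFun y) (τ'.toFun y), ⟨fun k => μ (g k) (g' k),
          fun y => congrArg₂ μ (hg y) (hg' y), ?_⟩, fun y => ?_⟩, s + t, ⟨hx, hx'⟩, ?_, fun y => ?_⟩
        · refine hμ.comp (hgs.prodMk hgs') ?_
          rintro _ ⟨y, hy, rfl⟩
          change R.proj (g y.arrow) = R'.proj (g' y.arrow)
          rw [hg ⟨y, hy⟩, hg' ⟨y, hy⟩, τ.proj_toFun, τ'.proj_toFun]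
        · rw [h1, τ.proj_toFun]
          rw [τ.proj_toFun, τ'.proj_toFun]
        · rw [edgeVal_add, map_add, injπ', map_add]
          exact congrArg₂ _ hs ht
        · rw [fibEv_add y.2, ← hs', ← ht']
          exact key _ _ _ _ _ (τ.proj_toFun y) (τ'.proj_toFun y)
    val_map := fun φ x a b r hr => by
      rw [map_add, v.val_map φ x a b _ ((hF r).trans hr), v'.val_map φ x a b _ ((hF' r).trans hr)]
    val_mul := fun x a b c r s hr hs => by
      have hr1 := (hF r).trans hr
      have hr1' := (hF' r).trans hr
      have hs1 := (hF s).trans hs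
      have hs1' := (hF' s).trans hs
      have h4 : R''.str.mul r s = μ (R.str.mul (F r) (F s)) (R'.str.mul (F' r) (F' s)) := by
        rw [h3 _ _ _ _ (hr1.trans hr1'.symm) (hs1.trans hs1'.symm), hFF', hFF']
        rw [← R.src_proj, ← R.tgt_proj, hr1, hs1, x.composable]
      rw [h4, key x a c _ _ (proj_mul_eq hr1 hs1) (proj_mul_eq hr1' hs1'),
        v.val_mul x a b c _ _ hr1 hs1, v'.val_mul x a b c _ _ hr1' hs1']
      abel }⟩

end ExtPotential

end LieGroupoid

end

noncomputable section

/-! ### Pullbacks and gauge extensions in terms of potentials -/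

namespace LieGroupoid

variable {G G' : LieGroupoid.{u}} {p q : SimplexCategory}

namespace ExtPotential

variable {φ : Hom G' G} {R : CentralExtension G} {R' : CentralExtension G'}
  {n : G.edgeSheaf ⟶ G.injQuot}

/-- The covering map sends `r` to the point of `R` over `φ.arr (R'.proj r)` whose potential is
mapped by `φ.fibMap` to that of `r`. -/
theorem isPullback (v : ExtPotential R n) (v' : ExtPotential R' (φ.pullEdgeHom n)) :
    R.IsPullback φ R' := by
  have hy : SmoothInto ((𝓡 G'.n).prod (𝓡 1)) Set.univ (fun r : R'.total => nerve₁ (R'.proj r)) :=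
    smoothInto_nerve₁ R'.contMDiff_proj.contMDiffOn
  have hne : ∀ r : R'.total, ∃ _ : R.total, True := fun r =>
    ⟨(R.exists_proj_eq (φ.arr (R'.proj r))).choose, trivial⟩
  choose F₀ _ using hne
  obtain ⟨F, h1, h2⟩ := ((v.isPotential (.mk 1) 0 1).fibMap φ).exists_lift hy F₀
    (fun r hr => by
      have := (v'.isPotential (.mk 1) 0 1).smoothVal hy hr (F := id) contMDiffWithinAt_id
        fun r _ => (nerve₁_arrow _).symm
      rwa [edgeVal_pullEdgeHom] at this)
  have h3 : ∀ r, R.proj (F r) = φ.arr (R'.proj r) := fun r =>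
    (h2 r trivial).1.trans (congrArg φ.arr (nerve₁_arrow _))
  have hv : ∀ {p : SimplexCategory} (x : G'.Nerve p) a b r, a ≤ b → R'.proj r = x.arrow (a, b) →
      φ.fibMap x (v.val (φ.nerveMap x) a b (F r)) = v'.val x a b r := by
    intro p x a b r hab hr
    refine edge_induction (motive := fun x a b =>
      φ.fibMap x (v.val (φ.nerveMap x) a b (F r)) = v'.val x a b r) (h2 r trivial).2 ?_ x a b hab hr
    intro p q ψ x a b hg h
    have h4 := v.val_map ψ (φ.nerveMap x) a b (F r) ((h3 r).trans (congrArg φ.arr hg.symm))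
    rw [← v'.val_map ψ x a b _ hg.symm, ← h, ← h4]
    exact φ.fibMap_fibPull ψ x _
  have hw := fun p a b => (v.isPotential p a b).fibMap φ
  refine ⟨F, contMDiffOn_univ.1 h1, h3, fun z r => ?_, fun r s h => ?_⟩
  · have h1 := (nerve₁_arrow (R'.proj r)).symm
    have h2 := (h3 r).trans (congrArg φ.arr h1)
    have h4 := (R'.proj_smul z r).trans h1
    refine (hw (.mk 1) 0 1).injective (x := nerve₁ (R'.proj r))
      ((h3 _).trans (congrArg φ.arr h4)) ((R.proj_smul _ _).trans h2) ?_
    refine (hv _ 0 1 _ (by decide) h4).trans ?_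
    refine ((v'.isPotential (.mk 1) 0 1).smul _ z r h1).trans ?_
    refine Eq.trans ?_ ((hw (.mk 1) 0 1).smul _ z (F r) h2).symm
    exact congrArg _ (hv _ 0 1 _ (by decide) h1).symm
  · have e : G'.str.src (R'.proj r) = G'.str.tgt (R'.proj s) := by rw [R'.src_proj, R'.tgt_proj, h]
    have hr := (nerve₂_arrow₀₁ e).symm
    have hs := (nerve₂_arrow₁₂ e).symm
    have hr' : R.proj (F r) = (φ.nerveMap (nerve₂ (R'.proj r) (R'.proj s))).arrow (0, 1) :=
      (h3 r).trans (congrArg φ.arr hr)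
    have hs' : R.proj (F s) = (φ.nerveMap (nerve₂ (R'.proj r) (R'.proj s))).arrow (1, 2) :=
      (h3 s).trans (congrArg φ.arr hs)
    refine (hw (.mk 2) 0 2).injective (x := nerve₂ (R'.proj r) (R'.proj s))
      ((h3 _).trans (congrArg φ.arr (proj_mul_eq hr hs))) (proj_mul_eq hr' hs') ?_
    refine (hv _ 0 2 _ (by decide) (proj_mul_eq hr hs)).trans ?_
    refine (v'.val_mul _ 0 1 2 r s hr hs).trans ?_
    refine Eq.trans ?_ (congrArg _ (v.val_mul _ 0 1 2 (F r) (F s) hr' hs').symm)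
    rw [map_add]
    exact congrArg₂ _ (hv _ 0 1 _ (by decide) hr).symm (hv _ 1 2 _ (by decide) hs).symm

/-- Potentials of `R` are transported along the covering map `F` and then to the fibres of `G'`. -/
theorem of_isPullback (v : ExtPotential R n) (h : R.IsPullback φ R') :
    Nonempty (ExtPotential R' (φ.pullEdgeHom n)) := by
  obtain ⟨F, hF, h1, h2, h3⟩ := h
  have hw := fun p a b => (v.isPotential p a b).fibMap φ
  have hp : ∀ {p : SimplexCategory} {x : G'.Nerve p} {a b r}, R'.proj r = x.arrow (a, b) →
      R.proj (F r) = (φ.nerveMap x).arrow (a, b) := fun h => (h1 _).trans (congrArg φ.arr h)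
  exact ⟨{
    val := fun x a b r => φ.fibMap x (v.val (φ.nerveMap x) a b (F r))
    isPotential := fun p a b => by
      refine IsPotential.of_sections (fun x z r hr => ?_) fun x => ?_
      · rw [h2]
        exact (hw p a b).smul _ _ _ (hp hr)
      · obtain ⟨r, hr⟩ := R'.exists_proj_eq (x.arrow (a, b))
        obtain ⟨V, hx, σ, -⟩ := exists_sectionAlong (P := R'.toCircleBundle)
          (contMDiff_arrow p (a, b)) (fun _ => rfl) hr
        obtain ⟨g, hg, hs⟩ := σ.smooth
        obtain ⟨s, hs, hs'⟩ := (hw p a b).exists_section V (fun x => F (σ.toFun x))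
          ⟨fun a => F (g a), fun x => congrArg F (hg x), hF.comp_contMDiffOn hs⟩
          fun x => hp (σ.proj_toFun x)
        refine ⟨V, σ, s, hx, ?_, hs'⟩
        rw [edgeVal_pullEdgeHom]
        exact hs
    val_map := fun ψ x a b r hr => by
      rw [← v.val_map ψ (φ.nerveMap x) a b (F r) (hp hr)]
      exact (φ.fibMap_fibPull ψ x _).symm
    val_mul := fun x a b c r s hr hs => by
      rw [h3, v.val_mul _ a b c _ _ (hp hr) (hp hs), map_add]
      rw [← R'.src_proj, ← R'.tgt_proj, hr, hs, x.composable] }⟩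

end ExtPotential

/-! #### Gauge extensions -/

section Gauge

variable {R : CentralExtension G} {L : CircleBundle (n := G.m) G.M} {n : G.vertexSheaf ⟶ G.injQuot}

theorem contMDiff_vertex (p : SimplexCategory) (a : Fin (p.len + 1)) :
    ContMDiff (G.pairsModel p) (𝓡 G.m) ∞ (fun k : Pairs p → G.Γ => G.str.src (k (a, a))) :=
  G.str.src_submersion.contMDiff.comp (contMDiff_arrow p (a, a))

theorem src_eq_vertex {x : G.Nerve p} {a b : Fin (p.len + 1)} {r : R.total}
    (hr : R.proj r = x.arrow (a, b)) : R.str.src r = x.vertex b := by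
  rw [← R.src_proj, hr, x.src_arrow]

theorem tgt_eq_vertex {x : G.Nerve p} {a b : Fin (p.len + 1)} {r : R.total}
    (hr : R.proj r = x.arrow (a, b)) : R.str.tgt r = x.vertex a := by
  rw [← R.tgt_proj, hr, x.tgt_arrow]

/-- On the edge from `b` to `a` the class of `R` is the difference of the classes at the two
vertices. Adding the potential of `r` to that of a point `l` over `b` gives a lift over `a`, and
this lift is the point `r l`. -/
theorem ExtPotential.isGaugeExtension (v : ExtPotential R (G.edgeι ≫ n))
    (w : BundlePotential L n) : R.IsGaugeExtension L := by
  let D : Set (R.total × L.total) := {z | R.str.src z.1 = L.proj z.2}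
  have hy : SmoothInto (((𝓡 G.n).prod (𝓡 1)).prod ((𝓡 G.m).prod (𝓡 1))) D
      (fun z : R.total × L.total => nerve₁ (R.proj z.1)) :=
    smoothInto_nerve₁ (R.contMDiff_proj.comp contMDiff_fst).contMDiffOn
  have hc : edgeVal (G.edgeι ≫ n) (.mk 1) 0 1 + vertexVal n (.mk 1) 1 = vertexVal n (.mk 1) 0 := by
    rw [edgeVal_edgeι, sub_add_cancel]
  obtain ⟨F, h1, h2⟩ := (w.isPotential (.mk 1) 0).exists_lift hy Prod.snd (fun z hz => by
    have h := ((v.isPotential (.mk 1) 0 1).smoothVal hy hz (F := Prod.fst)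
      contMDiffWithinAt_fst fun r _ => (nerve₁_arrow _).symm).add
        ((w.isPotential (.mk 1) 1).smoothVal hy hz (F := Prod.snd)
      contMDiffWithinAt_snd fun r hr =>
        (Eq.symm hr).trans (src_eq_vertex (nerve₁_arrow (R.proj r.1)).symm))
    rwa [hc] at h)
  have hp : ∀ r l, R.str.src r = L.proj l → L.proj (F (r, l)) = R.str.tgt r := fun r l h =>
    (h2 (r, l) h).1.trans (tgt_eq_vertex (nerve₁_arrow (R.proj r)).symm).symm
  have hv : ∀ {p : SimplexCategory} (x : G.Nerve p) a b r l, a ≤ b → R.str.src r = L.proj l →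
      R.proj r = x.arrow (a, b) → w.val x a (F (r, l)) = v.val x a b r + w.val x b l := by
    intro p x a b r l hab h hr
    refine edge_induction (motive := fun x a b => w.val x a (F (r, l)) =
      v.val x a b r + w.val x b l) (h2 (r, l) h).2 ?_ x a b hab hr
    intro p q φ x a b hg h'
    rw [← w.val_map φ x a _ ((hp r l h).trans (tgt_eq_vertex (x := x.map φ) hg.symm)),
      ← v.val_map φ x a b _ hg.symm,
      ← w.val_map φ x b _ (h.symm.trans (src_eq_vertex (x := x.map φ) hg.symm)), h', map_add]
  have hone : ∀ l, R.str.src (R.str.one (L.proj l)) = L.proj l := fun l => R.str.src_one _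
  have hmul : ∀ r s l, R.str.src r = R.str.tgt s → R.str.src s = L.proj l →
      F (R.str.mul r s, l) = F (r, F (s, l)) := by
    intro r s l h hl
    have e : G.str.src (R.proj r) = G.str.tgt (R.proj s) := by rw [R.src_proj, R.tgt_proj, h]
    have hr := (nerve₂_arrow₀₁ e).symm
    have hs := (nerve₂_arrow₁₂ e).symm
    have hl' : R.str.src (R.str.mul r s) = L.proj l := (R.str.src_mul _ _ h).trans hl
    have hsl : R.str.src r = L.proj (F (s, l)) := h.trans (hp s l hl).symm
    refine (w.isPotential (.mk 2) 0).injective (x := nerve₂ (R.proj r) (R.proj s))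
      ((hp _ _ hl').trans (tgt_eq_vertex (proj_mul_eq hr hs)))
      ((hp _ _ hsl).trans (tgt_eq_vertex hr)) ?_
    refine (hv _ 0 2 _ _ (by decide) hl' (proj_mul_eq hr hs)).trans ?_
    refine Eq.trans ?_ (hv _ 0 1 _ _ (by decide) hsl hr).symm
    rw [v.val_mul _ 0 1 2 r s hr hs, hv _ 1 2 _ _ (by decide) hl hs, add_assoc]
  refine ⟨fun r l => F (r, l), h1, hp, fun l => ?_, hmul, fun z r l h => ?_, fun z r l h => ?_⟩
  · have e1 := (nerve₁_arrow (R.proj (R.str.one (L.proj l)))).symm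
    have h3 := hmul (R.str.one (L.proj l)) (R.str.one (L.proj l)) l
      ((hone l).trans (R.str.tgt_one _).symm) (hone l)
    have h4 := R.str.mul_one (R.str.one (L.proj l))
    rw [hone] at h4
    rw [h4] at h3
    have h5 := (hp _ _ (hone l)).trans (R.str.tgt_one _)
    refine (w.isPotential (.mk 1) 1).injective (x := nerve₁ (R.proj (R.str.one (L.proj l))))
      (h5.trans ((hone l).symm.trans (src_eq_vertex e1)))
      ((hone l).symm.trans (src_eq_vertex e1)) ?_
    -- Unit arrows are idempotent, so `1 l` and `1 (1 l)` have the same potential; cancelling that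
    -- of the unit arrow leaves the equality of the potentials of `l` and `1 l`.
    have h6 := congrArg (w.val (nerve₁ (R.proj (R.str.one (L.proj l)))) 0) h3
    rw [hv _ 0 1 _ _ (by decide) (hone l) e1,
      hv _ 0 1 _ _ (by decide) ((hone l).trans h5.symm) e1] at h6
    exact (add_left_cancel h6).symm
  · have e1 := (nerve₁_arrow (R.proj r)).symm
    have h3 : R.str.src r = L.proj (z • l) := by rw [L.proj_smul, h]
    refine (w.isPotential (.mk 1) 0).injective (x := nerve₁ (R.proj r))
      ((hp _ _ h3).trans (tgt_eq_vertex e1))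
      (((L.proj_smul _ _).trans (hp _ _ h)).trans (tgt_eq_vertex e1)) ?_
    refine (hv _ 0 1 _ _ (by decide) h3 e1).trans ?_
    refine Eq.trans ?_
      ((w.isPotential (.mk 1) 0).smul _ z _ ((hp _ _ h).trans (tgt_eq_vertex e1))).symm
    rw [(w.isPotential (.mk 1) 1).smul _ z l (h.symm.trans (src_eq_vertex e1)),
      hv _ 0 1 _ _ (by decide) h e1]
    abel
  · have e1 := (nerve₁_arrow (R.proj r)).symm
    have e2 := (R.proj_smul z r).trans e1
    have h3 : R.str.src (z • r) = L.proj l := by rw [← R.src_proj, R.proj_smul, R.src_proj, h]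
    refine (w.isPotential (.mk 1) 0).injective (x := nerve₁ (R.proj r))
      ((hp _ _ h3).trans (tgt_eq_vertex e2))
      (((L.proj_smul _ _).trans (hp _ _ h)).trans (tgt_eq_vertex e1)) ?_
    refine (hv _ 0 1 _ _ (by decide) h3 e2).trans ?_
    refine Eq.trans ?_
      ((w.isPotential (.mk 1) 0).smul _ z _ ((hp _ _ h).trans (tgt_eq_vertex e1))).symm
    rw [(v.isPotential (.mk 1) 0 1).smul _ z r e1, hv _ 0 1 _ _ (by decide) h e1, add_assoc]

/-- The potential of `r` is that of `r l` minus that of `l`, for any `l` over the source.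
Equivariance of the action in `l` makes this independent of `l`, and associativity of the action
makes it multiplicative. -/
theorem BundlePotential.of_isGaugeExtension (w : BundlePotential L n) (h : R.IsGaugeExtension L) :
    Nonempty (ExtPotential R (G.edgeι ≫ n)) := by
  obtain ⟨α, hα, h1, -, h3, h4, h5⟩ := h
  choose l hl using fun x : G.M => L.exists_proj_eq x
  have hr' : ∀ {p : SimplexCategory} {x : G.Nerve p} {a b : Fin (p.len + 1)} {r : R.total}
      {k : L.total}, R.proj r = x.arrow (a, b) → L.proj k = x.vertex b → R.str.src r = L.proj k :=
    fun hr hk => (src_eq_vertex hr).trans hk.symm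
  have hp : ∀ {p : SimplexCategory} {x : G.Nerve p} {a b : Fin (p.len + 1)} {r : R.total}
      {k : L.total}, R.proj r = x.arrow (a, b) → L.proj k = x.vertex b →
      L.proj (α r k) = x.vertex a :=
    fun hr hk => (h1 _ _ (hr' hr hk)).trans (tgt_eq_vertex hr)
  have key : ∀ {p : SimplexCategory} (x : G.Nerve p) (a b : Fin (p.len + 1)) (r : R.total)
      (k : L.total), R.proj r = x.arrow (a, b) → L.proj k = x.vertex b →
      w.val x a (α r (l (x.vertex b))) - w.val x b (l (x.vertex b)) =
        w.val x a (α r k) - w.val x b k := by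
    intro p x a b r k hr hk
    obtain ⟨z, hz⟩ := CircleBundle.exists_smul_eq ((hl _).trans hk.symm)
    rw [← hz, h4 z r k (hr' hr hk), (w.isPotential p a).smul _ _ _ (hp hr hk),
      (w.isPotential p b).smul _ _ _ hk]
    abel
  exact ⟨{
    val := fun x a b r => w.val x a (α r (l (x.vertex b))) - w.val x b (l (x.vertex b))
    isPotential := fun p a b => by
      refine IsPotential.of_sections (fun x z r hr => ?_) fun x => ?_
      · rw [h5 z r _ (hr' hr (hl _)), (w.isPotential p a).smul _ _ _ (hp hr (hl _)), add_sub_assoc]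
      · obtain ⟨r, hr⟩ := R.exists_proj_eq (x.arrow (a, b))
        obtain ⟨V, hx, σ, -⟩ := exists_sectionAlong (P := R.toCircleBundle)
          (contMDiff_arrow p (a, b)) (fun _ => rfl) hr
        obtain ⟨V', hx', σ', -⟩ := exists_sectionAlong (P := L) (f := fun x => x.vertex b)
          (contMDiff_vertex p b) (fun _ => rfl) (hl (x.vertex b))
        let τ := σ.restrict (inf_le_left : V ⊓ V' ≤ V)
        let τ' := σ'.restrict (inf_le_right : V ⊓ V' ≤ V')
        obtain ⟨g, hg, hgs⟩ := τ.smooth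
        obtain ⟨g', hg', hgs'⟩ := τ'.smooth
        obtain ⟨s, hs, hs'⟩ := (w.isPotential p a).exists_section (V ⊓ V')
          (fun y => α (τ.toFun y) (τ'.toFun y))
          ⟨fun k => α (g k) (g' k), fun y => congrArg₂ α (hg y) (hg' y), by
            refine hα.comp (hgs.prodMk hgs') ?_
            rintro _ ⟨y, hy, rfl⟩
            change R.str.src (g y.arrow) = L.proj (g' y.arrow)
            rw [hg ⟨y, hy⟩, hg' ⟨y, hy⟩]
            exact hr' (τ.proj_toFun _) (τ'.proj_toFun _)⟩
          fun y => hp (τ.proj_toFun _) (τ'.proj_toFun _)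
        obtain ⟨t, ht, ht'⟩ := (w.isPotential p b).exists_section _ _ τ'.smooth τ'.proj_toFun
        refine ⟨V ⊓ V', τ, s - t, ⟨hx, hx'⟩, ?_, fun y => ?_⟩
        · rw [edgeVal_edgeι, map_sub, injπ', map_sub]
          exact congrArg₂ _ hs ht
        · rw [fibEv_sub y.2, ← hs', ← ht']
          exact key _ _ _ _ _ (τ.proj_toFun y) (τ'.proj_toFun y)
    val_map := fun φ x a b r hr => by
      rw [map_sub, w.val_map φ x a _ (hp (x := x.map φ) hr (hl _)),
        w.val_map φ x b (l ((x.map φ).vertex b)) (hl _)]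
      rfl
    val_mul := fun x a b c r s hr hs => by
      have hk := hl (x.vertex c)
      rw [key x a b r _ hr (hp hs hk), h3 r s _ _ (hr' hs hk), sub_add_sub_cancel]
      rw [← R.src_proj, ← R.tgt_proj, hr, hs, x.composable] }⟩

end Gauge

end LieGroupoid

end

noncomputable section

/-! ### Potentials from maps on local sections -/

namespace LieGroupoid

variable {G : LieGroupoid.{u}} {p q : SimplexCategory}

theorem injπ'_add {U : G.SimplicialOpen} (s t : G.inj.obj.obj (op U)) :
    injπ' (s + t) = injπ' s + injπ' t := map_add _ _ _

theorem fibPull_fibEv (φ : q ⟶ p) {V : Opens (G.Nerve q)} {x : G.Nerve p} (hx : x.map φ ∈ V)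
    (s : G.inj.obj.obj (op ⟨q, V⟩)) :
    fibPull φ x (fibEv (x.map φ) s) = fibEv x (G.inj.obj.map (overHom φ V).op s) := by
  obtain ⟨e, rfl⟩ := exists_secRes_eq s
  rw [fibEv_secRes_top hx, fibPull_mk, ← secRes_topMap]
  exact (fibEv_secRes_top (U := opensMap φ V) hx _).symm

/-- A compatible family of maps from the local sections of `R` to local lifts of `n`. -/
structure SectionMap (R : CentralExtension G) (n : G.edgeSheaf ⟶ G.injQuot) where
  ρ : ∀ (U : G.SimplicialOpen) (a b : Fin (U.deg.len + 1)), R.Section U a b → G.inj.obj.obj (op U)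
  ρ_map : ∀ (U V : G.SimplicialOpen) (h : V ⟶ U) (a b : Fin (U.deg.len + 1))
    (σ : R.Section U a b)
    (τ : R.Section V (h.operator.toOrderHom a) (h.operator.toOrderHom b)),
    (∀ x, τ.toFun x = σ.toFun (LieGroupoid.SimplicialOpen.Hom.toFun h x)) →
      ρ V _ _ τ = G.inj.obj.map h.op (ρ U a b σ)
  ρ_smul : ∀ (U : G.SimplicialOpen) (a b : Fin (U.deg.len + 1))
    (f : LieGroupoid.circleSections U) (σ τ : R.Section U a b),
    (∀ x, τ.toFun x = f.1 x • σ.toFun x) → ρ U a b τ = injι' (circleSec f) + ρ U a b σ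
  ρ_mul : ∀ (U : G.SimplicialOpen) (a b c : Fin (U.deg.len + 1)) (σ : R.Section U a b)
    (τ : R.Section U b c) (υ : R.Section U a c),
    (∀ x, υ.toFun x = R.str.mul (σ.toFun x) (τ.toFun x)) →
      ρ U a c υ = ρ U a b σ + ρ U b c τ
  ρ_π : ∀ (U : G.SimplicialOpen) (a b : Fin (U.deg.len + 1)) (σ : R.Section U a b),
    injπ' (ρ U a b σ) = n.hom.app (op U) (edgeSec U a b)

section

variable {R : CentralExtension G} {V W : Opens (G.Nerve p)} {a b c : Fin (p.len + 1)}

/-- Local sections of `R` along an arrow. -/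
abbrev ArrowSection (R : CentralExtension G) (V : Opens (G.Nerve p)) (a b : Fin (p.len + 1)) :=
  SectionAlong R.toCircleBundle (fun x : G.Nerve p => x.arrow (a, b)) V

def ArrowSection.toSection (σ : ArrowSection R V a b) : R.Section ⟨p, V⟩ a b :=
  ⟨σ.toFun, σ.smooth, σ.proj_toFun⟩

def ArrowSection.comap {V : Opens (G.Nerve q)} {a b : Fin (q.len + 1)} (σ : ArrowSection R V a b)
    (φ : q ⟶ p) : ArrowSection R (opensMap φ V) (φ.toOrderHom a) (φ.toOrderHom b) :=
  ⟨fun y => σ.toFun ⟨y.1.map φ, y.2⟩, σ.smooth.comp_operator φ, fun _ => σ.proj_toFun _⟩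

theorem exists_arrowSection {x : G.Nerve p} {r : R.total} (hr : R.proj r = x.arrow (a, b)) :
    ∃ (V : Opens (G.Nerve p)) (hx : x ∈ V) (σ : ArrowSection R V a b), σ.toFun ⟨x, hx⟩ = r :=
  exists_sectionAlong (P := R.toCircleBundle) (contMDiff_arrow p (a, b)) (fun _ => rfl) hr

def ArrowSection.mul (σ : ArrowSection R V a b) (τ : ArrowSection R V b c) :
    ArrowSection R V a c where
  toFun y := R.str.mul (σ.toFun y) (τ.toFun y)
  smooth := by
    obtain ⟨g, hg, hs⟩ := σ.smooth
    obtain ⟨g', hg', hs'⟩ := τ.smooth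
    refine ⟨fun k => R.str.mul (g k) (g' k), fun y => congrArg₂ R.str.mul (hg y) (hg' y), ?_⟩
    refine R.str.contMDiffOn_mul.comp (hs.prodMk hs') ?_
    rintro _ ⟨y, hy, rfl⟩
    change R.str.src (g y.arrow) = R.str.tgt (g' y.arrow)
    rw [hg ⟨y, hy⟩, hg' ⟨y, hy⟩, ← R.src_proj, ← R.tgt_proj, σ.proj_toFun, τ.proj_toFun,
      y.composable]
  proj_toFun y := proj_mul_eq (σ.proj_toFun y) (τ.proj_toFun y)

end

/-- Each pair of vertices gets a potential from `exists_isPotential`. Its values are computed by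
local sections, so compatibility with operators and products is inherited from `ρ`. -/
theorem SectionMap.nonempty_extPotential {R : CentralExtension G} {n : G.edgeSheaf ⟶ G.injQuot}
    (ρ : SectionMap R n) : Nonempty (ExtPotential R n) := by
  choose w hw hw' using fun (p : SimplexCategory) (a b : Fin (p.len + 1)) =>
    exists_isPotential (P := R.toCircleBundle) (f := fun x : G.Nerve p => x.arrow (a, b))
      (contMDiff_arrow p (a, b)) (fun _ => rfl) (edgeVal n p a b)
      (fun V σ => ρ.ρ ⟨p, V⟩ a b (ArrowSection.toSection σ))
      (fun V W h σ => ρ.ρ_map ⟨p, V⟩ ⟨p, W⟩ (SimplicialOpen.incl h) a b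
        (ArrowSection.toSection σ) (ArrowSection.toSection (σ.restrict h)) fun _ => rfl)
      (fun V z σ τ h => ρ.ρ_smul ⟨p, V⟩ a b z (ArrowSection.toSection σ)
        (ArrowSection.toSection τ) h)
      (fun V σ => by
        rw [ρ.ρ_π, edgeVal, ← secRes_naturality, secRes_edgeSec])
  refine ⟨⟨fun {p} x a b r => w p a b x r, hw, fun {p q} φ x a b r hr => ?_,
    fun {p} x a b c r s hr hs => ?_⟩⟩
  · obtain ⟨V, hx, σ, rfl⟩ := exists_arrowSection (x := x.map φ) hr
    have h1 := hw' q a b V σ ⟨x.map φ, hx⟩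
    have h2 := hw' p _ _ _ (ArrowSection.comap σ φ) ⟨x, hx⟩
    have h3 := ρ.ρ_map ⟨q, V⟩ ⟨p, opensMap φ V⟩ (overHom φ V) a b (ArrowSection.toSection σ)
      (ArrowSection.toSection (ArrowSection.comap σ φ)) fun _ => rfl
    rw [h1, fibPull_fibEv φ hx]
    exact (congrArg (fibEv x) h3).symm.trans h2.symm
  · obtain ⟨V, hx, σ, rfl⟩ := exists_arrowSection hr
    obtain ⟨V', hx', τ, rfl⟩ := exists_arrowSection hs
    let σ' : ArrowSection R (V ⊓ V') a b := σ.restrict inf_le_left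
    let τ' : ArrowSection R (V ⊓ V') b c := τ.restrict inf_le_right
    have h1 := hw' p a b _ σ' ⟨x, hx, hx'⟩
    have h2 := hw' p b c _ τ' ⟨x, hx, hx'⟩
    have h3 := hw' p a c _ (ArrowSection.mul σ' τ') ⟨x, hx, hx'⟩
    have h4 := ρ.ρ_mul ⟨p, V ⊓ V'⟩ a b c (ArrowSection.toSection σ') (ArrowSection.toSection τ')
      (ArrowSection.toSection (ArrowSection.mul σ' τ')) fun _ => rfl
    rw [h4, fibEv_add (show x ∈ V ⊓ V' from ⟨hx, hx'⟩), ← h1, ← h2] at h3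
    exact h3

/-- Integrates pointwise potentials to sections of `inj`. Identities between such sections hold
because both sides have the same image in `injQuot` and the same values in all fibres. -/
theorem ExtPotential.nonempty_sectionMap {R : CentralExtension G} {n : G.edgeSheaf ⟶ G.injQuot}
    (v : ExtPotential R n) : Nonempty (SectionMap R n) := by
  have key : ∀ (p : SimplexCategory) (V : Opens (G.Nerve p)) (a b : Fin (p.len + 1))
      (σ : R.Section ⟨p, V⟩ a b), ∃ s : G.inj.obj.obj (op ⟨p, V⟩),
        injπ' s = n.hom.app (op ⟨p, V⟩) (edgeSec ⟨p, V⟩ a b) ∧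
          ∀ x : V, v.val x.1 a b (σ.toFun x) = fibEv x.1 s := by
    intro p V a b σ
    obtain ⟨s, hs, hs'⟩ := (v.isPotential p a b).exists_section V σ.toFun σ.smooth σ.proj_toFun
    refine ⟨s, hs.trans ?_, hs'⟩
    rw [edgeVal, ← secRes_naturality, secRes_edgeSec]
  choose ρ hρ hρ' using key
  refine ⟨⟨fun U a b σ => ρ U.deg U.set a b σ, ?_, ?_, ?_, fun U a b σ => hρ U.deg U.set a b σ⟩⟩
  · rintro ⟨p, U⟩ ⟨q, V⟩ h a b σ τ hτ
    refine fibEv_ext ?_ fun x hx => ?_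
    · rw [hρ]
      refine Eq.trans ?_ (section_naturality G.injπ.hom h _).symm
      refine Eq.trans ?_ (congrArg _ (hρ p U a b σ).symm)
      refine Eq.trans ?_ (section_naturality n.hom h _)
      exact congrArg _ (edgeSec_map h a b).symm
    · rw [← hρ' q V _ _ τ ⟨x, hx⟩, hτ]
      obtain ⟨k, hk⟩ : ∃ k : (⟨q, V⟩ : G.SimplicialOpen) ⟶ ⟨q, opensMap h.operator U⟩,
          h = k ≫ overHom h.operator U ∧ k.operator = 𝟙 q :=
        ⟨⟨𝟙 q, fun y hy => h.mem y hy⟩, SimplicialOpen.Hom.ext (Category.comp_id _).symm, rfl⟩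
      have h1 := v.val_map h.operator x a b (σ.toFun ⟨x.map h.operator, h.mem x hx⟩)
        (σ.proj_toFun _)
      refine h1.symm.trans ?_
      rw [hρ' p U a b σ ⟨x.map h.operator, h.mem x hx⟩, fibPull_fibEv h.operator (h.mem x hx)]
      -- The site morphism `h` is the restriction to `V` of the operator on the full preimage of
      -- `U`; `fibPull_fibEv` covers only the latter.
      have h2 : V ≤ opensMap h.operator U := fun y hy => h.mem y hy
      have h3 : secRes G.inj h2 (G.inj.obj.map (overHom h.operator U).op (ρ p U a b σ)) =
          G.inj.obj.map h.op (ρ p U a b σ) := by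
        refine (section_map_comp G.inj.obj _ _ _).trans ?_
        exact congrArg (fun k : (⟨q, V⟩ : G.SimplicialOpen) ⟶ ⟨p, U⟩ =>
          G.inj.obj.map k.op (ρ p U a b σ)) (SimplicialOpen.Hom.ext (Category.comp_id h.operator))
      rw [← h3, fibEv_secRes hx]
  · rintro ⟨p, U⟩ a b f σ τ hτ
    refine fibEv_ext ?_ fun x hx => ?_
    · refine ((hρ p U a b τ).trans (hρ p U a b σ).symm).trans (Eq.trans ?_ (injπ'_add _ _).symm)
      rw [injπ'_injι', zero_add]
    · rw [fibEv_add hx, fibEv_injι' hx, ← hρ' p U a b τ ⟨x, hx⟩, ← hρ' p U a b σ ⟨x, hx⟩, hτ]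
      exact (v.isPotential p a b).smul x _ _ (σ.proj_toFun _)
  · rintro ⟨p, U⟩ a b c σ τ υ hυ
    refine fibEv_ext ?_ fun x hx => ?_
    · refine (hρ p U a c υ).trans (Eq.trans ?_ (injπ'_add _ _).symm)
      refine Eq.trans ?_ (congrArg₂ (· + ·) (hρ p U a b σ) (hρ p U b c τ)).symm
      refine Eq.trans ?_ (map_add _ _ _)
      exact congrArg _ (edgeSec_add ⟨p, U⟩ a b c).symm
    · rw [fibEv_add hx, ← hρ' p U a c υ ⟨x, hx⟩, ← hρ' p U a b σ ⟨x, hx⟩, ← hρ' p U b c τ ⟨x, hx⟩,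
        hυ]
      exact v.val_mul x a b c _ _ (σ.proj_toFun _) (τ.proj_toFun _)

/-! #### Existence of potentials -/

section Existence

variable (R : CentralExtension G)

/-- Multiplicative trivializations of `R` over the arrows of a composable sequence. -/
structure Triv (x : G.Nerve p) where
  val : Fin (p.len + 1) → Fin (p.len + 1) → R.total → Additive Circle
  smul : ∀ a b (z : Circle) r, R.proj r = x.arrow (a, b) →
    val a b (z • r) = Additive.ofMul z + val a b r
  mul : ∀ a b c r s, R.proj r = x.arrow (a, b) → R.proj s = x.arrow (b, c) →
    val a c (R.str.mul r s) = val a b r + val b c s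

variable {R}

def Triv.map {x : G.Nerve p} (t : Triv R x) (φ : q ⟶ p) : Triv R (x.map φ) where
  val a b r := t.val (φ.toOrderHom a) (φ.toOrderHom b) r
  smul _ _ := t.smul _ _
  mul _ _ _ := t.mul _ _ _

theorem smul_mul' {r s : R.total} (z : Circle) (h : R.str.src r = R.str.tgt s) :
    R.str.mul (z • r) s = z • R.str.mul r s := by
  have := R.smul_mul_smul z 1 r s h
  rwa [one_smul, mul_one] at this

theorem mul_smul' {r s : R.total} (z : Circle) (h : R.str.src r = R.str.tgt s) :
    R.str.mul r (z • s) = z • R.str.mul r s := by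
  have := R.smul_mul_smul 1 z r s h
  rwa [one_smul, one_mul] at this

/-- Over a single composable sequence every central extension is trivial. With chosen points `τ a`
over the arrows from the vertex `0`, an element `r` from `b` to `a` satisfies `r τ_b = z τ_a` for a
unique `z`, and `z` is its coordinate; centrality and associativity give multiplicativity. -/
theorem nonempty_triv (x : G.Nerve p) : Nonempty (Triv R x) := by
  classical
  choose τ hτ using fun a : Fin (p.len + 1) => R.exists_proj_eq (x.arrow (a, 0))
  have hst : ∀ {a b c r s}, R.proj r = x.arrow (a, b) → R.proj s = x.arrow (b, c) →
      R.str.src r = R.str.tgt s := fun hr hs => by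
    rw [← R.src_proj, ← R.tgt_proj, hr, hs, x.composable]
  have h1 : ∀ a b r, ∃ z : Circle, R.proj r = x.arrow (a, b) →
      R.str.mul r (τ b) = z • τ a := by
    intro a b r
    by_cases hr : R.proj r = x.arrow (a, b)
    · obtain ⟨z, hz⟩ := CircleBundle.exists_smul_eq
        ((proj_mul_eq hr (hτ b)).trans (hτ a).symm)
      exact ⟨z, fun _ => hz.symm⟩
    · exact ⟨1, fun h => absurd h hr⟩
  choose t ht using h1
  refine ⟨⟨fun a b r => Additive.ofMul (t a b r), fun a b z r hr => ?_,
    fun a b c r s hr hs => ?_⟩⟩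
  · have h2 : t a b (z • r) = z * t a b r := by
      refine CircleBundle.smul_right_cancel (P := R.toCircleBundle) (r := τ a) ?_
      rw [← ht a b _ ((R.proj_smul z r).trans hr), mul_smul, ← ht a b r hr,
        smul_mul' z (hst hr (hτ b))]
    exact congrArg Additive.ofMul h2
  · have h2 : t a c (R.str.mul r s) = t a b r * t b c s := by
      refine CircleBundle.smul_right_cancel (P := R.toCircleBundle) (r := τ a) ?_
      rw [← ht a c _ (proj_mul_eq hr hs), R.str.mul_assoc _ _ _ (hst hr hs) (hst hs (hτ c)),
        ht b c s hs, mul_smul' _ (hst hr (hτ b)), ht a b r hr, smul_smul, mul_comm]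
    exact congrArg Additive.ofMul h2

variable (R)

/-- The presheaf of functions on the trivializations of `R`. -/
def trivPresheaf : G.SimplicialOpenᵒᵖ ⥤ AddCommGrpCat.{u} where
  obj U := AddCommGrpCat.of ((Σ x : U.unop.set, Triv R x.1) → Additive Circle)
  map h := AddCommGrpCat.ofHom
    { toFun := fun f k => f ⟨SimplicialOpen.Hom.toFun h.unop k.1, k.2.map h.unop.operator⟩
      map_zero' := rfl
      map_add' := fun _ _ => rfl }
  map_id _ := rfl
  map_comp _ _ := rfl

/-- Embeds smooth functions as those that do not depend on the trivialization. No smoothness is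
imposed on the larger presheaf, so nothing obstructs evaluating trivializations on sections of `R`.
-/
def circleToTriv : G.simplicialCircleSheaf.obj ⟶ trivPresheaf R where
  app _ := AddCommGrpCat.ofHom
    { toFun := fun f k => Additive.ofMul (circleVal f k.1)
      map_zero' := rfl
      map_add' := fun _ _ => rfl }
  naturality _ _ _ := rfl

/-- A function on `U` can be recovered because there is a trivialization over every point. -/
instance : Mono (circleToTriv R) := by
  rw [NatTrans.mono_iff_mono_app]
  intro U
  rw [AddCommGrpCat.mono_iff_injective]
  intro f g h
  refine circleVal_ext (U := U.unop) fun x => ?_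
  exact congrFun h ⟨x, (nonempty_triv x.1).some⟩

/-- A local section of `R` defines the function sending a trivialization to the coordinate of the
section. Scalars and products become sums in `trivPresheaf`, which contains `S¹`. Since `inj` is
injective also as a presheaf, `injι` extends to `trivPresheaf`, and the images of the sections of
`R` are the required lifts; their classes modulo `S¹` glue to `n`. -/
theorem exists_sectionMap : ∃ n, Nonempty (SectionMap R n) := by
  let k : trivPresheaf R ⟶ G.inj.obj := Injective.factorThru G.injι.hom (circleToTriv R)
  have hk : circleToTriv R ≫ k = G.injι.hom := Injective.comp_factorThru _ _
  let ev : ∀ (U : G.SimplicialOpen) (a b : Fin (U.deg.len + 1)), R.Section U a b →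
      (trivPresheaf R).obj (op U) := fun U a b σ k => k.2.val a b (σ.toFun k.1)
  let ρ : ∀ (U : G.SimplicialOpen) (a b : Fin (U.deg.len + 1)), R.Section U a b →
      G.inj.obj.obj (op U) := fun U a b σ => k.app (op U) (ev U a b σ)
  have ρ_map : ∀ (U V : G.SimplicialOpen) (h : V ⟶ U) (a b : Fin (U.deg.len + 1))
      (σ : R.Section U a b)
      (τ : R.Section V (h.operator.toOrderHom a) (h.operator.toOrderHom b)),
      (∀ x, τ.toFun x = σ.toFun (LieGroupoid.SimplicialOpen.Hom.toFun h x)) →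
        ρ V _ _ τ = G.inj.obj.map h.op (ρ U a b σ) := by
    intro U V h a b σ τ hτ
    refine Eq.trans ?_ (section_naturality k h _)
    exact congrArg (k.app (op V)) (funext fun y => congrArg (y.2.val _ _) (hτ y.1))
  have ρ_smul : ∀ (U : G.SimplicialOpen) (a b : Fin (U.deg.len + 1))
      (f : LieGroupoid.circleSections U) (σ τ : R.Section U a b),
      (∀ x, τ.toFun x = f.1 x • σ.toFun x) → ρ U a b τ = injι' (circleSec f) + ρ U a b σ := by
    intro U a b f σ τ hτ
    have h1 : injι' (circleSec f) = k.app (op U) ((circleToTriv R).app (op U) (circleSec f)) :=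
      (ConcreteCategory.congr_hom (NatTrans.congr_app hk (op U)) (circleSec f)).symm
    rw [h1, ← map_add]
    refine congrArg (k.app (op U)) (funext fun y => ?_)
    exact (congrArg (y.2.val _ _) (hτ y.1)).trans (y.2.smul a b _ _ (σ.proj_toFun y.1))
  have ρ_mul : ∀ (U : G.SimplicialOpen) (a b c : Fin (U.deg.len + 1)) (σ : R.Section U a b)
      (τ : R.Section U b c) (υ : R.Section U a c),
      (∀ x, υ.toFun x = R.str.mul (σ.toFun x) (τ.toFun x)) →
        ρ U a c υ = ρ U a b σ + ρ U b c τ := by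
    intro U a b c σ τ υ hυ
    refine Eq.trans ?_ (map_add (k.app (op U)).hom _ _)
    refine congrArg (k.app (op U)) (funext fun y => ?_)
    exact (congrArg (y.2.val _ _) (hυ y.1)).trans
      (y.2.mul a b c _ _ (σ.proj_toFun y.1) (τ.proj_toFun y.1))
  -- Sections along the same arrow differ by a smooth function, which dies in `injQuot`; so their
  -- common image depends only on the arrow.
  have huniq : ∀ {p : SimplexCategory} {V : Opens (G.Nerve p)} {a b : Fin (p.len + 1)}
      (σ τ : R.Section ⟨p, V⟩ a b), injπ' (ρ ⟨p, V⟩ a b σ) = injπ' (ρ ⟨p, V⟩ a b τ) := by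
    intro p V a b σ τ
    obtain ⟨f, hf⟩ := exists_circleSection_smul (P := R.toCircleBundle) σ.smooth τ.smooth
      fun x => (τ.proj_toFun x).trans (σ.proj_toFun x).symm
    rw [ρ_smul ⟨p, V⟩ a b f σ τ hf, injπ'_add, injπ'_injι', zero_add]
  -- Sections of `R` exist only locally, but their images in `injQuot` are canonical and hence glue
  -- over all of `Γ_p`.
  have hex : ∀ (p : SimplexCategory) (a b : Fin (p.len + 1)), ∃ e : TopSec G.injQuot p,
      ∀ (V : Opens (G.Nerve p)) (σ : ArrowSection R V a b),
        secRes _ (le_top : V ≤ ⊤) e = injπ' (ρ ⟨p, V⟩ a b σ.toSection) := by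
    intro p a b
    obtain ⟨e, he⟩ := exists_glue G.injQuot (⊤ : Opens (G.Nerve p))
      (fun V s => ∃ σ : ArrowSection R V a b, s = injπ' (ρ ⟨p, V⟩ a b σ.toSection))
      (fun V W h s => by
        rintro ⟨σ, rfl⟩
        refine ⟨σ.restrict h, ?_⟩
        rw [← secRes_naturality]
        refine congrArg injπ' ?_
        exact (ρ_map ⟨p, V⟩ ⟨p, W⟩ (SimplicialOpen.incl h) a b _
          (ArrowSection.toSection (σ.restrict h)) fun _ => rfl).symm)
      (fun V s t _ => by
        rintro ⟨σ, rfl⟩ ⟨τ, rfl⟩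
        exact huniq _ _)
      (fun x _ => by
        obtain ⟨r, hr⟩ := R.exists_proj_eq (x.arrow (a, b))
        obtain ⟨V, hx, σ, -⟩ := exists_arrowSection hr
        exact ⟨V, le_top, hx, _, σ, rfl⟩)
    exact ⟨e, fun V σ => he V le_top _ ⟨σ, rfl⟩⟩
  choose e he using hex
  refine ⟨(EdgeFamily.ofTop e ?_ ?_).hom, ⟨⟨ρ, ρ_map, ρ_smul, ρ_mul, ?_⟩⟩⟩
  · intro p q φ a b
    refine secRes_ext _ fun x _ => ?_
    obtain ⟨r, hr⟩ := R.exists_proj_eq ((x.map φ).arrow (a, b))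
    obtain ⟨V, hx, σ, -⟩ := exists_arrowSection hr
    refine ⟨opensMap φ V, le_top, hx, ?_⟩
    rw [secRes_topMap, he q a b V σ, he p _ _ _ (ArrowSection.comap σ φ)]
    refine (section_naturality G.injπ.hom (overHom φ V) _).symm.trans (congrArg injπ' ?_)
    exact (ρ_map ⟨q, V⟩ ⟨p, opensMap φ V⟩ (overHom φ V) a b σ.toSection
      (ArrowSection.toSection (ArrowSection.comap σ φ)) fun _ => rfl).symm
  · intro p a b c
    refine secRes_ext _ fun x _ => ?_
    obtain ⟨r, hr⟩ := R.exists_proj_eq (x.arrow (a, b))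
    obtain ⟨V, hx, σ, -⟩ := exists_arrowSection hr
    obtain ⟨s, hs⟩ := R.exists_proj_eq (x.arrow (b, c))
    obtain ⟨V', hx', τ, -⟩ := exists_arrowSection hs
    let σ' : ArrowSection R (V ⊓ V') a b := σ.restrict inf_le_left
    let τ' : ArrowSection R (V ⊓ V') b c := τ.restrict inf_le_right
    refine ⟨V ⊓ V', le_top, ⟨hx, hx'⟩, ?_⟩
    rw [map_add, he p a b _ σ', he p b c _ τ', he p a c _ (ArrowSection.mul σ' τ'),
      ρ_mul ⟨p, V ⊓ V'⟩ a b c σ'.toSection τ'.toSection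
        (ArrowSection.toSection (ArrowSection.mul σ' τ')) fun _ => rfl]
    exact (map_add _ _ _).symm
  · rintro ⟨p, V⟩ a b σ
    refine Eq.trans ?_ (EdgeFamily.hom_edgeSec _ _ _ _).symm
    exact (he p a b V ⟨σ.toFun, σ.smooth, σ.proj_toFun⟩).symm

theorem exists_extPotential : ∃ n, Nonempty (ExtPotential R n) := by
  obtain ⟨n, ⟨ρ⟩⟩ := exists_sectionMap R
  exact ⟨n, ρ.nonempty_extPotential⟩

end Existence

end LieGroupoid

end

noncomputable section

/-! ### The class of the gerbe of a central extension -/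

section

variable {C : Type u} [SmallCategory C] {J : GrothendieckTopology C}

theorem section_isPullback_ext {A B D E : AbSheaf J} {p : A ⟶ B} {r : A ⟶ D} {g : B ⟶ E}
    {n : D ⟶ E} (h : CategoryTheory.IsPullback p r g n) {U : C} {x y : A.obj.obj (op U)}
    (hp : p.hom.app (op U) x = p.hom.app (op U) y) (hr : r.hom.app (op U) x = r.hom.app (op U) y) :
    x = y := by
  have h1 := h.map (sheafToPresheaf J _ ⋙ (evaluation _ _).obj (op U) ⋙ forget AddCommGrpCat.{u})
  exact (Types.isPullback_iff _ _ _ _).1 h1 |>.2.1 x y ⟨hp, hr⟩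

/-- A morphism extending one from the first term of a short exact sequence induces a morphism on
the last terms. -/
theorem exists_desc_of_shortExact {A : Type*} [Category* A] [Abelian A] {X₁ X₂ X₃ Y₁ Y₂ Y₃ : A}
    {f : X₁ ⟶ X₂} {g : X₂ ⟶ X₃} {w : f ≫ g = 0} {f' : Y₁ ⟶ Y₂} {g' : Y₂ ⟶ Y₃} (w' : f' ≫ g' = 0)
    (h : (ShortComplex.mk f g w).ShortExact) (a : X₁ ⟶ Y₁) (b : X₂ ⟶ Y₂) (e : f ≫ b = a ≫ f') :
    ∃ c : X₃ ⟶ Y₃, g ≫ c = b ≫ g' := by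
  have : Epi (ShortComplex.mk f g w).g := h.epi_g
  exact ⟨h.exact.desc (b ≫ g') (by
    change f ≫ _ = 0
    rw [← Category.assoc, e, Category.assoc, w', comp_zero]), h.exact.g_desc _ _⟩

end

namespace LieGroupoid

variable {G : LieGroupoid.{u}} {p q : SimplexCategory} {R : CentralExtension G}

/-- The pullback of `0 → S¹ → inj → injQuot → 0` along `n` is an extension of `edgeSheaf` with class
`quotClass n`. Spliced with the vertex sequence it presents the gerbe: `v` is the vertex of `Γ_0`,
and a section of `R` gives the pair of its lift in `inj` and the edge. -/
theorem ExtPotential.hasGerbeClass {n : G.edgeSheaf ⟶ G.injQuot} (v : ExtPotential R n) :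
    R.HasGerbeClass (Ext.comp (X := ZSheaf G.topology) (Y := G.edgeSheaf)
      G.edge_shortExact.extClass (quotClass n) (rfl : 1 + 1 = 2)) := by
  obtain ⟨ρ⟩ := v.nonempty_sectionMap
  have hp : CategoryTheory.IsPullback (pullback.fst G.injπ n) (pullback.snd G.injπ n) G.injπ n :=
    IsPullback.of_hasPullback _ _
  let i : G.simplicialCircleSheaf ⟶ pullback G.injπ n :=
    pullback.lift G.injι 0 (by rw [G.injι_injπ, zero_comp])
  have hi : i ≫ pullback.fst G.injπ n = G.injι := pullback.lift_fst _ _ _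
  have hi' : i ≫ pullback.snd G.injπ n = 0 := pullback.lift_snd _ _ _
  have hE := shortExact_of_isPullback G.inj_shortExact hp hi hi'
  choose t ht ht' using fun (U : G.SimplicialOpen) (a b : Fin (U.deg.len + 1))
    (σ : R.Section U a b) => section_isPullback hp (ρ.ρ U a b σ) (edgeSec U a b) (ρ.ρ_π U a b σ)
  let T : R.GerbePresentation :=
    { E := pullback G.injπ n
      K := G.edgeSheaf
      P := G.vertexSheaf
      i := i
      q := pullback.snd G.injπ n
      j := G.edgeι
      ε := G.augmentation
      w₁ := hi'
      w₂ := G.edgeι_augmentation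
      exact₁ := hE
      exact₂ := G.edge_shortExact
      v := vertexSec G.objTop 0
      ε_v := augmentation_vertexSec _ _
      ρ := t
      ρ_map := fun U V h a b σ τ hτ => by
        refine section_isPullback_ext hp ?_ ?_
        · rw [ht, section_naturality, ht]
          exact ρ.ρ_map U V h a b σ τ hτ
        · rw [ht', section_naturality, ht', edgeSec_map]
      ρ_smul := fun U a b f σ τ hτ => by
        have h1 : (pullback.fst G.injπ n).hom.app (op U) (i.hom.app (op U) (circleSec f)) =
            injι' (circleSec f) := by rw [← section_comp, hi]
        have h2 : (pullback.snd G.injπ n).hom.app (op U) (i.hom.app (op U) (circleSec f)) = 0 := by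
          rw [← section_comp, hi']
          rfl
        refine section_isPullback_ext hp ?_ ?_
        · rw [ht, map_add, ht]
          exact (ρ.ρ_smul U a b f σ τ hτ).trans (congrArg (· + ρ.ρ U a b σ) h1.symm)
        · rw [ht', map_add, ht']
          exact ((congrArg (· + edgeSec U a b) h2).trans (zero_add _)).symm
      ρ_mul := fun U a b c σ τ υ hυ => by
        refine section_isPullback_ext hp ?_ ?_
        · rw [ht, map_add, ht, ht]
          exact ρ.ρ_mul U a b c σ τ υ hυ
        · rw [ht', map_add, ht', ht', edgeSec_add]
      ρ_lift := fun U a b σ => by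
        rw [ht', edgeι_edgeSec]
        exact congrArg₂ _ (vertexSec_map (CentralExtension.vertexHom U a) 0).symm
          (vertexSec_map (CentralExtension.vertexHom U b) 0).symm }
  refine ⟨T, ?_⟩
  have h1 := extClass_naturality_mk hE G.inj_shortExact (𝟙 _) (pullback.fst G.injπ n) n
    ((Category.id_comp _).trans hi.symm) hp.w
  rw [Ext.comp_mk₀_id] at h1
  exact congrArg (fun y => Ext.comp (X := ZSheaf G.topology) (Y := G.edgeSheaf)
    G.edge_shortExact.extClass y (rfl : 1 + 1 = 2)) h1.symm

/-- Compares an arbitrary presentation with the standard one. Injectivity extends `injι` to `e : T.E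
⟶ inj`, inducing `k : T.K ⟶ injQuot`, while the section `T.v` defines `l : vertexSheaf ⟶ T.P` over
`ℤ`, inducing `f : edgeSheaf ⟶ T.K`. Then `n = f ≫ k`, and the two comparisons identify the Yoneda
products. -/
theorem exists_extPotential_of_hasGerbeClass {c : G.simplicialH 2} (h : R.HasGerbeClass c) :
    ∃ n : G.edgeSheaf ⟶ G.injQuot, Nonempty (ExtPotential R n) ∧
      c = Ext.comp (X := ZSheaf G.topology) (Y := G.edgeSheaf)
        G.edge_shortExact.extClass (quotClass n) (rfl : 1 + 1 = 2) := by
  obtain ⟨T, rfl⟩ := h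
  have : Mono T.i := T.exact₁.mono_f
  have : Mono T.j := T.exact₂.mono_f
  let e : T.E ⟶ G.inj := Injective.factorThru G.injι T.i
  have he : T.i ≫ e = G.injι := Injective.comp_factorThru _ _
  obtain ⟨k, hk⟩ := exists_desc_of_shortExact G.injι_injπ T.exact₁ (𝟙 _) e
    (he.trans (Category.id_comp _).symm)
  let l : G.vertexSheaf ⟶ T.P := vertexSheafLiftTop T.v
  have hl : l ≫ T.ε = G.augmentation := by
    refine vertexSheaf_hom_ext fun U a => ?_
    rw [section_comp, vertexSheafLiftTop_vertexSec, section_naturality, T.ε_v, ZSheaf.map_one,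
      augmentation_vertexSec]
  let f : G.edgeSheaf ⟶ T.K := T.exact₂.exact.lift (G.edgeι ≫ l) (by
    change (G.edgeι ≫ l) ≫ T.ε = 0
    rw [Category.assoc, hl, G.edgeι_augmentation])
  have hf : f ≫ T.j = G.edgeι ≫ l := T.exact₂.exact.lift_f _ _
  refine ⟨f ≫ k, SectionMap.nonempty_extPotential
    ⟨fun U a b σ => e.hom.app (op U) (T.ρ U a b σ), fun U V h a b σ τ hτ => ?_,
      fun U a b g σ τ hτ => ?_, fun U a b c σ τ υ hυ => ?_, fun U a b σ => ?_⟩, ?_⟩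
  · rw [T.ρ_map U V h a b σ τ hτ, section_naturality]
  · rw [T.ρ_smul U a b g σ τ hτ, map_add]
    refine congrArg (· + e.hom.app (op U) (T.ρ U a b σ)) ?_
    change (T.i ≫ e).hom.app (op U) (circleSec g) = _
    rw [he]
  · rw [T.ρ_mul U a b c σ τ υ hυ, map_add]
  · have h1 : T.q.hom.app (op U) (T.ρ U a b σ) = f.hom.app (op U) (edgeSec U a b) := by
      refine section_injective_of_mono T.j U ?_
      rw [T.ρ_lift, ← section_comp, hf, section_comp, edgeι_edgeSec, map_sub]
      exact congrArg₂ _ (vertexSheafLiftTop_vertexSec T.v U a).symm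
        (vertexSheafLiftTop_vertexSec T.v U b).symm
    rw [section_comp, ← h1]
    change (e ≫ G.injπ).hom.app (op U) (T.ρ U a b σ) = (T.q ≫ k).hom.app (op U) (T.ρ U a b σ)
    rw [hk]
  · have h1 := extClass_naturality_mk G.edge_shortExact T.exact₂ f l (𝟙 _) hf
      (hl.trans (Category.comp_id _).symm)
    have h2 := extClass_naturality_mk T.exact₁ G.inj_shortExact (𝟙 _) e k
      ((Category.id_comp _).trans he.symm) hk.symm
    rw [Ext.mk₀_id_comp] at h1
    rw [Ext.comp_mk₀_id] at h2
    rw [quotClass_precomp]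
    refine (congrArg₂ (fun x y => Ext.comp (X := ZSheaf G.topology) (Y := T.K)
      (Z := G.simplicialCircleSheaf) x y (rfl : 1 + 1 = 2)) h1.symm h2).trans ?_
    exact Ext.comp_assoc_of_second_deg_zero _ _ _ _

theorem hasGerbeClass_iff {c : G.simplicialH 2} : R.HasGerbeClass c ↔
    ∃ n : G.edgeSheaf ⟶ G.injQuot, Nonempty (ExtPotential R n) ∧
      c = Ext.comp (X := ZSheaf G.topology) (Y := G.edgeSheaf)
        G.edge_shortExact.extClass (quotClass n) (rfl : 1 + 1 = 2) :=
  ⟨exists_extPotential_of_hasGerbeClass, by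
    rintro ⟨n, ⟨v⟩, rfl⟩
    exact v.hasGerbeClass⟩

/-! ### The class of a circle bundle -/

variable (G) in
/-- The embedding of the sheaf `S¹` on `M` in the restriction of the injective sheaf. -/
def baseι : circleSheaf (m := G.m) G.M ⟶ G.baseFunctor.obj G.inj :=
  inv G.restrictCircle ≫ G.baseFunctor.map G.injι

theorem restrictCircle_baseι : G.restrictCircle ≫ G.baseι = G.baseFunctor.map G.injι := by
  rw [baseι, IsIso.hom_inv_id_assoc]

theorem baseι_injπ : G.baseι ≫ G.baseFunctor.map G.injπ = 0 := by
  rw [baseι, Category.assoc, ← Functor.map_comp, G.injι_injπ, Functor.map_zero, comp_zero]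

variable (G) in
-- Restriction to `M` is exact, and `restrictCircle` replaces the restricted sheaf `S¹` by the sheaf
-- of smooth functions on `M`. This sequence represents classes of circle bundles.
theorem base_shortExact :
    (ShortComplex.mk G.baseι (G.baseFunctor.map G.injπ) baseι_injπ).ShortExact := by
  refine ShortComplex.shortExact_of_iso ?_ (shortExact_map G.baseFunctor G.inj_shortExact)
  exact ShortComplex.isoMk (asIso G.restrictCircle) (Iso.refl _) (Iso.refl _)
    (restrictCircle_baseι.trans (Category.comp_id _).symm)
    ((Category.id_comp _).trans (Category.comp_id _).symm)

/-- Translates a representative on `Γ_•` into one on `M`, by compatibility of `extMap` with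
connecting classes. -/
theorem vertexComparison_quotClass (n : G.vertexSheaf ⟶ G.injQuot) :
    G.vertexComparison 1 (quotClass n) =
      (Ext.mk₀ (G.baseVertex ≫ G.baseFunctor.map n)).comp (Y := G.baseFunctor.obj G.injQuot)
        (Z := circleSheaf (m := G.m) G.M) G.base_shortExact.extClass (zero_add 1) := by
  have := extMap_comp_extClass G.baseFunctor G.inj_shortExact G.base_shortExact G.restrictCircle
    (𝟙 _) (𝟙 _) (restrictCircle_baseι.trans (Category.comp_id _).symm)
    ((Category.id_comp _).trans (Category.comp_id _).symm) G.baseVertex (Ext.mk₀ n)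
  rw [extMap_mk₀, Category.comp_id] at this
  exact this

/-- The value of the smooth function on `Γ_0` corresponding to a smooth function on `M`. -/
theorem circleVal_inv_restrictCircle {U : Opens G.M} (f : C^∞⟮𝓡 G.m, U; 𝓡 1, Circle⟯)
    (y : (G.baseInclusion.obj U).set) :
    circleVal ((inv G.restrictCircle).hom.app (op U)
      (Additive.ofMul f : Additive C^∞⟮𝓡 G.m, U; 𝓡 1, Circle⟯)) y = f ⟨y.1.vertex 0, y.2⟩ := by
  have h1 : (inv G.restrictCircle ≫ G.restrictCircle).hom.app (op U)
      (Additive.ofMul f : Additive C^∞⟮𝓡 G.m, U; 𝓡 1, Circle⟯) =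
        (Additive.ofMul f : Additive C^∞⟮𝓡 G.m, U; 𝓡 1, Circle⟯) := by
    rw [IsIso.inv_hom_id]
    rfl
  have h2 := DFunLike.congr_fun (F := C^∞⟮𝓡 G.m, U; 𝓡 1, Circle⟯) h1 ⟨y.1.vertex 0, y.2⟩
  refine Eq.trans ?_ h2
  exact congrArg (circleVal ((inv G.restrictCircle).hom.app (op U)
    (Additive.ofMul f : Additive C^∞⟮𝓡 G.m, U; 𝓡 1, Circle⟯)))
    (Subtype.ext (Nerve.const_vertex y.1).symm)

theorem baseι_apply {U : Opens G.M} (f : C^∞⟮𝓡 G.m, U; 𝓡 1, Circle⟯) :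
    G.baseι.hom.app (op U) (Additive.ofMul f : Additive C^∞⟮𝓡 G.m, U; 𝓡 1, Circle⟯) =
      injι' ((inv G.restrictCircle).hom.app (op U)
        (Additive.ofMul f : Additive C^∞⟮𝓡 G.m, U; 𝓡 1, Circle⟯)) := rfl

theorem fibEv_baseι {U : Opens G.M} (f : C^∞⟮𝓡 G.m, U; 𝓡 1, Circle⟯) {y : G.Nerve (.mk 0)}
    (hy : y ∈ (G.baseInclusion.obj U).set) :
    fibEv (U := (G.baseInclusion.obj U).set) y (G.baseι.hom.app (op U)
      (Additive.ofMul f : Additive C^∞⟮𝓡 G.m, U; 𝓡 1, Circle⟯)) =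
        fibι y (f ⟨y.vertex 0, hy⟩) := by
  rw [baseι_apply]
  refine (fibEv_injι' (U := (G.baseInclusion.obj U).set) hy _).trans (congrArg (fibι y) ?_)
  exact circleVal_inv_restrictCircle f ⟨y, hy⟩

section BundleClass

variable {L : CircleBundle (n := G.m) G.M}

/-- As for gerbes, the extension is the pullback of the restricted sequence along the section of the
quotient given by `n`, and the potential turns sections of `L` into sections of this pullback lying
over `1`. -/
theorem BundlePotential.hasClass {n : G.vertexSheaf ⟶ G.injQuot} (v : BundlePotential L n) :
    L.HasClass (G.vertexComparison 1 (quotClass n)) := by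
  let c := G.baseVertex ≫ G.baseFunctor.map n
  have hp : CategoryTheory.IsPullback (pullback.fst (G.baseFunctor.map G.injπ) c)
      (pullback.snd (G.baseFunctor.map G.injπ) c) (G.baseFunctor.map G.injπ) c :=
    IsPullback.of_hasPullback _ _
  let i : circleSheaf (m := G.m) G.M ⟶ pullback (G.baseFunctor.map G.injπ) c :=
    pullback.lift G.baseι 0 (by rw [baseι_injπ, zero_comp])
  have hi : i ≫ pullback.fst _ c = G.baseι := pullback.lift_fst _ _ _
  have hi' : i ≫ pullback.snd _ c = 0 := pullback.lift_snd _ _ _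
  have hE := shortExact_of_isPullback G.base_shortExact hp hi hi'
  have hone : ∀ U : Opens G.M, c.hom.app (op U) (ZSheaf.one _ U) =
      n.hom.app (op (G.baseInclusion.obj U)) (vertexSec (G.baseInclusion.obj U) 0) := fun U =>
    (section_comp G.baseVertex (G.baseFunctor.map n) _).trans
      (congrArg (n.hom.app (op (G.baseInclusion.obj U))) (G.baseVertex_one U))
  have hs : ∀ (U : Opens G.M) (σ : L.Section U), ∃ s : G.inj.obj.obj (op (G.baseInclusion.obj U)),
      injπ' s = n.hom.app (op (G.baseInclusion.obj U)) (vertexSec (G.baseInclusion.obj U) 0) ∧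
        ∀ y : (G.baseInclusion.obj U).set, v.val y.1 0 (σ.toFun ⟨y.1.vertex 0, y.2⟩) =
          fibEv y.1 (U := (G.baseInclusion.obj U).set) s := by
    intro U σ
    classical
    -- An extension of `σ` to all of `M` by arbitrary points of the fibres; it is smooth on `U`,
    -- which is all that `SmoothOnNerve` needs.
    let k : G.M → L.total := fun x => if h : x ∈ U then σ.toFun ⟨x, h⟩ else
      (L.exists_proj_eq x).choose
    have hk : ∀ x (hx : x ∈ U), k x = σ.toFun ⟨x, hx⟩ := fun x hx => dif_pos hx
    have hks : ContMDiffOn (𝓡 G.m) ((𝓡 G.m).prod (𝓡 1)) ∞ k U := by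
      intro x hx
      refine ContMDiffAt.contMDiffWithinAt ((contMDiffAt_subtype_iff (x := ⟨x, hx⟩)).1 ?_)
      have : (fun y : U => k y.1) = σ.toFun := funext fun y => hk y.1 y.2
      rw [this]
      exact σ.contMDiff_toFun _
    obtain ⟨s, hs, hs'⟩ := (v.isPotential (.mk 0) 0).exists_section (G.baseInclusion.obj U).set
      (fun y => σ.toFun ⟨y.1.vertex 0, y.2⟩)
      ⟨fun a => k (G.str.src (a (0, 0))), fun y => hk _ y.2, by
        refine hks.comp (contMDiff_vertex (.mk 0) 0).contMDiffOn ?_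
        rintro _ ⟨y, hy, rfl⟩
        exact hy⟩ (fun y => σ.proj_toFun _)
    refine ⟨s, hs.trans ?_, hs'⟩
    exact (secRes_naturality n (le_top : (G.baseInclusion.obj U).set ≤ ⊤) _).symm.trans
      (congrArg (n.hom.app (op (G.baseInclusion.obj U)))
        (vertexSec_map (SimplicialOpen.incl (le_top : (G.baseInclusion.obj U).set ≤ ⊤)) 0))
  choose s hs hs' using hs
  choose t ht ht' using fun (U : Opens G.M) (σ : L.Section U) =>
    section_isPullback hp (s U σ) (ZSheaf.one _ U) ((hs U σ).trans (hone U).symm)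
  refine ⟨pullback (G.baseFunctor.map G.injπ) c, i, pullback.snd _ c, hi', hE, t, ?_, ?_, ht', ?_⟩
  · intro U V j σ τ hτ
    refine section_isPullback_ext hp ?_ ?_
    · rw [ht, section_naturality, ht]
      refine fibEv_ext (U := (G.baseInclusion.obj V).set) ?_ fun y hy => ?_
      · refine (hs V τ).trans (Eq.trans ?_ (section_naturality G.injπ.hom
          (G.baseInclusion.map j) (s U σ)).symm)
        refine Eq.trans ?_ (congrArg _ (hs U σ).symm)
        refine Eq.trans ?_ (section_naturality n.hom (G.baseInclusion.map j) _)
        exact congrArg _ (vertexSec_map (G.baseInclusion.map j) 0).symm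
      · rw [← hs' V τ ⟨y, hy⟩, hτ]
        refine (hs' U σ ⟨y, leOfHom j hy⟩).trans ?_
        have h1 : (G.baseInclusion.obj V).set ≤ (G.baseInclusion.obj U).set :=
          fun y hy => leOfHom j hy
        exact (fibEv_secRes hy h1 (s U σ)).symm
    · rw [ht', section_naturality, ht', ZSheaf.map_one]
  · intro U f σ τ hτ
    have h1 : (pullback.fst _ c).hom.app (op U) (i.hom.app (op U)
        (Additive.ofMul f : Additive C^∞⟮𝓡 G.m, U; 𝓡 1, Circle⟯)) =
          G.baseι.hom.app (op U) (Additive.ofMul f : Additive C^∞⟮𝓡 G.m, U; 𝓡 1, Circle⟯) :=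
      congrArg (fun k : circleSheaf (m := G.m) G.M ⟶ G.baseFunctor.obj G.inj =>
        k.hom.app (op U) (Additive.ofMul f : Additive C^∞⟮𝓡 G.m, U; 𝓡 1, Circle⟯)) hi
    have h2 : (pullback.snd _ c).hom.app (op U) (i.hom.app (op U)
        (Additive.ofMul f : Additive C^∞⟮𝓡 G.m, U; 𝓡 1, Circle⟯)) = 0 :=
      congrArg (fun k : circleSheaf (m := G.m) G.M ⟶ ZSheaf (Opens.grothendieckTopology G.M) =>
        k.hom.app (op U) (Additive.ofMul f : Additive C^∞⟮𝓡 G.m, U; 𝓡 1, Circle⟯)) hi'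
    refine section_isPullback_ext hp ?_ ?_
    · rw [ht, map_add, ht, h1]
      refine fibEv_ext (U := (G.baseInclusion.obj U).set) ?_ fun y hy => ?_
      · refine (hs U τ).trans (Eq.trans ?_ (injπ'_add _ _).symm)
        refine (hs U σ).symm.trans (Eq.trans (zero_add _).symm ?_)
        refine congrArg (· + _) ?_
        exact (injπ'_injι' _).symm
      · refine Eq.trans ?_ (fibEv_add (U := (G.baseInclusion.obj U).set) hy _ _).symm
        rw [fibEv_baseι f hy, ← hs' U τ ⟨y, hy⟩, hτ, ← hs' U σ ⟨y, hy⟩]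
        exact (v.isPotential (.mk 0) 0).smul y _ _ (σ.proj_toFun _)
    · rw [ht', map_add, ht', h2, zero_add]
  · have h1 := extClass_naturality_mk hE G.base_shortExact (𝟙 _) (pullback.fst _ c) c
      ((Category.id_comp _).trans hi.symm) hp.w
    rw [Ext.comp_mk₀_id] at h1
    exact (vertexComparison_quotClass n).trans h1.symm

/-- The given extension is mapped to the restricted resolution: `baseι` extends to `E`, the induced
map on quotients is a section of `injQuot` over `M`, that is, some `n` on `vertexSheaf`, and the
images in `inj` of the sections of `L` form the potential. -/
theorem exists_bundlePotential_of_hasClass {a : G.baseH 1} (h : L.HasClass a) :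
    ∃ n : G.vertexSheaf ⟶ G.injQuot, Nonempty (BundlePotential L n) ∧
      a = G.vertexComparison 1 (quotClass n) := by
  obtain ⟨E, i, q, w, hE, ρ, ρ_map, ρ_smul, ρ_one, rfl⟩ := h
  -- Flasqueness replaces injectivity of the restricted sheaf: the obstruction to extending `baseι`
  -- along `i` lies in the first `Ext` group out of `ℤ`.
  have hfl : ∀ x : Ext.{u} (ZSheaf (Opens.grothendieckTopology G.M)) (G.baseFunctor.obj G.inj) 1,
      x = 0 := by
    refine ext_one_eq_zero_of_flasque _ fun U V i => ?_
    have : Mono (G.baseInclusion.map i) := ⟨fun f g h => SimplicialOpen.Hom.ext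
      ((Category.id_comp _).symm.trans ((congrArg SimplicialOpen.Hom.operator h).trans
        (Category.id_comp _)))⟩
    exact injective_section_surjective G.inj (G.baseInclusion.map i)
  obtain ⟨e', he'⟩ := Ext.contravariant_sequence_exact₁ hE _ (Ext.mk₀ G.baseι) (add_zero 1) (hfl _)
  obtain ⟨e, rfl⟩ := (Ext.mk₀_bijective _ _).2 e'
  have he : i ≫ e = G.baseι := by
    rw [Ext.mk₀_comp_mk₀] at he'
    exact (Ext.mk₀_bijective _ _).1 he'
  obtain ⟨k, hk⟩ := exists_desc_of_shortExact G.baseι_injπ hE (𝟙 _) e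
    (he.trans (Category.id_comp _).symm)
  obtain ⟨n, hn⟩ := (baseVertex_comp _).2 k
  change G.baseVertex ≫ G.baseFunctor.map n = k at hn
  refine ⟨n, ?_, ?_⟩
  -- Potentials live on `Γ_0` and `ρ` on `M`. Open subsets and sections are carried over along
  -- `Nerve.const`, and the results are restricted back along `hbase`.
  · let base : Opens (G.Nerve (.mk 0)) → Opens G.M := fun V =>
      V.comap ⟨_, Nerve.continuous_const _⟩
    have hbase : ∀ V, V ≤ (G.baseInclusion.obj (base V)).set := by
      intro V y hy
      change Nerve.const _ (y.vertex 0) ∈ V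
      rwa [Nerve.const_vertex]
    let sec : ∀ V : Opens (G.Nerve (.mk 0)),
        SectionAlong L (fun x : G.Nerve (.mk 0) => x.vertex 0) V → L.Section (base V) :=
      fun V σ =>
        { toFun := fun x => σ.toFun ⟨Nerve.const _ x.1, x.2⟩
          contMDiff_toFun := by
            obtain ⟨g, hg, hs⟩ := σ.smooth
            have h1 : ContMDiff (𝓡 G.m) (G.pairsModel (.mk 0)) ∞
                (fun x : base V => (Nerve.const (.mk 0) x.1).arrow) := fun x =>
              contMDiffWithinAt_piManifold fun _ =>
                (G.str.contMDiff_one.comp contMDiff_subtype_val) x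
            have h2 := hs.comp_contMDiff h1 fun x => ⟨_, x.2, rfl⟩
            have h3 : (fun x : base V => g (Nerve.const (.mk 0) x.1).arrow) =
                fun x : base V => σ.toFun ⟨Nerve.const _ x.1, x.2⟩ :=
              funext fun x => hg ⟨_, x.2⟩
            exact h3 ▸ h2
          proj_toFun := fun x => (σ.proj_toFun _).trans (Nerve.vertex_const _ _ _) }
    obtain ⟨w, hw, -⟩ := exists_isPotential (P := L)
      (f := fun x : G.Nerve (.mk 0) => x.vertex 0) (contMDiff_vertex (.mk 0) 0) (fun _ => rfl)
      (vertexVal n (.mk 0) 0)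
      (fun V σ => secRes G.inj (hbase V) (e.hom.app (op (base V)) (ρ (base V) (sec V σ))))
      (fun V W h σ => by
        have h1 : base W ≤ base V := fun x hx => h hx
        rw [ρ_map (base V) (base W) (homOfLE h1) (sec V σ) (sec W (σ.restrict h)) fun _ => rfl,
          section_naturality]
        exact (section_map_comp G.inj.obj (G.baseInclusion.map (homOfLE h1))
          (SimplicialOpen.incl (hbase W)) _).trans
            (section_map_comp G.inj.obj (SimplicialOpen.incl (hbase V))
              (SimplicialOpen.incl h) _).symm)
      (fun V z σ τ h => by
        let f : C^∞⟮𝓡 G.m, base V; 𝓡 1, Circle⟯ := ⟨fun x => z.1 ⟨Nerve.const _ x.1, x.2⟩, by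
          obtain ⟨g, hg, hs⟩ := z.2
          have h1 : ContMDiff (𝓡 G.m) (G.pairsModel (.mk 0)) ∞
              (fun x : base V => (Nerve.const (.mk 0) x.1).arrow) := fun x =>
            contMDiffWithinAt_piManifold fun _ =>
              (G.str.contMDiff_one.comp contMDiff_subtype_val) x
          have h2 := hs.comp_contMDiff h1 fun x => ⟨_, x.2, rfl⟩
          have h3 : (fun x : base V => g (Nerve.const (.mk 0) x.1).arrow) =
              fun x : base V => z.1 ⟨Nerve.const _ x.1, x.2⟩ := funext fun x => hg ⟨_, x.2⟩
          exact h3 ▸ h2⟩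
        rw [ρ_smul (base V) f (sec V σ) (sec V τ) fun x => h ⟨_, x.2⟩, map_add]
        refine (map_add (secRes G.inj (hbase V)) _ _).trans (congrArg (· + _) ?_)
        have h4 : e.hom.app (op (base V)) (i.hom.app (op (base V)) (Additive.ofMul f :
            Additive C^∞⟮𝓡 G.m, base V; 𝓡 1, Circle⟯)) = G.baseι.hom.app (op (base V))
              (Additive.ofMul f : Additive C^∞⟮𝓡 G.m, base V; 𝓡 1, Circle⟯) :=
          congrArg (fun k : circleSheaf (m := G.m) G.M ⟶ G.baseFunctor.obj G.inj =>
            k.hom.app (op (base V))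
              (Additive.ofMul f : Additive C^∞⟮𝓡 G.m, base V; 𝓡 1, Circle⟯)) he
        refine (congrArg (secRes G.inj (hbase V)) (h4.trans (baseι_apply f))).trans ?_
        refine (secRes_naturality G.injι (hbase V) _).symm.trans (congrArg injι' ?_)
        refine circleVal_ext fun y => ?_
        refine (circleVal_inv_restrictCircle f ⟨y.1, hbase V y.2⟩).trans ?_
        exact congrArg z.1 (Subtype.ext (Nerve.const_vertex y.1)))
      (fun V σ => by
        have h1 : G.injπ.hom.app (op (G.baseInclusion.obj (base V)))
            (e.hom.app (op (base V)) (ρ (base V) (sec V σ))) =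
              n.hom.app (op (G.baseInclusion.obj (base V)))
                (vertexSec (G.baseInclusion.obj (base V)) 0) := by
          change (e ≫ G.baseFunctor.map G.injπ).hom.app (op (base V)) (ρ (base V) (sec V σ)) = _
          rw [← hk, section_comp, ρ_one, ← hn, section_comp, G.baseVertex_one]
          rfl
        refine (secRes_naturality G.injπ (hbase V) _).trans ?_
        refine (congrArg (secRes G.injQuot (hbase V)) h1).trans ?_
        refine (secRes_naturality n (hbase V) _).symm.trans (Eq.trans ?_
          (secRes_naturality n (le_top : V ≤ ⊤) _))
        refine congrArg (n.hom.app (op ⟨.mk 0, V⟩)) ?_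
        exact (vertexSec_map (SimplicialOpen.incl (hbase V)) 0).trans
          (vertexSec_map (SimplicialOpen.incl (le_top : V ≤ ⊤)) 0).symm)
    exact ⟨BundlePotential.ofZero hw⟩
  · have h1 := extClass_naturality_mk hE G.base_shortExact (𝟙 _) e k
      ((Category.id_comp _).trans he.symm) hk.symm
    rw [Ext.comp_mk₀_id] at h1
    rw [vertexComparison_quotClass, hn]
    exact h1

end BundleClass

end LieGroupoid

end

noncomputable section

/-! ### Iterated charted spaces -/

section LocalDiffeomorphisms

variable {E H : Type*} [NormedAddCommGroup E] [NormedSpace ℝ E] [TopologicalSpace H]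
  (I : ModelWithCorners ℝ E H) (N : Type*) [TopologicalSpace N] [ChartedSpace H N]

/-- The groupoid of smooth local diffeomorphisms of a manifold. -/
def localDiffeoGroupoid : StructureGroupoid N where
  members := {e | ContMDiffOn I I ∞ e e.source ∧ ContMDiffOn I I ∞ e.symm e.target}
  trans' e e' he he' := by
    refine ⟨?_, ?_⟩
    · rw [OpenPartialHomeomorph.trans_source]
      exact he'.1.comp (he.1.mono Set.inter_subset_left) fun x hx => hx.2
    · rw [OpenPartialHomeomorph.trans_target]
      exact he.2.comp (he'.2.mono Set.inter_subset_left) fun x hx => hx.2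
  symm' e he := ⟨he.2, he.1⟩
  id_mem' := ⟨contMDiffOn_id, contMDiffOn_id⟩
  locality' e h := by
    have key : ∀ x ∈ e.source, ContMDiffAt I I ∞ e x ∧ ContMDiffAt I I ∞ e.symm (e x) := by
      intro x hx
      obtain ⟨s, hs, hxs, h1, h2⟩ := h x hx
      refine ⟨h1.contMDiffAt ((e.restr s).open_source.mem_nhds ?_),
        h2.contMDiffAt ((e.restr s).open_target.mem_nhds ((e.restr s).map_source ?_))⟩ <;>
      · rw [OpenPartialHomeomorph.restr_source' _ _ hs]
        exact ⟨hx, hxs⟩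
    refine ⟨fun x hx => (key x hx).1.contMDiffWithinAt, fun y hy => ?_⟩
    have := (key _ (e.map_target hy)).2
    rw [e.right_inv hy] at this
    exact this.contMDiffWithinAt
  mem_of_eqOnSource' e e' he h := by
    refine ⟨?_, ?_⟩
    · rw [h.source_eq]
      exact he.1.congr fun x hx => h.eqOn (h.source_eq ▸ hx)
    · rw [h.target_eq]
      exact he.2.congr fun x hx => h.symm_eqOn_target (h.target_eq.symm ▸ hx)

variable {I N} {X : Type*} [TopologicalSpace X] [ChartedSpace N X]

/-- A space with charts in a manifold `N` and smooth transition maps is a manifold through the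
charts of `N`: smooth local diffeomorphisms of `N` are local structomorphisms for the smooth
groupoid of the model. -/
theorem isManifold_comp [IsManifold I ∞ N]
    (h : ∀ e ∈ atlas N X, ∀ e' ∈ atlas N X, ContMDiffOn I I ∞ (e.symm ≫ₕ e')
      (e.symm ≫ₕ e').source) :
    @IsManifold _ _ _ _ _ _ _ I ∞ X _ (ChartedSpace.comp H N X) := by
  have : HasGroupoid X (localDiffeoGroupoid I N) :=
    ⟨fun {e e'} he he' => ⟨h e he e' he', h e' he' e he⟩⟩
  have h1 : @HasGroupoid H _ X _ (ChartedSpace.comp H N X) (contDiffGroupoid ∞ I) := by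
    refine StructureGroupoid.HasGroupoid.comp (localDiffeoGroupoid I N) fun e he => ?_
    rw [isLocalStructomorphOn_contDiffGroupoid_iff]
    exact he
  let _ := ChartedSpace.comp H N X
  exact { h1 with }

/-- Followed by a chart of `N`, the map `e` is a chart of the composite atlas; undoing the chart of
`N` shows that `e` and its inverse are smooth. -/
theorem contMDiffOn_atlas_comp [IsManifold I ∞ N]
    (hX : @IsManifold _ _ _ _ _ _ _ I ∞ X _ (ChartedSpace.comp H N X))
    {e : OpenPartialHomeomorph X N} (he : e ∈ atlas N X) :
    let _ := ChartedSpace.comp H N X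
    ContMDiffOn I I ∞ e e.source ∧ ContMDiffOn I I ∞ e.symm e.target := by
  let _ := ChartedSpace.comp H N X
  have hc : ∀ y : N, e ≫ₕ chartAt H y ∈ IsManifold.maximalAtlas I ∞ X := fun y =>
    IsManifold.subset_maximalAtlas ⟨e, he, _, chart_mem_atlas _ _, rfl⟩
  constructor
  · intro x hx
    let c := chartAt H (e x)
    have h1 := contMDiffOn_of_mem_maximalAtlas (hc (e x))
    have hxc : x ∈ (e ≫ₕ c).source := by
      rw [OpenPartialHomeomorph.trans_source]
      exact ⟨hx, mem_chart_source H (e x)⟩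
    have h2 : ContMDiffAt I I ∞ (c.symm ∘ (e ≫ₕ c)) x :=
      (((contMDiffOn_chart_symm (I := I) (n := ∞) (x := e x)).contMDiffAt
        (c.open_target.mem_nhds (mem_chart_target H (e x)))).comp x
          (h1.contMDiffAt ((e ≫ₕ c).open_source.mem_nhds hxc)))
    refine (h2.congr_of_eventuallyEq ?_).contMDiffWithinAt
    filter_upwards [(e ≫ₕ c).open_source.mem_nhds hxc] with x' hx'
    rw [OpenPartialHomeomorph.trans_source] at hx'
    exact (c.left_inv hx'.2).symm
  · intro y hy
    let c := chartAt H y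
    have h1 := contMDiffOn_symm_of_mem_maximalAtlas (hc y)
    have hyc : c y ∈ (e ≫ₕ c).target := by
      rw [OpenPartialHomeomorph.trans_target]
      refine ⟨mem_chart_target H y, ?_⟩
      change c.symm (c y) ∈ e.target
      rwa [c.left_inv (mem_chart_source H y)]
    have h2 : ContMDiffAt I I ∞ ((e ≫ₕ c).symm ∘ c) y :=
      ((h1.contMDiffAt ((e ≫ₕ c).open_target.mem_nhds hyc)).comp y
        ((contMDiffOn_chart (I := I) (n := ∞) (x := y)).contMDiffAt
          (c.open_source.mem_nhds (mem_chart_source H y))))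
    refine (h2.congr_of_eventuallyEq ?_).contMDiffWithinAt
    filter_upwards [c.open_source.mem_nhds (mem_chart_source H y)] with y' hy'
    exact congrArg e.symm (c.left_inv hy').symm

end LocalDiffeomorphisms

/-! ### Circle bundles from cocycles -/

/-- A smooth `S¹`-valued cocycle on a manifold, for a covering indexed by the points. -/
structure CircleCocycle {n : ℕ} (B : Type u) [TopologicalSpace B]
    [ChartedSpace (EuclideanSpace ℝ (Fin n)) B] where
  baseSet : B → Opens B
  mem_baseSet : ∀ b, b ∈ baseSet b
  g : B → B → B → Circle
  contMDiffOn_g : ∀ i j, ContMDiffOn (𝓡 n) (𝓡 1) ∞ (g i j) (baseSet i ∩ baseSet j)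
  mul_g : ∀ i j k b, b ∈ baseSet i → b ∈ baseSet j → b ∈ baseSet k → g i j b * g j k b = g i k b

namespace CircleCocycle

variable {n : ℕ} {B : Type u} [TopologicalSpace B] [ChartedSpace (EuclideanSpace ℝ (Fin n)) B]
  (Z : CircleCocycle (n := n) B)

theorem g_self {i b : B} (h : b ∈ Z.baseSet i) : Z.g i i b = 1 :=
  mul_eq_left.1 (Z.mul_g i i i b h h h)

/-- The covering is indexed by the points, so `indexAt` is the identity and the stored coordinate of
a point over `b` refers to the trivialization with index `b`. -/
def core : FiberBundleCore B B Circle where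
  baseSet i := Z.baseSet i
  isOpen_baseSet i := (Z.baseSet i).isOpen
  indexAt := id
  mem_baseSet_at := Z.mem_baseSet
  coordChange i j b z := z * Z.g i j b
  coordChange_self i b h z := by rw [Z.g_self h, mul_one]
  continuousOn_coordChange i j := continuousOn_snd.mul
    ((Z.contMDiffOn_g i j).continuousOn.comp continuousOn_fst fun _ hx => hx.1)
  coordChange_comp i j k b h z := by rw [mul_assoc, Z.mul_g i j k b h.1.1 h.1.2 h.2]

/-- The total space of the bundle defined by a cocycle. -/
def Total : Type u := Bundle.TotalSpace Circle Z.core.Fiber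

instance : TopologicalSpace Z.Total :=
  inferInstanceAs (TopologicalSpace (Bundle.TotalSpace Circle Z.core.Fiber))

instance : ChartedSpace (B × Circle) Z.Total :=
  inferInstanceAs (ChartedSpace (B × Circle) (Bundle.TotalSpace Circle Z.core.Fiber))

instance : ChartedSpace (ModelProd (EuclideanSpace ℝ (Fin n)) (EuclideanSpace ℝ (Fin 1))) Z.Total :=
  ChartedSpace.comp _ (B × Circle) _

def point (b : B) (z : Circle) : Z.Total := ⟨b, z⟩

def proj (r : Z.Total) : B := Bundle.TotalSpace.proj r

def coord (r : Z.Total) : Circle := Bundle.TotalSpace.snd r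

variable {Z} in
theorem ext {r s : Z.Total} (h : Z.proj r = Z.proj s) (h' : Z.coord r = Z.coord s) : r = s := by
  obtain ⟨b, z⟩ := r
  obtain ⟨b', z'⟩ := s
  obtain rfl : b = b' := h
  obtain rfl : z = z' := h'
  rfl

def triv (i : B) : OpenPartialHomeomorph Z.Total (B × Circle) :=
  (Z.core.localTriv i).toOpenPartialHomeomorph

theorem triv_mem_atlas (i : B) : Z.triv i ∈ atlas (B × Circle) Z.Total :=
  ⟨Z.core.localTriv i, ⟨i, rfl⟩, rfl⟩

instance : MulAction Circle Z.Total where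
  smul z r := Z.point (Z.proj r) (z * Z.coord r)
  one_smul _ := ext rfl (one_mul _)
  mul_smul _ _ _ := ext rfl (mul_assoc _ _ _)

theorem proj_smul (z : Circle) (r : Z.Total) : Z.proj (z • r) = Z.proj r := rfl

theorem triv_smul (i : B) (z : Circle) (r : Z.Total) :
    Z.triv i (z • r) = ((Z.triv i r).1, z * (Z.triv i r).2) :=
  Prod.ext rfl (mul_assoc _ _ _)

variable [IsManifold (𝓡 n) ∞ B]

instance : IsManifold ((𝓡 n).prod (𝓡 1)) ∞ Z.Total := by
  refine isManifold_comp ?_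
  rintro _ ⟨_, ⟨i, rfl⟩, rfl⟩ _ ⟨_, ⟨j, rfl⟩, rfl⟩
  change ContMDiffOn _ _ ∞ ((Z.triv i).symm ≫ₕ Z.triv j) ((Z.triv i).symm ≫ₕ Z.triv j).source
  have h1 : ((Z.triv i).symm ≫ₕ Z.triv j).source ⊆
      Prod.fst ⁻¹' ((Z.baseSet i : Set B) ∩ Z.baseSet j) := by
    intro q hq
    rw [OpenPartialHomeomorph.trans_source] at hq
    exact ⟨hq.1.1, hq.2⟩
  have h2 : ContMDiffOn ((𝓡 n).prod (𝓡 1)) ((𝓡 n).prod (𝓡 1)) ∞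
      (fun q : B × Circle => (q.1, q.2 * Z.g i j q.1)) ((Z.triv i).symm ≫ₕ Z.triv j).source :=
    contMDiffOn_fst.prodMk (contMDiffOn_snd.mul ((Z.contMDiffOn_g i j).comp contMDiffOn_fst h1))
  refine h2.congr fun q hq => Prod.ext rfl ?_
  change q.2 * Z.g i q.1 q.1 * Z.g q.1 j q.1 = _
  -- The transition from `i` to `j` passes through the trivialization indexed by the base point
  -- itself; the cocycle identity removes the detour.
  rw [mul_assoc, Z.mul_g i q.1 j q.1 (h1 hq).1 (Z.mem_baseSet _) (h1 hq).2]

theorem contMDiffOn_triv (i : B) : ContMDiffOn ((𝓡 n).prod (𝓡 1)) ((𝓡 n).prod (𝓡 1)) ∞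
    (Z.triv i) (Z.triv i).source :=
  (contMDiffOn_atlas_comp (I := (𝓡 n).prod (𝓡 1)) inferInstance (Z.triv_mem_atlas i)).1

theorem contMDiffOn_triv_symm (i : B) : ContMDiffOn ((𝓡 n).prod (𝓡 1)) ((𝓡 n).prod (𝓡 1)) ∞
    (Z.triv i).symm (Z.triv i).target :=
  (contMDiffOn_atlas_comp (I := (𝓡 n).prod (𝓡 1)) inferInstance (Z.triv_mem_atlas i)).2

theorem contMDiff_proj : ContMDiff ((𝓡 n).prod (𝓡 1)) (𝓡 n) ∞ Z.proj := fun r =>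
  contMDiffAt_fst.comp r ((Z.contMDiffOn_triv (Z.proj r)).contMDiffAt
    ((Z.triv (Z.proj r)).open_source.mem_nhds (Z.mem_baseSet (Z.proj r))))

/-- The principal bundle defined by a cocycle. -/
def bundle : CircleBundle (n := n) B where
  total := Z.Total
  proj := Z.proj
  contMDiff_proj := Z.contMDiff_proj
  contMDiff_smul := by
    rintro ⟨z, r⟩
    let i := Z.proj r
    have hr : r ∈ (Z.triv i).source := Z.mem_baseSet (Z.proj r)
    have h1 : ContMDiffAt ((𝓡 1).prod ((𝓡 n).prod (𝓡 1))) ((𝓡 n).prod (𝓡 1)) ∞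
        (fun q : Circle × Z.Total => Z.triv i q.2) (z, r) :=
      ((Z.contMDiffOn_triv i).contMDiffAt ((Z.triv i).open_source.mem_nhds hr)).comp
        (z, r) contMDiffAt_snd
    have h2 : ContMDiffAt ((𝓡 1).prod ((𝓡 n).prod (𝓡 1))) ((𝓡 n).prod (𝓡 1)) ∞
        (fun q : Circle × Z.Total => ((Z.triv i q.2).1, q.1 * (Z.triv i q.2).2)) (z, r) :=
      (contMDiffAt_fst.comp _ h1).prodMk (contMDiffAt_fst.mul (contMDiffAt_snd.comp _ h1))
    have h3 : ((Z.triv i r).1, z * (Z.triv i r).2) ∈ (Z.triv i).target :=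
      ⟨((Z.triv i).map_source hr).1, trivial⟩
    have h4 : ContMDiffAt ((𝓡 1).prod ((𝓡 n).prod (𝓡 1))) ((𝓡 n).prod (𝓡 1)) ∞
        (fun q : Circle × Z.Total => (Z.triv i).symm ((Z.triv i q.2).1, q.1 * (Z.triv i q.2).2))
          (z, r) :=
      ContMDiffAt.comp (z, r) ((Z.contMDiffOn_triv_symm i).contMDiffAt
        ((Z.triv i).open_target.mem_nhds h3)) h2
    refine h4.congr_of_eventuallyEq ?_
    filter_upwards [(continuous_snd.continuousAt (x := (z, r))).preimage_mem_nhds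
      ((Z.triv i).open_source.mem_nhds hr)] with q hq
    rw [← triv_smul]
    exact ((Z.triv i).left_inv (show q.1 • q.2 ∈ (Z.triv i).source from hq)).symm
  proj_smul := Z.proj_smul
  locally_trivial b := ⟨Z.baseSet b, Z.triv b, Z.mem_baseSet b, rfl, rfl, fun _ _ => rfl,
    fun z r _ => congrArg Prod.snd (Z.triv_smul b z r), Z.contMDiffOn_triv b,
    Z.contMDiffOn_triv_symm b⟩

end CircleCocycle

/-! ### The projection of a circle bundle -/

namespace CircleBundle

variable {n : ℕ} {B : Type u} [TopologicalSpace B] [ChartedSpace (EuclideanSpace ℝ (Fin n)) B]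
  [IsManifold (𝓡 n) ∞ B] (P : CircleBundle (n := n) B)
  {E H N : Type*} [NormedAddCommGroup E] [NormedSpace ℝ E] [TopologicalSpace H]
  {J : ModelWithCorners ℝ E H} [TopologicalSpace N] [ChartedSpace H N]

/-- In a local trivialization, with adapted charts for `f` and a chart of the circle, the composite
is a linear projection whose complement is enlarged by the line tangent to the circle. -/
theorem isSubmersion_comp_proj {f : B → N} (hf : Manifold.IsSubmersion (𝓡 n) J ∞ f) :
    Manifold.IsSubmersion ((𝓡 n).prod (𝓡 1)) J ∞ (fun r => f (P.proj r)) := by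
  refine Manifold.IsSubmersionOfComplement.isSubmersion
    (F := hf.complement × EuclideanSpace ℝ (Fin 1)) fun r => ?_
  obtain ⟨U, e, hb, hs, ht, h1, h2, h3, h4⟩ := P.locally_trivial (P.proj r)
  have hr : r ∈ e.source := by rw [hs]; exact hb
  have hf' := hf.isSubmersionOfComplement_complement (P.proj r)
  let χ := hf'.domChart.prod (chartAt (EuclideanSpace ℝ (Fin 1)) (e r).2)
  have hχ : χ ∈ IsManifold.maximalAtlas ((𝓡 n).prod (𝓡 1)) ∞ (B × Circle) :=
    IsManifold.mem_maximalAtlas_prod hf'.domChart_mem_maximalAtlas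
      (IsManifold.chart_mem_maximalAtlas _)
  refine Manifold.IsSubmersionAtOfComplement.mk_of_charts
    ((hf'.equiv.prodCongr (ContinuousLinearEquiv.refl ℝ (EuclideanSpace ℝ (Fin 1)))).trans
      (ContinuousLinearEquiv.prodAssoc ℝ E hf.complement (EuclideanSpace ℝ (Fin 1))))
    (e ≫ₕ χ) hf'.codChart ?_ hf'.mem_codChart_source ?_ hf'.codChart_mem_maximalAtlas ?_ ?_
  · rw [OpenPartialHomeomorph.trans_source]
    refine ⟨hr, ?_, mem_chart_source _ _⟩
    rw [h1 r hr]
    exact hf'.mem_domChart_source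
  · refine OpenPartialHomeomorph.mem_maximalAtlas_of_contMDiffOn _ ?_ ?_
    · rw [OpenPartialHomeomorph.trans_source]
      exact (contMDiffOn_of_mem_maximalAtlas hχ).comp (h3.mono Set.inter_subset_left)
        fun x hx => hx.2
    · rw [OpenPartialHomeomorph.trans_target]
      exact h4.comp ((contMDiffOn_symm_of_mem_maximalAtlas hχ).mono Set.inter_subset_left)
        fun x hx => hx.2
  · intro s hs'
    rw [OpenPartialHomeomorph.trans_source] at hs'
    refine hf'.source_subset_preimage_source ?_
    have := hs'.2.1
    rwa [h1 s hs'.1] at this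
  · rintro ⟨u, v⟩ hx
    have hx' : ((u, v) : EuclideanSpace ℝ (Fin n) × EuclideanSpace ℝ (Fin 1)) ∈
        (e ≫ₕ χ).target := by
      rw [OpenPartialHomeomorph.extend_target] at hx
      exact hx.1
    rw [OpenPartialHomeomorph.trans_target] at hx'
    have h5 : P.proj (e.symm (χ.symm (u, v))) = hf'.domChart.symm u := by
      rw [← h1 _ (e.map_target hx'.2), e.right_inv hx'.2]
      rfl
    have h6 : u ∈ (hf'.domChart.extend (𝓡 n)).target := by
      rw [OpenPartialHomeomorph.extend_target]
      exact ⟨hx'.1.1, by simp⟩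
    exact (congrArg (fun b => hf'.codChart.extend J (f b)) h5).trans (hf'.writtenInCharts h6)

end CircleBundle

/-! ### The bundle of lifts of a section -/

namespace LieGroupoid

variable {G : LieGroupoid.{u}} {p : SimplexCategory} {n : ℕ} {B : Type u} [TopologicalSpace B]
  [ChartedSpace (EuclideanSpace ℝ (Fin n)) B] [IsManifold (𝓡 n) ∞ B]

/-- Two lifts of a section of the quotient sheaf over open subsets differ by a smooth function. -/
theorem exists_transition {V V' : Opens (G.Nerve p)} {e e' : TopSec G.inj p}
    {c : TopSec G.injQuot p}
    (h : secRes G.injQuot (le_top : V ≤ ⊤) (injπ' e) = secRes G.injQuot le_top c)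
    (h' : secRes G.injQuot (le_top : V' ≤ ⊤) (injπ' e') = secRes G.injQuot le_top c) :
    ∃ g : G.Nerve p → Circle, SmoothOnNerve (𝓡 1) (V ⊓ V') (fun x => g x.1) ∧
      ∀ x ∈ V ⊓ V', fibMk x e = fibι x (g x) + fibMk x e' := by
  obtain ⟨f, hf⟩ := exists_injι' (secRes G.inj (le_top : V ⊓ V' ≤ ⊤) (e - e')) (by
    rw [injπ', secRes_naturality, map_sub, map_sub, secRes_congr inf_le_left h,
      secRes_congr inf_le_right h', sub_self])
  classical
  let g : G.Nerve p → Circle := fun x => if hx : x ∈ V ⊓ V' then circleVal f ⟨x, hx⟩ else 1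
  have hg : ∀ x : (V ⊓ V' : Opens _), g x.1 = circleVal f x := fun x => dif_pos x.2
  refine ⟨g, ?_, fun x hx => ?_⟩
  rotate_left
  · rw [hg ⟨x, hx⟩]
    exact fibMk_eq_of_secRes hx (by rw [hf, map_sub, sub_add_cancel])
  · rw [funext hg]
    exact (show circleSections ⟨p, V ⊓ V'⟩ from Additive.toMul f).2

/-- The lifts of a section of the quotient sheaf form a circle bundle. -/
theorem exists_bundle_isPotential (c : TopSec G.injQuot p) (k : (Pairs p → G.Γ) → B)
    (hk : ContMDiff (G.pairsModel p) (𝓡 n) ∞ k) (y : B → G.Nerve p)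
    (hy : SmoothInto (𝓡 n) Set.univ y)
    (hyk : ∀ x, y (k x.arrow) = x) :
    ∃ (P : CircleBundle (n := n) B) (w : ∀ x : G.Nerve p, P.total → Fib x),
      IsPotential P (fun x => k x.arrow) c w := by
  -- Around each point a lift `e b` of `c` on `V b` is chosen; the ratios of these lifts form the
  -- cocycle that defines the bundle.
  choose e V hV he using fun b => exists_nearEq_lift (y b) c
  choose g hg hge using fun i j => exists_transition (he i) (he j)
  have hyc : Continuous y := continuousOn_univ.1 fun b hb => hy.continuousWithinAt hb
  let Z : CircleCocycle (n := n) B :=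
    { baseSet := fun b => (V b).comap ⟨y, hyc⟩
      mem_baseSet := hV
      g := fun i j b => g i j (y b)
      contMDiffOn_g := fun i j b hb => by
        obtain ⟨g', hg', hs⟩ := hg i j
        have h1 : ContMDiffWithinAt (𝓡 n) (𝓡 1) ∞ (fun b => g' (y b).arrow) Set.univ b :=
          hy.comp_smooth trivial (W := V i ⊓ V j) hb hs
        refine (h1.mono (Set.subset_univ _)).congr (fun b' hb' => (hg' ⟨y b', hb'⟩).symm)
          (hg' ⟨y b, hb⟩).symm
      mul_g := fun i j k b hi hj hk => by
        refine fibι_injective (y b) (add_right_cancel (b := fibMk (y b) (e k)) ?_)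
        rw [← hge i k (y b) ⟨hi, hk⟩, hge i j (y b) ⟨hi, hj⟩, hge j k (y b) ⟨hj, hk⟩, fibι_mul,
          add_assoc] }
  -- A point over `b` with coordinate `z` in its own trivialization stands for the lift `e b`
  -- multiplied by `z`.
  refine ⟨Z.bundle, fun x r => fibι x (Z.coord r) + fibMk x (e (Z.proj r)), ?_, ?_⟩
  · intro x z r hr
    change fibι x (z * Z.coord r) + fibMk x (e (Z.proj r)) = _
    rw [fibι_mul, add_assoc]
  · intro x
    let b := k x.arrow
    have hyx : ∀ x' ∈ V b, y (k x'.arrow) ∈ V b := fun x' hx' => by rwa [hyk]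
    have hxV : x ∈ V b := by
      have := hV b
      rwa [hyk] at this
    refine ⟨V b, fun a => (Z.triv b).symm (k a, 1), e b, hxV, ?_, fun _ _ => rfl,
      ⟨V b, hxV, he b⟩, fun x' hx' => ?_⟩
    · refine (Z.contMDiffOn_triv_symm b).comp (hk.prodMk contMDiff_const).contMDiffOn ?_
      rintro _ ⟨x', hx', rfl⟩
      exact ⟨hyx x' hx', trivial⟩
    -- The point with coordinate `1` in the trivialization at `b` has coordinate `g b b'` in that at
    -- its own base point `b'`, and `hge` turns the resulting multiple of `e b'` back into `e b`.
    · change fibι x' (1 * g b (k x'.arrow) (y (k x'.arrow))) + fibMk x' (e (k x'.arrow)) = _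
      have h1 : x' ∈ V (k x'.arrow) := by
        have := hV (k x'.arrow)
        rwa [hyk] at this
      rw [one_mul, hyk, ← hge b (k x'.arrow) x' ⟨hx', h1⟩]

end LieGroupoid

end

noncomputable section

/-! ### The central extension of lifts of a section -/

namespace LieGroupoid

variable {G : LieGroupoid.{u}} {p q : SimplexCategory} {n : G.edgeSheaf ⟶ G.injQuot}

theorem eq_nerve₂ {x : G.Nerve (.mk 2)} {g h : G.Γ} (hg : g = x.arrow (0, 1))
    (hh : h = x.arrow (1, 2)) : x = nerve₂ g h := by
  have e : G.str.src g = G.str.tgt h := by rw [hg, hh]; exact x.composable 0 1 2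
  have hl := Nerve.star_arrow_last (p := .mk 2) (nerve₂_compat e) (l := 2)
    (congrArg G.str.one (G.str.src_one _).symm)
  refine Nerve.ext_last 2 fun i => Eq.trans ?_ (hl i).symm
  fin_cases i
  · rw [hg, hh]
    exact (x.mul_arrow 0 1 2).symm
  · exact hh.symm
  · refine (x.arrow_self 2).trans (congrArg G.str.one ?_)
    rw [hh]
    exact (x.src_arrow 2 2).trans (x.src_arrow 1 2).symm

section EdgePotential

variable {P : CircleBundle (n := G.n) G.Γ} (w : ∀ x : G.Nerve (.mk 1), P.total → Fib x)

/-- The family of elements of fibres over an increasing edge induced by one over `Γ_1`. -/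
def edgePot (x : G.Nerve p) (a b : Fin (p.len + 1)) (h : a ≤ b) (r : P.total) : Fib x :=
  fibPull (edgeOp a b h) x (w (x.map (edgeOp a b h)) r)

theorem edgePot_map (φ : q ⟶ p) (x : G.Nerve p) (a b : Fin (q.len + 1)) (h : a ≤ b)
    (r : P.total) : fibPull φ x (edgePot w (x.map φ) a b h r) =
      edgePot w x (φ.toOrderHom a) (φ.toOrderHom b) (φ.toOrderHom.monotone h) r := by
  have h1 : edgeOp a b h ≫ φ =
      edgeOp (φ.toOrderHom a) (φ.toOrderHom b) (φ.toOrderHom.monotone h) := by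
    ext i
    fin_cases i <;> rfl
  refine (fibPull_fibPull φ (edgeOp a b h) x _).trans ?_
  rw [edgePot, ← h1]
  rfl

variable {w} (hw : IsPotential P (fun x : G.Nerve (.mk 1) => x.arrow (0, 1))
  (edgeVal n (.mk 1) 0 1) w)

include hw

theorem IsPotential.edgePot (a b : Fin (p.len + 1)) (h : a ≤ b) :
    IsPotential P (fun x : G.Nerve p => x.arrow (a, b)) (edgeVal n p a b)
      (fun x => edgePot w x a b h) := by
  have h1 := hw.pull (edgeOp a b h)
  rw [topMap_edgeVal] at h1
  exact h1

/-- On a triangle the values of `n` on the edges `01` and `12` add up to that on `02`. Hence the sum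
of the potentials of `r` and `s` is a smooth family of lifts on the edge `02` and defines their
product. The formula on other triples `a ≤ b ≤ c` is pulled back from `Γ_2`. -/
theorem IsPotential.exists_mul : ∃ μ : P.total → P.total → P.total,
    ContMDiffOn (((𝓡 G.n).prod (𝓡 1)).prod ((𝓡 G.n).prod (𝓡 1))) ((𝓡 G.n).prod (𝓡 1)) ∞
      (fun z : P.total × P.total => μ z.1 z.2)
      {z | G.str.src (P.proj z.1) = G.str.tgt (P.proj z.2)} ∧
    (∀ r s, G.str.src (P.proj r) = G.str.tgt (P.proj s) →
      P.proj (μ r s) = G.str.mul (P.proj r) (P.proj s)) ∧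
    ∀ {p : SimplexCategory} (x : G.Nerve p) (a b c : Fin (p.len + 1)) (h : a ≤ b) (h' : b ≤ c)
      (r s : P.total), P.proj r = x.arrow (a, b) → P.proj s = x.arrow (b, c) →
        LieGroupoid.edgePot w x a c (h.trans h') (μ r s) =
          LieGroupoid.edgePot w x a b h r + LieGroupoid.edgePot w x b c h' s := by
  let D : Set (P.total × P.total) := {z | G.str.src (P.proj z.1) = G.str.tgt (P.proj z.2)}
  have hy : SmoothInto (((𝓡 G.n).prod (𝓡 1)).prod ((𝓡 G.n).prod (𝓡 1))) D
      (fun z : P.total × P.total => nerve₂ (P.proj z.1) (P.proj z.2)) :=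
    smoothInto_nerve₂ (P.contMDiff_proj.comp contMDiff_fst).contMDiffOn
      (P.contMDiff_proj.comp contMDiff_snd).contMDiffOn fun _ h => h
  obtain ⟨F, h1, h2⟩ := (hw.edgePot (p := .mk 2) 0 2 (by decide)).exists_lift hy Prod.fst
    (fun z hz => by
      have h1 := ((hw.edgePot (p := .mk 2) 0 1 (by decide)).smoothVal hy hz (F := Prod.fst)
        contMDiffWithinAt_fst fun r hr => (nerve₂_arrow₀₁ hr).symm).add
          ((hw.edgePot (p := .mk 2) 1 2 (by decide)).smoothVal hy hz (F := Prod.snd)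
        contMDiffWithinAt_snd fun r hr => (nerve₂_arrow₁₂ hr).symm)
      rw [edgeVal_add_edgeVal] at h1
      exact h1)
  refine ⟨fun r s => F (r, s), h1, fun r s h => (h2 (r, s) h).1.trans (nerve₂_arrow₀₂ h), ?_⟩
  intro p x a b c h h' r s hr hs
  have e : G.str.src (P.proj r) = G.str.tgt (P.proj s) := by rw [hr, hs, x.composable]
  have hx : x.map (triOp a b c h h') = nerve₂ (P.proj r) (P.proj s) := eq_nerve₂ hr hs
  have h3 : ∀ y, y = nerve₂ (P.proj r) (P.proj s) →
      LieGroupoid.edgePot w y 0 2 (by decide) (F (r, s)) =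
        LieGroupoid.edgePot w y 0 1 (by decide) r + LieGroupoid.edgePot w y 1 2 (by decide) s := by
    rintro _ rfl
    exact (h2 (r, s) e).2
  have h4 := congrArg (fibPull (triOp a b c h h') x) (h3 _ hx)
  rw [map_add, edgePot_map, edgePot_map, edgePot_map] at h4
  exact h4

/-- The value of `n` on the degenerate edge of `Γ_0` is zero, so the zero family is a family of
lifts; the unit is the point with potential zero. -/
theorem IsPotential.exists_one : ∃ ε : G.M → P.total, ContMDiff (𝓡 G.m) ((𝓡 G.n).prod (𝓡 1)) ∞ ε ∧
    (∀ m, P.proj (ε m) = G.str.one m) ∧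
    ∀ {p : SimplexCategory} (x : G.Nerve p) (a : Fin (p.len + 1)) (m : G.M), m = x.vertex a →
      LieGroupoid.edgePot w x a a le_rfl (ε m) = 0 := by
  have hy : SmoothInto (𝓡 G.m) Set.univ (fun m : G.M => Nerve.const (G := G) (.mk 0) m) :=
    smoothInto_const contMDiffOn_id _
  obtain ⟨F, h1, h2⟩ := (hw.edgePot (p := .mk 0) 0 0 le_rfl).exists_lift hy
    (fun m => (P.exists_proj_eq (G.str.one m)).choose) (t := fun _ => 0) (fun m _ => by
      refine ⟨fun _ => 1, contMDiffWithinAt_const, 0, ?_, ?_⟩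
      · have h3 : edgeVal n (.mk 0) 0 0 = 0 :=
          add_eq_left.1 (edgeVal_add_edgeVal n (.mk 0) 0 0 0)
        rw [h3, injπ', map_zero]
        exact NearEq.rfl
      · refine Filter.Eventually.of_forall fun m => ?_
        rw [fibι_one, map_zero, add_zero])
  refine ⟨F, contMDiffOn_univ.1 h1, fun m => (h2 m trivial).1, fun {p} x a m hm => ?_⟩
  have hx : x.map (SimplexCategory.const (.mk 0) p a) = Nerve.const (.mk 0) m := by
    rw [hm]
    exact (Nerve.const_vertex (x.map (SimplexCategory.const (.mk 0) p a))).symm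
  have h3 : ∀ y, y = Nerve.const (.mk 0) m → LieGroupoid.edgePot w y 0 0 le_rfl (F m) = 0 := by
    rintro _ rfl
    exact (h2 m trivial).2
  have h4 := congrArg (fibPull (SimplexCategory.const (.mk 0) p a) x) (h3 _ hx)
  rw [map_zero, edgePot_map] at h4
  exact h4

/-- At this stage potentials exist only for increasing edges, so an inverse cannot be read off on a
reversed edge. On the triangle formed by `g⁻¹` and `g` the equation for a left inverse is solved on
the edge `01`: its potential is that of the unit on `02` minus that of `r` on `12`. -/
theorem IsPotential.exists_inv {μ : P.total → P.total → P.total} {ε : G.M → P.total}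
    (hμ : ∀ r s, G.str.src (P.proj r) = G.str.tgt (P.proj s) →
      P.proj (μ r s) = G.str.mul (P.proj r) (P.proj s))
    (hμ' : ∀ {p : SimplexCategory} (x : G.Nerve p) (a b c : Fin (p.len + 1)) (h : a ≤ b)
      (h' : b ≤ c) (r s : P.total), P.proj r = x.arrow (a, b) → P.proj s = x.arrow (b, c) →
        LieGroupoid.edgePot w x a c (h.trans h') (μ r s) =
          LieGroupoid.edgePot w x a b h r + LieGroupoid.edgePot w x b c h' s)
    (hε : ContMDiff (𝓡 G.m) ((𝓡 G.n).prod (𝓡 1)) ∞ ε) (hε' : ∀ m, P.proj (ε m) = G.str.one m) :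
    ∃ ν : P.total → P.total, ContMDiff ((𝓡 G.n).prod (𝓡 1)) ((𝓡 G.n).prod (𝓡 1)) ∞ ν ∧
      (∀ r, P.proj (ν r) = G.str.inv (P.proj r)) ∧
      ∀ r, μ (ν r) r = ε (G.str.src (P.proj r)) := by
  have hc : ∀ g : G.Γ, G.str.src (G.str.inv g) = G.str.tgt g := G.str.src_inv
  have hy : SmoothInto ((𝓡 G.n).prod (𝓡 1)) Set.univ
      (fun r : P.total => nerve₂ (G.str.inv (P.proj r)) (P.proj r)) :=
    smoothInto_nerve₂ (G.str.contMDiff_inv.comp P.contMDiff_proj).contMDiffOn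
      P.contMDiff_proj.contMDiffOn fun r _ => hc _
  have hε₂ : ∀ r : P.total, P.proj (ε (G.str.src (P.proj r))) =
      (nerve₂ (G.str.inv (P.proj r)) (P.proj r)).arrow (0, 2) := fun r => by
    rw [hε', nerve₂_arrow₀₂ (hc _), G.str.inv_mul]
  obtain ⟨F, h1, h2⟩ := (hw.edgePot (p := .mk 2) 0 1 (by decide)).exists_lift hy id
    (fun r hr => by
      have h1 := ((hw.edgePot (p := .mk 2) 0 2 (by decide)).smoothVal hy hr
        (F := fun r : P.total => ε (G.str.src (P.proj r)))
        ((hε.comp (G.str.src_submersion.contMDiff.comp P.contMDiff_proj)) r).contMDiffWithinAt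
          fun r _ => hε₂ r).sub
          ((hw.edgePot (p := .mk 2) 1 2 (by decide)).smoothVal hy hr (F := id)
        contMDiffWithinAt_id fun r _ => (nerve₂_arrow₁₂ (hc _)).symm)
      rw [← edgeVal_add_edgeVal n (.mk 2) 0 1 2, add_sub_cancel_right] at h1
      exact h1)
  have hF : ∀ r, P.proj (F r) = G.str.inv (P.proj r) := fun r =>
    (h2 r trivial).1.trans (nerve₂_arrow₀₁ (hc _))
  refine ⟨F, contMDiffOn_univ.1 h1, hF, fun r => ?_⟩
  have e : G.str.src (P.proj (F r)) = G.str.tgt (P.proj r) := by rw [hF, hc]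
  refine (hw.edgePot (p := .mk 2) 0 2 (by decide)).injective
    (x := nerve₂ (G.str.inv (P.proj r)) (P.proj r)) ?_ (hε₂ r) ?_
  · rw [hμ _ _ e, hF, nerve₂_arrow₀₂ (hc _)]
  · refine (hμ' _ 0 1 2 (by decide) (by decide) _ _ (h2 r trivial).1
      (nerve₂_arrow₁₂ (hc _)).symm).trans ?_
    rw [(h2 r trivial).2]
    exact sub_add_cancel _ _

/-- A potential on `Γ_1` defines the structure of a central extension on a circle bundle. -/
theorem IsPotential.exists_centralExtension :
    ∃ (R : CentralExtension G) (w : ∀ x : G.Nerve (.mk 1), R.total → Fib x),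
      IsPotential R.toCircleBundle (fun x : G.Nerve (.mk 1) => x.arrow (0, 1))
        (edgeVal n (.mk 1) 0 1) w ∧
      ∀ {p : SimplexCategory} (x : G.Nerve p) (a b c : Fin (p.len + 1)) (h : a ≤ b) (h' : b ≤ c)
        (r s : R.total), R.proj r = x.arrow (a, b) → R.proj s = x.arrow (b, c) →
          LieGroupoid.edgePot (P := R.toCircleBundle) w x a c (h.trans h') (R.str.mul r s) =
            LieGroupoid.edgePot (P := R.toCircleBundle) w x a b h r +
              LieGroupoid.edgePot (P := R.toCircleBundle) w x b c h' s := by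
  obtain ⟨μ, hμs, hμ, hμ'⟩ := hw.exists_mul
  obtain ⟨ε, hεs, hε, hε'⟩ := hw.exists_one
  obtain ⟨ν, hνs, hν, hν'⟩ := hw.exists_inv hμ hμ' hεs hε
  have hsmul : ∀ r s, G.str.src (P.proj r) = G.str.tgt (P.proj s) →
      G.str.src (P.proj (μ r s)) = G.str.src (P.proj s) := fun r s h => by
    rw [hμ r s h, G.str.src_mul _ _ h]
  have htmul : ∀ r s, G.str.src (P.proj r) = G.str.tgt (P.proj s) →
      G.str.tgt (P.proj (μ r s)) = G.str.tgt (P.proj r) := fun r s h => by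
    rw [hμ r s h, G.str.tgt_mul _ _ h]
  have hassoc : ∀ r s t, G.str.src (P.proj r) = G.str.tgt (P.proj s) →
      G.str.src (P.proj s) = G.str.tgt (P.proj t) → μ (μ r s) t = μ r (μ s t) := by
    intro r s t h h'
    obtain ⟨x, hr, hs, ht⟩ := exists_nerve₃ h h'
    have hrs : P.proj (μ r s) = x.arrow (0, 2) := by
      rw [hμ r s h, ← hr, ← hs]; exact x.mul_arrow 0 1 2
    have hst : P.proj (μ s t) = x.arrow (1, 3) := by
      rw [hμ s t h', ← hs, ← ht]; exact x.mul_arrow 1 2 3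
    -- Both bracketings have the potential of `r` on `01` plus that of `s` on `12` plus that of `t`
    -- on `23`.
    refine (hw.edgePot (p := .mk 3) 0 3 (by decide)).injective (x := x) ?_ ?_ ?_
    · rw [hμ _ _ ((hsmul r s h).trans h'), hrs, ← ht]; exact x.mul_arrow 0 2 3
    · rw [hμ _ _ (h.trans (htmul s t h').symm), hst, ← hr]; exact x.mul_arrow 0 1 3
    · refine (hμ' x 0 2 3 (by decide) (by decide) _ _ hrs ht.symm).trans ?_
      refine Eq.trans ?_ (hμ' x 0 1 3 (by decide) (by decide) _ _ hr.symm hst).symm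
      rw [hμ' x 0 1 2 (by decide) (by decide) _ _ hr.symm hs.symm,
        hμ' x 1 2 3 (by decide) (by decide) _ _ hs.symm ht.symm, add_assoc]
  have hone_mul : ∀ r, μ (ε (G.str.tgt (P.proj r))) r = r := by
    intro r
    have e : G.str.src (P.proj (ε (G.str.tgt (P.proj r)))) = G.str.tgt (P.proj r) := by
      rw [hε, G.str.src_one]
    have hr := (nerve₁_arrow (P.proj r)).symm
    have hv : G.str.tgt (P.proj r) = (nerve₁ (P.proj r)).vertex 0 := by
      rw [← Nerve.tgt_arrow _ 0 1, ← hr]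
    refine (hw.edgePot (p := .mk 1) 0 1 (by decide)).injective (x := nerve₁ (P.proj r)) ?_ hr ?_
    · rw [hμ _ _ e, hε, G.str.one_mul, ← hr]
    · refine (hμ' _ 0 0 1 le_rfl (by decide) _ _ ?_ hr).trans ?_
      · rw [hε, hv]; exact (Nerve.arrow_self _ 0).symm
      · rw [hε' _ 0 _ hv, zero_add]
  have hmul_one : ∀ r, μ r (ε (G.str.src (P.proj r))) = r := by
    intro r
    have e : G.str.src (P.proj r) = G.str.tgt (P.proj (ε (G.str.src (P.proj r)))) := by
      rw [hε, G.str.tgt_one]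
    have hr := (nerve₁_arrow (P.proj r)).symm
    have hv : G.str.src (P.proj r) = (nerve₁ (P.proj r)).vertex 1 := by
      rw [← Nerve.src_arrow _ 0 1, ← hr]
    refine (hw.edgePot (p := .mk 1) 0 1 (by decide)).injective (x := nerve₁ (P.proj r)) ?_ hr ?_
    · rw [hμ _ _ e, hε, G.str.mul_one, ← hr]
    · refine (hμ' _ 0 1 1 (by decide) le_rfl _ _ hr ?_).trans ?_
      · rw [hε, hv]; exact (Nerve.arrow_self _ 1).symm
      · rw [hε' _ 1 _ hv, add_zero]
  have hmul_inv : ∀ r, μ r (ν r) = ε (G.str.tgt (P.proj r)) := by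
    intro r
    have e1 : G.str.src (P.proj (ν r)) = G.str.tgt (P.proj r) := by rw [hν, G.str.src_inv]
    have e2 : G.str.src (P.proj r) = G.str.tgt (P.proj (ν r)) := by rw [hν, G.str.tgt_inv]
    have e3 : G.str.src (P.proj (ν (ν r))) = G.str.tgt (P.proj (ν r)) := by rw [hν, G.str.src_inv]
    -- Left inverses are right inverses: the unit in front of `r r⁻¹` is written as `(r⁻¹)⁻¹ r⁻¹`
    -- and the product is regrouped.
    have h1 := hone_mul (μ r (ν r))
    rw [htmul _ _ e2, ← e1, ← hν' (ν r), hassoc _ _ _ e3 (e1.trans (htmul _ _ e2).symm),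
      ← hassoc _ _ _ e1 e2, hν', e2, hone_mul, hν', e1] at h1
    exact h1.symm
  let R : CentralExtension G :=
    { P with
      str :=
        { src := fun r => G.str.src (P.proj r)
          tgt := fun r => G.str.tgt (P.proj r)
          one := ε
          inv := ν
          mul := μ
          src_one := fun x => by rw [hε, G.str.src_one]
          tgt_one := fun x => by rw [hε, G.str.tgt_one]
          src_inv := fun r => by rw [hν, G.str.src_inv]
          tgt_inv := fun r => by rw [hν, G.str.tgt_inv]
          src_mul := hsmul
          tgt_mul := htmul
          mul_assoc := hassoc
          one_mul := hone_mul
          mul_one := hmul_one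
          inv_mul := hν'
          mul_inv := hmul_inv
          src_submersion := P.isSubmersion_comp_proj G.str.src_submersion
          tgt_submersion := P.isSubmersion_comp_proj G.str.tgt_submersion
          contMDiff_one := hεs
          contMDiff_inv := hνs
          contMDiffOn_mul := hμs }
      src_proj := fun _ => rfl
      tgt_proj := fun _ => rfl
      proj_one := hε
      proj_mul := hμ
      smul_mul_smul := fun z z' r s (h : G.str.src (P.proj r) = G.str.tgt (P.proj s)) => by
        have h' : G.str.src (P.proj (z • r)) = G.str.tgt (P.proj (z' • s)) := by
          rw [P.proj_smul, P.proj_smul, h]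
        have hr := (nerve₂_arrow₀₁ h).symm
        have hs := (nerve₂_arrow₁₂ h).symm
        have hrs : P.proj (μ r s) = (nerve₂ (P.proj r) (P.proj s)).arrow (0, 2) :=
          (hμ r s h).trans (nerve₂_arrow₀₂ h).symm
        refine (hw.edgePot (p := .mk 2) 0 2 (by decide)).injective
          (x := nerve₂ (P.proj r) (P.proj s)) ?_ ((P.proj_smul _ _).trans hrs) ?_
        · rw [← hrs, hμ _ _ h', P.proj_smul, P.proj_smul, hμ r s h]
        · refine (hμ' _ 0 1 2 (by decide) (by decide) _ _ ((P.proj_smul _ _).trans hr)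
            ((P.proj_smul _ _).trans hs)).trans ?_
          rw [(hw.edgePot (p := .mk 2) 0 1 (by decide)).smul _ _ _ hr,
            (hw.edgePot (p := .mk 2) 1 2 (by decide)).smul _ _ _ hs,
            (hw.edgePot (p := .mk 2) 0 2 (by decide)).smul _ _ _ hrs,
            hμ' _ 0 1 2 (by decide) (by decide) _ _ hr hs, fibι_mul]
          abel }
  exact ⟨R, w, hw, fun x a b c h h' r s hr hs => hμ' x a b c h h' r s hr hs⟩

end EdgePotential

/-- A multiplicative potential on `Γ_1` extends to all pairs of vertices. -/
theorem IsPotential.nonempty_extPotential {R : CentralExtension G}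
    {w : ∀ x : G.Nerve (.mk 1), R.total → Fib x}
    (hw : IsPotential R.toCircleBundle (fun x : G.Nerve (.mk 1) => x.arrow (0, 1))
      (edgeVal n (.mk 1) 0 1) w)
    (hmul : ∀ {p : SimplexCategory} (x : G.Nerve p) (a b c : Fin (p.len + 1)) (h : a ≤ b)
      (h' : b ≤ c) (r s : R.total), R.proj r = x.arrow (a, b) → R.proj s = x.arrow (b, c) →
        LieGroupoid.edgePot (P := R.toCircleBundle) w x a c (h.trans h') (R.str.mul r s) =
          LieGroupoid.edgePot (P := R.toCircleBundle) w x a b h r +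
            LieGroupoid.edgePot (P := R.toCircleBundle) w x b c h' s) :
    Nonempty (ExtPotential R n) := by
  -- For an arbitrary pair `(a, b)`, multiplying by a point `τ` over the arrow `(0, a)` moves an
  -- element into the increasing edge `(0, b)`; the potential on `(a, b)` is the difference of those
  -- of `τ r` and `τ`, independent of `τ`.
  choose τ hτ using fun {p : SimplexCategory} (x : G.Nerve p) (a : Fin (p.len + 1)) =>
    R.exists_proj_eq (x.arrow (0, a))
  let v : ∀ {p : SimplexCategory} (x : G.Nerve p) (_ : Fin (p.len + 1)), R.total → Fib x :=
    fun {p} x a r => LieGroupoid.edgePot (P := R.toCircleBundle) w x 0 a (Fin.zero_le a) r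
  have hv : ∀ (p : SimplexCategory) (a : Fin (p.len + 1)), IsPotential R.toCircleBundle
      (fun x : G.Nerve p => x.arrow (0, a)) (edgeVal n p 0 a) (fun x => v x a) :=
    fun p a => hw.edgePot 0 a (Fin.zero_le a)
  have hst : ∀ {p : SimplexCategory} {x : G.Nerve p} {a b c : Fin (p.len + 1)} {r s : R.total},
      R.proj r = x.arrow (a, b) → R.proj s = x.arrow (b, c) → R.str.src r = R.str.tgt s :=
    fun hr hs => (src_eq_vertex hr).trans (tgt_eq_vertex hs).symm
  have key : ∀ {p : SimplexCategory} (x : G.Nerve p) (a b : Fin (p.len + 1)) (r t t' : R.total),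
      R.proj r = x.arrow (a, b) → R.proj t = x.arrow (0, a) → R.proj t' = x.arrow (0, a) →
        v x b (R.str.mul t r) - v x a t = v x b (R.str.mul t' r) - v x a t' := by
    intro p x a b r t t' hr ht ht'
    obtain ⟨z, rfl⟩ := CircleBundle.exists_smul_eq (ht.trans ht'.symm)
    rw [smul_mul' _ (hst ht' hr), (hv p b).smul _ _ _ (proj_mul_eq ht' hr),
      (hv p a).smul _ _ _ ht', add_sub_add_left_eq_sub]
  refine ⟨{
    val := fun x a b r => v x b (R.str.mul (τ x a) r) - v x a (τ x a)
    isPotential := fun p a b => ?_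
    val_map := fun {p q} φ x a b r hr => ?_
    val_mul := fun {p} x a b c r s hr hs => ?_ }⟩
  · refine IsPotential.of_sections (fun x z r hr => ?_) fun x => ?_
    · rw [mul_smul' _ (hst (hτ x a) hr), (hv p b).smul _ _ _ (proj_mul_eq (hτ x a) hr),
        add_sub_assoc]
    · obtain ⟨r, hr⟩ := R.exists_proj_eq (x.arrow (a, b))
      obtain ⟨V, hx, σ, -⟩ := LieGroupoid.exists_sectionAlong (P := R.toCircleBundle)
        (contMDiff_arrow p (a, b)) (fun _ => rfl) hr
      obtain ⟨V', hx', σ', -⟩ := LieGroupoid.exists_sectionAlong (P := R.toCircleBundle)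
        (contMDiff_arrow p (0, a)) (fun _ => rfl) (hτ x a)
      let ρ := σ.restrict (inf_le_left : V ⊓ V' ≤ V)
      let ρ' := σ'.restrict (inf_le_right : V ⊓ V' ≤ V')
      obtain ⟨g, hg, hgs⟩ := ρ.smooth
      obtain ⟨g', hg', hgs'⟩ := ρ'.smooth
      obtain ⟨s, hs, hs'⟩ := (hv p b).exists_section (V ⊓ V')
        (fun y => R.str.mul (ρ'.toFun y) (ρ.toFun y))
        ⟨fun k => R.str.mul (g' k) (g k), fun y => congrArg₂ _ (hg' y) (hg y), by
          refine R.str.contMDiffOn_mul.comp (hgs'.prodMk hgs) ?_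
          rintro _ ⟨y, hy, rfl⟩
          change R.str.src (g' y.arrow) = R.str.tgt (g y.arrow)
          rw [hg ⟨y, hy⟩, hg' ⟨y, hy⟩]
          exact hst (ρ'.proj_toFun _) (ρ.proj_toFun _)⟩
        fun y => proj_mul_eq (ρ'.proj_toFun y) (ρ.proj_toFun y)
      obtain ⟨t, ht, ht'⟩ := (hv p a).exists_section (V ⊓ V') ρ'.toFun ρ'.smooth ρ'.proj_toFun
      refine ⟨V ⊓ V', ρ, s - t, ⟨hx, hx'⟩, ?_, fun y => ?_⟩
      · rw [injπ', map_sub, ← edgeVal_add_edgeVal n p a 0 b]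
        have h0 : edgeVal n p a 0 = -edgeVal n p 0 a := by
          rw [eq_neg_iff_add_eq_zero, edgeVal_add_edgeVal]
          exact add_eq_left.1 (edgeVal_add_edgeVal n p a a a)
        rw [h0, neg_add_eq_sub, map_sub]
        exact congrArg₂ _ hs ht
      · rw [fibEv_sub y.2, ← hs', ← ht']
        exact key _ _ _ _ _ _ (ρ.proj_toFun y) (hτ _ _) (ρ'.proj_toFun y)
  · obtain ⟨t, ht⟩ := R.exists_proj_eq (x.arrow (φ.toOrderHom 0, φ.toOrderHom a))
    have h0 := hτ x (φ.toOrderHom 0)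
    rw [key (x.map φ) a b r _ t hr (hτ _ _) ht,
      key x _ _ r _ _ hr (hτ x _) (proj_mul_eq h0 ht), map_sub,
      R.str.mul_assoc _ _ _ (hst h0 ht) (hst ht hr)]
    -- An operator may move the vertex `0`. The edge from its image back to `0` adds the same term
    -- to both parts of the difference, where it cancels.
    have h1 : ∀ (d : Fin (q.len + 1)) (s : R.total),
        R.proj s = x.arrow (φ.toOrderHom 0, φ.toOrderHom d) →
          fibPull φ x (v (x.map φ) d s) =
            v x (φ.toOrderHom d) (R.str.mul (τ x (φ.toOrderHom 0)) s) -
              v x (φ.toOrderHom 0) (τ x (φ.toOrderHom 0)) := fun d s hs => by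
      refine (edgePot_map w φ x 0 d (Fin.zero_le d) s).trans ?_
      rw [eq_sub_iff_add_eq']
      exact (hmul x 0 _ _ (Fin.zero_le _) (φ.toOrderHom.monotone (Fin.zero_le d)) _ _ h0 hs).symm
    rw [h1 b _ (proj_mul_eq ht hr), h1 a t ht, sub_sub_sub_cancel_right]
  · rw [key x b c s _ _ hs (hτ x b) (proj_mul_eq (hτ x a) hr),
      R.str.mul_assoc _ _ _ (hst (hτ x a) hr) (hst hr hs)]
    abel

/-- Every morphism to the quotient sheaf comes from a central extension. -/
theorem exists_centralExtension (n : G.edgeSheaf ⟶ G.injQuot) :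
    ∃ R : CentralExtension G, Nonempty (ExtPotential R n) := by
  obtain ⟨P, w, hw⟩ := exists_bundle_isPotential (edgeVal n (.mk 1) 0 1)
    (fun a => a (0, 1)) (contMDiff_arrow (.mk 1) (0, 1)) nerve₁
    (smoothInto_nerve₁ contMDiffOn_id) fun x => (eq_nerve₁ rfl).symm
  obtain ⟨R, w', hw', hmul⟩ := hw.exists_centralExtension
  exact ⟨R, hw'.nonempty_extPotential hmul⟩

/-- Every morphism to the quotient sheaf comes from a circle bundle on the base. -/
theorem exists_circleBundle (n : G.vertexSheaf ⟶ G.injQuot) :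
    ∃ L : CircleBundle (n := G.m) G.M, Nonempty (BundlePotential L n) := by
  obtain ⟨P, w, hw⟩ := exists_bundle_isPotential (vertexVal n (.mk 0) 0)
    (fun a => G.str.src (a (0, 0))) (contMDiff_vertex (.mk 0) 0) (Nerve.const (.mk 0))
    (smoothInto_const contMDiffOn_id _) fun x => Nerve.const_vertex x
  exact ⟨P, ⟨BundlePotential.ofZero hw⟩⟩

end LieGroupoid

end

noncomputable section

/-! ### The exact sequence -/

namespace LieGroupoid

variable (G : LieGroupoid.{u})

/-- Degree one extensions of the edge sheaf by the simplicial circle sheaf. -/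
abbrev EdgeExt : Type u := Ext.{u} G.edgeSheaf G.simplicialCircleSheaf 1

variable {G}

theorem ExtPotential.quotClass_eq {R : CentralExtension G} {n n' : G.edgeSheaf ⟶ G.injQuot}
    (v : ExtPotential R n) (v' : ExtPotential R n') : quotClass n = quotClass n' :=
  quotClass_eq_iff.2 (v.exists_eq_add v')

theorem ExtPotential.nonempty_of_quotClass_eq {R : CentralExtension G}
    {n n' : G.edgeSheaf ⟶ G.injQuot} (v : ExtPotential R n) (h : quotClass n = quotClass n') :
    Nonempty (ExtPotential R n') := by
  obtain ⟨m, rfl⟩ := quotClass_eq_iff.1 h.symm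
  exact ⟨v.addHom m⟩

/-- The class in `Ext¹` of a central extension. -/
def edgeExtOf : ExtClasses G → G.EdgeExt :=
  Quotient.lift (fun R => quotClass (exists_extPotential R).choose) fun R R' h => by
    obtain ⟨v⟩ := (exists_extPotential R).choose_spec
    obtain ⟨v'⟩ := (exists_extPotential R').choose_spec
    obtain ⟨v''⟩ := v.of_isIso h
    exact v''.quotClass_eq v'

/-- Replaces the chosen representative by any other: changing `n` within its class changes the
potential by a morphism to `inj`. All later identifications go through this criterion. -/
theorem edgeExtOf_toClass {R : CentralExtension G} {n : G.edgeSheaf ⟶ G.injQuot} :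
    edgeExtOf R.toClass = quotClass n ↔ Nonempty (ExtPotential R n) := by
  obtain ⟨v⟩ := (exists_extPotential R).choose_spec
  exact ⟨fun h => v.nonempty_of_quotClass_eq h, fun ⟨v'⟩ => v.quotClass_eq v'⟩

/-- Extensions with potentials for the same `n` are isomorphic, and each `n` is realized by the
bundle of lifts. -/
theorem edgeExtOf_bijective : Function.Bijective (edgeExtOf (G := G)) := by
  constructor
  · rintro ⟨R⟩ ⟨R'⟩ h
    obtain ⟨n, ⟨v⟩⟩ := exists_extPotential R
    obtain ⟨v'⟩ := edgeExtOf_toClass.1 (h.symm.trans (edgeExtOf_toClass.2 ⟨v⟩))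
    exact Quotient.sound (v.isIso v')
  · intro x
    obtain ⟨n, rfl⟩ := quotClass_surjective x
    obtain ⟨R, hR⟩ := exists_centralExtension n
    exact ⟨R.toClass, edgeExtOf_toClass.2 hR⟩

variable (G) in
/-- Isomorphism classes of central extensions are classified by `Ext¹` of the edge sheaf. -/
def edgeExtEquiv : ExtClasses G ≃ G.EdgeExt := Equiv.ofBijective _ edgeExtOf_bijective

/-- Transported from `Ext¹`, so that the group axioms need no geometric verification;
`toClass_add_toClass_eq_iff` shows that the sum is the tensor product. -/
instance : AddCommGroup (ExtClasses G) := (edgeExtEquiv G).addCommGroup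

variable (G) in
/-- `edgeExtEquiv` as an isomorphism of groups. -/
def edgeExtAddEquiv : ExtClasses G ≃+ G.EdgeExt where
  toEquiv := edgeExtEquiv G
  map_add' _ _ := (edgeExtEquiv G).apply_symm_apply _

theorem edgeExtAddEquiv_toClass {R : CentralExtension G} {n : G.edgeSheaf ⟶ G.injQuot} :
    edgeExtAddEquiv G R.toClass = quotClass n ↔ Nonempty (ExtPotential R n) :=
  edgeExtOf_toClass

/-- The sum of the classes is represented by `n + n'`, and `R''` has a potential for `n + n'`
exactly when it is the tensor product. -/
theorem toClass_add_toClass_eq_iff (R R' R'' : CentralExtension G) :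
    R.toClass + R'.toClass = R''.toClass ↔ R.IsTensor R' R'' := by
  obtain ⟨n, ⟨v⟩⟩ := exists_extPotential R
  obtain ⟨n', ⟨v'⟩⟩ := exists_extPotential R'
  rw [← (edgeExtAddEquiv G).injective.eq_iff, map_add, edgeExtAddEquiv_toClass.2 ⟨v⟩,
    edgeExtAddEquiv_toClass.2 ⟨v'⟩, ← quotClass_add, eq_comm, edgeExtAddEquiv_toClass]
  exact ⟨fun ⟨v''⟩ => v.isTensor v' v'', v.of_isTensor v'⟩

/-- The pullback of central extensions along a morphism of Lie groupoids. -/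
def Hom.pullClass {G' : LieGroupoid.{u}} (φ : Hom G' G) : ExtClasses G →+ ExtClasses G' :=
  (edgeExtAddEquiv G').symm.toAddMonoidHom.comp
    (φ.pullEdgeClass.comp (edgeExtAddEquiv G).toAddMonoidHom)

theorem Hom.edgeExtAddEquiv_pullClass {G' : LieGroupoid.{u}} (φ : Hom G' G) (r : ExtClasses G) :
    edgeExtAddEquiv G' (φ.pullClass r) = φ.pullEdgeClass (edgeExtAddEquiv G r) :=
  (edgeExtAddEquiv G').apply_symm_apply _

theorem Hom.pullClass_toClass_eq_iff {G' : LieGroupoid.{u}} (φ : Hom G' G)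
    (R : CentralExtension G) (R' : CentralExtension G') :
    φ.pullClass R.toClass = R'.toClass ↔ R.IsPullback φ R' := by
  obtain ⟨n, ⟨v⟩⟩ := exists_extPotential R
  rw [← (edgeExtAddEquiv G').injective.eq_iff, edgeExtAddEquiv_pullClass,
    edgeExtAddEquiv_toClass.2 ⟨v⟩, pullEdgeClass_quotClass, eq_comm, edgeExtAddEquiv_toClass]
  exact ⟨fun ⟨v'⟩ => v.isPullback v', v.of_isPullback⟩

variable (G)

/-- The classes of circle bundles on the base as extensions of the vertex sheaf. -/
def vertexExtEquiv : Ext.{u} G.vertexSheaf G.simplicialCircleSheaf 1 ≃+ G.baseH 1 :=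
  AddEquiv.ofBijective (G.vertexComparison 1) G.vertexComparison_bijective

/-- Restriction of extensions along `edgeι`. -/
def edgeRestrict : Ext.{u} G.vertexSheaf G.simplicialCircleSheaf 1 →+ G.EdgeExt :=
  (Ext.mk₀ G.edgeι).precomp G.simplicialCircleSheaf (zero_add 1)

/-- The class of the central extension associated with a circle bundle on the base. -/
def gaugeClass : G.baseH 1 →+ ExtClasses G :=
  (edgeExtAddEquiv G).symm.toAddMonoidHom.comp
    (G.edgeRestrict.comp G.vertexExtEquiv.symm.toAddMonoidHom)

theorem edgeExtAddEquiv_gaugeClass (x : Ext.{u} G.vertexSheaf G.simplicialCircleSheaf 1) :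
    edgeExtAddEquiv G (G.gaugeClass (G.vertexComparison 1 x)) =
      (Ext.mk₀ G.edgeι).comp x (zero_add 1) :=
  ((edgeExtAddEquiv G).apply_symm_apply _).trans
    (congrArg G.edgeRestrict (G.vertexExtEquiv.symm_apply_apply x))

theorem gaugeClass_eq_iff (a : G.baseH 1) (R : CentralExtension G) : G.gaugeClass a = R.toClass ↔
    ∃ L : CircleBundle (n := G.m) G.M, L.HasClass a ∧ R.IsGaugeExtension L := by
  -- Restriction along `edgeι` takes the class represented by `n` to that of `edgeι ≫ n`, so the
  -- question is whether `R` has a potential for this composite.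
  have key : ∀ n : G.vertexSheaf ⟶ G.injQuot,
      G.gaugeClass (G.vertexComparison 1 (quotClass n)) = R.toClass ↔
        Nonempty (ExtPotential R (G.edgeι ≫ n)) := fun n => by
    rw [← edgeExtAddEquiv_toClass, ← (edgeExtAddEquiv G).injective.eq_iff, quotClass_precomp]
    exact ⟨fun h => h.symm.trans (G.edgeExtAddEquiv_gaugeClass _),
      fun h => (G.edgeExtAddEquiv_gaugeClass _).trans h.symm⟩
  constructor
  · intro h
    obtain ⟨x, rfl⟩ := G.vertexComparison_bijective.2 a
    obtain ⟨n, rfl⟩ := quotClass_surjective x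
    obtain ⟨L, ⟨w⟩⟩ := exists_circleBundle n
    obtain ⟨v⟩ := (key n).1 h
    exact ⟨L, w.hasClass, v.isGaugeExtension w⟩
  · rintro ⟨L, h, hR⟩
    obtain ⟨n, ⟨w⟩, rfl⟩ := exists_bundlePotential_of_hasClass h
    exact (key n).2 (w.of_isGaugeExtension hR)

/-- The connecting map from extensions of the edge sheaf. -/
def edgeConnecting : G.EdgeExt →+ G.simplicialH 2 :=
  Ext.precomp (X := ZSheaf G.topology) (Y := G.edgeSheaf) G.edge_shortExact.extClass
    G.simplicialCircleSheaf (rfl : 1 + 1 = 2)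

/-- The class of the gerbe of a central extension. -/
def gerbeClass : ExtClasses G →+ G.simplicialH 2 :=
  G.edgeConnecting.comp (edgeExtAddEquiv G).toAddMonoidHom

theorem gerbeClass_eq_iff (R : CentralExtension G) (c : G.simplicialH 2) :
    G.gerbeClass R.toClass = c ↔ R.HasGerbeClass c := by
  have key : ∀ {n : G.edgeSheaf ⟶ G.injQuot}, Nonempty (ExtPotential R n) →
      G.gerbeClass R.toClass = Ext.comp (X := ZSheaf G.topology) (Y := G.edgeSheaf)
        G.edge_shortExact.extClass (quotClass n) (rfl : 1 + 1 = 2) := fun h =>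
    congrArg G.edgeConnecting (edgeExtAddEquiv_toClass.2 h)
  rw [hasGerbeClass_iff]
  constructor
  · rintro rfl
    obtain ⟨n, h⟩ := exists_extPotential R
    exact ⟨n, h, key h⟩
  · rintro ⟨n, h, rfl⟩
    exact key h

theorem edgeConnecting_exact : Function.Exact G.edgeRestrict G.edgeConnecting := by
  intro x
  constructor
  · exact Ext.contravariant_sequence_exact₁ G.edge_shortExact G.simplicialCircleSheaf x
      (rfl : 1 + 1 = 2)
  · rintro ⟨y, rfl⟩
    exact G.edge_shortExact.extClass_comp_assoc y (h := (rfl : 1 + 1 = 2))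

/-- Exactness at `Ext¹(vertexSheaf, S¹)` of the long exact sequence, carried to `H¹(M, S¹)` by the
bijective comparison map. -/
theorem gaugeClass_exact : Function.Exact (G.restriction 1) G.gaugeClass := by
  intro a
  obtain ⟨x, rfl⟩ := G.vertexComparison_bijective.2 a
  rw [← (edgeExtAddEquiv G).map_eq_zero_iff, edgeExtAddEquiv_gaugeClass]
  constructor
  · intro h
    obtain ⟨y, hy⟩ := Ext.contravariant_sequence_exact₂ G.edge_shortExact
      G.simplicialCircleSheaf x h
    exact ⟨y, (G.restriction_eq 1 y).trans (congrArg _ hy)⟩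
  · rintro ⟨y, hy⟩
    have h := G.vertexComparison_bijective.1 ((G.restriction_eq 1 y).symm.trans hy)
    rw [← h, Ext.mk₀_comp_mk₀_assoc, edgeι_augmentation, Ext.mk₀_zero, Ext.zero_comp]

theorem gerbeClass_exact : Function.Exact G.gaugeClass G.gerbeClass := by
  intro r
  refine (G.edgeConnecting_exact (edgeExtAddEquiv G r)).trans ⟨?_, ?_⟩
  · rintro ⟨y, hy⟩
    exact ⟨G.vertexComparison 1 y,
      (edgeExtAddEquiv G).injective ((G.edgeExtAddEquiv_gaugeClass y).trans hy)⟩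
  · rintro ⟨a, rfl⟩
    obtain ⟨y, rfl⟩ := G.vertexComparison_bijective.2 a
    exact ⟨y, (G.edgeExtAddEquiv_gaugeClass y).symm⟩

/-- A class vanishes on `M` exactly when it vanishes in `Ext²(vertexSheaf, S¹)`, by injectivity of
the comparison map, and then it comes from `Ext¹(edgeSheaf, S¹)`. -/
theorem restriction_exact : Function.Exact G.gerbeClass (G.restriction 2) := by
  intro c
  rw [restriction_eq, map_eq_zero_iff _ G.vertexComparison_injective]
  constructor
  · intro h
    obtain ⟨x, hx⟩ := Ext.contravariant_sequence_exact₃ G.edge_shortExact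
      G.simplicialCircleSheaf c h (rfl : 1 + 1 = 2)
    exact ⟨(edgeExtAddEquiv G).symm x,
      (congrArg G.edgeConnecting ((edgeExtAddEquiv G).apply_symm_apply x)).trans hx⟩
  · rintro ⟨r, rfl⟩
    exact G.edge_shortExact.comp_extClass_assoc (edgeExtAddEquiv G r) (rfl : 1 + 1 = 2)

variable {G} {G' : LieGroupoid.{u}} (φ : Hom G' G)

/-- Reduces to the commutation of `edgeMap` and `vertexMap` with `edgeι`, because `extMap` is
natural in its first variable. -/
theorem gaugeClass_basePullbackH (a : G.baseH 1) :
    G'.gaugeClass (φ.basePullbackH 1 a) = φ.pullClass (G.gaugeClass a) := by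
  obtain ⟨x, rfl⟩ := G.vertexComparison_bijective.2 a
  apply (edgeExtAddEquiv G').injective
  rw [φ.basePullbackH_vertexComparison, edgeExtAddEquiv_gaugeClass,
    Hom.edgeExtAddEquiv_pullClass, edgeExtAddEquiv_gaugeClass]
  exact (extMap_precomp φ.invImage _ _ φ.invCircle _ _ φ.edgeMap_edgeι x).symm

theorem gerbeClass_pullClass (r : ExtClasses G) :
    G'.gerbeClass (φ.pullClass r) = φ.pullbackH 2 (G.gerbeClass r) :=
  (congrArg G'.edgeConnecting (φ.edgeExtAddEquiv_pullClass r)).trans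
    (φ.pullbackH_extClass_comp (edgeExtAddEquiv G r)).symm

end LieGroupoid

end

/-- For every Lie groupoid `Γ ⇉ M` the isomorphism classes of `S¹`-central extensions form an
abelian group under the tensor product, and there is an exact sequence
`H¹(Γ_•, S¹) → H¹(M, S¹) → {central extensions} → H²(Γ_•, S¹) → H²(M, S¹)`, natural in `Γ ⇉ M`. -/
theorem mainTheorem6 :
    ∃ (_ : ∀ G : LieGroupoid.{u}, AddCommGroup (ExtClasses G))
      (pull : ∀ (G' G : LieGroupoid.{u}), G'.Hom G → (ExtClasses G →+ ExtClasses G'))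
      (δ : ∀ G : LieGroupoid.{u}, G.baseH 1 →+ ExtClasses G)
      (cls : ∀ G : LieGroupoid.{u}, ExtClasses G →+ G.simplicialH 2),
      -- the group law is the tensor product
      (∀ (G : LieGroupoid.{u}) (R R' R'' : CentralExtension G),
        R.toClass + R'.toClass = R''.toClass ↔ R.IsTensor R' R'') ∧
      -- `pull` is the pullback of central extensions
      (∀ (G' G : LieGroupoid.{u}) (φ : G'.Hom G) (R : CentralExtension G)
        (R' : CentralExtension G'),
        pull G' G φ R.toClass = R'.toClass ↔ R.IsPullback φ R') ∧
      -- `δ` sends the class of `L` to the extension with fibres `Iso(L_{src g}, L_{tgt g})`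
      (∀ (G : LieGroupoid.{u}) (a : G.baseH 1) (R : CentralExtension G),
        δ G a = R.toClass ↔
          ∃ L : CircleBundle (n := G.m) G.M, L.HasClass a ∧ R.IsGaugeExtension L) ∧
      -- `cls` sends a central extension to the class of its gerbe
      (∀ (G : LieGroupoid.{u}) (R : CentralExtension G) (c : G.simplicialH 2),
        cls G R.toClass = c ↔ R.HasGerbeClass c) ∧
      -- exactness
      (∀ G : LieGroupoid.{u},
        Function.Exact (G.restriction 1) (δ G) ∧
        Function.Exact (δ G) (cls G) ∧
        Function.Exact (cls G) (G.restriction 2)) ∧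
      -- naturality
      (∀ (G' G : LieGroupoid.{u}) (φ : G'.Hom G),
        (∀ a, G'.restriction 1 (φ.pullbackH 1 a) = φ.basePullbackH 1 (G.restriction 1 a)) ∧
        (∀ a, δ G' (φ.basePullbackH 1 a) = pull G' G φ (δ G a)) ∧
        (∀ r, cls G' (pull G' G φ r) = φ.pullbackH 2 (cls G r)) ∧
        (∀ c, G'.restriction 2 (φ.pullbackH 2 c) = φ.basePullbackH 2 (G.restriction 2 c))) :=
  ⟨fun _ => inferInstance, fun _ _ φ => φ.pullClass, fun G => G.gaugeClass, fun G => G.gerbeClass,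
    fun _ => LieGroupoid.toClass_add_toClass_eq_iff, fun _ _ φ => φ.pullClass_toClass_eq_iff,
    fun G => G.gaugeClass_eq_iff, fun G => G.gerbeClass_eq_iff,
    fun G => ⟨G.gaugeClass_exact, G.gerbeClass_exact, G.restriction_exact⟩,
    fun _ _ φ => ⟨φ.restriction_pullbackH 1, LieGroupoid.gaugeClass_basePullbackH φ,
      LieGroupoid.gerbeClass_pullClass φ, φ.restriction_pullbackH 2⟩⟩
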